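/- Let $X$ be a compact connected Riemann surface of genus $g>1$, let $\omega$ be a holomorphic one-form on $X$ with exactly $2g-2$ zeros $P_1,\dots,P_{2g-2}$, all simple, and let $C$ be a holomorphic line bundle on $X$ with an isomorphism $C\otimes C\cong K$, $K$ the canonical bundle. Equip $X$ with the flat conical metric $|\omega|^2=\rho^{-2}|dz|^2$, with area form $dS$, and $C$ with the Hermitian metric $h=|\omega|^{-1}$. Let $L_2(X;C)$ be the Hilbert space of square integrable sections with $(a,b)=\int_X a\,h\,\overline b\,dS$, put $\dot X=X\setminus\{P_1,\dots,P_{2g-2}\}$, let $\Delta_{min}$ be the closure in $L_2(X;C)$ of the Laplacian $\Delta=-\rho^2h^{-1}\partial(h\bar\partial)$ with domain $C_c^\infty(\dot X;C)$, and let $\Delta_{min}^*$ be its adjoint. A distinguished coordinate at $P_k$ is a holomorphic local coordinate $x_k$ with $x_k(P_k)=0$ and $\omega=x_k\,dx_k$, i.e. $x_k=(2\int_{P_k}\omega)^{1/2}$. Sections of $C$ over its domain are identified with functions of $x_k$ through a holomorphic frame $e_k$ with $e_k\otimes e_k=dx_k$. Let $\mathcal H^2_{-1}$ be the space of measurable sections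 $u$ of $C$ such that (a) for every local coordinate $z$ with $\omega=dz$, every holomorphic frame $e$ with $e\otimes e=dz$ and every smooth cut-off function $\chi$ with support in the domain of $z$, the representative of $\chi u$ in $z$ (extended by zero) is in the Sobolev space $H^2(\mathbb R^2)$; (b) for every $k$, every distinguished coordinate $x_k$ at $P_k$ with frame $e_k$, and every smooth cut-off function $\chi$ with support in the domain of $x_k$, the representative $v$ of $\chi u$ in the coordinate $x_k^2/2=re^{i\varphi}$ (that is, $x_k^{-1/2}$ times its representative in $x_k$), regarded as a $4\pi$-antiperiodic function of $\varphi$ and extended by zero, has weak derivatives with $$\sup_{\phi_0}\int_{-\infty}^{\infty}ds\int_{\phi_0}^{\phi_0+4\pi}d\varphi\,\big|\partial_\varphi^q\partial_s^pv\big|^2e^{-2s}<\infty\qquad(p+q\le 2,\ s=\log r).$$ Then: 1. $\Delta_{min}\subset\Delta_{min}^*$ and $\mathrm{Dom}\,\Delta_{min}=\mathcal H^2_{-1}$. 2. The quotient $\mathrm{Dom}\,\Delta_{min}^*/\mathrm{Dom}\,\Delta_{min}$ has dimension $8(2g-2)$. With $\pi$ the canonical projection onto it, $\mathcal G(\pi(u),\pi(v))=(\Delta_{min}^*u,v)-(u,\Delta_{min}^*v)$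 is a well-defined sesquilinear form on it. 3. Distinguished coordinates $x_k$ with frames $e_k$, with domain contained in an arbitrarily small neighbourhood of $P_k$, and smooth cut-off functions $\chi_k$ supported in that domain with $\chi_k=1$ near $P_k$, exist for every $k$. For any choice of distinguished coordinates $x_k$, frames $e_k$, and smooth cut-off functions $\chi_k$ supported in the domain of $x_k$ and equal to $1$ near $P_k$, the $8(2g-2)$ elements $$\pi(\chi_kf_{k,m,+}),\quad \pi(\chi_kf_{k,m,-})\qquad(1\le k\le 2g-2,\ -1\le m\le 2)$$ with $$f_{k,m,+}=x_k^m,\qquad f_{k,m,-}=\frac{\overline{x_k}^{\,1/2-m}x_k^{1/2}}{\pi\,(m-\frac12)}=\frac{\overline{x_k}^{\,-m}|x_k|}{\pi\,(m-\frac12)}$$ (in this formula $\pi=3.14\ldots$) form a Darboux basis of the quotient: they are a basis, and $$\mathcal G(\pi(\chi_kf_{k,m,+}),\pi(\chi_{k'}f_{k',m',-}))=\delta_{kk'}\delta_{mm'}=-\mathcal G(\pi(\chi_kf_{k,m,-}),\pi(\chi_{k'}f_{k',m',+})),$$ $$\mathcal G(\pi(\chi_kf_{k,m,+}),\pi(\chi_{k'}f_{k',m',+}))=\mathcal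 G(\pi(\chi_kf_{k,m,-}),\pi(\chi_{k'}f_{k',m',-}))=0.$$ -/

import Mathlib

open MeasureTheory Filter Bundle Manifold
open scoped Topology ComplexConjugate InnerProductSpace LinearPMap

namespace SpinorLaplacian

set_option linter.unusedSectionVars false

noncomputable section

/-- The fibre at `y` of the canonical bundle `K` (the holomorphic cotangent line). -/
abbrev Cotangent (X : Type*) [TopologicalSpace X] [ChartedSpace ℂ X] (y : X) : Type _ :=
  TangentSpace 𝓘(ℂ) y →L[ℂ] ℂ

section Forms

variable {X : Type*} [TopologicalSpace X] [ChartedSpace ℂ X]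

/-- The coefficient `η_c` of a one-form `η = η_c(z) dz` in a local coordinate `c`. -/
def coefficient (η : ∀ y : X, Cotangent X y) (c : OpenPartialHomeomorph X ℂ) (z : ℂ) : ℂ :=
  η (c.symm z) (mfderiv 𝓘(ℂ) 𝓘(ℂ) c.symm z (1 : ℂ))

/-- The quotient `η / θ` of two cotangent vectors at a point of a Riemann surface (`θ ≠ 0`). -/
def quot {y : X} (η θ : Cotangent X y) : ℂ := η (1 : ℂ) / θ (1 : ℂ)

variable (X) in
/-- The space `H⁰(X, K)` of holomorphic one-forms. -/
def HolomorphicForm : Submodule ℂ (∀ y : X, Cotangent X y) where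
  carrier := {η | ∀ x₀ : X,
    DifferentiableOn ℂ (coefficient η (chartAt ℂ x₀)) (chartAt ℂ x₀).target}
  add_mem' := fun ha hb x₀ => (ha x₀).add (hb x₀)
  zero_mem' := fun _ => differentiableOn_const 0
  smul_mem' := fun r _ ha x₀ => (ha x₀).const_smul r

variable (X) in
/-- The genus `dim H⁰(X, K)` of a compact Riemann surface. -/
def genus : ℕ := Module.finrank ℂ (HolomorphicForm X)

/-- `ω` has a simple zero at `p`. -/
def IsSimpleZero (ω : HolomorphicForm X) (p : X) : Prop :=
  ω.1 p = 0 ∧ deriv (coefficient ω.1 (chartAt ℂ p)) (chartAt ℂ p p) ≠ 0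

/-- The area measure `dS` of the metric `|ω|²`: on every coordinate neighbourhood it is
`|ω_c(z)|²` times Lebesgue measure, and the supremum glues these measures together. -/
def area [MeasurableSpace X] (ω : HolomorphicForm X) : Measure X :=
  ⨆ x₀ : X, ((volume.withDensity
    fun z : ℂ => ‖coefficient ω.1 (chartAt ℂ x₀) z‖ₑ ^ 2).restrict (chartAt ℂ x₀).target).map
      (chartAt ℂ x₀).symm

end Forms

section Spinors

variable {X : Type*} [TopologicalSpace X] [ChartedSpace ℂ X]
  (C : X → Type*) [TopologicalSpace (TotalSpace ℂ C)] [∀ y, AddCommGroup (C y)]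
  [∀ y, Module ℂ (C y)] [∀ y, TopologicalSpace (C y)] [FiberBundle ℂ C] [VectorBundle ℂ ℂ C]

/-- The local frame of the line bundle `C` given by its trivialization around `x₀`. -/
def frame (x₀ y : X) : C y := (trivializationAt ℂ C x₀).symmₗ ℂ y 1

/-- The component of a vector of `C` in the local frame around `x₀`. -/
def component (x₀ y : X) : C y →ₗ[ℂ] ℂ := (trivializationAt ℂ C x₀).linearMapAt ℂ y

/-- A holomorphic isomorphism `C ⊗ C ≅ K`, given as a fibrewise nondegenerate product
`C × C → K` that is holomorphic in the local holomorphic frames of `C`. -/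
structure SpinStructure where
  mul : ∀ y : X, C y →ₗ[ℂ] C y →ₗ[ℂ] Cotangent X y
  mul_ne_zero : ∀ (y : X) (u v : C y), u ≠ 0 → v ≠ 0 → mul y u v ≠ 0
  holomorphic : ∀ x₀ : X, DifferentiableOn ℂ
    (coefficient (fun y => mul y (frame C x₀ y) (frame C x₀ y)) (chartAt ℂ x₀))
    ((chartAt ℂ x₀).target ∩ (chartAt ℂ x₀).symm ⁻¹' (trivializationAt ℂ C x₀).baseSet)

variable {C}

/-- The metric `h = |ω|⁻¹` of `C` in the local frame `e` around `x₀`: its coefficient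
is `|e ⊗ e / ω|`. -/
def metric (S : SpinStructure C) (ω : HolomorphicForm X) (x₀ y : X) : ℝ :=
  ‖quot (S.mul y (frame C x₀ y) (frame C x₀ y)) (ω.1 y)‖

/-- The Hermitian product `u h v̄` on the fibre of `C` at `y`. -/
def herm (S : SpinStructure C) (ω : HolomorphicForm X) (y : X) (u v : C y) : ℂ :=
  component C y y u * metric S ω y y * conj (component C y y v)

end Spinors

section L2

variable {X : Type*} [TopologicalSpace X] [ChartedSpace ℂ X]
  {C : X → Type*} [TopologicalSpace (TotalSpace ℂ C)] [∀ y, AddCommGroup (C y)]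
  [∀ y, Module ℂ (C y)] [∀ y, TopologicalSpace (C y)] [FiberBundle ℂ C] [VectorBundle ℂ ℂ C]

theorem component_smul_frame (x₀ y : X) (hy : y ∈ (trivializationAt ℂ C x₀).baseSet) (u : C y) :
    component C x₀ y u • frame C x₀ y = u := by
  have h : (trivializationAt ℂ C x₀).symmₗ ℂ y ((trivializationAt ℂ C x₀).linearMapAt ℂ y u) = u :=
    (trivializationAt ℂ C x₀).symmₗ_linearMapAt hy u
  rw [frame, component, ← map_smul, smul_eq_mul, mul_one, h]

theorem component_frame (x₀ y : X) (hy : y ∈ (trivializationAt ℂ C x₀).baseSet) :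
    component C x₀ y (frame C x₀ y) = 1 :=
  (trivializationAt ℂ C x₀).linearMapAt_symmₗ hy 1

theorem frame_ne_zero (x₀ y : X) (hy : y ∈ (trivializationAt ℂ C x₀).baseSet) :
    frame C x₀ y ≠ 0 := by
  intro h
  have := component_frame x₀ y hy
  rw [h, map_zero] at this
  exact zero_ne_one this

theorem quot_smul {y : X} (a : ℂ) (η θ : Cotangent X y) : quot (a • η) θ = a * quot η θ :=
  mul_div_assoc a (η (1 : ℂ) : ℂ) (θ (1 : ℂ))

theorem herm_smul_smul (S : SpinStructure C) (ω : HolomorphicForm X) (y : X) (e : C y) (a b : ℂ) :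
    herm S ω y (a • e) (b • e) = a * ‖quot (S.mul y e e) (ω.1 y)‖ * conj b := by
  have he := component_smul_frame (C := C) y y (FiberBundle.mem_baseSet_trivializationAt' y) e
  have : ‖quot (S.mul y e e) (ω.1 y)‖
      = ‖component C y y e‖ ^ 2 * ‖quot (S.mul y (frame C y y) (frame C y y)) (ω.1 y)‖ := by
    conv_lhs => rw [← he]
    rw [map_smul, map_smul, LinearMap.smul_apply, quot_smul, quot_smul, norm_mul, norm_mul]
    ring
  rw [this, herm, metric, map_smul, map_smul, smul_eq_mul, smul_eq_mul, map_mul]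
  push_cast
  rw [← Complex.mul_conj']
  ring

theorem herm_eq (S : SpinStructure C) (ω : HolomorphicForm X) (x₀ y : X)
    (hy : y ∈ (trivializationAt ℂ C x₀).baseSet) (u v : C y) :
    herm S ω y u v = component C x₀ y u * metric S ω x₀ y * conj (component C x₀ y v) := by
  conv_lhs => rw [← component_smul_frame x₀ y hy u, ← component_smul_frame x₀ y hy v]
  rw [herm_smul_smul, metric]

theorem herm_self (S : SpinStructure C) (ω : HolomorphicForm X) (y : X) (u : C y) :
    herm S ω y u u = ((metric S ω y y * ‖component C y y u‖ ^ 2 : ℝ) : ℂ) := by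
  rw [herm, mul_right_comm, Complex.mul_conj']
  push_cast
  ring

theorem herm_self_re_nonneg (S : SpinStructure C) (ω : HolomorphicForm X) (y : X) (u : C y) :
    0 ≤ (herm S ω y u u).re := by
  rw [herm_self, Complex.ofReal_re]
  exact mul_nonneg (norm_nonneg _) (sq_nonneg _)

theorem norm_herm_le (S : SpinStructure C) (ω : HolomorphicForm X) (y : X) (u v : C y) :
    ‖herm S ω y u v‖ ≤ ‖herm S ω y u u‖ + ‖herm S ω y v v‖ := by
  have hm : 0 ≤ metric S ω y y := norm_nonneg _
  simp only [herm, norm_mul, RCLike.norm_conj, Complex.norm_real, Real.norm_of_nonneg hm]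
  nlinarith [sq_nonneg (‖component C y y u‖ - ‖component C y y v‖),
    sq_nonneg (‖component C y y u‖), sq_nonneg (‖component C y y v‖),
    mul_nonneg hm (sq_nonneg (‖component C y y u‖ - ‖component C y y v‖)),
    mul_nonneg hm (sq_nonneg (‖component C y y u‖ )), mul_nonneg hm (sq_nonneg (‖component C y y v‖)) ]

theorem herm_conj (S : SpinStructure C) (ω : HolomorphicForm X) (y : X) (u v : C y) :
    conj (herm S ω y u v) = herm S ω y v u := by
  simp only [herm, map_mul, Complex.conj_conj, Complex.conj_ofReal]
  ring

theorem herm_add_right (S : SpinStructure C) (ω : HolomorphicForm X) (y : X) (u v w : C y) :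
    herm S ω y u (v + w) = herm S ω y u v + herm S ω y u w := by
  simp only [herm, map_add]; ring

theorem herm_add_left (S : SpinStructure C) (ω : HolomorphicForm X) (y : X) (u v w : C y) :
    herm S ω y (u + v) w = herm S ω y u w + herm S ω y v w := by
  simp only [herm, map_add]; ring

theorem herm_smul_right (S : SpinStructure C) (ω : HolomorphicForm X) (y : X) (r : ℂ) (u v : C y) :
    herm S ω y u (r • v) = conj r * herm S ω y u v := by
  simp only [herm, map_smul, smul_eq_mul, map_mul]; ring

theorem herm_smul_left (S : SpinStructure C) (ω : HolomorphicForm X) (y : X) (r : ℂ) (u v : C y) :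
    herm S ω y (r • u) v = r * herm S ω y u v := by
  simp only [herm, map_smul, smul_eq_mul]; ring

/-- The neighbourhood of `x₀` on which both the chart and the trivialization are defined. -/
def nbhd (C : X → Type*) [TopologicalSpace (TotalSpace ℂ C)] [∀ y, AddCommGroup (C y)]
    [∀ y, Module ℂ (C y)] [∀ y, TopologicalSpace (C y)] [FiberBundle ℂ C] (x₀ : X) : Set X :=
  (chartAt ℂ x₀).source ∩ (trivializationAt ℂ C x₀).baseSet

theorem isOpen_nbhd (x₀ : X) : IsOpen (nbhd C x₀) :=
  (chartAt ℂ x₀).open_source.inter (trivializationAt ℂ C x₀).open_baseSet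

theorem mem_nbhd (x₀ : X) : x₀ ∈ nbhd C x₀ :=
  ⟨mem_chart_source ℂ x₀, FiberBundle.mem_baseSet_trivializationAt' x₀⟩

variable (C) in
theorem exists_finset_nbhd [CompactSpace X] : ∃ t : Finset X, ∀ y, ∃ x₀ ∈ t, y ∈ nbhd C x₀ := by
  obtain ⟨t, ht⟩ := isCompact_univ.elim_nhds_subcover (nbhd C)
    (fun x _ => (isOpen_nbhd x).mem_nhds (mem_nbhd x))
  refine ⟨t, fun y => ?_⟩
  simpa using ht.2 (Set.mem_univ y)

variable [IsManifold 𝓘(ℂ) (⊤ : WithTop ℕ∞) X]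

theorem mfderiv_symm_ne_zero (x₀ y : X) (hy : y ∈ (chartAt ℂ x₀).source) :
    (mfderiv 𝓘(ℂ) 𝓘(ℂ) (chartAt ℂ x₀).symm (chartAt ℂ x₀ y) (1 : ℂ) : ℂ) ≠ 0 := by
  have : IsManifold 𝓘(ℂ) 1 X := IsManifold.of_le (n := ⊤) le_top
  intro h
  have h1 := (mdifferentiable_chart (I := 𝓘(ℂ)) x₀).symm_comp_deriv hy
  have h2 : mfderiv 𝓘(ℂ) 𝓘(ℂ) (chartAt ℂ x₀).symm (chartAt ℂ x₀ y) = 0 := by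
    apply ContinuousLinearMap.ext_ring
    exact h
  rw [h2, ContinuousLinearMap.zero_comp] at h1
  have h3 := congrArg (fun T : TangentSpace 𝓘(ℂ) y →L[ℂ] TangentSpace 𝓘(ℂ) y => T (1 : ℂ)) h1
  exact zero_ne_one (α := ℂ) h3

theorem cotangent_apply {y : X} (η : Cotangent X y) (v : ℂ) : η v = v * η (1 : ℂ) := by
  have : η (v • (1 : ℂ)) = v • η (1 : ℂ) := map_smul η v (1 : ℂ)
  rw [smul_eq_mul, smul_eq_mul, mul_one] at this
  exact this

theorem quot_eq (η θ : ∀ y : X, Cotangent X y) (x₀ y : X) (hy : y ∈ (chartAt ℂ x₀).source) :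
    quot (η y) (θ y) = coefficient η (chartAt ℂ x₀) (chartAt ℂ x₀ y)
      / coefficient θ (chartAt ℂ x₀) (chartAt ℂ x₀ y) := by
  have hv := mfderiv_symm_ne_zero x₀ y hy
  have key : ∀ y' : X, y' = y → ∀ v : ℂ, v ≠ 0 → quot (η y) (θ y) = η y' v / θ y' v := by
    rintro _ rfl v hv
    rw [cotangent_apply (η _), cotangent_apply (θ _), mul_div_mul_left _ _ hv, quot]
  exact key _ ((chartAt ℂ x₀).left_inv hy) _ hv

variable [MeasurableSpace X] [BorelSpace X]

theorem aemeasurable_metric (S : SpinStructure C) (ω : HolomorphicForm X) (x₀ : X)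
    (μ : Measure X) : AEMeasurable (metric S ω x₀) (μ.restrict (nbhd C x₀)) := by
  have hm : MeasurableSet (nbhd C x₀) := (isOpen_nbhd x₀).measurableSet
  have hc : ContinuousOn (chartAt ℂ x₀) (nbhd C x₀) :=
    (chartAt ℂ x₀).continuousOn.mono Set.inter_subset_left
  have h1 : ContinuousOn (fun y => coefficient
      (fun y => S.mul y (frame C x₀ y) (frame C x₀ y)) (chartAt ℂ x₀) (chartAt ℂ x₀ y))
      (nbhd C x₀) := by
    refine (S.holomorphic x₀).continuousOn.comp hc fun y hy => ⟨(chartAt ℂ x₀).map_source hy.1, ?_⟩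
    rw [Set.mem_preimage, (chartAt ℂ x₀).left_inv hy.1]
    exact hy.2
  have h2 : ContinuousOn (fun y => coefficient ω.1 (chartAt ℂ x₀) (chartAt ℂ x₀ y))
      (nbhd C x₀) :=
    (ω.2 x₀).continuousOn.comp hc fun y hy => (chartAt ℂ x₀).map_source hy.1
  refine (((h1.aemeasurable hm).div (h2.aemeasurable hm)).norm).congr ?_
  filter_upwards [ae_restrict_mem hm] with y hy
  simp only [metric, Pi.div_apply]
  rw [quot_eq (fun y => S.mul y (frame C x₀ y) (frame C x₀ y)) ω.1 x₀ y hy.1]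

/-- Measurability (up to null sets) of a section of `C`, in terms of its components. -/
def MeasurableSection (μ : Measure X) (u : ∀ y, C y) : Prop :=
  ∀ x₀ : X, AEMeasurable (fun y => component C x₀ y (u y)) μ

theorem aemeasurable_of_nbhd [CompactSpace X] {μ : Measure X} {f : X → ℂ}
    (h : ∀ x₀, AEMeasurable f (μ.restrict (nbhd C x₀))) : AEMeasurable f μ := by
  obtain ⟨t, ht⟩ := exists_finset_nbhd C
  have : AEMeasurable f (μ.restrict (⋃ i : t, nbhd C i.1)) :=
    aemeasurable_iUnion_iff.2 fun i => h i.1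
  have hu : (⋃ i : t, nbhd C i.1) = Set.univ := by
    ext y
    obtain ⟨x, hx, hy⟩ := ht y
    simp only [Set.mem_iUnion, Set.mem_univ, iff_true]
    exact ⟨⟨x, hx⟩, hy⟩
  rwa [hu, Measure.restrict_univ] at this

theorem aemeasurable_herm [CompactSpace X] (S : SpinStructure C) (ω : HolomorphicForm X)
    {μ : Measure X} {u v : ∀ y, C y} (hu : MeasurableSection μ u) (hv : MeasurableSection μ v) :
    AEMeasurable (fun y => herm S ω y (u y) (v y)) μ := by
  refine aemeasurable_of_nbhd (C := C) fun x₀ => ?_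
  refine AEMeasurable.congr (f := fun y => component C x₀ y (u y) * (metric S ω x₀ y : ℂ)
    * conj (component C x₀ y (v y))) ?_ ?_
  · exact (((hu x₀).restrict).mul
      (Complex.measurable_ofReal.comp_aemeasurable (aemeasurable_metric S ω x₀ μ))).mul
      (Complex.continuous_conj.measurable.comp_aemeasurable (hv x₀).restrict)
  · filter_upwards [ae_restrict_mem (isOpen_nbhd x₀).measurableSet] with y hy
    exact (herm_eq S ω x₀ y hy.2 _ _).symm

variable [CompactSpace X]

theorem integrable_herm (S : SpinStructure C) (ω : HolomorphicForm X)
    {μ : Measure X} {u v : ∀ y, C y} (hu : MeasurableSection μ u) (hv : MeasurableSection μ v)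
    (hu' : Integrable (fun y => herm S ω y (u y) (u y)) μ)
    (hv' : Integrable (fun y => herm S ω y (v y) (v y)) μ) :
    Integrable (fun y => herm S ω y (u y) (v y)) μ :=
  (hu'.norm.add hv'.norm).mono' (aemeasurable_herm S ω hu hv).aestronglyMeasurable
    (Eventually.of_forall fun _ => norm_herm_le S ω _ _ _)

theorem measurableSection_add {μ : Measure X} {u v : ∀ y, C y} (hu : MeasurableSection μ u)
    (hv : MeasurableSection μ v) : MeasurableSection μ (fun y => u y + v y) := fun x₀ => by
  simp only [map_add]
  exact (hu x₀).add (hv x₀)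

theorem measurableSection_smul {μ : Measure X} (r : ℂ) {u : ∀ y, C y}
    (hu : MeasurableSection μ u) : MeasurableSection μ (fun y => r • u y) := fun x₀ => by
  simp only [map_smul, smul_eq_mul]
  exact (hu x₀).const_mul r

theorem integrable_herm_add (S : SpinStructure C) (ω : HolomorphicForm X)
    {μ : Measure X} {u v : ∀ y, C y} (hu : MeasurableSection μ u) (hv : MeasurableSection μ v)
    (hu' : Integrable (fun y => herm S ω y (u y) (u y)) μ)
    (hv' : Integrable (fun y => herm S ω y (v y) (v y)) μ) :
    Integrable (fun y => herm S ω y (u y + v y) (u y + v y)) μ := by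
  have h := (hu'.add (integrable_herm S ω hv hu hv' hu')).add
    ((integrable_herm S ω hu hv hu' hv').add hv')
  refine h.congr (Eventually.of_forall fun y => ?_)
  simp only [Pi.add_apply, herm_add_left, herm_add_right]

theorem integrable_herm_smul (S : SpinStructure C) (ω : HolomorphicForm X)
    {μ : Measure X} (r : ℂ) {u : ∀ y, C y}
    (hu' : Integrable (fun y => herm S ω y (u y) (u y)) μ) :
    Integrable (fun y => herm S ω y (r • u y) (r • u y)) μ := by
  simp only [herm_smul_left, herm_smul_right]
  exact (hu'.const_mul _).const_mul _

/-- The square integrable measurable sections of `C`. -/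
def squareIntegrable (S : SpinStructure C) (ω : HolomorphicForm X) :
    Submodule ℂ (∀ y, C y) where
  carrier := {u | MeasurableSection (area ω) u ∧
    Integrable (fun y => herm S ω y (u y) (u y)) (area ω)}
  add_mem' hu hv := ⟨measurableSection_add hu.1 hv.1, integrable_herm_add S ω hu.1 hv.1 hu.2 hv.2⟩
  zero_mem' := ⟨fun x₀ => by simp, by simp [herm]⟩
  smul_mem' r _ hu := ⟨measurableSection_smul r hu.1, integrable_herm_smul S ω r hu.2⟩

/-- Square integrable sections, with the seminorm given by `(u, v) = ∫ u h v̄ dS`. -/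
def SquareIntegrable (S : SpinStructure C) (ω : HolomorphicForm X) : Type _ :=
  squareIntegrable S ω

instance (S : SpinStructure C) (ω : HolomorphicForm X) : AddCommGroup (SquareIntegrable S ω) :=
  inferInstanceAs (AddCommGroup (squareIntegrable S ω))

instance (S : SpinStructure C) (ω : HolomorphicForm X) : Module ℂ (SquareIntegrable S ω) :=
  inferInstanceAs (Module ℂ (squareIntegrable S ω))

/-- The scalar product, which is linear in `v` and conjugate linear in `u`, following the
convention of the library; the scalar product `∫ u h v̄ dS` is `inner ℂ v u`. -/
instance squareIntegrableCore (S : SpinStructure C) (ω : HolomorphicForm X) :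
    PreInnerProductSpace.Core ℂ (SquareIntegrable S ω) where
  inner u v := ∫ y, herm S ω y (v.1 y) (u.1 y) ∂(area ω)
  conj_inner_symm u v := by
    rw [← integral_conj]
    exact integral_congr_ae (Eventually.of_forall fun y => herm_conj S ω y _ _)
  re_inner_nonneg u := by
    have : ∫ y, herm S ω y (u.1 y) (u.1 y) ∂(area ω)
        = ((∫ y, (herm S ω y (u.1 y) (u.1 y)).re ∂(area ω) : ℝ) : ℂ) := by
      rw [← integral_complex_ofReal]
      refine integral_congr_ae (Eventually.of_forall fun y => ?_)
      simp only [herm_self, Complex.ofReal_re]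
    change 0 ≤ (∫ y, herm S ω y (u.1 y) (u.1 y) ∂(area ω)).re
    rw [this, Complex.ofReal_re]
    exact integral_nonneg fun y => herm_self_re_nonneg S ω y _
  add_left u v w := by
    rw [← integral_add (integrable_herm S ω w.2.1 u.2.1 w.2.2 u.2.2)
      (integrable_herm S ω w.2.1 v.2.1 w.2.2 v.2.2)]
    exact integral_congr_ae (Eventually.of_forall fun y => herm_add_right S ω y _ _ _)
  smul_left u v r := by
    rw [← integral_const_mul]
    exact integral_congr_ae (Eventually.of_forall fun y => herm_smul_right S ω y _ _ _)

instance (S : SpinStructure C) (ω : HolomorphicForm X) :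
    SeminormedAddCommGroup (SquareIntegrable S ω) :=
  InnerProductSpace.Core.toSeminormedAddCommGroup (𝕜 := ℂ) (c := squareIntegrableCore S ω)

instance (S : SpinStructure C) (ω : HolomorphicForm X) :
    InnerProductSpace ℂ (SquareIntegrable S ω) :=
  InnerProductSpace.ofCore (squareIntegrableCore S ω)

theorem norm_sq_eq (S : SpinStructure C) (ω : HolomorphicForm X) (u : SquareIntegrable S ω) :
    ‖u‖ ^ 2 = ∫ y, ‖herm S ω y (u.1 y) (u.1 y)‖ ∂(area ω) := by
  have h : ‖u‖ ^ 2 = (∫ y, herm S ω y (u.1 y) (u.1 y) ∂(area ω)).re :=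
    (inner_self_eq_norm_sq (𝕜 := ℂ) u).symm
  have h2 : ∀ y, herm S ω y (u.1 y) (u.1 y) = ((‖herm S ω y (u.1 y) (u.1 y)‖ : ℝ) : ℂ) := by
    intro y
    rw [herm_self, Complex.norm_real, Real.norm_of_nonneg]
    exact mul_nonneg (norm_nonneg _) (sq_nonneg _)
  rw [h, integral_congr_ae (Eventually.of_forall h2), integral_complex_ofReal, Complex.ofReal_re]

theorem measurableSet_zeros_inter (ω : HolomorphicForm X) (x₀ : X) :
    MeasurableSet ((chartAt ℂ x₀).target ∩ coefficient ω.1 (chartAt ℂ x₀) ⁻¹' {0}) := by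
  have h : IsOpen ((chartAt ℂ x₀).target ∩ coefficient ω.1 (chartAt ℂ x₀) ⁻¹' {0}ᶜ) :=
    (ω.2 x₀).continuousOn.isOpen_inter_preimage (chartAt ℂ x₀).open_target
      isOpen_compl_singleton
  have h2 : (chartAt ℂ x₀).target ∩ coefficient ω.1 (chartAt ℂ x₀) ⁻¹' {0}
      = (chartAt ℂ x₀).target \
        ((chartAt ℂ x₀).target ∩ coefficient ω.1 (chartAt ℂ x₀) ⁻¹' {0}ᶜ) := by
    ext z; simp
  rw [h2]
  exact (chartAt ℂ x₀).open_target.measurableSet.diff h.measurableSet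

theorem eq_zero_iff (ω : HolomorphicForm X) (x₀ y : X) (hy : y ∈ (chartAt ℂ x₀).source) :
    ω.1 y = 0 ↔ coefficient ω.1 (chartAt ℂ x₀) (chartAt ℂ x₀ y) = 0 := by
  have hv := mfderiv_symm_ne_zero x₀ y hy
  have key : ∀ y' : X, y' = y → ∀ v : ℂ, v ≠ 0 → (ω.1 y = 0 ↔ (ω.1 y' v : ℂ) = 0) := by
    rintro _ rfl v hv
    rw [cotangent_apply (ω.1 _), mul_eq_zero, or_iff_right hv]
    exact ⟨fun h => by rw [h]; rfl, fun h => ContinuousLinearMap.ext_ring h⟩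
  exact key _ ((chartAt ℂ x₀).left_inv hy) _ hv

theorem isClosed_zeros (ω : HolomorphicForm X) : IsClosed {y : X | ω.1 y = 0} := by
  rw [← isOpen_compl_iff, isOpen_iff_mem_nhds]
  intro x₀ hx
  have hc : ContinuousOn (fun y => coefficient ω.1 (chartAt ℂ x₀) (chartAt ℂ x₀ y))
      (chartAt ℂ x₀).source :=
    (ω.2 x₀).continuousOn.comp (chartAt ℂ x₀).continuousOn fun y hy => (chartAt ℂ x₀).map_source hy
  have ho := hc.isOpen_inter_preimage (chartAt ℂ x₀).open_source (isOpen_compl_singleton (x := 0))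
  refine Filter.mem_of_superset (ho.mem_nhds ⟨mem_chart_source ℂ x₀, ?_⟩) ?_
  · exact fun h => hx ((eq_zero_iff ω x₀ x₀ (mem_chart_source ℂ x₀)).2 h)
  · exact fun y hy h => hy.2 ((eq_zero_iff ω x₀ y hy.1).1 h)

theorem area_zeros (ω : HolomorphicForm X) : area ω {y : X | ω.1 y = 0} = 0 := by
  have hZ : MeasurableSet {y : X | ω.1 y = 0} := (isClosed_zeros ω).measurableSet
  have h : area ω ≤ (area ω).restrict {y : X | ω.1 y = 0}ᶜ := by
    refine iSup_le fun x₀ => ?_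
    set m := ((volume.withDensity fun z : ℂ => ‖coefficient ω.1 (chartAt ℂ x₀) z‖ₑ ^ 2).restrict
      (chartAt ℂ x₀).target).map (chartAt ℂ x₀).symm with hm
    have h1 : m ≤ area ω := le_iSup (fun x₀ : X => ((volume.withDensity
      fun z : ℂ => ‖coefficient ω.1 (chartAt ℂ x₀) z‖ₑ ^ 2).restrict (chartAt ℂ x₀).target).map
      (chartAt ℂ x₀).symm) x₀
    have h2 : m {y : X | ω.1 y = 0} = 0 := by
      have hae : AEMeasurable (chartAt ℂ x₀).symm ((volume.withDensity
          fun z : ℂ => ‖coefficient ω.1 (chartAt ℂ x₀) z‖ₑ ^ 2).restrict (chartAt ℂ x₀).target) :=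
        (chartAt ℂ x₀).continuousOn_symm.aemeasurable (chartAt ℂ x₀).open_target.measurableSet
      rw [hm, Measure.map_apply_of_aemeasurable hae hZ,
        Measure.restrict_apply' (chartAt ℂ x₀).open_target.measurableSet]
      have hs : (chartAt ℂ x₀).symm ⁻¹' {y : X | ω.1 y = 0} ∩ (chartAt ℂ x₀).target
          = (chartAt ℂ x₀).target ∩ coefficient ω.1 (chartAt ℂ x₀) ⁻¹' {0} := by
        ext z
        constructor
        · rintro ⟨h1, h2⟩
          refine ⟨h2, ?_⟩
          have := (eq_zero_iff ω x₀ _ ((chartAt ℂ x₀).map_target h2)).1 h1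
          rwa [(chartAt ℂ x₀).right_inv h2] at this
        · rintro ⟨h1, h2⟩
          refine ⟨(eq_zero_iff ω x₀ _ ((chartAt ℂ x₀).map_target h1)).2 ?_, h1⟩
          rwa [(chartAt ℂ x₀).right_inv h1]
      rw [hs, withDensity_apply _ (measurableSet_zeros_inter ω x₀),
        setLIntegral_congr_fun (g := fun _ => 0) (measurableSet_zeros_inter ω x₀), lintegral_zero]
      intro z hz
      have : coefficient ω.1 (chartAt ℂ x₀) z = 0 := hz.2
      simp [this]
    have h3 : m.restrict {y : X | ω.1 y = 0}ᶜ = m :=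
      Measure.restrict_eq_self_of_ae_mem (by
        rw [ae_iff]; simpa using h2)
    rw [← h3]
    exact Measure.restrict_mono le_rfl h1
  have h2 := h {y : X | ω.1 y = 0}
  rw [Measure.restrict_apply hZ] at h2
  simpa using h2

theorem metric_ne_zero (S : SpinStructure C) (ω : HolomorphicForm X) (x₀ y : X)
    (hy : y ∈ (trivializationAt ℂ C x₀).baseSet) (hω : ω.1 y ≠ 0) : metric S ω x₀ y ≠ 0 := by
  have key : ∀ η : Cotangent X y, η ≠ 0 → (η (1 : ℂ) : ℂ) ≠ 0 :=
    fun η h h' => h (ContinuousLinearMap.ext_ring h')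
  have h1 := S.mul_ne_zero y _ _ (frame_ne_zero x₀ y hy) (frame_ne_zero x₀ y hy)
  exact norm_ne_zero_iff.2 (div_ne_zero (key _ h1) (key _ hω))

variable (C) in
/-- A choice of one of finitely many trivializations at every point, with measurable pieces. -/
theorem exists_index : ∃ (t : Finset X) (i : X → X), (∀ y, i y ∈ t ∧ y ∈ nbhd C (i y)) ∧
    ∀ j, MeasurableSet {y | i y = j} := by
  classical
  obtain ⟨t, ht⟩ := exists_finset_nbhd C
  have hlt : ∀ y, ∃ n, ∃ h : n < t.card, y ∈ nbhd C (t.equivFin.symm ⟨n, h⟩ : X) := fun y => by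
    obtain ⟨x, hx, hy⟩ := ht y
    refine ⟨t.equivFin ⟨x, hx⟩, (t.equivFin ⟨x, hx⟩).2, ?_⟩
    simpa using hy
  have hf := fun y => Nat.find_spec (hlt y)
  refine ⟨t, fun y => t.equivFin.symm ⟨Nat.find (hlt y), (hf y).1⟩,
    fun y => ⟨Subtype.property _, (hf y).2⟩, fun j => ?_⟩
  have hA : ∀ n, MeasurableSet
      {y : X | ∃ h : n < t.card, y ∈ nbhd C (t.equivFin.symm ⟨n, h⟩ : X)} := fun n => by
    by_cases h : n < t.card
    · simpa [h] using (isOpen_nbhd (C := C) (t.equivFin.symm ⟨n, h⟩ : X)).measurableSet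
    · simp [h]
  have hn : Measurable fun y => Nat.find (hlt y) := measurable_find hlt hA
  by_cases hj : j ∈ t
  · convert hn (measurableSet_singleton ((t.equivFin ⟨j, hj⟩ : Fin t.card) : ℕ)) using 1
    ext y
    simp only [Set.mem_ofPred_eq, Set.mem_preimage, Set.mem_singleton_iff]
    constructor
    · intro h
      have h' : t.equivFin.symm ⟨Nat.find (hlt y), (hf y).1⟩ = ⟨j, hj⟩ := Subtype.ext h
      rw [← h', Equiv.apply_symm_apply]
    · intro h
      have : (⟨Nat.find (hlt y), (hf y).1⟩ : Fin t.card) = t.equivFin ⟨j, hj⟩ := Fin.ext h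
      rw [this, Equiv.symm_apply_apply]
  · convert MeasurableSet.empty
    ext y
    simp only [Set.mem_ofPred_eq, Set.mem_empty_iff_false, iff_false]
    rintro rfl
    exact hj (Subtype.property _)

theorem aemeasurable_of_index {t : Finset X} {i : X → X}
    (hi : ∀ y, i y ∈ t ∧ y ∈ nbhd C (i y)) (him : ∀ j, MeasurableSet {y | i y = j})
    {μ : Measure X} {f : X → ℂ} (g : X → X → ℂ) (hfg : ∀ y, f y = g (i y) y)
    (hg : ∀ j, AEMeasurable (g j) (μ.restrict (nbhd C j))) : AEMeasurable f μ := by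
  have hu : (⋃ j : t, {y | i y = j.1}) = Set.univ := by
    ext y
    simpa using (hi y).1
  have : AEMeasurable f (μ.restrict (⋃ j : t, {y | i y = j.1})) := by
    refine aemeasurable_iUnion_iff.2 fun j => ?_
    have h1 : AEMeasurable (g j) (μ.restrict {y | i y = j.1}) :=
      (hg j).mono_measure (Measure.restrict_mono (fun y (hy : i y = j.1) => hy ▸ (hi y).2) le_rfl)
    refine h1.congr ?_
    filter_upwards [ae_restrict_mem (him j)] with y hy
    rw [hfg, show i y = j.1 from hy]
  rwa [hu, Measure.restrict_univ] at this

theorem aemeasurable_component_frame (x₀ j : X) (μ : Measure X) :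
    AEMeasurable (fun y => component C x₀ y (frame C j y)) (μ.restrict (nbhd C j)) := by
  set e := trivializationAt ℂ C j
  set e' := trivializationAt ℂ C x₀
  have hc : ContinuousOn (fun y => component C x₀ y (frame C j y)) (e.baseSet ∩ e'.baseSet) := by
    have h := ((continuousOn_coordChange ℂ e e').clm_apply
      (continuousOn_const (c := (1 : ℂ))))
    refine h.congr fun y hy => ?_
    simp only [component, frame]
    rw [Trivialization.symmₗ_apply _ hy.1, Trivialization.linearMapAt_apply, if_pos hy.2]
    exact (Trivialization.coordChangeL_apply (R := ℂ) e e' hy 1).symm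
  have hm := (e.open_baseSet.inter e'.open_baseSet).measurableSet
  have h0 : ∀ y, y ∉ e'.baseSet → component C x₀ y (frame C j y) = 0 := fun y hy => by
    simp only [component]
    rw [Trivialization.linearMapAt_apply, if_neg hy]
  have h1 : AEMeasurable ((e.baseSet ∩ e'.baseSet).indicator
      (fun y => component C x₀ y (frame C j y))) μ :=
    (aemeasurable_indicator_iff hm).2 (hc.aemeasurable hm)
  refine h1.restrict.congr ?_
  filter_upwards [ae_restrict_mem (isOpen_nbhd (C := C) j).measurableSet] with y hy
  by_cases h : y ∈ e'.baseSet
  · rw [Set.indicator_of_mem (show y ∈ e.baseSet ∩ e'.baseSet from ⟨hy.2, h⟩)]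
  · rw [Set.indicator_of_notMem (fun h' => h h'.2), h0 y h]

instance completeSpace_squareIntegrable (S : SpinStructure C) (ω : HolomorphicForm X) :
    CompleteSpace (SquareIntegrable S ω) := by
  obtain ⟨t, i, hi, him⟩ := exists_index C
  set T : (∀ y, C y) → X → ℂ :=
    fun u y => component C (i y) y (u y) * (√(metric S ω (i y) y) : ℂ) with hT
  have hpos : ∀ x y, 0 ≤ metric S ω x y := fun x y => norm_nonneg _
  have hsqrt : ∀ j, AEMeasurable (fun y => (√(metric S ω j y) : ℂ))
      ((area ω).restrict (nbhd C j)) := fun j =>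
    Complex.measurable_ofReal.comp_aemeasurable
      (Real.continuous_sqrt.measurable.comp_aemeasurable (aemeasurable_metric S ω j _))
  have hTm : ∀ u : ∀ y, C y, MeasurableSection (area ω) u → AEMeasurable (T u) (area ω) :=
    fun u hu => aemeasurable_of_index hi him
      (fun j y => component C j y (u y) * (√(metric S ω j y) : ℂ)) (fun y => rfl)
      fun j => (hu j).restrict.mul (hsqrt j)
  have hTn : ∀ (u : ∀ y, C y) y, ‖T u y‖ ^ 2 = ‖herm S ω y (u y) (u y)‖ := fun u y => by
    rw [herm_eq S ω (i y) y (hi y).2.2, hT]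
    simp only [norm_mul, Complex.norm_real, RCLike.norm_conj, mul_pow,
      Real.norm_of_nonneg (hpos _ _), Real.norm_of_nonneg (Real.sqrt_nonneg _),
      Real.sq_sqrt (hpos _ _)]
    ring
  have hTL : ∀ u : ∀ y, C y, u ∈ squareIntegrable S ω ↔
      MeasurableSection (area ω) u ∧ MemLp (T u) 2 (area ω) := fun u => by
    refine and_congr_right fun hu => ?_
    rw [memLp_two_iff_integrable_sq_norm (hTm u hu).aestronglyMeasurable]
    simp only [hTn]
    exact (integrable_norm_iff (aemeasurable_herm S ω hu hu).aestronglyMeasurable).symm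
  let Φ : SquareIntegrable S ω → Lp ℂ 2 (area ω) := fun u => ((hTL u.1).1 u.2).2.toLp _
  have hsub : ∀ u v, Φ (u - v) = Φ u - Φ v := fun u v => by
    rw [← MemLp.toLp_sub]
    refine MemLp.toLp_congr _ _ (Eventually.of_forall fun y => ?_)
    have h : (u - v).1 y = u.1 y - v.1 y := rfl
    simp only [hT, Pi.sub_apply, h, map_sub, sub_mul]
  have hnorm : ∀ u, ‖Φ u‖ = ‖u‖ := fun u => by
    have h1 : ‖Φ u‖ ^ 2 = ‖u‖ ^ 2 := by
      rw [norm_sq_eq, ← inner_self_eq_norm_sq (𝕜 := ℂ), L2.inner_def, ← integral_re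
        (L2.integrable_inner _ _)]
      refine integral_congr_ae ?_
      filter_upwards [((hTL u.1).1 u.2).2.coeFn_toLp] with y hy
      rw [inner_self_eq_norm_sq, hy, hTn]
    exact (sq_eq_sq₀ (norm_nonneg _) (norm_nonneg _)).1 h1
  have hiso : Isometry Φ := Isometry.of_dist_eq fun u v => by
    rw [dist_eq_norm, dist_eq_norm, ← hsub, hnorm]
  have hsurj : Function.Surjective Φ := fun g => by
    let u : ∀ y, C y := fun y => (g y / (√(metric S ω (i y) y) : ℂ)) • frame C (i y) y
    have hum : MeasurableSection (area ω) u := fun x₀ => by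
      refine aemeasurable_of_index hi him (fun j y => (g y / (√(metric S ω j y) : ℂ))
        * component C x₀ y (frame C j y)) (fun y => ?_) fun j => ?_
      · simp only [u, map_smul, smul_eq_mul]
      · exact (((Lp.aestronglyMeasurable g).aemeasurable.restrict).div (hsqrt j)).mul
          (aemeasurable_component_frame x₀ j _)
    have hTu : T u =ᵐ[area ω] g := by
      have h0 : ∀ᵐ y ∂(area ω), ω.1 y ≠ 0 := by
        rw [ae_iff]; simpa using area_zeros ω
      filter_upwards [h0] with y hy
      have h1 : (√(metric S ω (i y) y) : ℂ) ≠ 0 := by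
        rw [Ne, Complex.ofReal_eq_zero, Real.sqrt_eq_zero (hpos _ _)]
        exact metric_ne_zero S ω _ _ (hi y).2.2 hy
      simp only [hT, u, map_smul, smul_eq_mul, component_frame _ _ (hi y).2.2, mul_one]
      exact div_mul_cancel₀ _ h1
    have hu : u ∈ squareIntegrable S ω :=
      (hTL u).2 ⟨hum, (memLp_congr_ae hTu).2 (Lp.memLp g)⟩
    refine ⟨⟨u, hu⟩, ?_⟩
    calc Φ ⟨u, hu⟩ = (Lp.memLp g).toLp g := MemLp.toLp_congr _ _ hTu
      _ = g := Lp.toLp_coeFn g _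
  rw [completeSpace_iff_isComplete_range hiso.isUniformInducing, hsurj.range_eq]
  exact isComplete_univ

/-- The Hilbert space `L₂(X; C)`: square integrable sections modulo null sections. -/
abbrev L2 (S : SpinStructure C) (ω : HolomorphicForm X) : Type _ :=
  SeparationQuotient (SquareIntegrable S ω)

end L2

section Laplacian

/-- The Wirtinger derivative `∂_z f`. -/
def wirtinger (f : ℂ → ℂ) (z : ℂ) : ℂ := (fderiv ℝ f z 1 - Complex.I * fderiv ℝ f z Complex.I) / 2

/-- The Wirtinger derivative `∂_z̄ f`. -/
def wirtingerBar (f : ℂ → ℂ) (z : ℂ) : ℂ :=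
  (fderiv ℝ f z 1 + Complex.I * fderiv ℝ f z Complex.I) / 2

variable {X : Type*} [TopologicalSpace X] [ChartedSpace ℂ X]
  {C : X → Type*} [TopologicalSpace (TotalSpace ℂ C)] [∀ y, AddCommGroup (C y)]
  [∀ y, Module ℂ (C y)] [∀ y, TopologicalSpace (C y)] [FiberBundle ℂ C] [VectorBundle ℂ ℂ C]

/-- The Dolbeault Laplacian `Δ u = -ρ² h⁻¹ ∂(h ∂̄ u)`, where `ρ⁻² = |ω|²`, computed at `y` in the
local coordinate and the local holomorphic frame around `y`. -/
def laplacian (S : SpinStructure C) (ω : HolomorphicForm X) (u : ∀ y, C y) : ∀ y, C y := fun y =>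
  let c := chartAt ℂ y
  let h : ℂ → ℂ := fun z => (metric S ω y (c.symm z) : ℂ)
  let f : ℂ → ℂ := fun z => component C y (c.symm z) (u (c.symm z))
  (-(((‖coefficient ω.1 c (c y)‖ ^ 2 : ℝ) : ℂ)⁻¹ * (h (c y))⁻¹ *
    wirtinger (fun z => h z * wirtingerBar f z) (c y))) • frame C y y

/-- The sections in `C_c^∞(Ẋ; C)`: smooth in the real sense, with support (automatically compact)
in the complement `Ẋ` of the zeros of `ω`. -/
def IsTestSection (ω : HolomorphicForm X) (u : ∀ y, C y) : Prop :=
  ContMDiff 𝓘(ℝ, ℂ) (𝓘(ℝ, ℂ).prod 𝓘(ℝ, ℂ)) ((⊤ : ℕ∞) : WithTop ℕ∞)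
      (fun y => TotalSpace.mk' ℂ y (u y)) ∧
    closure {y | u y ≠ 0} ⊆ {y | ω.1 y ≠ 0}

variable [IsManifold 𝓘(ℂ) (⊤ : WithTop ℕ∞) X] [MeasurableSpace X] [BorelSpace X] [CompactSpace X]

/-- The element `a` of `L₂(X; C)` is the class of the section `u`. -/
def Represents (S : SpinStructure C) (ω : HolomorphicForm X) (u : ∀ y, C y) (a : L2 S ω) : Prop :=
  ∃ hu : u ∈ squareIntegrable S ω, SeparationQuotient.mk (X := SquareIntegrable S ω) ⟨u, hu⟩ = a

/-- The graph of `Δ` on `C_c^∞(Ẋ; C)`. (The spanning set is already a linear subspace.) -/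
def coreGraph (S : SpinStructure C) (ω : HolomorphicForm X) : Submodule ℂ (L2 S ω × L2 S ω) :=
  Submodule.span ℂ {p | ∃ u : ∀ y, C y, IsTestSection ω u ∧
    Represents S ω u p.1 ∧ Represents S ω (laplacian S ω u) p.2}

/-- `Δ_min`: the closure in `L₂(X; C)` of the operator `Δ` with domain `C_c^∞(Ẋ; C)`. -/
def minimalLaplacian (S : SpinStructure C) (ω : HolomorphicForm X) : L2 S ω →ₗ.[ℂ] L2 S ω :=
  (coreGraph S ω).toLinearPMap.closure

/-- `Δ_min^*`: the adjoint of `Δ_min` in `L₂(X; C)`. -/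
def maximalLaplacian (S : SpinStructure C) (ω : HolomorphicForm X) : L2 S ω →ₗ.[ℂ] L2 S ω :=
  (minimalLaplacian S ω).adjoint

/-- The quotient `Dom Δ_min^* / Dom Δ_min`. -/
abbrev BoundarySpace (S : SpinStructure C) (ω : HolomorphicForm X) : Type _ :=
  (maximalLaplacian S ω).domain ⧸
    (minimalLaplacian S ω).domain.submoduleOf (maximalLaplacian S ω).domain

/-- The canonical projection `π : Dom Δ_min^* → Dom Δ_min^* / Dom Δ_min`. -/
abbrev boundaryProj (S : SpinStructure C) (ω : HolomorphicForm X) :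
    (maximalLaplacian S ω).domain →ₗ[ℂ] BoundarySpace S ω :=
  Submodule.mkQ _

/-- `(Δ_min^* u, v) - (u, Δ_min^* v)`, where `(a, b) = ∫ a h b̄ dS = inner ℂ b a`. -/
def boundaryForm (S : SpinStructure C) (ω : HolomorphicForm X)
    (u v : (maximalLaplacian S ω).domain) : ℂ :=
  inner ℂ (v : L2 S ω) (maximalLaplacian S ω u) - inner ℂ (maximalLaplacian S ω v) (u : L2 S ω)

end Laplacian

section WeightedSpaces

/-- `w` is the weak derivative `∂₁^p ∂₂^q v` on `ℝ²`. -/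
def HasWeakDeriv (p q : ℕ) (v w : ℝ × ℝ → ℂ) : Prop :=
  ∀ φ : ℝ × ℝ → ℂ, ContDiff ℝ ((⊤ : ℕ∞) : WithTop ℕ∞) φ → HasCompactSupport φ →
    ∫ a, v a * ((fun (ψ : ℝ × ℝ → ℂ) b => fderiv ℝ ψ b (1, 0))^[p]
        ((fun (ψ : ℝ × ℝ → ℂ) b => fderiv ℝ ψ b (0, 1))^[q] φ)) a
      = (-1) ^ (p + q) * ∫ a, w a * φ a

/-- The Sobolev space `H^l(ℝ²)`. -/
def MemSobolevSpace (l : ℕ) (v : ℝ × ℝ → ℂ) : Prop :=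
  LocallyIntegrable v ∧ ∀ p q : ℕ, p + q ≤ l → ∃ w, MemLp w 2 volume ∧ HasWeakDeriv p q v w

/-- The space `H_ν^l` of functions `v(s, φ)`, `s = log r`, that are `α`-antiperiodic in `φ` and
satisfy `sup_{φ₀} ∑_{p + q ≤ l} ∫ ds ∫_{φ₀}^{φ₀ + α} dφ |∂_φ^q ∂_s^p v|² e^{2 ν s} < ∞`. -/
def MemConeSpace (α : ℝ) (l : ℕ) (ν : ℝ) (v : ℝ × ℝ → ℂ) : Prop :=
  LocallyIntegrable v ∧ (∀ s φ : ℝ, v (s, φ + α) = -v (s, φ)) ∧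
    ∀ p q : ℕ, p + q ≤ l → ∃ w, LocallyIntegrable w ∧ HasWeakDeriv p q v w ∧
      (⨆ φ₀ : ℝ, ∫⁻ a in Set.univ ×ˢ Set.Icc φ₀ (φ₀ + α),
        ‖w a‖ₑ ^ 2 * ENNReal.ofReal (Real.exp (2 * ν * a.1))) < ⊤

variable {X : Type*} [TopologicalSpace X] [ChartedSpace ℂ X]
  {C : X → Type*} [TopologicalSpace (TotalSpace ℂ C)] [∀ y, AddCommGroup (C y)]
  [∀ y, Module ℂ (C y)] [∀ y, TopologicalSpace (C y)] [FiberBundle ℂ C] [VectorBundle ℂ ℂ C]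

/-- `x` is a holomorphic local coordinate and `e` is a holomorphic section of `C` over its domain
with `e ⊗ e = dx`. Such an `e` is unique up to sign on connected sets; the representative of a
section `u` in the coordinate `x` is the function `u(x)` with `u = u(x) e`. -/
structure IsSpinorChart (S : SpinStructure C) (x : OpenPartialHomeomorph X ℂ) (e : ∀ y, C y) :
    Prop where
  mem_maximalAtlas : x ∈ IsManifold.maximalAtlas 𝓘(ℂ) (⊤ : WithTop ℕ∞) X
  holomorphic : ContMDiffOn 𝓘(ℂ) (𝓘(ℂ).prod 𝓘(ℂ)) (⊤ : WithTop ℕ∞)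
    (fun y => TotalSpace.mk' ℂ y (e y)) x.source
  square : ∀ z ∈ x.target, coefficient (fun y => S.mul y (e y) (e y)) x z = 1

/-- A flat coordinate `z = ∫ ω`, that is, `ω = dz`. -/
structure IsFlatChart (S : SpinStructure C) (ω : HolomorphicForm X)
    (x : OpenPartialHomeomorph X ℂ) (e : ∀ y, C y) : Prop extends IsSpinorChart S x e where
  flat : ∀ z ∈ x.target, coefficient ω.1 x z = 1

/-- A distinguished coordinate `x = (2 ∫_p ω)^{1/2}` at a conical point `p`,
that is, `x(p) = 0` and `ω = x dx`. -/
structure IsDistinguishedChart (S : SpinStructure C) (ω : HolomorphicForm X) (p : X)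
    (x : OpenPartialHomeomorph X ℂ) (e : ∀ y, C y) : Prop extends IsSpinorChart S x e where
  mem_source : p ∈ x.source
  map_point : x p = 0
  distinguished : ∀ z ∈ x.target, coefficient ω.1 x z = z

/-- A smooth cut-off function supported in `U`. -/
def IsCutoff (U : Set X) (χ : X → ℝ) : Prop :=
  ContMDiff 𝓘(ℝ, ℂ) 𝓘(ℝ, ℝ) ((⊤ : ℕ∞) : WithTop ℕ∞) χ ∧ tsupport χ ⊆ U

open scoped Classical in
/-- The representative of `χ u` in the coordinate `x`, extended by zero. -/
def representative (x : OpenPartialHomeomorph X ℂ) (e : ∀ y, C y) (χ : X → ℝ) (u : ∀ y, C y)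
    (z : ℂ) : ℂ :=
  if z ∈ x.target then
    (χ (x.symm z) : ℂ) * (component C (x.symm z) (x.symm z) (u (x.symm z)) /
      component C (x.symm z) (x.symm z) (e (x.symm z)))
  else 0

/-- Near a conical point with distinguished coordinate `x`: the representative of `χ u` in the
coordinate `x² / 2 = e^{s + i φ}`, as a function of `s` and `φ`; it arises from the representative
in the coordinate `x = √2 e^{(s + i φ) / 2}` upon multiplication by `x^{-1/2}`. -/
def coneRepresentative (x : OpenPartialHomeomorph X ℂ) (e : ∀ y, C y) (χ : X → ℝ)
    (u : ∀ y, C y) (a : ℝ × ℝ) : ℂ :=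
  let ζ : ℂ := a.1 + a.2 * Complex.I
  ((2 : ℝ) ^ (-(1 / 4) : ℝ) : ℝ) * Complex.exp (-(ζ / 4)) *
    representative x e χ u ((√2 : ℝ) * Complex.exp (ζ / 2))

/-- The weighted space `𝓗_ν^l` of sections of `C`: near the conical points the localizations of
`u` are in `H_ν^l` (for the cone of angle `4π`), and elsewhere they are in `H^l`. -/
def MemWeightedSpace [MeasurableSpace X] (S : SpinStructure C) (ω : HolomorphicForm X)
    (l : ℕ) (ν : ℝ) (u : ∀ y, C y) : Prop :=
  MeasurableSection (area ω) u ∧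
  (∀ (x : OpenPartialHomeomorph X ℂ) (e : ∀ y, C y) (χ : X → ℝ), IsFlatChart S ω x e →
    IsCutoff x.source χ →
    MemSobolevSpace l fun a => representative x e χ u (a.1 + a.2 * Complex.I)) ∧
  ∀ (p : X) (x : OpenPartialHomeomorph X ℂ) (e : ∀ y, C y) (χ : X → ℝ),
    IsDistinguishedChart S ω p x e → IsCutoff x.source χ →
    MemConeSpace (4 * Real.pi) l ν (coneRepresentative x e χ u)

/-- The section `χ f_{m,+}`, where `f_{m,+} = x^m`. -/
def modelPlus (x : OpenPartialHomeomorph X ℂ) (e : ∀ y, C y) (χ : X → ℝ) (m : ℤ) : ∀ y, C y :=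
  fun y => ((χ y : ℂ) * x y ^ m) • e y

/-- The section `χ f_{m,-}`, where `f_{m,-} = x̄^{1/2 - m} x^{1/2} / (π (m - 1/2))`
and `x̄^{1/2} x^{1/2} = |x|`. -/
def modelMinus (x : OpenPartialHomeomorph X ℂ) (e : ∀ y, C y) (χ : X → ℝ) (m : ℤ) : ∀ y, C y :=
  fun y => ((χ y : ℂ) * (conj (x y) ^ (-m) * (‖x y‖ : ℂ) / ((Real.pi : ℂ) * ((m : ℂ) - 1 / 2)))) •
    e y

end WeightedSpaces

end

end SpinorLaplacian

open MeasureTheory Filter Bundle Manifold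
open scoped Real Topology ComplexConjugate InnerProductSpace LinearPMap

namespace SpinorLaplacian

set_option linter.unusedSectionVars false

noncomputable section

open Complex

local notation "⊤ω" => (⊤ : WithTop ℕ∞)

local notation "∞" => ((⊤ : ℕ∞) : WithTop ℕ∞)

local notation "ℝ²" => ℝ × ℝ

local notation "Fn" => ℝ² → ℂ

local notation "Idx" => Finset.Icc (-1 : ℤ) 2

lemma zero_off_tsupport {α β : Type*} [TopologicalSpace α] [Zero β] {f : α → β} {a : α}
  (h : a ∉ tsupport f) : f a = 0 := image_eq_zero_of_notMem_tsupport h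

variable {f g : Fn}

section PlanarCalculus

/-- The class of smooth functions on the plane. -/
abbrev Smooth (f : Fn) : Prop := ContDiff ℝ ∞ f

/-- The derivative in the first variable. -/
def dS (f : Fn) (a : ℝ²) : ℂ := fderiv ℝ f a (1, 0)

/-- The derivative in the second variable. -/
def dP (f : Fn) (a : ℝ²) : ℂ := fderiv ℝ f a (0, 1)

/-- The Laplacian of the plane. -/
def lap (f : Fn) (a : ℝ²) : ℂ := dS (dS f) a + dP (dP f) a

local notation "DS" => SpinorLaplacian.dS

local notation "DP" => SpinorLaplacian.dP

lemma smooth_fderiv_apply (hf : Smooth f) (v : ℝ²) : Smooth fun a => fderiv ℝ f a v :=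
  (hf.fderiv_right (m := ∞) (by simp)).clm_apply contDiff_const

lemma Smooth.dS (hf : Smooth f) : Smooth (dS f) := smooth_fderiv_apply hf _

lemma Smooth.dP (hf : Smooth f) : Smooth (dP f) := smooth_fderiv_apply hf _

lemma Smooth.lap (hf : Smooth f) : Smooth (lap f) := hf.dS.dS.add hf.dP.dP

lemma Smooth.diff (hf : Smooth f) : Differentiable ℝ f := hf.differentiable (by simp)

lemma Smooth.conj (hf : Smooth f) : Smooth fun a => conj (f a) := conjCLE.contDiff.comp hf

lemma dS_add (hf : Smooth f) (hg : Smooth g) :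
  dS (fun a => f a + g a) = fun a => dS f a + dS g a := by
  funext a
  simp [dS]
  rw [fderiv_fun_add (hf.diff a) (hg.diff a)]; rfl

lemma dP_add (hf : Smooth f) (hg : Smooth g) :
  dP (fun a => f a + g a) = fun a => dP f a + dP g a := by
  funext a
  simp [dP]
  rw [fderiv_fun_add (hf.diff a) (hg.diff a)]; rfl

lemma dS_const_mul (hf : Smooth f) (c : ℂ) : dS (fun a => c * f a) = fun a => c * dS f a := by
  funext a
  simp [dS]
  rw [fderiv_const_mul (hf.diff a)]; rfl

lemma dP_const_mul (hf : Smooth f) (c : ℂ) : dP (fun a => c * f a) = fun a => c * dP f a := by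
  funext a
  simp [dP]
  rw [fderiv_const_mul (hf.diff a)]; rfl

lemma dS_mul (hf : Smooth f) (hg : Smooth g) :
  dS (fun a => f a * g a) = fun a => dS f a * g a + f a * dS g a := by
  funext a
  simp [dS]
  rw [fderiv_fun_mul (hf.diff a) (hg.diff a)]
  simp; ring

lemma dP_mul (hf : Smooth f) (hg : Smooth g) :
  dP (fun a => f a * g a) = fun a => dP f a * g a + f a * dP g a := by
  funext a
  simp [dP]
  rw [fderiv_fun_mul (hf.diff a) (hg.diff a)]
  simp; ring

lemma fderiv_conj_apply {a : ℝ²} (hf : DifferentiableAt ℝ f a) (v : ℝ²) :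
  fderiv ℝ (fun a => conj (f a)) a v = conj (fderiv ℝ f a v) := by
  have h := (conjCLE.toContinuousLinearMap.hasFDerivAt.comp a hf.hasFDerivAt).fderiv
  have h2 : (fun a => conj (f a)) = conjCLE.toContinuousLinearMap ∘ f := rfl
  rw [h2, h]; rfl

lemma dS_conj (hf : Smooth f) : dS (fun a => conj (f a)) = fun a => conj (dS f a) :=
  funext fun a => fderiv_conj_apply (hf.diff a) _

lemma dP_conj (hf : Smooth f) : dP (fun a => conj (f a)) = fun a => conj (dP f a) :=
  funext fun a => fderiv_conj_apply (hf.diff a) _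

lemma lap_conj (hf : Smooth f) : lap (fun a => conj (f a)) = fun a => conj (lap f a) := by
  funext a
  simp only [lap]
  rw [dS_conj hf, dS_conj hf.dS, dP_conj hf, dP_conj hf.dP, map_add]

lemma lap_mul (hf : Smooth f) (hg : Smooth g) :
  lap (fun a => f a * g a) = fun a => lap f a * g a + 2 * (dS f a * dS g a + dP f a * dP g a)
    + f a * lap g a := by
  funext a
  simp [lap]
  rw [dS_mul hf hg, dP_mul hf hg, dS_add (hf.dS.mul hg) (hf.mul hg.dS),
    dP_add (hf.dP.mul hg) (hf.mul hg.dP), dS_mul hf.dS hg, dS_mul hf hg.dS, dP_mul hf.dP hg,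
    dP_mul hf hg.dP]
  ring

lemma lap_add (hf : Smooth f) (hg : Smooth g) :
  lap (fun a => f a + g a) = fun a => lap f a + lap g a := by
  funext a
  simp [lap]
  rw [dS_add hf hg, dP_add hf hg, dS_add hf.dS hg.dS, dP_add hf.dP hg.dP]
  ring

lemma lap_const_mul (hf : Smooth f) (c : ℂ) : lap (fun a => c * f a) = fun a => c * lap f a := by
  funext a
  simp [lap]
  rw [dS_const_mul hf, dP_const_mul hf, dS_const_mul hf.dS, dP_const_mul hf.dP]
  ring

lemma dP_dS (hf : Smooth f) : dP (dS f) = dS (dP f) := by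
  funext a
  have h1 : ∀ v w, fderiv ℝ (fun b => fderiv ℝ f b v) a w = fderiv ℝ (fderiv ℝ f) a w v := by
    intro v w
    have hd : DifferentiableAt ℝ (fderiv ℝ f) a :=
      ((hf.fderiv_right (m := ∞) (by simp)).differentiable (by simp)) a
    rw [fderiv_clm_apply hd (differentiableAt_const v)]
    simp
  have h2 : IsSymmSndFDerivAt ℝ f a := hf.contDiffAt.isSymmSndFDerivAt (by
      rw [minSmoothness_of_isRCLikeNormedField]
      exact WithTop.coe_le_coe.2 (le_top : (2 : ℕ∞) ≤ ⊤))
  exact (h1 _ _).trans ((h2 _ _).trans (h1 _ _).symm)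

lemma dS_eqOn_zero {U : Set ℝ²} (hU : IsOpen U) (hf : ∀ a ∈ U, f a = 0) :
  ∀ a ∈ U, dS f a = 0 := fun a ha => by
  have : f =ᶠ[𝓝 a] fun _ => 0 := by filter_upwards [hU.mem_nhds ha] with b hb using hf b hb
  simp [dS, this.fderiv_eq]

lemma dP_eqOn_zero {U : Set ℝ²} (hU : IsOpen U) (hf : ∀ a ∈ U, f a = 0) :
  ∀ a ∈ U, dP f a = 0 := fun a ha => by
  have : f =ᶠ[𝓝 a] fun _ => 0 := by filter_upwards [hU.mem_nhds ha] with b hb using hf b hb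
  simp [dP, this.fderiv_eq]

lemma Filter.EventuallyEq.dS {a : ℝ²} (h : f =ᶠ[𝓝 a] g) : dS f =ᶠ[𝓝 a] dS g := by
  filter_upwards [h.fderiv (𝕜 := ℝ)] with b hb
  simp [SpinorLaplacian.dS, hb]

lemma Filter.EventuallyEq.dP {a : ℝ²} (h : f =ᶠ[𝓝 a] g) : dP f =ᶠ[𝓝 a] dP g := by
  filter_upwards [h.fderiv (𝕜 := ℝ)] with b hb
  simp [SpinorLaplacian.dP, hb]

lemma Filter.EventuallyEq.lap {a : ℝ²} (h : f =ᶠ[𝓝 a] g) : lap f =ᶠ[𝓝 a] lap g := by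
  filter_upwards [Filter.EventuallyEq.dS (Filter.EventuallyEq.dS h),
    Filter.EventuallyEq.dP (Filter.EventuallyEq.dP h)] with b h1 h2
  simp [SpinorLaplacian.lap, h1, h2]

/-- The mixed derivative `∂₁^p ∂₂^q`. -/
def dSP (p q : ℕ) (f : Fn) : Fn := dP^[q] (dS^[p] f)

lemma iterate_mem {α : Type*} {Q : α → Prop} {D : α → α} (h : ∀ a, Q a → Q (D a)) {a : α}
  (ha : Q a) (n : ℕ) : Q (D^[n] a) := by
  induction n with
  | zero => exact ha
  | succ n ih => rw [Function.iterate_succ_apply']; exact h _ ih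

lemma Smooth.dS_iterate (hf : Smooth f) (p : ℕ) : Smooth (DS^[p] f) :=
  iterate_mem (fun _ h => h.dS) hf p

lemma Smooth.dP_iterate (hf : Smooth f) (p : ℕ) : Smooth (DP^[p] f) :=
  iterate_mem (fun _ h => h.dP) hf p

lemma Smooth.dSP (hf : Smooth f) (p q : ℕ) : Smooth (dSP p q f) := (hf.dS_iterate p).dP_iterate q

/-- A class of smooth functions, stable under the derivatives, for which integration by parts with
respect to `μ` produces no boundary terms. -/
structure IBPClass (μ : Measure ℝ²) (B : Fn → Prop) : Prop where
  smooth : ∀ {f}, B f → Smooth f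
  dS : ∀ {f}, B f → B (dS f)
  dP : ∀ {f}, B f → B (dP f)
  add : ∀ {f g}, B f → B g → B fun a => f a + g a
  smul : ∀ {f} (c : ℂ), B f → B fun a => c * f a
  integrable : ∀ {f g}, B f → B g → Integrable (fun a => f a * conj (g a)) μ
  int_dS : ∀ {f g}, B f → B g →
    ∫ a, DS f a * conj (g a) ∂μ = -∫ a, f a * conj (DS g a) ∂μ
  int_dP : ∀ {f g}, B f → B g →
    ∫ a, DP f a * conj (g a) ∂μ = -∫ a, f a * conj (DP g a) ∂μ

/-- The square of the `L²` norm. -/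
def nsq (μ : Measure ℝ²) (f : Fn) : ℝ := ∫ a, ‖f a‖ ^ 2 ∂μ

lemma nsq_nonneg (μ : Measure ℝ²) (f : Fn) : 0 ≤ nsq μ f := integral_nonneg fun _ => sq_nonneg _

namespace IBPClass

variable {μ : Measure ℝ²} {B : Fn → Prop} (hB : IBPClass μ B)
include hB

lemma memLp (hf : B f) : MemLp f 2 μ := by
  rw [memLp_two_iff_integrable_sq_norm (hB.smooth hf).continuous.aestronglyMeasurable]
  refine (hB.integrable hf hf).norm.congr (.of_forall fun a => ?_)
  simp [sq]

lemma integrable_sq (hf : B f) : Integrable (fun a => ‖f a‖ ^ 2) μ :=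
  (memLp_two_iff_integrable_sq_norm (hB.smooth hf).continuous.aestronglyMeasurable).1 (hB.memLp hf)

lemma nsq_add (hf : B f) (hg : B g) :
  nsq μ (fun a => f a + g a) = nsq μ f + nsq μ g + 2 * (∫ a, f a * conj (g a) ∂μ).re := by
  have h : ∀ a, ‖f a + g a‖ ^ 2 = ‖f a‖ ^ 2 + ‖g a‖ ^ 2 + 2 * (f a * conj (g a)).re := fun a => by
    rw [Complex.sq_norm, Complex.sq_norm, Complex.sq_norm, Complex.normSq_add]
  simp only [nsq, h]
  have h2 : (∫ a, f a * conj (g a) ∂μ).re = ∫ a, (f a * conj (g a)).re ∂μ :=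
    (integral_re (hB.integrable hf hg)).symm
  have h3 : Integrable (fun a => (f a * conj (g a)).re) μ := (hB.integrable hf hg).re
  rw [integral_add (f := fun a => ‖f a‖ ^ 2 + ‖g a‖ ^ 2)
    ((hB.integrable_sq hf).add (hB.integrable_sq hg)) (h3.const_mul 2),
    integral_add (hB.integrable_sq hf) (hB.integrable_sq hg), h2, integral_const_mul]

omit hB in
lemma nsq_smul (f : Fn) (c : ℂ) : nsq μ (fun a => c * f a) = ‖c‖ ^ 2 * nsq μ f := by
  simp [nsq, mul_pow]
  rw [integral_const_mul]

lemma nsq_add_le (hf : B f) (hg : B g) :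
  nsq μ (fun a => f a + g a) ≤ 2 * nsq μ f + 2 * nsq μ g := by
  have h := hB.nsq_add hf (hB.smul (-1) hg)
  have h1 := hB.nsq_add hf hg
  have h2 : (∫ a, f a * conj (-1 * g a) ∂μ) = -∫ a, f a * conj (g a) ∂μ := by
    rw [← integral_neg]; congr 1; simp
  rw [h2, nsq_smul, neg_re] at h
  have h3 := nsq_nonneg μ fun a => f a + -1 * g a
  norm_num at h
  norm_num at h3
  linarith

lemma nsq_first_order (hf : B f) (c ε : ℝ) : nsq μ (fun a => DS f a +
    ((c : ℂ) * f a + (ε * I) * DP f a))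
    = nsq μ (DS f) + nsq μ (fun a => (c : ℂ) * f a + (ε * I) * DP f a) := by
  have h1 := hB.smul (c : ℂ) hf
  have h2 := hB.smul (ε * I) (hB.dP hf)
  rw [hB.nsq_add (hB.dS hf) (hB.add h1 h2), add_eq_left]
  have e1 : (∫ a, DS f a * conj (f a) ∂μ).re = 0 := by
    have h := hB.int_dS hf hf
    have h' : (∫ a, f a * conj (DS f a) ∂μ) = conj (∫ a, DS f a * conj (f a) ∂μ) := by
      rw [← integral_conj]; congr 1; simp [mul_comm]
    rw [h'] at h
    have := congrArg re h
    simp at this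
    linarith
  have e2 : (∫ a, DS f a * conj (DP f a) ∂μ).im = 0 := by
    have h := hB.int_dS hf (hB.dP hf)
    rw [← dP_dS (hB.smooth hf)] at h
    have h3 := hB.int_dP hf (hB.dS hf)
    rw [← h3] at h
    have h' : (∫ a, DP f a * conj (DS f a) ∂μ) = conj (∫ a, DS f a * conj (DP f a) ∂μ) := by
      rw [← integral_conj]; congr 1; simp [mul_comm]
    rw [h'] at h
    have := congrArg im h
    simp at this
    linarith
  have e3 : ∫ a, DS f a * conj ((c : ℂ) * f a + (ε * I) * DP f a) ∂μ
      = c * ∫ a, DS f a * conj (f a) ∂μ + (-(ε * I)) * ∫ a, DS f a * conj (DP f a) ∂μ := by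
    rw [← integral_const_mul, ← integral_const_mul, ← integral_add
      ((hB.integrable (hB.dS hf) hf).const_mul _)
      ((hB.integrable (hB.dS hf) (hB.dP hf)).const_mul _)]
    congr 1; funext a
    simp; ring
  rw [e3]
  simp [e1, e2]

lemma factor (hf : B f) (ε : ℝ) (hε : ε ^ 2 = 1) : (fun a => DS (fun a => DS f a + (ε * I)
    * DP f a) a + ((-ε : ℝ) * I) * DP
    (fun a => DS f a + (ε * I) * DP f a) a) = lap f := by
  have hs := hB.smooth hf
  have he : (ε : ℂ) ^ 2 = 1 := by exact_mod_cast hε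
  funext a
  rw [dS_add hs.dS (hB.smooth (hB.smul _ (hB.dP hf))), dP_add hs.dS
    (hB.smooth (hB.smul _ (hB.dP hf))), dS_const_mul hs.dP, dP_const_mul hs.dP, dP_dS hs, lap]
  push_cast
  linear_combination (DP (DP f) a) * (he - ε ^ 2 * I_sq)

end IBPClass

/-- Smooth functions with compact support in the plane. -/
def IsBump (f : Fn) : Prop := Smooth f ∧ HasCompactSupport f

lemma hasCompactSupport_dS (h : HasCompactSupport f) : HasCompactSupport (dS f) :=
  (h.fderiv (𝕜 := ℝ)).comp_left (g := fun L : ℝ × ℝ →L[ℝ] ℂ => L (1, 0)) rfl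

lemma hasCompactSupport_dP (h : HasCompactSupport f) : HasCompactSupport (dP f) :=
  (h.fderiv (𝕜 := ℝ)).comp_left (g := fun L : ℝ × ℝ →L[ℝ] ℂ => L (0, 1)) rfl

lemma IsBump.dS (hf : IsBump f) : IsBump (dS f) := ⟨hf.1.dS, hasCompactSupport_dS hf.2⟩

lemma IsBump.dP (hf : IsBump f) : IsBump (dP f) := ⟨hf.1.dP, hasCompactSupport_dP hf.2⟩

lemma IsBump.smooth_mul (hf : IsBump f) (hg : Smooth g) :
  IsBump fun a => f a * g a := ⟨hf.1.mul hg, hf.2.mul_right⟩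

lemma IsBump.mul_smooth (hf : Smooth f) (hg : IsBump g) :
  IsBump fun a => f a * g a := ⟨hf.mul hg.1, hg.2.mul_left⟩

lemma IsBump.add (hf : IsBump f) (hg : IsBump g) :
  IsBump fun a => f a + g a := ⟨hf.1.add hg.1, hf.2.add hg.2⟩

lemma IsBump.smul (c : ℂ) (hf : IsBump f) : IsBump fun a => c * f a :=
  IsBump.mul_smooth contDiff_const hf

lemma IsBump.conj (hf : IsBump f) : IsBump fun a => conj (f a) :=
  ⟨hf.1.conj, hf.2.comp_left (map_zero _)⟩

lemma IsBump.lap (hf : IsBump f) : IsBump (lap f) := hf.dS.dS.add hf.dP.dP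

lemma IsBump.integrable (hf : IsBump f) : Integrable f :=
  hf.1.continuous.integrable_of_hasCompactSupport hf.2

lemma integral_mul_dS (hf : Smooth f) (hg : IsBump g) : ∫ a, f a * dS g a = -∫ a, dS f a * g a :=
  integral_mul_fderiv_eq_neg_fderiv_mul_of_integrable (IsBump.mul_smooth hf.dS hg).integrable
    (IsBump.mul_smooth hf hg.dS).integrable (IsBump.mul_smooth hf hg).integrable
    (fun a _ => hf.diff a) (fun a _ => hg.1.diff a)

lemma integral_mul_dP (hf : Smooth f) (hg : IsBump g) : ∫ a, f a * dP g a = -∫ a, dP f a * g a :=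
  integral_mul_fderiv_eq_neg_fderiv_mul_of_integrable (IsBump.mul_smooth hf.dP hg).integrable
    (IsBump.mul_smooth hf hg.dP).integrable (IsBump.mul_smooth hf hg).integrable
    (fun a _ => hf.diff a) (fun a _ => hg.1.diff a)

lemma integral_mul_lap (hf : Smooth f) (hg : IsBump g) :
  ∫ a, f a * lap g a = ∫ a, lap f a * g a := by
  simp [lap, mul_add, add_mul]
  rw [integral_add (IsBump.mul_smooth hf hg.dS.dS).integrable
    (IsBump.mul_smooth hf hg.dP.dP).integrable,
    integral_add (IsBump.mul_smooth hf.dS.dS hg).integrable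
    (IsBump.mul_smooth hf.dP.dP hg).integrable, integral_mul_dS hf hg.dS, integral_mul_dP hf hg.dP,
    integral_mul_dS hf.dS hg, integral_mul_dP hf.dP hg, neg_neg, neg_neg]

lemma IsBump.dS_iterate (hf : IsBump f) (p : ℕ) : IsBump (DS^[p] f) :=
  iterate_mem (fun _ h => h.dS) hf p

lemma IsBump.dP_iterate (hf : IsBump f) (p : ℕ) : IsBump (DP^[p] f) :=
  iterate_mem (fun _ h => h.dP) hf p

lemma ibpClass_isBump : IBPClass volume IsBump where
  smooth h := h.1
  dS h := h.dS
  dP h := h.dP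
  add h1 h2 := h1.add h2
  smul c h := h.smul c
  integrable hf hg := (hf.smooth_mul hg.1.conj).integrable
  int_dS {f g} hf hg := by
    have h := integral_mul_dS hg.1.conj hf
    rw [dS_conj hg.1] at h
    simpa only [mul_comm] using h
  int_dP {f g} hf hg := by
    have h := integral_mul_dP hg.1.conj hf
    rw [dP_conj hg.1] at h
    simpa only [mul_comm] using h

end PlanarCalculus

section FlatEstimates

local notation "DS" => SpinorLaplacian.dS

local notation "DP" => SpinorLaplacian.dP

/-- The operators `∂₁ + i ε ∂₂`. -/
def wz (ε : ℝ) (f : Fn) (a : ℝ²) : ℂ := dS f a + (ε * Complex.I) * dP f a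

namespace IBPClass

variable {μ : Measure ℝ²} {B : Fn → Prop} (hB : IBPClass μ B)
include hB

omit hB in
lemma dS_eq_half (f : Fn) : DS f = fun a => (1 / 2 : ℂ) * (wz 1 f a + wz (-1) f a) := by
  simp [wz]; push_cast; ring

omit hB in
lemma dP_eq_half (f : Fn) :
  DP f = fun a => (-Complex.I / 2 : ℂ) * (wz 1 f a + (-1) * wz (-1) f a) := by
  funext a; simp [wz]; push_cast
  linear_combination (DP f a) * Complex.I_sq

lemma wirt (hf : B f) (ε : ℝ) : B (wz ε f) := hB.add (hB.dS hf) (hB.smul _ (hB.dP hf))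

lemma dS_dS_eq (hf : B f) : DS (DS f) =
  fun a => (1 / 2 : ℂ) * (DS (wz 1 f) a + DS (wz (-1) f) a) := by
  have hp := hB.wirt hf 1
  have hm := hB.wirt hf (-1)
  conv_lhs => rw [dS_eq_half f]
  rw [dS_const_mul (hB.smooth (hB.add hp hm)), dS_add (hB.smooth hp) (hB.smooth hm)]

lemma dP_dS_eq (hf : B f) : DP (DS f) =
  fun a => (1 / 2 : ℂ) * (DP (wz 1 f) a + DP (wz (-1) f) a) := by
  have hp := hB.wirt hf 1
  have hm := hB.wirt hf (-1)
  conv_lhs => rw [dS_eq_half f]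
  rw [dP_const_mul (hB.smooth (hB.add hp hm)), dP_add (hB.smooth hp) (hB.smooth hm)]

lemma dP_dP_eq (hf : B f) : DP (DP f) = fun a => (-I / 2 : ℂ) * (DP (wz 1 f) a
    + (-1) * DP (wz (-1) f) a) := by
  have hp := hB.wirt hf 1
  have hm := hB.wirt hf (-1)
  have hm' := hB.smul (-1) hm
  conv_lhs => rw [dP_eq_half f]
  rw [dP_const_mul (hB.smooth (hB.add hp hm')), dP_add (hB.smooth hp) (hB.smooth hm'),
    dP_const_mul (hB.smooth hm)]

lemma bound_of_wirt {Q : Fn → ℝ} (hQ : ∀ {f g}, B f → B g →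
    Q (fun a => f a + g a) ≤ 2 * Q f + 2 * Q g)
  (hQs : ∀ f (c : ℂ), Q (fun a => c * f a) = ‖c‖ ^ 2 * Q f)
  {u v : Fn} (hu : B u) (hv : B v) {M : ℝ} (h1 : Q u ≤ M) (h2 : Q v ≤ M) :
  Q (fun a => (1 / 2 : ℂ) * (u a + v a)) ≤ M ∧
    Q (fun a => (-I / 2 : ℂ) * (u a + (-1) * v a)) ≤ M := by
  have h3 := hQ hu hv
  have h4 := hQ hu (hB.smul (-1) hv)
  rw [hQs v] at h4
  rw [hQs, hQs]
  norm_num at h4 ⊢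
  constructor <;> nlinarith

end IBPClass

lemma nsq_second_order_le (hf : IsBump f) :
  nsq volume (dS (dS f)) ≤ nsq volume (lap f) ∧ nsq volume (dP (dS f)) ≤ nsq volume (lap f) ∧
    nsq volume (dP (dP f)) ≤ nsq volume (lap f) := by
  have hB := ibpClass_isBump
  have key : ∀ ε : ℝ, ε ^ 2 = 1 → nsq volume (dS (wz ε f)) ≤ nsq volume (lap f) ∧
      nsq volume (dP (wz ε f)) ≤ nsq volume (lap f) := by
    intro ε hε
    have h := hB.nsq_first_order (hB.wirt hf ε) 0 (-ε)
    simp only [ofReal_zero, zero_mul, zero_add] at h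
    have hfac : (fun a => dS (wz ε f) a + ((-ε : ℝ) * I) * dP (wz ε f) a) = lap f :=
      hB.factor hf ε hε
    rw [hfac, IBPClass.nsq_smul] at h
    have h2 : ‖((-ε : ℝ) : ℂ) * I‖ ^ 2 = 1 := by simp_all
    rw [h2, one_mul] at h
    constructor
    · linarith [nsq_nonneg volume (dP (wz ε f))]
    · linarith [nsq_nonneg volume (dS (wz ε f))]
  have hp := key 1 (by norm_num)
  have hm := key (-1) (by norm_num)
  have hwp := hB.wirt hf 1
  have hwm := hB.wirt hf (-1)
  have hadd : ∀ {f g}, IsBump f → IsBump g → nsq volume (fun a => f a + g a)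
    ≤ 2 * nsq volume f + 2 * nsq volume g := fun h1 h2 => hB.nsq_add_le h1 h2
  have hs := hB.bound_of_wirt hadd (fun f c => IBPClass.nsq_smul f c) hwp.dS hwm.dS hp.1 hm.1
  have hpp := hB.bound_of_wirt hadd (fun f c => IBPClass.nsq_smul f c) hwp.dP hwm.dP hp.2 hm.2
  rw [hB.dS_dS_eq hf, hB.dP_dS_eq hf, hB.dP_dP_eq hf]
  exact ⟨hs.1, hpp.1, hpp.2⟩

lemma nsq_first_order_le (hf : IsBump f) :
  nsq volume (dS f) + nsq volume (dP f) ≤ nsq volume f + nsq volume (lap f) := by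
  have hB := ibpClass_isBump
  have key : ∀ g : Fn, ((nsq volume g : ℝ) : ℂ) = ∫ a, g a * conj (g a) := fun g => by
    rw [nsq, ← integral_complex_ofReal]
    congr 1; funext a; rw [mul_conj']; push_cast; rfl
  have h1 := hB.int_dS hf hf.dS
  have h2 := hB.int_dP hf hf.dP
  rw [← key] at h1 h2
  have h3 : ((nsq volume (dS f) + nsq volume (dP f) : ℝ) : ℂ) = -∫ a, f a * conj (lap f a) := by
    push_cast
    rw [h1, h2, ← neg_add, ← integral_add (hB.integrable hf hf.dS.dS) (hB.integrable hf hf.dP.dP)]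
    congr 2; simp [lap, mul_add]
  have h4 := hB.nsq_add hf hf.lap
  have h5 := congrArg re h3
  rw [ofReal_re, neg_re] at h5
  have h6 := nsq_nonneg volume fun a => f a + lap f a
  have h7 := nsq_nonneg volume (dS f)
  have h8 := nsq_nonneg volume (dP f)
  linarith

lemma nsq_dSP_le (hf : IsBump f) {p q : ℕ} (hpq : p + q ≤ 2) :
  nsq volume (dSP p q f) ≤ nsq volume f + nsq volume (lap f) := by
  have h1 := nsq_second_order_le hf
  have h2 := nsq_first_order_le hf
  have n := nsq_nonneg volume
  have hp : p ≤ 2 := by omega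
  have hq : q ≤ 2 := by omega
  interval_cases p <;> interval_cases q <;> first
    | omega
    | simp only [dSP, Function.iterate_zero, id, Function.iterate_succ, Function.comp]
      linarith [n f, n (lap f), n (dS f), n (dP f)]

lemma zero_of_notMem_tsupport {a : ℝ²} (ha : a ∉ tsupport f) :
  f a = 0 ∧ dS f a = 0 ∧ dP f a = 0 ∧ lap f a = 0 := by
  have z : ∀ {g}, g =ᶠ[𝓝 a] 0 → dS g =ᶠ[𝓝 a] 0 ∧ dP g =ᶠ[𝓝 a] 0 := fun h =>
    ⟨(Filter.EventuallyEq.dS h).trans (.of_forall fun _ => by simp [dS]),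
      (Filter.EventuallyEq.dP h).trans (.of_forall fun _ => by simp [dP])⟩
  have h := notMem_tsupport_iff_eventuallyEq.1 ha
  obtain ⟨h1, h2⟩ := z h
  refine ⟨h.eq_of_nhds, h1.eq_of_nhds, h2.eq_of_nhds, ?_⟩
  rw [lap, (z h1).1.eq_of_nhds, (z h2).2.eq_of_nhds]
  simp

lemma bump_exists_sq_bound (hf : IsBump f) : ∃ M, 0 ≤ M ∧
  ∀ a, ‖f a‖ ^ 2 ≤ M ∧ ‖dS f a‖ ^ 2 ≤ M ∧ ‖dP f a‖ ^ 2 ≤ M ∧ ‖lap f a‖ ^ 2 ≤ M := by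
  have h : ∀ {g}, IsBump g → ∃ M, 0 ≤ M ∧ ∀ a, ‖g a‖ ^ 2 ≤ M := fun hg => by
    obtain ⟨M, hM⟩ := hg.2.exists_bound_of_continuous hg.1.continuous
    exact ⟨M ^ 2, sq_nonneg _, fun a => by gcongr; exact hM a⟩
  obtain ⟨A, hA, a⟩ := h hf
  obtain ⟨B, hB, b⟩ := h hf.dS
  obtain ⟨C, hC, c⟩ := h hf.dP
  obtain ⟨D, hD, d⟩ := h hf.lap
  refine ⟨A + B + C + D, by positivity, fun x => ⟨?_, ?_, ?_, ?_⟩⟩ <;> linarith [a x, b x, c x, d x]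

lemma caccioppoli {θ w : Fn} (hθ : IsBump θ) (hθr : ∀ a, conj (θ a) = θ a) (hw : Smooth w) :
  ∫ a, ‖θ a‖ ^ 2 * (‖w a‖ ^ 2 + ‖lap w a‖ ^ 2 + ‖dS w a‖ ^ 2 + ‖dP w a‖ ^ 2) ≤
    ∫ a, (2 * ‖θ a‖ ^ 2 * (‖w a‖ ^ 2 + ‖lap w a‖ ^ 2)
      + 4 * (‖dS θ a‖ ^ 2 + ‖dP θ a‖ ^ 2) * ‖w a‖ ^ 2) := by
  set G : Fn := fun a => θ a * θ a * conj (w a) with hG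
  have bG : IsBump G := (hθ.smooth_mul hθ.1).smooth_mul hw.conj
  have i1 := (IsBump.mul_smooth hw.dS bG.dS).integrable
  have i2 := (IsBump.mul_smooth hw.dP bG.dP).integrable
  have i3 := (IsBump.mul_smooth hw.lap bG).integrable
  set T : Fn := fun a => dS w a * dS G a + dP w a * dP G a + lap w a * G a with hT
  have itot : Integrable T := (i1.add i2).add i3
  have itre : Integrable fun a => (T a).re := itot.re
  have e3 : ∫ a, lap w a * G a = (∫ a, dS (dS w) a * G a) + ∫ a, dP (dP w) a * G a := by
    simp only [lap, add_mul]
    exact integral_add (IsBump.mul_smooth hw.dS.dS bG).integrable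
      (IsBump.mul_smooth hw.dP.dP bG).integrable
  have h0 : ∫ a, T a = 0 := by
    rw [hT, integral_add (f := fun a => _ + _) (i1.add i2) i3, integral_add i1 i2, e3,
      integral_mul_dS hw.dS bG, integral_mul_dP hw.dP bG]
    ring
  have hre : ∫ a, (T a).re = 0 := (integral_re itot).trans (congrArg re h0)
  have hcs : ∀ {g : Fn}, IsBump g → HasCompactSupport fun a => ‖g a‖ ^ 2 := fun h =>
    h.2.comp_left (g := fun z : ℂ => ‖z‖ ^ 2) (by simp)
  have := hθ.1.continuous
  have := hθ.dS.1.continuous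
  have := hθ.dP.1.continuous
  have := hw.continuous
  have := hw.lap.continuous
  have := hw.dS.continuous
  have := hw.dP.continuous
  have iX : Integrable fun a =>
      ‖θ a‖ ^ 2 * (‖w a‖ ^ 2 + ‖lap w a‖ ^ 2 + ‖dS w a‖ ^ 2 + ‖dP w a‖ ^ 2) :=
    Continuous.integrable_of_hasCompactSupport (by fun_prop) (hcs hθ).mul_right
  have iY : Integrable fun a => 2 * ‖θ a‖ ^ 2 * (‖w a‖ ^ 2 + ‖lap w a‖ ^ 2)
      + 4 * (‖dS θ a‖ ^ 2 + ‖dP θ a‖ ^ 2) * ‖w a‖ ^ 2 :=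
    Continuous.integrable_of_hasCompactSupport (by fun_prop) ((hcs hθ).mul_left.mul_right.add
      ((hcs hθ.dS).add (hcs hθ.dP)).mul_left.mul_right)
  have aux : ∀ z t d W : ℂ, conj t = t → (z * ((d * t + t * d) * conj W + t * t * conj z)).re
      ≥ ‖t‖ ^ 2 * ‖z‖ ^ 2 - 2 * (‖t‖ * ‖z‖) * (‖d‖ * ‖W‖) := by
    intro z t d W ht
    have e : z * ((d * t + t * d) * conj W + t * t * conj z)
        = ((‖t‖ ^ 2 * ‖z‖ ^ 2 : ℝ) : ℂ) + 2 * (z * d * t * conj W) := by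
      have h2 := mul_conj' t
      rw [ht] at h2
      push_cast
      rw [← mul_conj' z, ← h2]; ring
    have h3 := (abs_le.1 (abs_re_le_norm (2 * (z * d * t * conj W)))).1
    rw [e, add_re, ofReal_re]
    simp only [norm_mul, RCLike.norm_conj, norm_ofNat] at h3
    linarith
  have hnn : 0 ≤ ∫ a, ((2 * ‖θ a‖ ^ 2 * (‖w a‖ ^ 2 + ‖lap w a‖ ^ 2)
      + 4 * (‖dS θ a‖ ^ 2 + ‖dP θ a‖ ^ 2) * ‖w a‖ ^ 2
      - ‖θ a‖ ^ 2 * (‖w a‖ ^ 2 + ‖lap w a‖ ^ 2 + ‖dS w a‖ ^ 2 + ‖dP w a‖ ^ 2))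
      + 2 * (T a).re) := by
    refine integral_nonneg fun a => ?_
    have h1 := aux (dS w a) (θ a) (dS θ a) (w a) (hθr a)
    have h2 := aux (dP w a) (θ a) (dP θ a) (w a) (hθr a)
    have h3 := (abs_le.1 (abs_re_le_norm (lap w a * G a))).1
    simp only [hG, norm_mul, RCLike.norm_conj] at h3
    simp only [Pi.zero_apply, hT, add_re, hG, dS_mul (hθ.1.mul hθ.1) hw.conj, dS_mul hθ.1 hθ.1,
      dS_conj hw, dP_mul (hθ.1.mul hθ.1) hw.conj, dP_mul hθ.1 hθ.1, dP_conj hw]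
    nlinarith [sq_nonneg (‖θ a‖ * ‖dS w a‖ - 2 * (‖dS θ a‖ * ‖w a‖)),
      sq_nonneg (‖θ a‖ * ‖dP w a‖ - 2 * (‖dP θ a‖ * ‖w a‖)),
      mul_nonneg (sq_nonneg ‖θ a‖) (sq_nonneg (‖w a‖ - ‖lap w a‖))]
  rw [integral_add (f := fun a => _ - _) (iY.sub iX) (itre.const_mul 2), integral_const_mul, hre,
    integral_sub iY iX] at hnn
  linarith

end FlatEstimates

section SquareNorms

open ENNReal

variable {α : Type*} [MeasurableSpace α]

lemma eLpNorm_two_sq (μ : Measure α) (f : α → ℂ) : eLpNorm f 2 μ ^ 2 = ∫⁻ a, ‖f a‖ₑ ^ 2 ∂μ := by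
  have h := eLpNorm_nnreal_pow_eq_lintegral (μ := μ) (f := f) (p := 2) (by norm_num)
  simpa using h

lemma eLpNorm_two_sq_eq_ofReal {μ : Measure α} {f : α → ℂ} (hf : MemLp f 2 μ) :
  eLpNorm f 2 μ ^ 2 = ENNReal.ofReal (∫ a, ‖f a‖ ^ 2 ∂μ) := by
  rw [eLpNorm_two_sq, ofReal_integral_eq_lintegral_ofReal
    ((memLp_two_iff_integrable_sq_norm hf.1).1 hf) (.of_forall fun a => sq_nonneg _)]
  simp

lemma tendsto_sq_iff {ι : Type*} {l : Filter ι} {f : ι → ℝ≥0∞} :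
  Tendsto (fun i => f i ^ 2) l (𝓝 0) ↔ Tendsto f l (𝓝 0) := by
  constructor
  · intro h
    have h2 := (ENNReal.continuous_rpow_const (y := (1 / 2 : ℝ))).continuousAt.tendsto.comp h
    simp only [Function.comp_def] at h2
    have e : ∀ x : ℝ≥0∞, (x ^ 2) ^ (1 / 2 : ℝ) = x := fun x => by
      rw [← ENNReal.rpow_natCast, ← ENNReal.rpow_mul]; norm_num
    simp_all
  · intro h
    simpa using ENNReal.Tendsto.pow (n := 2) h

lemma sq_le_sq_ennreal {x y : ℝ≥0∞} : x ^ 2 ≤ y ^ 2 ↔ x ≤ y :=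
  ENNReal.pow_le_pow_left_iff two_ne_zero

lemma exists_eLpNorm_limit {μ : Measure α} {f : ℕ → α → ℂ} (hf : ∀ n, MemLp (f n) 2 μ)
  (hc : Tendsto (fun k : ℕ × ℕ => eLpNorm (fun a => f k.1 a - f k.2 a) 2 μ) atTop (𝓝 0)) :
  ∃ w, MemLp w 2 μ ∧ Tendsto (fun n => eLpNorm (fun a => f n a - w a) 2 μ) atTop (𝓝 0) := by
  have hcs : CauchySeq fun n => (hf n).toLp (f n) := by
    rw [EMetric.cauchySeq_iff]
    intro ε hε
    have h := hc.eventually (gt_mem_nhds hε)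
    obtain ⟨N, hN⟩ := eventually_atTop_prod_self.1 h
    refine ⟨N, fun m hm n hn => ?_⟩
    rw [Lp.edist_toLp_toLp]
    exact hN m n hm hn
  obtain ⟨w, hw⟩ := cauchySeq_tendsto_of_complete hcs
  refine ⟨w, Lp.memLp w, ?_⟩
  exact (Lp.tendsto_Lp_iff_tendsto_eLpNorm'' _ hf _ (Lp.memLp w)).1 (by simpa using hw)

lemma norm_rexp (t : ℝ) : ‖(rexp t : ℂ)‖ = rexp t := by
  rw [norm_real, Real.norm_of_nonneg (Real.exp_pos _).le]

lemma tendsto_cauchy_of_tendsto {μ : Measure α} {f : ℕ → α → ℂ} {w : α → ℂ}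
  (hf : ∀ n, AEStronglyMeasurable (f n) μ) (hw : AEStronglyMeasurable w μ)
  (h : Tendsto (fun n => eLpNorm (fun a => f n a - w a) 2 μ) atTop (𝓝 0)) :
  Tendsto (fun k : ℕ × ℕ => eLpNorm (fun a => f k.1 a - f k.2 a) 2 μ) atTop (𝓝 0) := by
  rw [← prod_atTop_atTop_eq]
  have h1 := (h.comp tendsto_fst).add (h.comp (tendsto_snd (f := (atTop : Filter ℕ))))
  rw [add_zero] at h1
  refine tendsto_of_tendsto_of_tendsto_of_le_of_le tendsto_const_nhds h1 (fun _ => zero_le)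
    fun k => ?_
  have e : (fun a => f k.1 a - f k.2 a) = (fun a => f k.1 a - w a) - fun a => f k.2 a - w a := by
    funext a; simp
  rw [e]
  exact eLpNorm_sub_le ((hf _).sub hw) ((hf _).sub hw) (by norm_num)

lemma tendsto_of_le_const_mul {ι : Type*} {l : Filter ι} {f g : ι → ℝ≥0∞} {c : ℝ≥0∞}
  (hc : c ≠ ⊤) (hg : Tendsto g l (𝓝 0)) (h : ∀ i, f i ≤ c * g i) : Tendsto f l (𝓝 0) := by
  have h1 := ENNReal.Tendsto.const_mul hg (.inr hc) (a := c)
  rw [mul_zero] at h1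
  exact tendsto_of_tendsto_of_tendsto_of_le_of_le tendsto_const_nhds h1 (fun _ => zero_le) h

end SquareNorms

section WeakDerivatives

open ENNReal

/-- The measure `μ` dominates Lebesgue measure on compact sets. -/
structure Dominates (μ : Measure ℝ²) : Prop where
  absCont : (volume : Measure ℝ²) ≪ μ
  exists_le : ∀ K : Set ℝ², IsCompact K → ∃ c : ℝ≥0∞, c ≠ ⊤ ∧ volume.restrict K ≤ c • μ

lemma dominates_volume : Dominates volume :=
  ⟨Measure.AbsolutelyContinuous.rfl, fun K _ => ⟨1, one_ne_top, by
    rw [one_smul]; exact Measure.restrict_le_self⟩⟩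

variable {μ : Measure ℝ²} (hμ : Dominates μ)
include hμ

lemma Dominates.lintegral_le {K : Set ℝ²} (hK : IsCompact K) :
  ∃ c : ℝ≥0∞, c ≠ ⊤ ∧ ∀ f : Fn, AEStronglyMeasurable f μ →
    ∫⁻ a in K, ‖f a‖ₑ ≤ c * eLpNorm f 2 μ := by
  obtain ⟨c, hc, hle⟩ := hμ.exists_le K hK
  refine ⟨c ^ (1 / 2 : ℝ) * volume K ^ (1 / 2 : ℝ), ?_, fun f hf => ?_⟩
  · exact ENNReal.mul_ne_top (ENNReal.rpow_ne_top_of_nonneg (by norm_num) hc)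
      (ENNReal.rpow_ne_top_of_nonneg (by norm_num) hK.measure_lt_top.ne)
  · have hac := Measure.absolutelyContinuous_of_le_smul hle
    have h1 := eLpNorm_le_eLpNorm_mul_rpow_measure_univ (μ := volume.restrict K) (f := f)
      (p := 1) (q := 2) (by norm_num) (hf.mono_ac hac)
    rw [eLpNorm_one_eq_lintegral_enorm, Measure.restrict_apply_univ] at h1
    have h2 : eLpNorm f 2 (volume.restrict K) ≤ c ^ (1 / 2 : ℝ) * eLpNorm f 2 μ := by
      refine (eLpNorm_mono_measure f hle).trans ?_
      rw [eLpNorm_smul_measure_of_ne_top (by norm_num)]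
      simp
    calc _ ≤ _ := h1
      _ ≤ (c ^ (1 / 2 : ℝ) * eLpNorm f 2 μ) * volume K ^ (1 / 2 : ℝ) := by norm_num at h2 ⊢; gcongr
      _ = _ := by ring

lemma Dominates.locallyIntegrable (hf : MemLp f 2 μ) : LocallyIntegrable f := by
  rw [locallyIntegrable_iff]
  intro K hK
  obtain ⟨c, hc, h⟩ := hμ.lintegral_le hK
  exact ⟨(hf.1.mono_ac hμ.absCont).restrict, (h f hf.1).trans_lt
    (ENNReal.mul_lt_top hc.lt_top hf.2)⟩

lemma Dominates.tendsto_integral_mul {ψ : ℕ → Fn} {v : Fn}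
  (hψ : ∀ n, MemLp (ψ n) 2 μ) (hv : MemLp v 2 μ)
  (h : Tendsto (fun n => eLpNorm (fun a => ψ n a - v a) 2 μ) atTop (𝓝 0))
  {φ : Fn} (hφ : Continuous φ) (hφc : HasCompactSupport φ) :
  Tendsto (fun n => ∫ a, ψ n a * φ a) atTop (𝓝 (∫ a, v a * φ a)) := by
  obtain ⟨M, hM⟩ := hφc.exists_bound_of_continuous hφ
  obtain ⟨c, hc, hle⟩ := hμ.lintegral_le hφc
  have hI : ∀ {f}, MemLp f 2 μ → Integrable fun a => f a * φ a := fun {f} hf => by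
    simpa only [smul_eq_mul, mul_comm] using
      (hμ.locallyIntegrable hf).integrable_smul_left_of_hasCompactSupport hφ hφc
  rw [tendsto_iff_edist_tendsto_0]
  refine tendsto_of_le_const_mul (c := c * ‖M‖ₑ) (ENNReal.mul_ne_top hc enorm_ne_top) h fun n => ?_
  rw [edist_eq_enorm_sub, ← integral_sub (hI (hψ n)) (hI hv)]
  calc ‖∫ a, (ψ n a * φ a - v a * φ a)‖ₑ ≤ ∫⁻ a, ‖ψ n a * φ a - v a * φ a‖ₑ :=
        enorm_integral_le_lintegral_enorm _
    _ = ∫⁻ a in tsupport φ, ‖ψ n a * φ a - v a * φ a‖ₑ := by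
        rw [setLIntegral_eq_of_support_subset]
        intro a ha
        by_contra h'
        have := zero_off_tsupport h'
        simp [this] at ha
    _ ≤ ∫⁻ a in tsupport φ, ‖M‖ₑ * ‖ψ n a - v a‖ₑ := by
        refine lintegral_mono fun a => ?_
        rw [← sub_mul, enorm_mul, mul_comm]
        gcongr
        rw [enorm_le_iff_norm_le]
        exact (hM a).trans (le_abs_self M)
    _ = ‖M‖ₑ * ∫⁻ a in tsupport φ, ‖ψ n a - v a‖ₑ := lintegral_const_mul' _ _ enorm_ne_top
    _ ≤ ‖M‖ₑ * (c * eLpNorm (fun a => ψ n a - v a) 2 μ) := by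
        gcongr
        exact hle _ ((hψ n).1.sub hv.1)
    _ = _ := by ring

omit hμ in
lemma smooth_hasWeakDeriv {ψ : Fn} (hψ : Smooth ψ) (p q : ℕ) : HasWeakDeriv p q ψ (dSP p q ψ) := by
  have key : ∀ D : Fn → Fn, (∀ f, Smooth f → Smooth (D f)) → (∀ {f}, IsBump f → IsBump (D f)) →
      (∀ f g, Smooth f → IsBump g → ∫ a, f a * D g a = -∫ a, D f a * g a) →
      ∀ (n : ℕ) {ψ φ : Fn}, Smooth ψ → IsBump φ →
        ∫ a, ψ a * (D^[n] φ) a = (-1) ^ n * ∫ a, (D^[n] ψ) a * φ a := by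
    intro D h1 h2 h3 n
    induction n with
    | zero => simp
    | succ n ih =>
      intro ψ φ hψ hφ
      rw [Function.iterate_succ_apply', h3 _ _ hψ (iterate_mem (Q := IsBump) (fun _ => h2) hφ n),
        ih (h1 _ hψ) hφ, Function.iterate_succ_apply, pow_succ]
      ring
  intro φ h1 h2
  have hφ : IsBump φ := ⟨h1, h2⟩
  have e1 := key dS (fun _ h => h.dS) (fun h => h.dS) (fun _ _ => integral_mul_dS) p hψ
    (hφ.dP_iterate q)
  rw [key dP (fun _ h => h.dP) (fun h => h.dP) (fun _ _ => integral_mul_dP) q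
    (hψ.dS_iterate p) hφ, ← mul_assoc, ← pow_add] at e1
  exact e1

lemma Dominates.exists_hasWeakDeriv {ψ : ℕ → Fn} {v : Fn}
  (hs : ∀ n, Smooth (ψ n)) (hψ : ∀ n, MemLp (ψ n) 2 μ) (hv : MemLp v 2 μ)
  (h : Tendsto (fun n => eLpNorm (fun a => ψ n a - v a) 2 μ) atTop (𝓝 0)) {p q : ℕ}
  (hd : ∀ n, MemLp (dSP p q (ψ n)) 2 μ)
  (hc : Tendsto (fun k : ℕ × ℕ => eLpNorm (fun a => dSP p q (ψ k.1) a - dSP p q (ψ k.2) a) 2 μ)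
    atTop (𝓝 0)) :
  ∃ w, MemLp w 2 μ ∧ HasWeakDeriv p q v w ∧
    Tendsto (fun n => eLpNorm (fun a => dSP p q (ψ n) a - w a) 2 μ) atTop (𝓝 0) := by
  obtain ⟨w, hw, hlim⟩ := exists_eLpNorm_limit hd hc
  refine ⟨w, hw, fun φ h1 h2 => ?_, hlim⟩
  have hφ : IsBump φ := ⟨h1, h2⟩
  have hb := (hφ.dP_iterate q).dS_iterate p
  have l1 := hμ.tendsto_integral_mul hψ hv h hb.1.continuous hb.2
  have l2 := (hμ.tendsto_integral_mul hd hw hlim h1.continuous h2).const_mul ((-1) ^ (p + q))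
  refine tendsto_nhds_unique l1 (l2.congr fun n => ?_)
  exact ((smooth_hasWeakDeriv (hs n) p q) φ h1 h2).symm

end WeakDerivatives

section FlatEstimate

lemma sq_norm_add_four (a b c d : ℂ) :
  ‖a + b + c + d‖ ^ 2 ≤ 4 * (‖a‖ ^ 2 + ‖b‖ ^ 2 + ‖c‖ ^ 2 + ‖d‖ ^ 2) := by
  have h1 := norm_add_le (a + b + c) d
  have h2 := norm_add_le (a + b) c
  have h3 := norm_add_le a b
  have h : ‖a + b + c + d‖ ^ 2 ≤ (‖a‖ + ‖b‖ + ‖c‖ + ‖d‖) ^ 2 := by gcongr; linarith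
  nlinarith [sq_nonneg (‖a‖ - ‖b‖), sq_nonneg (‖a‖ - ‖c‖), sq_nonneg (‖a‖ - ‖d‖),
    sq_nonneg (‖b‖ - ‖c‖), sq_nonneg (‖b‖ - ‖d‖), sq_nonneg (‖c‖ - ‖d‖)]

lemma sq_norm_lap_mul_le {θ w : Fn} (hθ : Smooth θ) (hw : Smooth w) (a : ℝ²) :
  ‖lap (fun a => θ a * w a) a‖ ^ 2 ≤ 4 * (‖lap θ a‖ ^ 2 * ‖w a‖ ^ 2
    + 4 * ‖dS θ a‖ ^ 2 * ‖dS w a‖ ^ 2 + 4 * ‖dP θ a‖ ^ 2 * ‖dP w a‖ ^ 2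
    + ‖θ a‖ ^ 2 * ‖lap w a‖ ^ 2) := by
  rw [lap_mul hθ hw]
  have := sq_norm_add_four (lap θ a * w a) (2 * dS θ a * dS w a) (2 * dP θ a * dP w a)
    (θ a * lap w a)
  simp [mul_pow] at this
  norm_num at this
  convert this using 2
  ring_nf

lemma interior_estimate {θ₁ θ : Fn} (h₁ : IsBump θ₁) (hθ : IsBump θ)
  (hθr : ∀ a, conj (θ a) = θ a) (hone : ∀ a ∈ tsupport θ₁, θ a = 1) :
  ∃ c : ℝ, 0 ≤ c ∧ ∀ w, Smooth w → nsq volume (lap fun a => θ₁ a * w a) ≤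
    c * ∫ a in tsupport θ, (‖w a‖ ^ 2 + ‖lap w a‖ ^ 2) := by
  obtain ⟨M, hM, b⟩ := bump_exists_sq_bound h₁
  obtain ⟨N, hN, c⟩ := bump_exists_sq_bound hθ
  refine ⟨16 * M * (10 * N), by positivity, fun w hw => ?_⟩
  have := hw.continuous
  have := hw.lap.continuous
  have := hw.dS.continuous
  have := hw.dP.continuous
  have := hθ.1.continuous
  have k : ∀ {x C : ℝ}, x ≤ C → ∀ y : ℝ, x * y ^ 2 ≤ C * y ^ 2 := fun h y =>
    mul_le_mul_of_nonneg_right h (sq_nonneg y)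
  have iX : Integrable fun a =>
      ‖θ a‖ ^ 2 * (‖w a‖ ^ 2 + ‖lap w a‖ ^ 2 + ‖dS w a‖ ^ 2 + ‖dP w a‖ ^ 2) :=
    Continuous.integrable_of_hasCompactSupport (by fun_prop)
      (hθ.2.comp_left (g := fun z : ℂ => ‖z‖ ^ 2) (by simp)).mul_right
  have iK : IntegrableOn (fun a => ‖w a‖ ^ 2 + ‖lap w a‖ ^ 2) (tsupport θ) :=
    (by fun_prop : Continuous fun a => ‖w a‖ ^ 2 + ‖lap w a‖ ^ 2).continuousOn.integrableOn_compact
      hθ.2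
  have hK := (isClosed_tsupport θ).measurableSet
  have hpt : ∀ a, ‖lap (fun a => θ₁ a * w a) a‖ ^ 2 ≤ 16 * M *
      (‖θ a‖ ^ 2 * (‖w a‖ ^ 2 + ‖lap w a‖ ^ 2 + ‖dS w a‖ ^ 2 + ‖dP w a‖ ^ 2)) := fun a => by
    refine (sq_norm_lap_mul_le h₁.1 hw a).trans ?_
    by_cases ha : a ∈ tsupport θ₁
    · rw [hone a ha, norm_one]
      obtain ⟨g0, g1, g2, g3⟩ := b a
      linarith [k g0 ‖lap w a‖, k g1 ‖dS w a‖, k g2 ‖dP w a‖, k g3 ‖w a‖,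
        mul_nonneg hM (sq_nonneg ‖lap w a‖), mul_nonneg hM (sq_nonneg ‖w a‖)]
    · obtain ⟨h0, hs, hp, hl⟩ := zero_of_notMem_tsupport ha
      rw [h0, hs, hp, hl]
      norm_num
      positivity
  calc _ ≤ 16 * M * ∫ a, ‖θ a‖ ^ 2 *
        (‖w a‖ ^ 2 + ‖lap w a‖ ^ 2 + ‖dS w a‖ ^ 2 + ‖dP w a‖ ^ 2) := by
        rw [← integral_const_mul]
        exact integral_mono (ibpClass_isBump.integrable_sq (h₁.smooth_mul hw).lap)
          (iX.const_mul _) hpt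
    _ ≤ 16 * M * (10 * N * ∫ a in tsupport θ, (‖w a‖ ^ 2 + ‖lap w a‖ ^ 2)) := by
        gcongr
        refine (caccioppoli hθ hθr hw).trans ?_
        rw [← integral_const_mul, ← integral_indicator hK]
        refine integral_mono_of_nonneg (.of_forall fun a => by positivity)
          (IntegrableOn.integrable_indicator (iK.const_mul _) hK) (.of_forall fun a => ?_)
        by_cases ha : a ∈ tsupport θ
        · simp only [Set.indicator_of_mem ha]
          obtain ⟨g0, g1, g2, -⟩ := c a
          linarith [k g0 ‖w a‖, k g0 ‖lap w a‖, k g1 ‖w a‖, k g2 ‖w a‖,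
            mul_nonneg hN (sq_nonneg ‖lap w a‖)]
        · obtain ⟨h0, hs, hp, -⟩ := zero_of_notMem_tsupport ha
          simp [Set.indicator_of_notMem ha, h0, hs, hp]
    _ = _ := by ring

end FlatEstimate

section Mollification

open ENNReal
open scoped Convolution

lemma exists_translation_bound {w : Fn} (hw : MemLp w 2 volume) {ε : ℝ≥0∞} (hε : 0 < ε) :
  ∃ δ > 0, ∀ t : ℝ², ‖t‖ < δ → eLpNorm (fun a => w (a - t) - w a) 2 volume ≤ ε := by
  have : Fact ((2 : ℝ≥0∞) ≠ ⊤) := ⟨by norm_num⟩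
  have hc : Tendsto (fun t : ℝ² => DomAddAct.mk (-t) +ᵥ hw.toLp w) (𝓝 0) (𝓝 (hw.toLp w)) := by
    have h1 : Continuous fun t : ℝ² => DomAddAct.mk (-t) +ᵥ hw.toLp w :=
      (DomAddAct.continuous_mk.comp continuous_neg).vadd continuous_const
    have h2 := h1.tendsto 0
    simp_all
  have h4 := EMetric.tendsto_nhds.1 hc ε hε
  obtain ⟨δ, hδ, h5⟩ := Metric.eventually_nhds_iff.1 h4
  refine ⟨δ, hδ, fun t ht => ?_⟩
  have h6 := h5 (y := t) (by simpa using ht)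
  rw [DomAddAct.mk_vadd_toLp, Lp.edist_toLp_toLp] at h6
  refine le_of_eq_of_le ?_ h6.le
  congr 1
  funext a
  simp [sub_eq_neg_add]

lemma exists_mollify_bound {w : Fn} (hw : MemLp w 2 volume) {ε : ℝ≥0∞} (hε : 0 < ε) :
  ∃ δ > 0, ∀ ρ : ℝ × ℝ → ℝ, Continuous ρ → (∀ t, 0 ≤ ρ t) → ∫ t, ρ t = 1 →
    (∀ t, ρ t ≠ 0 → ‖t‖ < δ) → HasCompactSupport ρ →
    eLpNorm (fun a => (∫ t, (ρ t : ℂ) * w (a - t)) - w a) 2 volume ≤ ε := by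
  wlog hwm : StronglyMeasurable w generalizing w
  · have hae := hw.1.ae_eq_mk
    have hw' := (memLp_congr_ae hae).1 hw
    obtain ⟨δ, hδ, h⟩ := this hw' hw.1.stronglyMeasurable_mk
    refine ⟨δ, hδ, fun ρ h1 h2 h3 h4 h5 => ?_⟩
    refine le_of_eq_of_le (eLpNorm_congr_ae ?_) (h ρ h1 h2 h3 h4 h5)
    filter_upwards [hae] with a ha
    congr 1
    refine integral_congr_ae ?_
    have : ∀ᵐ t, w (a - t) = hw.1.mk w (a - t) := (quasiMeasurePreserving_sub_left volume a).ae hae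
    filter_upwards [this] with t ht
    rw [ht]
  obtain ⟨δ, hδ, hb⟩ := exists_translation_bound hw hε
  refine ⟨δ, hδ, fun ρ h1 h2 h3 h4 h5 => ?_⟩
  have iρ : Integrable ρ := h1.integrable_of_hasCompactSupport h5
  set ν : Measure ℝ² := volume.withDensity fun t => ENNReal.ofReal (ρ t) with hν
  have hρm : Measurable fun t => ENNReal.ofReal (ρ t) := by fun_prop
  have : IsProbabilityMeasure ν := ⟨by
    rw [hν, withDensity_apply _ MeasurableSet.univ, Measure.restrict_univ,
      ← ofReal_integral_eq_lintegral_ofReal iρ (.of_forall h2), h3, ENNReal.ofReal_one]⟩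
  have hloc := dominates_volume.locallyIntegrable hw
  have hpt : ∀ a, ‖(∫ t, (ρ t : ℂ) * w (a - t)) - w a‖ₑ ^ 2 ≤ ∫⁻ t, ‖w (a - t) - w a‖ₑ ^ 2 ∂ν := by
    intro a
    have hm : AEStronglyMeasurable (fun t => w (a - t) - w a) ν :=
      ((hwm.comp_measurable (measurable_const_sub a)).sub
        stronglyMeasurable_const).aestronglyMeasurable
    have i1 : Integrable fun t => (ρ t : ℂ) * w (a - t) := by
      have := h5.convolutionExists_left (ContinuousLinearMap.lsmul ℝ ℝ) h1 hloc a
      simpa [ConvolutionExistsAt, real_smul] using this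
    have e1 : (∫ t, (ρ t : ℂ) * w (a - t)) - w a = ∫ t, (ρ t : ℂ) * (w (a - t) - w a) := by
      have i2 : Integrable fun t => (ρ t : ℂ) * w a := iρ.ofReal.mul_const _
      have e2 : w a = ∫ t, (ρ t : ℂ) * w a := by
        rw [integral_mul_const, integral_complex_ofReal, h3]; simp
      conv_lhs => rw [e2]
      rw [← integral_sub i1 i2]
      congr 1; funext t; ring
    have e3 : ‖∫ t, (ρ t : ℂ) * (w (a - t) - w a)‖ₑ ≤ ∫⁻ t, ‖w (a - t) - w a‖ₑ ∂ν := by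
      refine (enorm_integral_le_lintegral_enorm _).trans (le_of_eq ?_)
      rw [hν, lintegral_withDensity_eq_lintegral_mul₀ hρm.aemeasurable]
      · refine lintegral_congr fun t => ?_
        simp
        rw [← ofReal_norm, norm_real, Real.norm_of_nonneg (h2 t)]
      fun_prop
    rw [e1, ← eLpNorm_two_sq]
    gcongr
    refine e3.trans ?_
    rw [← eLpNorm_one_eq_lintegral_enorm]
    exact eLpNorm_le_eLpNorm_of_exponent_le (by norm_num) hm
  rw [← sq_le_sq_ennreal, eLpNorm_two_sq]
  calc ∫⁻ a, ‖(∫ t, (ρ t : ℂ) * w (a - t)) - w a‖ₑ ^ 2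
      ≤ ∫⁻ a, ∫⁻ t, ‖w (a - t) - w a‖ₑ ^ 2 ∂ν := lintegral_mono hpt
    _ = ∫⁻ t, (∫⁻ a, ‖w (a - t) - w a‖ₑ ^ 2) ∂ν := by
        refine lintegral_lintegral_swap ?_
        fun_prop
    _ ≤ ∫⁻ t, ε ^ 2 ∂ν := by
        refine lintegral_mono_ae ?_
        have hae : ∀ᵐ t ∂ν, ρ t ≠ 0 := by
          rw [hν, ae_withDensity_iff hρm]
          refine .of_forall fun t ht h0 => ht ?_
          rw [h0, ENNReal.ofReal_zero]
        filter_upwards [hae] with t ht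
        rw [← eLpNorm_two_sq]
        gcongr
        exact hb t (h4 t ht)
    _ = ε ^ 2 := by simp

end Mollification

section InteriorRegularity

open ENNReal
open scoped Convolution

lemma dSP_sub (hf : Smooth f) (hg : Smooth g) (p q : ℕ) :
  dSP p q (fun a => f a - g a) = fun a => dSP p q f a - dSP p q g a := by
  have key : ∀ D : Fn → Fn, (∀ f, Smooth f → Smooth (D f)) →
      (∀ f g, Smooth f → Smooth g → D (fun a => f a - g a) = fun a => D f a - D g a) →
      ∀ (n : ℕ) {f g : Fn}, Smooth f → Smooth g →
        D^[n] (fun a => f a - g a) = fun a => (D^[n] f) a - (D^[n] g) a := by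
    intro D h1 h2 n
    induction n with
    | zero => intros; rfl
    | succ n ih =>
      intro f g hf hg
      simp only [Function.iterate_succ_apply, h2 _ _ hf hg, ih (h1 _ hf) (h1 _ hg)]
  have h : ∀ {f g}, Smooth f → Smooth g → ∀ a v, fderiv ℝ (fun a => f a - g a) a v =
      fderiv ℝ f a v - fderiv ℝ g a v := fun hf hg a v => by
    rw [fderiv_fun_sub (hf.diff a) (hg.diff a)]; rfl
  rw [dSP, key dS (fun _ h => h.dS) (fun _ _ hf hg => funext fun a => h hf hg a _) p hf hg,
    key dP (fun _ h => h.dP) (fun _ _ hf hg => funext fun a => h hf hg a _) q (hf.dS_iterate p)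
      (hg.dS_iterate p)]
  rfl

lemma lap_sub (hf : Smooth f) (hg : Smooth g) :
  lap (fun a => f a - g a) = fun a => lap f a - lap g a := by
  funext a
  have e1 := congrFun (dSP_sub hf hg 2 0) a
  have e2 := congrFun (dSP_sub hf hg 0 2) a
  simp only [dSP, Function.iterate_zero, id, Function.iterate_succ, Function.comp] at e1 e2
  simp only [lap, e1, e2, add_sub_add_comm]

lemma IsBump.sub (hf : IsBump f) (hg : IsBump g) : IsBump fun a => f a - g a := by
  simpa only [neg_one_mul, sub_eq_add_neg] using hf.add (hg.smul (-1))

lemma IsBump.dSP (hf : IsBump f) (p q : ℕ) : IsBump (dSP p q f) := (hf.dS_iterate p).dP_iterate q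

lemma IsBump.memLp (hf : IsBump f) : MemLp f 2 volume := ibpClass_isBump.memLp hf

lemma eLpNorm_sq_eq_nsq {μ : Measure ℝ²} (hf : MemLp f 2 μ) :
  eLpNorm f 2 μ ^ 2 = ENNReal.ofReal (nsq μ f) := eLpNorm_two_sq_eq_ofReal hf

lemma memSobolevSpace_of_tendsto {g : ℕ → Fn} (hg : ∀ n, IsBump (g n)) {v : Fn}
  (hv : MemLp v 2 volume)
  (h : Tendsto (fun n => eLpNorm (fun a => g n a - v a) 2 volume) atTop (𝓝 0))
  (hc : Tendsto (fun k : ℕ × ℕ => eLpNorm (fun a => lap (g k.1) a - lap (g k.2) a) 2 volume)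
    atTop (𝓝 0)) : MemSobolevSpace 2 v := by
  refine ⟨dominates_volume.locallyIntegrable hv, fun p q hpq => ?_⟩
  have h0 := tendsto_cauchy_of_tendsto (fun n => (hg n).memLp.1) hv.1 h
  have hd : Tendsto (fun k : ℕ × ℕ => eLpNorm (fun a => dSP p q (g k.1) a - dSP p q (g k.2) a) 2
      volume) atTop (𝓝 0) := by
    rw [← tendsto_sq_iff]
    have h1 := (tendsto_sq_iff.2 h0).add (tendsto_sq_iff.2 hc)
    rw [add_zero] at h1
    refine tendsto_of_tendsto_of_tendsto_of_le_of_le tendsto_const_nhds h1 (fun _ => zero_le)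
      fun k => ?_
    have hb := (hg k.1).sub (hg k.2)
    have hl := hb.lap
    have hle := nsq_dSP_le hb hpq
    rw [← dSP_sub (hg _).1 (hg _).1, ← lap_sub (hg _).1 (hg _).1,
      eLpNorm_sq_eq_nsq (hb.dSP p q).memLp, eLpNorm_sq_eq_nsq hb.memLp, eLpNorm_sq_eq_nsq hl.memLp,
      ← ENNReal.ofReal_add (nsq_nonneg _ _) (nsq_nonneg _ _)]
    exact ENNReal.ofReal_le_ofReal hle
  obtain ⟨w, hw, hwd, -⟩ := dominates_volume.exists_hasWeakDeriv (fun n => (hg n).1)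
    (fun n => (hg n).memLp) hv h (fun n => ((hg n).dSP p q).memLp) hd
  exact ⟨w, hw, hwd⟩

lemma exists_bump {K U : Set ℝ²} (hK : IsCompact K) (hU : IsOpen U) (h : K ⊆ U) :
  ∃ θ : Fn, IsBump θ ∧ (∀ a, conj (θ a) = θ a) ∧ (∀ᶠ a in 𝓝ˢ K, θ a = 1) ∧ tsupport θ ⊆ U := by
  obtain ⟨L, hL, hKL, hLU⟩ := exists_compact_between hK hU h
  obtain ⟨f, h1, h2, -⟩ := exists_contMDiffMap_one_nhds_of_subset_interior
    (n := (⊤ : ℕ∞)) 𝓘(ℝ, ℝ²) hK.isClosed hKL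
  have hs : tsupport (fun a => ((f a : ℝ) : ℂ)) ⊆ L := by
    refine closure_minimal (fun a ha => ?_) hL.isClosed
    by_contra h'
    exact ha (by simp [h2 a h'])
  refine ⟨fun a => ((f a : ℝ) : ℂ), ⟨ofRealCLM.contDiff.comp f.contMDiff.contDiff,
    HasCompactSupport.of_support_subset_isCompact hL (subset_closure.trans hs)⟩,
    fun a => conj_ofReal _, ?_, hs.trans hLU⟩
  simp_all

/-- Convolution on the plane. -/
def conv (ρ w : Fn) (a : ℝ²) : ℂ := ∫ t, ρ t * w (a - t)

lemma conv_eq (ρ w : Fn) : conv ρ w = ρ ⋆[ContinuousLinearMap.mul ℝ ℂ, volume] w := rfl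

lemma smooth_conv {ρ w : Fn} (hρ : IsBump ρ) (hw : LocallyIntegrable w) : Smooth (conv ρ w) := by
  rw [conv_eq]
  exact hρ.2.contDiff_convolution_left _ hρ.1 hw

lemma fderiv_conv {ρ w : Fn} (hρ : IsBump ρ) (hw : LocallyIntegrable w) (v : ℝ²)
  (a : ℝ²) : fderiv ℝ (conv ρ w) a v = conv (fun t => fderiv ℝ ρ t v) w a := by
  have h := hρ.2.hasFDerivAt_convolution_left (ContinuousLinearMap.mul ℝ ℂ)
    (hρ.1.of_le (by exact_mod_cast le_top)) hw a
  rw [conv_eq, h.fderiv]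
  have hi := (hρ.2.fderiv (𝕜 := ℝ)).convolutionExists_left
    ((ContinuousLinearMap.mul ℝ ℂ).precompL ℝ²)
    (hρ.1.continuous_fderiv (by simp)) hw a
  rw [convolution_def, ContinuousLinearMap.integral_apply hi]
  rfl

lemma lap_conv {ρ w : Fn} (hρ : IsBump ρ) (hw : LocallyIntegrable w) :
  lap (conv ρ w) = conv (lap ρ) w := by
  have e1 : dS (conv ρ w) = conv (dS ρ) w := funext fun a => fderiv_conv hρ hw _ a
  have e2 : dP (conv ρ w) = conv (dP ρ) w := funext fun a => fderiv_conv hρ hw _ a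
  have e3 : dS (conv (dS ρ) w) = conv (dS (dS ρ)) w := funext fun a => fderiv_conv hρ.dS hw _ a
  have e4 : dP (conv (dP ρ) w) = conv (dP (dP ρ)) w := funext fun a => fderiv_conv hρ.dP hw _ a
  have hi : ∀ {σ : Fn}, IsBump σ → ∀ a, Integrable fun t => σ t * w (a - t) :=
    fun {σ} hσ a => hσ.2.convolutionExists_left (ContinuousLinearMap.mul ℝ ℂ) hσ.1.continuous hw a
  funext a
  simp [lap]
  rw [e1, e2, e3, e4]
  simp [conv]
  rw [← integral_add (hi hρ.dS.dS a) (hi hρ.dP.dP a)]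
  congr 1; funext t; simp [lap]; ring

lemma isBump_reflect {ρ : Fn} (hρ : IsBump ρ) (a : ℝ²) :
  IsBump (fun t => ρ (a - t)) ∧ lap (fun t => ρ (a - t)) = fun t => lap ρ (a - t) := by
  have key : ∀ {σ : Fn}, Smooth σ → ∀ v t, fderiv ℝ (fun t => σ (a - t)) t v
      = -1 * fderiv ℝ σ (a - t) v := fun {σ} hσ v t => by
    have h2 := ((hσ.diff (a - t)).hasFDerivAt.comp t ((hasFDerivAt_id t).const_sub a)).fderiv
    rw [show (fun t => σ (a - t)) = σ ∘ fun t => a - t from rfl, h2]; simp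
  have hs : ∀ {σ : Fn}, Smooth σ → Smooth fun t => σ (a - t) :=
    fun hσ => hσ.comp (contDiff_const.sub contDiff_id)
  have kS : ∀ {σ}, Smooth σ → dS (fun t => σ (a - t)) = fun t => -1 * dS σ (a - t) :=
    fun h => funext fun t => key h _ t
  have kP : ∀ {σ}, Smooth σ → dP (fun t => σ (a - t)) = fun t => -1 * dP σ (a - t) :=
    fun h => funext fun t => key h _ t
  refine ⟨⟨hs hρ.1, hρ.2.comp_homeomorph (Homeomorph.subLeft a)⟩, funext fun t => ?_⟩
  rw [lap, kS hρ.1, kP hρ.1, dS_const_mul (hs hρ.1.dS), dP_const_mul (hs hρ.1.dP), kS hρ.1.dS,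
    kP hρ.1.dP, lap]
  ring

lemma conv_swap (ρ w : Fn) (a : ℝ²) : conv ρ w a = ∫ t, w t * ρ (a - t) := by
  rw [conv_eq, convolution_eq_swap]
  congr 1; simp [mul_comm]

lemma exists_mollifier : ∃ ρ : ℕ → ℝ × ℝ → ℝ, (∀ n, ContDiff ℝ ∞ (ρ n)) ∧
  (∀ n t, 0 ≤ ρ n t) ∧ (∀ n, ∫ t, ρ n t = 1) ∧ (∀ n, HasCompactSupport (ρ n)) ∧
  ∀ δ > 0, ∀ᶠ n in atTop, ∀ t, t ∈ tsupport (ρ n) → ‖t‖ < δ := by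
  have hb : ∀ n : ℕ, ∃ b : ContDiffBump (0 : ℝ²), b.rOut = 2 / ((n : ℝ) + 1) := fun n => by
    exact ⟨⟨1 / ((n : ℝ) + 1), 2 / ((n : ℝ) + 1), by positivity, by gcongr; norm_num⟩, rfl⟩
  choose b hb using hb
  refine ⟨fun n => (b n).normed volume, fun n => (b n).contDiff_normed,
    fun n t => (b n).nonneg_normed t, fun n => (b n).integral_normed,
    fun n => (b n).hasCompactSupport_normed, fun δ hδ => ?_⟩
  have hlim : Tendsto (fun n : ℕ => 2 / ((n : ℝ) + 1)) atTop (𝓝 0) :=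
    tendsto_const_nhds.div_atTop (tendsto_natCast_atTop_atTop.atTop_add tendsto_const_nhds)
  filter_upwards [hlim.eventually (gt_mem_nhds hδ)] with n hn t ht
  rw [(b n).tsupport_normed_eq, hb, Metric.mem_closedBall, dist_zero_right] at ht
  exact ht.trans_lt hn

lemma exists_interior_approximation {U : Set ℝ²} (hU : IsOpen U) {w f : Fn}
  (hw : MemLp w 2 volume) (hf : MemLp f 2 volume)
  (hweak : ∀ g, IsBump g → tsupport g ⊆ U → ∫ a, w a * lap g a = ∫ a, f a * g a)
  {θ₁ : Fn} (h₁ : IsBump θ₁) (h₁U : tsupport θ₁ ⊆ U) :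
  ∃ g : ℕ → Fn, (∀ n, IsBump (g n) ∧ tsupport (g n) ⊆ tsupport θ₁) ∧
    Tendsto (fun n => eLpNorm (fun a => g n a - θ₁ a * w a) 2 volume) atTop (𝓝 0) ∧
    Tendsto (fun k : ℕ × ℕ => eLpNorm (fun a => lap (g k.1) a - lap (g k.2) a) 2 volume)
      atTop (𝓝 0) := by
  obtain ⟨θ, hθ, hθr, hθ1, hθU⟩ := exists_bump h₁.2 hU h₁U
  obtain ⟨c, hc, hest⟩ := interior_estimate h₁ hθ hθr (fun a ha => hθ1.self_of_nhdsSet a ha)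
  obtain ⟨ρ, ρs, ρ0, ρ1, ρc, ρδ⟩ := exists_mollifier
  obtain ⟨δ, hδ, hδU⟩ := hθ.2.exists_thickening_subset_open hU hθU
  obtain ⟨N, hN⟩ := eventually_atTop.1 (ρδ δ hδ)
  have hwl := dominates_volume.locallyIntegrable hw
  have hfl := dominates_volume.locallyIntegrable hf
  set σ : ℕ → Fn := fun n t => ((ρ (n + N) t : ℝ) : ℂ) with hσ
  have hσb : ∀ n, IsBump (σ n) := fun n => ⟨Complex.ofRealCLM.contDiff.comp (ρs _),
    (ρc _).comp_left (g := fun x : ℝ => (x : ℂ)) (by simp)⟩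
  have hσs : ∀ n, tsupport (σ n) ⊆ tsupport (ρ (n + N)) := fun n =>
    closure_mono fun t ht => by
      simp [hσ] at ht ⊢
      exact ht
  have happrox : ∀ {u : Fn}, MemLp u 2 volume →
      Tendsto (fun n => eLpNorm (fun a => conv (σ n) u a - u a) 2 volume) atTop (𝓝 0) := by
    intro u hu
    rw [ENNReal.tendsto_nhds_zero]
    intro ε hε
    obtain ⟨δ', hδ', h⟩ := exists_mollify_bound hu hε
    obtain ⟨N', hN'⟩ := eventually_atTop.1 (ρδ δ' hδ')
    filter_upwards [eventually_ge_atTop N'] with n hn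
    exact h (ρ (n + N)) (ρs _).continuous (ρ0 _) (ρ1 _)
      (fun t ht => hN' _ (by omega) t (subset_tsupport _ ht)) (ρc _)
  have hlap : ∀ n, ∀ a ∈ tsupport θ, lap (conv (σ n) w) a = conv (σ n) f a := by
    intro n a ha
    obtain ⟨hr1, hr2⟩ := isBump_reflect (hσb n) a
    rw [lap_conv (hσb n) hwl, conv_swap, conv_swap]
    have hsup : tsupport (fun t => σ n (a - t)) ⊆ U := by
      have hclosed : IsClosed ((fun t : ℝ² => a - t) ⁻¹' tsupport (ρ (n + N))) :=
        (isClosed_tsupport _).preimage (by fun_prop)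
      have hsub : tsupport (fun t => σ n (a - t)) ⊆
          (fun t : ℝ² => a - t) ⁻¹' tsupport (ρ (n + N)) :=
        closure_minimal (fun t ht => hσs n (subset_tsupport _ ht)) hclosed
      intro t ht
      refine hδU (Metric.mem_thickening_iff.2 ⟨a, ha, ?_⟩)
      rw [dist_comm, dist_eq_norm]
      exact hN _ (by omega) _ (hsub ht)
    have := hweak _ hr1 hsup
    rw [hr2] at this
    exact this
  have hcs : ∀ n, Smooth (conv (σ n) w) := fun n => smooth_conv (hσb n) hwl
  obtain ⟨M, hM⟩ := h₁.2.exists_bound_of_continuous h₁.1.continuous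
  refine ⟨fun n a => θ₁ a * conv (σ n) w a, fun n => ⟨h₁.smooth_mul (hcs n),
    tsupport_mul_subset_left⟩, ?_, ?_⟩
  · refine tendsto_of_le_const_mul (c := ‖M‖ₑ) enorm_ne_top (happrox hw) fun n => ?_
    have e : (fun a => θ₁ a * conv (σ n) w a - θ₁ a * w a)
        = fun a => θ₁ a * (conv (σ n) w a - w a) := by ring
    rw [e, ← ofReal_norm]
    refine eLpNorm_le_mul_eLpNorm_of_ae_le_mul (.of_forall fun a => ?_) 2
    rw [norm_mul]
    exact mul_le_mul_of_nonneg_right ((hM a).trans (le_abs_self M)) (norm_nonneg _)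
  · rw [← tendsto_sq_iff]
    have t1 := tendsto_cauchy_of_tendsto (fun n => (hcs n).continuous.aestronglyMeasurable)
      hw.1 (happrox hw)
    have t2 := tendsto_cauchy_of_tendsto
      (fun n => (smooth_conv (hσb n) hfl).continuous.aestronglyMeasurable) hf.1 (happrox hf)
    have t3 := (tendsto_sq_iff.2 t1).add (tendsto_sq_iff.2 t2)
    rw [add_zero] at t3
    refine tendsto_of_le_const_mul (c := ENNReal.ofReal c) ofReal_ne_top t3 fun k => ?_
    have hd := hest _ ((hcs k.1).sub (hcs k.2))
    have e1 : (fun a => θ₁ a * (conv (σ k.1) w a - conv (σ k.2) w a))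
        = fun a => θ₁ a * conv (σ k.1) w a - θ₁ a * conv (σ k.2) w a := by ring
    have hb : ∀ n, IsBump fun a => θ₁ a * conv (σ n) w a := fun n => h₁.smooth_mul (hcs n)
    have hb' := ((hb k.1).sub (hb k.2)).lap
    rw [e1] at hd
    rw [← lap_sub (hb _).1 (hb _).1, eLpNorm_sq_eq_nsq hb'.memLp, eLpNorm_two_sq, eLpNorm_two_sq,
      ← lintegral_add_left (by
        have := (hcs k.1).continuous; have := (hcs k.2).continuous; fun_prop)]
    refine (ENNReal.ofReal_le_ofReal hd).trans ?_
    rw [ENNReal.ofReal_mul hc]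
    gcongr
    have hcont : Continuous fun a => ‖conv (σ k.1) w a - conv (σ k.2) w a‖ ^ 2 +
        ‖lap (fun a => conv (σ k.1) w a - conv (σ k.2) w a) a‖ ^ 2 := by
      have := (Smooth.lap (f := fun a => conv (σ k.1) w a - conv (σ k.2) w a)
        ((hcs k.1).sub (hcs k.2))).continuous
      fun_prop
    rw [ofReal_integral_eq_lintegral_ofReal (hcont.continuousOn.integrableOn_compact hθ.2)
      (.of_forall fun a => by positivity)]
    refine le_trans (le_of_eq ?_) (setLIntegral_le_lintegral (tsupport θ) _)
    refine setLIntegral_congr_fun (isClosed_tsupport θ).measurableSet fun a ha => ?_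
    rw [lap_sub (hcs _) (hcs _)]
    beta_reduce
    rw [hlap _ a ha, hlap _ a ha, ENNReal.ofReal_add (by positivity)
      (by positivity), ENNReal.ofReal_pow (norm_nonneg _), ENNReal.ofReal_pow (norm_nonneg _),
      ofReal_norm, ofReal_norm]

end InteriorRegularity

section Cylinder

/-- A fundamental domain of the cone of angle `4π`, in the variables `s = log r` and `φ`. -/
def strip : Set ℝ² := Set.univ ×ˢ Set.Ioc (-(2 * π)) (2 * π)

/-- Lebesgue measure on the fundamental domain. -/
def svol : Measure ℝ² := volume.restrict strip

lemma measurableSet_strip : MeasurableSet strip := MeasurableSet.univ.prod measurableSet_Ioc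

lemma stripVol_eq : svol = (volume : Measure ℝ).prod
  (volume.restrict (Set.Ioc (-(2 * π)) (2 * π))) := by
  rw [svol, strip, Measure.volume_eq_prod, ← Measure.prod_restrict, Measure.restrict_univ]

/-- Antiperiodicity with respect to a rotation by `4π`. -/
def AntiPer (f : Fn) : Prop := ∀ s φ : ℝ, f (s, φ + 4 * π) = -f (s, φ)

/-- `f` vanishes for large `|s|`. -/
def SBounded (f : Fn) : Prop := ∃ R : ℝ, ∀ a : ℝ², R ≤ |a.1| → f a = 0

/-- The smooth antiperiodic functions that vanish for large `|s|`. -/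
def Cyl (f : Fn) : Prop := Smooth f ∧ AntiPer f ∧ SBounded f

lemma SBounded.mul_left (hf : SBounded f) (g : Fn) : SBounded fun a => g a * f a := by
  obtain ⟨R, hR⟩ := hf
  exact ⟨R, fun a ha => by simp [hR a ha]⟩

lemma SBounded.conj (hf : SBounded f) : SBounded fun a => conj (f a) := by
  obtain ⟨R, hR⟩ := hf
  exact ⟨R, fun a ha => by simp [hR a ha]⟩

lemma SBounded.add (hf : SBounded f) (hg : SBounded g) : SBounded fun a => f a + g a := by
  obtain ⟨R, hR⟩ := hf
  obtain ⟨R', hR'⟩ := hg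
  exact ⟨max R R', fun a ha => by grind⟩

lemma SBounded.derivs (hf : SBounded f) : SBounded (dS f) ∧ SBounded (dP f) := by
  obtain ⟨R, hR⟩ := hf
  have hU : IsOpen {a : ℝ² | R < |a.1|} := isOpen_lt continuous_const (by fun_prop)
  have h0 : ∀ a ∈ {a : ℝ² | R < |a.1|}, f a = 0 := fun a ha => hR a (le_of_lt ha)
  exact ⟨⟨R + 1, fun a ha => dS_eqOn_zero hU h0 a (show R < |a.1| by linarith)⟩,
    ⟨R + 1, fun a ha => dP_eqOn_zero hU h0 a (show R < |a.1| by linarith)⟩⟩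

lemma AntiPer.derivs (hf : AntiPer f) : AntiPer (dS f) ∧ AntiPer (dP f) := by
  have h1 : (fun a : ℝ² => f (a + (0, 4 * π))) = fun a => -f a := funext fun a => by
      have := hf a.1 a.2
      simpa [Prod.ext_iff, Prod.add_def] using this
  have key : ∀ v s φ, fderiv ℝ f (s, φ + 4 * π) v = -fderiv ℝ f (s, φ) v := by
    intro v s φ
    have h2 := congrArg (fun F => fderiv ℝ F (s, φ) v) h1
    simp [fderiv_comp_add_right] at h2
    simpa [Prod.add_def] using h2
  exact ⟨key _, key _⟩

lemma AntiPer.conj (hf : AntiPer f) : AntiPer fun a => conj (f a) := fun s φ => by simp [hf s φ]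

lemma integrable_strip (hf : Continuous f) (hb : SBounded f) : Integrable f svol := by
  obtain ⟨R, hR⟩ := hb
  have h1 : IntegrableOn f (Set.Icc (-R) R ×ˢ Set.Icc (-(2 * π)) (2 * π)) :=
    hf.continuousOn.integrableOn_compact (isCompact_Icc.prod isCompact_Icc)
  refine (integrableOn_iff_integrable_of_support_subset (s := {a : ℝ² | |a.1| ≤ R})
    (fun a ha => ?_)).1 ?_
  · by_contra h
    exact ha (hR a (le_of_lt (not_le.1 h)))
  · rw [IntegrableOn, svol, Measure.restrict_restrict
      (measurableSet_le (by fun_prop) measurable_const)]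
    refine h1.mono_set fun a ha => ⟨abs_le.1 ha.1, ha.2.2.1.le, ha.2.2.2⟩

lemma integral_strip_derivs {h : Fn} (hs : Smooth h)
  (hp : ∀ s φ, h (s, φ + 4 * π) = h (s, φ)) (hb : SBounded h) :
  ∫ a, dS h a ∂svol = 0 ∧ ∫ a, dP h a ∂svol = 0 := by
  have i1 := integrable_strip hs.dS.continuous hb.derivs.1
  have i2 := integrable_strip hs.dP.continuous hb.derivs.2
  have d1 : ∀ φ s, HasDerivAt (fun s => h (s, φ)) (dS h (s, φ)) s := fun φ s =>
    (hs.diff (s, φ)).hasFDerivAt.comp_hasDerivAt s ((hasDerivAt_id s).prodMk (hasDerivAt_const s φ))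
  have d2 : ∀ s φ, HasDerivAt (fun φ => h (s, φ)) (dP h (s, φ)) φ := fun s φ =>
    (hs.diff (s, φ)).hasFDerivAt.comp_hasDerivAt φ ((hasDerivAt_const φ s).prodMk (hasDerivAt_id φ))
  obtain ⟨R, hR⟩ := hb
  have hc : ∀ {g : Fn}, Continuous g → SBounded g → ∀ φ, Integrable fun s => g (s, φ) := by
    rintro g hg ⟨R, hR⟩ φ
    refine Continuous.integrable_of_hasCompactSupport (by fun_prop)
      (HasCompactSupport.intro (isCompact_Icc (a := -R) (b := R)) fun s hs => hR (s, φ) ?_)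
    grind
  constructor
  · rw [stripVol_eq] at i1 ⊢
    rw [integral_prod_symm _ i1]
    refine (integral_congr_ae (.of_forall fun φ => ?_)).trans (integral_zero _ _)
    exact integral_eq_zero_of_hasDerivAt_of_integrable (d1 φ)
      (hc hs.dS.continuous (SBounded.derivs ⟨R, hR⟩).1 φ) (hc hs.continuous ⟨R, hR⟩ φ)
  · rw [stripVol_eq] at i2 ⊢
    rw [integral_prod _ i2]
    refine (integral_congr_ae (.of_forall fun s => ?_)).trans (integral_zero _ _)
    have hpi := Real.pi_pos
    rw [← intervalIntegral.integral_of_le (by linarith),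
      intervalIntegral.integral_eq_sub_of_hasDerivAt (fun φ _ => d2 s φ)
        ((hs.dP.continuous.comp (by fun_prop : Continuous fun φ : ℝ => (s, φ))).intervalIntegrable _ _),
      sub_eq_zero, ← hp s (-(2 * π))]
    ring_nf

lemma integral_strip_mul_dS (hf : Smooth f) (hg : Smooth g) (hf' : AntiPer f)
  (hg' : AntiPer g) (hb : SBounded g) :
  ∫ a, dS f a * conj (g a) ∂svol = -∫ a, f a * conj (dS g a) ∂svol ∧
  ∫ a, dP f a * conj (g a) ∂svol = -∫ a, f a * conj (dP g a) ∂svol := by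
  have h := integral_strip_derivs (h := fun a => f a * conj (g a)) (hf.mul hg.conj)
    (fun s φ => by simp [hf' s φ, hg' s φ]) (hb.conj.mul_left f)
  rw [dS_mul hf hg.conj, dP_mul hf hg.conj, dS_conj hg, dP_conj hg] at h
  have hi : ∀ {u v : Fn}, Smooth u → Smooth v → SBounded v →
      Integrable (fun a => u a * conj (v a)) svol := fun hu hv hb =>
    integrable_strip (hu.mul hv.conj).continuous (hb.conj.mul_left _)
  rw [integral_add (hi hf.dS hg hb) (hi hf hg.dS hb.derivs.1),
    integral_add (hi hf.dP hg hb) (hi hf hg.dP hb.derivs.2)] at h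
  grind

lemma ibpClass_cyl : IBPClass svol Cyl where
  smooth h := h.1
  dS h := ⟨h.1.dS, h.2.1.derivs.1, h.2.2.derivs.1⟩
  dP h := ⟨h.1.dP, h.2.1.derivs.2, h.2.2.derivs.2⟩
  add {f g} h1 h2 := ⟨h1.1.add h2.1, fun s φ => by simp [h1.2.1 s φ, h2.2.1 s φ]; ring, h1.2.2.add h2.2.2⟩
  smul {f} c h := ⟨contDiff_const.mul h.1, fun s φ => by simp only [h.2.1 s φ]; ring, h.2.2.mul_left _⟩
  integrable hf hg := integrable_strip (hf.1.mul hg.1.conj).continuous (hg.2.2.conj.mul_left _)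
  int_dS hf hg := (integral_strip_mul_dS hf.1 hg.1 hf.2.1 hg.2.1 hg.2.2).1
  int_dP hf hg := (integral_strip_mul_dS hf.1 hg.1 hf.2.1 hg.2.1 hg.2.2).2

lemma Cyl.lap (hf : Cyl f) : Cyl (lap f) :=
  ibpClass_cyl.add (ibpClass_cyl.dS (ibpClass_cyl.dS hf)) (ibpClass_cyl.dP (ibpClass_cyl.dP hf))

lemma integral_strip_lap (hf : Smooth f) (hf' : AntiPer f) (hg : Cyl g) :
  ∫ a, lap f a * conj (g a) ∂svol = ∫ a, f a * conj (lap g a) ∂svol := by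
  have hB := ibpClass_cyl
  have hi : ∀ {u v : Fn}, Smooth u → Cyl v →
      Integrable (fun a => u a * conj (v a)) svol := fun hu hv =>
    integrable_strip (hu.mul hv.1.conj).continuous (hv.2.2.conj.mul_left _)
  simp [lap, add_mul, mul_add]
  rw [integral_add (hi hf.dS.dS hg) (hi hf.dP.dP hg),
    integral_add (hi hf (hB.dS (hB.dS hg))) (hi hf (hB.dP (hB.dP hg))),
    (integral_strip_mul_dS hf.dS hg.1 hf'.derivs.1 hg.2.1 hg.2.2).1,
    (integral_strip_mul_dS hf.dP hg.1 hf'.derivs.2 hg.2.1 hg.2.2).2,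
    (integral_strip_mul_dS hf (hB.dS hg).1 hf' (hB.dS hg).2.1 (hB.dS hg).2.2).1,
    (integral_strip_mul_dS hf (hB.dP hg).1 hf' (hB.dP hg).2.1 (hB.dP hg).2.2).2, neg_neg, neg_neg]

lemma sq_integral_le {g : ℝ → ℂ} (hg : Continuous g) {a b : ℝ} (hab : a < b) :
  ‖∫ x in a..b, g x‖ ^ 2 ≤ (b - a) * ∫ x in a..b, ‖g x‖ ^ 2 := by
  set A := ∫ x in a..b, ‖g x‖
  have h1 : ‖∫ x in a..b, g x‖ ≤ A := intervalIntegral.norm_integral_le_integral_norm hab.le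
  have hL : 0 < b - a := sub_pos.2 hab
  have h2 : 0 ≤ ∫ x in a..b, (‖g x‖ - A / (b - a)) ^ 2 :=
    intervalIntegral.integral_nonneg hab.le fun x _ => sq_nonneg _
  have h3 : ∫ x in a..b, (‖g x‖ - A / (b - a)) ^ 2
      = (∫ x in a..b, ‖g x‖ ^ 2) - 2 * (A / (b - a)) * A + (b - a) * (A / (b - a)) ^ 2 := by
    have e : ∀ x, (‖g x‖ - A / (b - a)) ^ 2
        = ‖g x‖ ^ 2 - 2 * (A / (b - a)) * ‖g x‖ + (A / (b - a)) ^ 2 := fun x => by ring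
    simp only [e]
    rw [intervalIntegral.integral_add, intervalIntegral.integral_sub,
      intervalIntegral.integral_const_mul, intervalIntegral.integral_const, smul_eq_mul]
    all_goals exact Continuous.intervalIntegrable (by fun_prop) _ _
  have h4 : (b - a) * ((∫ x in a..b, ‖g x‖ ^ 2) - 2 * (A / (b - a)) * A
      + (b - a) * (A / (b - a)) ^ 2) = (b - a) * (∫ x in a..b, ‖g x‖ ^ 2) - A ^ 2 := by
    field_simp; ring
  rw [h3] at h2
  have h5 := mul_nonneg hL.le h2
  rw [h4] at h5
  have : ‖∫ x in a..b, g x‖ ^ 2 ≤ A ^ 2 := by gcongr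
  linarith

lemma nsq_le_nsq_dP (hf : Cyl f) : nsq svol f ≤ (4 * π) ^ 2 * nsq svol (dP f) := by
  have hpi := Real.pi_pos
  have hB := ibpClass_cyl
  have i1 := hB.integrable_sq hf
  have i2 := hB.integrable_sq (hB.dP hf)
  simp [nsq]
  rw [stripVol_eq] at *
  rw [integral_prod _ i1, integral_prod _ i2, ← integral_const_mul]
  refine integral_mono i1.integral_prod_left (i2.integral_prod_left.const_mul _) fun s => ?_
  rw [← intervalIntegral.integral_of_le (by linarith), ← intervalIntegral.integral_of_le (by linarith)]
  have d2 : ∀ φ, HasDerivAt (fun φ => f (s, φ)) (dP f (s, φ)) φ := fun φ =>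
    (hf.1.diff (s, φ)).hasFDerivAt.comp_hasDerivAt φ
      ((hasDerivAt_const φ s).prodMk (hasDerivAt_id φ))
  have hc : Continuous fun φ => dP f (s, φ) := hf.1.dP.continuous.comp (by fun_prop)
  have hc' : Continuous fun φ => f (s, φ) := hf.1.continuous.comp (by fun_prop)
  set B := ∫ φ in (-(2 * π))..(2 * π), ‖dP f (s, φ)‖ ^ 2
  have hper : Function.Periodic (fun φ => ‖dP f (s, φ)‖ ^ 2) (4 * π) := fun φ => by
    simp [hf.2.1.derivs.2 s φ]
  have key : ∀ φ, ‖f (s, φ)‖ ^ 2 ≤ 4 * π * B := fun φ => by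
    have h1 : ∫ t in φ..(φ + 4 * π), dP f (s, t) = -2 * f (s, φ) := by
      rw [intervalIntegral.integral_eq_sub_of_hasDerivAt (fun t _ => d2 t)
        (hc.intervalIntegrable _ _), hf.2.1]; ring
    have h2 := sq_integral_le hc (show φ < φ + 4 * π by linarith)
    have h3 : ∫ t in φ..(φ + 4 * π), ‖dP f (s, t)‖ ^ 2 = B := by
      rw [hper.intervalIntegral_add_eq φ (-(2 * π))]
      congr 1; ring
    rw [h1, h3, norm_mul, mul_pow] at h2
    norm_num at h2
    nlinarith [sq_nonneg ‖f (s, φ)‖]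
  have h5 : ∫ φ in (-(2 * π))..(2 * π), ‖f (s, φ)‖ ^ 2 ≤ ∫ φ in (-(2 * π))..(2 * π), 4 * π * B :=
    intervalIntegral.integral_mono_on (by linarith) ((hc'.norm.pow 2).intervalIntegrable _ _)
      (continuous_const.intervalIntegrable _ _) fun φ _ => key φ
  rw [intervalIntegral.integral_const, smul_eq_mul] at h5
  grind

end Cylinder

section WeightedEstimate

/-- The weight `e^{-s}`. -/
def wt (a : ℝ²) : ℂ := (rexp (-a.1) : ℂ)

lemma wt_mul_rexp (a : ℝ²) : wt a * (rexp a.1 : ℂ) = 1 := by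
  rw [wt, ← ofReal_mul, ← Real.exp_add]; simp

lemma hasFDerivAt_of_comp_fst {η : ℝ → ℂ} {η' : ℂ} {a : ℝ²} (h : HasDerivAt η η' a.1) :
  HasFDerivAt (fun b : ℝ² => η b.1) ((ContinuousLinearMap.fst ℝ ℝ ℝ).smulRight η') a := by
  have h1 := h.hasFDerivAt.comp a (hasFDerivAt_fst (𝕜 := ℝ) (E := ℝ) (F := ℝ) (p := a))
  refine h1.congr_fderiv ?_
  ext <;> simp

lemma hasFDerivAt_of_comp_snd {η : ℝ → ℂ} {η' : ℂ} {a : ℝ²} (h : HasDerivAt η η' a.2) :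
  HasFDerivAt (fun b : ℝ² => η b.2) ((ContinuousLinearMap.snd ℝ ℝ ℝ).smulRight η') a := by
  have h1 := h.hasFDerivAt.comp a (hasFDerivAt_snd (𝕜 := ℝ) (E := ℝ) (F := ℝ) (p := a))
  refine h1.congr_fderiv ?_
  ext <;> simp

lemma dS_fst {η : ℝ → ℂ} {η' : ℂ} {a : ℝ²} (h : HasDerivAt η η' a.1) :
  dS (fun b => η b.1) a = η' ∧ dP (fun b => η b.1) a = 0 := by
  simp [dS, dP, (hasFDerivAt_of_comp_fst h).fderiv]

lemma dP_snd {η : ℝ → ℂ} {η' : ℂ} {a : ℝ²} (h : HasDerivAt η η' a.2) :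
  dS (fun b => η b.2) a = 0 ∧ dP (fun b => η b.2) a = η' := by
  simp [dS, dP, (hasFDerivAt_of_comp_snd h).fderiv]

lemma smooth_fst {η : ℝ → ℂ} (h : ContDiff ℝ ∞ η) : Smooth fun a => η a.1 := h.comp contDiff_fst

lemma smooth_snd {η : ℝ → ℂ} (h : ContDiff ℝ ∞ η) : Smooth fun a => η a.2 := h.comp contDiff_snd

lemma smooth_wt : Smooth wt :=
  smooth_fst (ofRealCLM.contDiff.comp (Real.contDiff_exp.comp contDiff_neg))

lemma wt_derivs : dS wt = (fun a => -wt a) ∧ dP wt = fun _ => 0 := by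
  have h : ∀ a : ℝ², dS wt a = -wt a ∧ dP wt a = 0 := fun a => by
    have h1 : HasDerivAt (fun s : ℝ => (rexp (-s) : ℂ)) (-(rexp (-a.1) : ℂ)) a.1 := by
      have := ((Real.hasDerivAt_exp (-a.1)).comp a.1 (hasDerivAt_neg a.1)).ofReal_comp
      simp_all
    exact dS_fst h1
  grind

lemma Cyl.wt_mul (hf : Cyl f) : Cyl fun a => wt a * f a :=
  ⟨smooth_wt.mul hf.1, fun s φ => by simp only [hf.2.1 s φ, wt]; ring, hf.2.2.mul_left _⟩

/-- The phase `e^{iαφ}`. -/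
def phase (α : ℝ) (a : ℝ²) : ℂ := Complex.exp ((α * a.2 : ℝ) * Complex.I)

lemma norm_phase (α : ℝ) (a : ℝ²) : ‖phase α a‖ = 1 := norm_exp_ofReal_mul_I _

lemma smooth_phase (α : ℝ) : Smooth (phase α) := by
  have : ContDiff ℝ ∞ fun t : ℝ => ((α * t : ℝ) : ℂ) * I :=
    (ofRealCLM.contDiff.comp (contDiff_const.mul contDiff_id)).mul contDiff_const
  exact smooth_snd (η := fun t => exp ((α * t : ℝ) * I)) this.cexp

lemma phase_derivs (α : ℝ) : dS (phase α) = (fun _ => 0) ∧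
  dP (phase α) = fun a => (α * I) * phase α a := by
  have h : ∀ a : ℝ², dS (phase α) a = 0 ∧ dP (phase α) a = (α * I) * phase α a := by
    intro a
    have h1 : HasDerivAt (fun t : ℝ => exp ((α * t : ℝ) * I)) ((α * I) * phase α a) a.2 := by
      have h0 : HasDerivAt (fun t : ℝ => ((α * t : ℝ) : ℂ) * I) (α * I) a.2 := by
        have := (((hasDerivAt_id a.2).const_mul α).ofReal_comp).mul_const I
        simpa using this
      exact h0.cexp.congr_deriv (by rw [phase]; ring)
    exact dP_snd h1
  grind

lemma Cyl.phase_mul (hf : Cyl f) (n : ℤ) : Cyl fun a => phase n a * f a :=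
  ⟨(smooth_phase _).mul hf.1, fun s φ => by
    have : phase n (s, φ + 4 * π) = phase n (s, φ) := by
      rw [phase, phase, exp_eq_exp_iff_exists_int]
      exact ⟨2 * n, by push_cast; ring⟩
    simp only [hf.2.1 s φ, this]; ring, hf.2.2.mul_left _⟩

/-- The norm with weight `e^{-2s}`. -/
def wnsq (f : Fn) : ℝ := nsq svol fun a => wt a * f a

lemma wnsq_nonneg (f : Fn) : 0 ≤ wnsq f := nsq_nonneg _ _

lemma wnsq_smul (f : Fn) (c : ℂ) : wnsq (fun a => c * f a) = ‖c‖ ^ 2 * wnsq f := by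
  rw [wnsq, wnsq, ← IBPClass.nsq_smul]
  congr 1; funext a; ring

lemma wnsq_add_le (hf : Cyl f) (hg : Cyl g) :
  wnsq (fun a => f a + g a) ≤ 2 * wnsq f + 2 * wnsq g := by
  have := ibpClass_cyl.nsq_add_le hf.wt_mul hg.wt_mul
  simpa only [wnsq, mul_add] using this

lemma wnsq_wz (hf : Cyl f) (ε : ℤ) (hε : ε ^ 2 = 1) :
  ∃ g h : Fn, wnsq f = nsq svol g ∧ nsq svol g ≤ (4 * π) ^ 2 * nsq svol h ∧
    wnsq (wz ε f) = nsq svol (fun a => dS (fun a => wt a * f a) a) + nsq svol h ∧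
    wnsq (dP f) ≤ 2 * nsq svol h + 2 * nsq svol g := by
  have hB := ibpClass_cyl
  set w : Fn := fun a => wt a * f a with hw
  have hwC : Cyl w := hf.wt_mul
  set g : Fn := fun a => phase ((-ε : ℤ) : ℝ) a * w a with hg
  have hgC : Cyl g := hwC.phase_mul (-ε)
  have he : (ε : ℂ) ^ 2 = 1 := by exact_mod_cast hε
  have hdw : dP w = fun a => wt a * dP f a := by rw [hw, dP_mul smooth_wt hf.1, wt_derivs.2]; ring
  have hdg : dP g = fun a => phase ((-ε : ℤ) : ℝ) a * (dP w a - (ε * I) * w a) := by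
    rw [hg, dP_mul (smooth_phase _) hwC.1, (phase_derivs _).2]; push_cast; ring
  refine ⟨g, dP g, ?_, nsq_le_nsq_dP hgC, ?_, ?_⟩
  · simp [wnsq, nsq, hg, norm_phase, hw]
  · have h1 := hB.nsq_first_order hwC 1 ε
    have e1 : (fun a => wt a * wz ε f a) = fun a => dS w a + (((1 : ℝ) : ℂ) * w a
        + ((ε : ℝ) * I) * dP w a) := by
      rw [hdw, hw, dS_mul smooth_wt hf.1, wt_derivs.1]
      funext a; simp [wz]; push_cast; ring
    rw [wnsq, e1, h1]
    congr 1
    simp only [nsq, hdg, norm_mul, norm_phase]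
    congr 1; funext a
    have e2 : ((1 : ℝ) : ℂ) * w a + ((ε : ℝ) * I) * dP w a
        = (ε * I) * (dP w a - (ε * I) * w a) := by
      push_cast
      linear_combination (-(w a)) * he + (ε : ℂ) ^ 2 * w a * I_sq
    have e3 : ‖(ε : ℂ)‖ = 1 := by
      have := congrArg norm he
      rw [norm_pow, norm_one] at this
      exact (pow_eq_one_iff_of_nonneg (norm_nonneg _) two_ne_zero).1 this
    simp_all
  · have h1 := hB.nsq_add_le (hB.dP hgC) (hB.smul (ε * I) hgC)
    rw [IBPClass.nsq_smul] at h1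
    have e3 : ‖(ε : ℂ) * I‖ ^ 2 = 1 := by rw [← norm_pow, mul_pow, he]; simp
    rw [e3, one_mul] at h1
    refine le_trans (le_of_eq ?_) h1
    have e4 : (fun a => dP g a + ε * I * g a)
        = fun a => phase ((-ε : ℤ) : ℝ) a * (wt a * dP f a) := by
      rw [hdg, hdw, hg]; ring
    rw [e4, wnsq]
    simp [nsq, norm_phase]

lemma exists_wnsq_wz_le : ∃ C : ℝ, 1 ≤ C ∧ ∀ f, Cyl f → ∀ ε : ℤ, ε ^ 2 = 1 →
  wnsq f ≤ C * wnsq (wz ε f) ∧ wnsq (dS f) ≤ C * wnsq (wz ε f) ∧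
    wnsq (dP f) ≤ C * wnsq (wz ε f) := by
  have hB := ibpClass_cyl
  refine ⟨4 + 4 * (4 * π) ^ 2, by nlinarith [sq_nonneg (4 * π)], fun f hf ε hε => ?_⟩
  obtain ⟨g, h, h1, h2, h3, h4⟩ := wnsq_wz hf ε hε
  have hS : wnsq (dS f) ≤ 2 * nsq svol (fun a => dS (fun a => wt a * f a) a) + 2 * wnsq f := by
    have := hB.nsq_add_le (hB.dS hf.wt_mul) hf.wt_mul
    refine le_trans (le_of_eq ?_) this
    rw [wnsq, dS_mul smooth_wt hf.1, wt_derivs.1]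
    congr 1; funext a; ring
  have n1 := nsq_nonneg svol (fun a => dS (fun a => wt a * f a) a)
  have n2 := nsq_nonneg svol h
  have n3 := mul_nonneg (sq_nonneg (4 * π)) n1
  have n4 := mul_nonneg (sq_nonneg (4 * π)) n2
  rw [h3]
  refine ⟨?_, ?_, ?_⟩ <;> nlinarith

lemma exists_wnsq_dSP_le : ∃ C : ℝ, 0 ≤ C ∧ ∀ f, Cyl f → ∀ p q : ℕ, p + q ≤ 2 →
  wnsq (dSP p q f) ≤ C * wnsq (lap f) := by
  have hB := ibpClass_cyl
  obtain ⟨C, hC, h⟩ := exists_wnsq_wz_le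
  refine ⟨C ^ 2, by positivity, fun f hf p q hpq => ?_⟩
  have hfac : ∀ ε : ℤ, ε ^ 2 = 1 → wz (-ε : ℤ) (wz ε f) = lap f := fun ε hε => by
    have := hB.factor hf (ε : ℝ) (by exact_mod_cast hε)
    rw [← this]
    funext a
    simp [wz]
    push_cast
    rfl
  have n := wnsq_nonneg (lap f)
  have hw : ∀ ε : ℤ, ε ^ 2 = 1 → wnsq (wz ε f) ≤ C * wnsq (lap f) ∧
      wnsq (dS (wz ε f)) ≤ C * wnsq (lap f) ∧ wnsq (dP (wz ε f)) ≤ C * wnsq (lap f) :=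
    fun ε hε => by
    have := h _ (hB.wirt hf ε) (-ε) (by rw [neg_sq, hε])
    rwa [hfac ε hε] at this
  have w1 := hw 1 (by norm_num)
  have w2 := hw (-1) (by norm_num)
  have f1 := h f hf 1 (by norm_num)
  have hle : C * wnsq (lap f) ≤ C ^ 2 * wnsq (lap f) := by gcongr; nlinarith
  have hle2 : C * wnsq (wz (1 : ℤ) f) ≤ C ^ 2 * wnsq (lap f) := by
    rw [sq, mul_assoc]; gcongr; exact w1.1
  push_cast at w1 w2 f1 hle2
  have cS := hB.bound_of_wirt wnsq_add_le wnsq_smul (hB.dS (hB.wirt hf 1)) (hB.dS (hB.wirt hf (-1)))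
    w1.2.1 w2.2.1
  have cP := hB.bound_of_wirt wnsq_add_le wnsq_smul (hB.dP (hB.wirt hf 1)) (hB.dP (hB.wirt hf (-1)))
    w1.2.2 w2.2.2
  have hp : p ≤ 2 := by omega
  have hq : q ≤ 2 := by omega
  interval_cases p <;> interval_cases q <;> first | omega | skip
  · exact f1.1.trans hle2
  · exact f1.2.2.trans hle2
  · change wnsq (dP (dP f)) ≤ _
    rw [hB.dP_dP_eq hf]; exact cP.2.trans hle
  · exact f1.2.1.trans hle2
  · change wnsq (dP (dS f)) ≤ _
    rw [hB.dP_dS_eq hf]; exact cP.1.trans hle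
  · change wnsq (dS (dS f)) ≤ _
    rw [hB.dS_dS_eq hf]; exact cS.1.trans hle

end WeightedEstimate

section OrdinaryDifferentialEquation

/-- Smooth functions on the line. -/
abbrev Smooth1 (η : ℝ → ℂ) : Prop := ContDiff ℝ ∞ η

/-- The operator `η'' - k² η`. -/
def ode (k : ℝ) (η : ℝ → ℂ) (s : ℝ) : ℂ := deriv (deriv η) s - (k : ℂ) ^ 2 * η s

lemma Smooth1.deriv {η : ℝ → ℂ} (h : Smooth1 η) : Smooth1 (deriv η) :=
  (contDiff_infty_iff_deriv.1 h).2

lemma Smooth1.diff {η : ℝ → ℂ} (h : Smooth1 η) : Differentiable ℝ η :=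
  (contDiff_infty_iff_deriv.1 h).1

lemma smooth1_of_hasDerivAt {η η' : ℝ → ℂ} (h : ∀ s, HasDerivAt η (η' s) s) (h' : Smooth1 η') :
  Smooth1 η :=
  contDiff_infty_iff_deriv.2 ⟨fun s => (h s).differentiableAt, by
    rwa [show _root_.deriv η = η' from funext fun s => (h s).deriv]⟩

lemma smooth1_ode {η : ℝ → ℂ} (k : ℝ) (h : Smooth1 η) : Smooth1 (ode k η) :=
  h.deriv.deriv.sub (contDiff_const.mul h)

lemma ode_eq {η η' η'' : ℝ → ℂ} (h : ∀ s, HasDerivAt η (η' s) s)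
  (h' : ∀ s, HasDerivAt η' (η'' s) s) (k : ℝ) : ode k η = fun s => η'' s - (k : ℂ) ^ 2 * η s := by
  have e := funext fun s => (h s).deriv
  funext s
  rw [ode, e, (h' s).deriv]

lemma ode_sub {η θ : ℝ → ℂ} (hη : Smooth1 η) (hθ : Smooth1 θ) (k : ℝ) :
  ode k (fun s => η s - θ s) = fun s => ode k η s - ode k θ s := by
  rw [ode_eq (fun s => (hη.diff s).hasDerivAt.fun_sub (hθ.diff s).hasDerivAt)
    (fun s => (hη.deriv.diff s).hasDerivAt.fun_sub (hθ.deriv.diff s).hasDerivAt)]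
  funext s; simp [ode]; ring

lemma ode_const_mul {η : ℝ → ℂ} (hη : Smooth1 η) (k : ℝ) (c : ℂ) :
  ode k (fun s => c * η s) = fun s => c * ode k η s := by
  rw [ode_eq (fun s => (hη.diff s).hasDerivAt.const_mul c)
    (fun s => (hη.deriv.diff s).hasDerivAt.const_mul c)]
  funext s; simp [ode]; ring

lemma ode_eqOn_zero {η : ℝ → ℂ} {U : Set ℝ} (hU : IsOpen U) (h : ∀ s ∈ U, η s = 0) (k : ℝ) :
  ∀ s ∈ U, ode k η s = 0 := fun s hs => by
  have h1 : η =ᶠ[𝓝 s] fun _ => 0 := by filter_upwards [hU.mem_nhds hs] with t ht using h t ht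
  have h2 := h1.deriv.deriv
  simp [ode, h2.eq_of_nhds, h s hs]

/-- The exponential function `e^{ks}`. -/
def cexpR (k : ℝ) (s : ℝ) : ℂ := (rexp (k * s) : ℂ)

lemma hasDerivAt_cexpR (k s : ℝ) : HasDerivAt (cexpR k) (k * cexpR k s) s := by
  have h1 := ((hasDerivAt_id s).const_mul k).exp
  refine h1.ofReal_comp.congr_deriv ?_
  simp [cexpR]; push_cast; ring

lemma smooth1_cexpR (k : ℝ) : Smooth1 (cexpR k) :=
  ofRealCLM.contDiff.comp (Real.contDiff_exp.comp (contDiff_const.mul contDiff_id))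

lemma cexpR_mul_neg (k s : ℝ) : cexpR k s * cexpR (-k) s = 1 := by
  simp only [cexpR, ← ofReal_mul, ← Real.exp_add]; simp

lemma norm_cexpR (k s : ℝ) : ‖cexpR k s‖ = rexp (k * s) := by rw [cexpR, norm_rexp]

lemma ode_cexpR_mul {χ : ℝ → ℂ} (hχ : Smooth1 χ) (k l : ℝ) (hl : l ^ 2 = k ^ 2) :
  ode k (fun s => χ s * cexpR l s)
    = fun s => (deriv (deriv χ) s + 2 * l * deriv χ s) * cexpR l s := by
  have hl' : (l : ℂ) ^ 2 = (k : ℂ) ^ 2 := by exact_mod_cast hl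
  rw [ode_eq (fun s => (hχ.diff s).hasDerivAt.fun_mul (hasDerivAt_cexpR l s))
    (fun s => ((hχ.deriv.diff s).hasDerivAt.fun_mul (hasDerivAt_cexpR l s)).fun_add
      ((hχ.diff s).hasDerivAt.fun_mul ((hasDerivAt_cexpR l s).const_mul (l : ℂ))))]
  grind

lemma exists_ode_solution {k : ℝ} (hk : k ≠ 0) {g : ℝ → ℂ} (hg : Smooth1 g) {c d : ℝ}
  (hcd : ∀ s, s ≤ c ∨ d ≤ s → g s = 0) :
  ∃ η : ℝ → ℂ, Smooth1 η ∧ ode k η = g ∧ (∀ s ≤ c, η s = 0) ∧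
    ∀ s ≥ d, η s = (1 / (2 * k) * ∫ t, cexpR (-k) t * g t) * cexpR k s
      - (1 / (2 * k) * ∫ t, cexpR k t * g t) * cexpR (-k) s := by
  have hk' : (k : ℂ) ≠ 0 := by exact_mod_cast hk
  have A : ∀ l : ℝ, ∃ A : ℝ → ℂ, (∀ s, HasDerivAt A (cexpR l s * g s) s) ∧ (∀ s ≤ c, A s = 0) ∧
      ∀ s ≥ d, A s = ∫ t, cexpR l t * g t := by
    intro l
    have hcont := (smooth1_cexpR l).continuous.mul hg.continuous
    refine ⟨fun s => ∫ t in c..s, cexpR l t * g t, fun s =>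
      intervalIntegral.integral_hasDerivAt_right (hcont.intervalIntegrable _ _)
        (hcont.stronglyMeasurableAtFilter _ _) hcont.continuousAt, fun s hs => ?_, fun s hs =>
      intervalIntegral.integral_eq_integral_of_support_subset fun t ht => ?_⟩
    · beta_reduce
      rw [intervalIntegral.integral_congr (g := fun _ => 0), intervalIntegral.integral_zero]
      intro t ht
      rw [Set.uIcc_of_ge hs] at ht
      simp [hcd t (.inl ht.2)]
    · have := mt (hcd t) (right_ne_zero_of_mul ht)
      push Not at this
      exact ⟨this.1, this.2.le.trans hs⟩
  obtain ⟨A1, d1, z1, e1⟩ := A (-k)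
  obtain ⟨A2, d2, z2, e2⟩ := A k
  have s1 := smooth1_of_hasDerivAt d1 ((smooth1_cexpR _).mul hg)
  have s2 := smooth1_of_hasDerivAt d2 ((smooth1_cexpR _).mul hg)
  refine ⟨fun s => 1 / (2 * k) * (cexpR k s * A1 s - cexpR (-k) s * A2 s),
    contDiff_const.mul (((smooth1_cexpR k).mul s1).sub ((smooth1_cexpR (-k)).mul s2)), ?_,
    fun s hs => by simp [z1 s hs, z2 s hs], fun s hs => by simp only [e1 s hs, e2 s hs]; ring⟩
  rw [ode_eq (η' := fun s => 1 / 2 * (cexpR k s * A1 s + cexpR (-k) s * A2 s))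
    (η'' := fun s => k / 2 * (cexpR k s * A1 s - cexpR (-k) s * A2 s) + g s) (fun s => ?_)
    fun s => ?_]
  · funext s
    field_simp
    ring
  · refine ((((hasDerivAt_cexpR k s).mul (d1 s)).sub
      ((hasDerivAt_cexpR (-k) s).mul (d2 s))).const_mul (1 / (2 * k) : ℂ)).congr_deriv ?_
    push_cast
    field_simp
    ring
  · refine ((((hasDerivAt_cexpR k s).mul (d1 s)).add
      ((hasDerivAt_cexpR (-k) s).mul (d2 s))).const_mul (1 / 2 : ℂ)).congr_deriv ?_
    push_cast
    linear_combination (g s) * cexpR_mul_neg k s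

/-- Compactly supported smooth functions on the line. -/
def IsBump1 (η : ℝ → ℂ) : Prop := Smooth1 η ∧ ∃ c d : ℝ, ∀ s, s ≤ c ∨ d ≤ s → η s = 0

lemma IsBump1.hasCompactSupport {η : ℝ → ℂ} (h : IsBump1 η) : HasCompactSupport η := by
  obtain ⟨-, c, d, h⟩ := h
  refine HasCompactSupport.intro (isCompact_Icc (a := c) (b := d)) fun s hs => h s ?_
  grind

lemma IsBump1.ode {η : ℝ → ℂ} (h : IsBump1 η) (k : ℝ) : IsBump1 (ode k η) := by
  obtain ⟨hs, c, d, h⟩ := h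
  refine ⟨smooth1_ode k hs, c - 1, d + 1, fun s hs => ?_⟩
  rcases hs with hs | hs
  · exact ode_eqOn_zero isOpen_Iio (fun t (ht : t < c) => h t (.inl ht.le)) k s
      (show s < c by linarith)
  · exact ode_eqOn_zero isOpen_Ioi (fun t (ht : d < t) => h t (.inr ht.le)) k s
      (show d < s by linarith)

lemma integrable_mul_bump1 {y η : ℝ → ℂ} (hy : LocallyIntegrable y)
  (h : IsBump1 η) : Integrable fun s => y s * η s := by
  simpa only [smul_eq_mul, mul_comm] using
    hy.integrable_smul_left_of_hasCompactSupport h.1.continuous h.hasCompactSupport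

/-- A step function: smooth, zero near `-∞` and one near `∞`. -/
structure IsStep (χ : ℝ → ℂ) : Prop where
  smooth : Smooth1 χ
  left : ∃ c, ∀ s ≤ c, χ s = 0
  right : ∃ d, ∀ s ≥ d, χ s = 1

lemma IsStep.isBump1_ode {χ : ℝ → ℂ} (hχ : IsStep χ) (k l : ℝ) (hl : l ^ 2 = k ^ 2) :
  IsBump1 (ode k fun s => χ s * cexpR l s) := by
  obtain ⟨hs, ⟨c, hc⟩, ⟨d, hd⟩⟩ := hχ
  refine ⟨smooth1_ode k (hs.mul (smooth1_cexpR l)), c - 1, d + 1, fun s h => ?_⟩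
  rcases h with h | h
  · exact ode_eqOn_zero isOpen_Iio (fun t (ht : t < c) => by simp [hc t ht.le]) k s
      (show s < c by linarith)
  · have h1 : χ =ᶠ[𝓝 s] fun _ => 1 := by
      filter_upwards [lt_mem_nhds (show d < s by linarith)] with t ht using hd t ht.le
    rw [ode_cexpR_mul hs k l hl]
    have e1 : deriv χ s = 0 := by rw [h1.deriv_eq]; simp
    have e2 : deriv (deriv χ) s = 0 := by rw [h1.deriv.deriv_eq]; simp
    simp [e1, e2]

lemma Smooth1.ae_eq_zero {y : ℝ → ℂ} (hy : LocallyIntegrable y)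
  (h : ∀ g, IsBump1 g → ∫ s, y s * g s = 0) : ∀ᵐ s, y s = 0 := by
  refine ae_eq_zero_of_integral_contDiff_smul_eq_zero hy fun g hg hc => ?_
  obtain ⟨R, hR⟩ := hc.isCompact.isBounded.subset_closedBall 0
  have h1 := h (fun s => (g s : ℂ)) ⟨ofRealCLM.contDiff.comp hg, -R - 1, R + 1, fun s hs => by
      have : s ∉ tsupport g := fun hs' => by
        have := hR hs'
        rw [Metric.mem_closedBall, dist_zero_right, Real.norm_eq_abs, abs_le] at this
        grind
      simp [zero_off_tsupport this]⟩
  rw [← h1]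
  congr 1; simp [mul_comm]

lemma integral_sub_sub {α : Type*} [MeasurableSpace α] {μ : Measure α} {f g h : α → ℂ}
  (hf : Integrable f μ) (hg : Integrable g μ) (hh : Integrable h μ) :
  ∫ a, f a - (g a - h a) ∂μ = ∫ a, f a ∂μ - (∫ a, g a ∂μ - ∫ a, h a ∂μ) :=
  (integral_sub hf (hg.sub hh)).trans (congrArg _ (integral_sub hg hh))

lemma weak_ode {k : ℝ} (hk : k ≠ 0) {y : ℝ → ℂ} (hy : LocallyIntegrable y)
  (h : ∀ η, IsBump1 η → ∫ s, y s * ode k η s = 0) {χ : ℝ → ℂ} (hχ : IsStep χ) :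
  ∀ᵐ s, y s = (1 / (2 * k) * ∫ t, y t * ode k (fun s => χ s * cexpR k s) t) * cexpR (-k) s
    - (1 / (2 * k) * ∫ t, y t * ode k (fun s => χ s * cexpR (-k) s) t) * cexpR k s := by
  have sp := hχ.smooth.mul (smooth1_cexpR k)
  have sm := hχ.smooth.mul (smooth1_cexpR (-k))
  have b1 := hχ.isBump1_ode k k rfl
  have b2 := hχ.isBump1_ode k (-k) (by ring)
  set p := fun s => χ s * cexpR k s
  set m := fun s => χ s * cexpR (-k) s
  have c1 : ∀ l : ℝ, Continuous (cexpR l) := fun l => (smooth1_cexpR l).continuous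
  set a := ∫ t, y t * ode k p t
  set b := ∫ t, y t * ode k m t
  have h0 := Smooth1.ae_eq_zero (y := fun s => y s - ((1 / (2 * k) * a) * cexpR (-k) s
    - (1 / (2 * k) * b) * cexpR k s)) (hy.sub (((continuous_const.mul (c1 (-k))).sub
    (continuous_const.mul (c1 k))).locallyIntegrable)) fun g hg => ?_
  · filter_upwards [h0] with s hs using sub_eq_zero.1 hs
  obtain ⟨hgs, c, d, hcd⟩ := id hg
  obtain ⟨η, hη, hηg, hηc, hηd⟩ := exists_ode_solution hk hgs hcd
  set α := 1 / (2 * k : ℂ) * ∫ t, cexpR (-k) t * g t with hα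
  set β := 1 / (2 * k : ℂ) * ∫ t, cexpR k t * g t with hβ
  have hb : IsBump1 fun s => η s - (α * p s - β * m s) := by
    obtain ⟨c', hc'⟩ := hχ.left
    obtain ⟨d', hd'⟩ := hχ.right
    refine ⟨hη.sub ((contDiff_const.mul sp).sub (contDiff_const.mul sm)), min c c', max d d',
      fun s hs => ?_⟩
    rcases hs with hs | hs
    · simp [p, m, hηc s (hs.trans (min_le_left _ _)), hc' s (hs.trans (min_le_right _ _))]
    · simp [p, m, hηd s ((le_max_left _ _).trans hs), hd' s ((le_max_right _ _).trans hs)]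
  have h1 := h _ hb
  rw [ode_sub hη ((contDiff_const.mul sp).sub (contDiff_const.mul sm)),
    ode_sub (contDiff_const.mul sp) (contDiff_const.mul sm), ode_const_mul sp, ode_const_mul sm,
    hηg] at h1
  simp only [mul_sub, mul_left_comm (y _)] at h1
  have i0 := integrable_mul_bump1 hy hg
  rw [integral_sub_sub i0 ((integrable_mul_bump1 hy b1).const_mul α)
    ((integrable_mul_bump1 hy b2).const_mul β), integral_const_mul, integral_const_mul] at h1
  have j := fun l => integrable_mul_bump1 (c1 l).locallyIntegrable hg
  simp only [sub_mul, mul_assoc (_ * _ : ℂ)]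
  rw [integral_sub_sub i0 ((j (-k)).const_mul _) ((j k).const_mul _), integral_const_mul,
    integral_const_mul]
  linear_combination h1 + a * hα - b * hβ

lemma not_memLp_of_tendsto {f : ℝ → ℂ} (hf : MemLp f 2 volume) {c d : ℝ} (hc : 0 < c)
  (h : ∀ᵐ s, d ≤ s → c ≤ ‖f s‖) : False := by
  have h1 := (memLp_two_iff_integrable_sq_norm hf.1).1 hf
  have h2 : IntegrableOn (fun _ : ℝ => c ^ 2) (Set.Ici d) := by
    refine Integrable.mono' h1.integrableOn (by fun_prop) ?_
    filter_upwards [ae_restrict_of_ae h, ae_restrict_mem measurableSet_Ici] with s hs hd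
    rw [Real.norm_of_nonneg (sq_nonneg c)]
    exact pow_le_pow_left₀ hc.le (hs hd) 2
  simp_all

lemma coeff_eq_zero_of_memLp {y w : ℝ → ℂ} {A B : ℂ} {k ν : ℝ} (hk : 0 < k) (hν : 0 ≤ ν + k)
  (hy : ∀ᵐ s, y s = A * cexpR k s + B * cexpR (-k) s) (hw : ∀ s ≥ 0, ‖w s‖ = rexp (ν * s))
  (h : MemLp (fun s => w s * y s) 2 volume) : A = 0 := by
  by_contra hA
  have hA' := norm_pos_iff.2 hA
  have hlim : Tendsto (fun s : ℝ => ‖B‖ * rexp (-(2 * k) * s)) atTop (𝓝 0) := by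
    have h1 : Tendsto (fun s : ℝ => -(2 * k) * s) atTop atBot :=
      tendsto_id.const_mul_atTop_of_neg (by linarith)
    simpa using (Real.tendsto_exp_atBot.comp h1).const_mul ‖B‖
  obtain ⟨d, hd⟩ := eventually_atTop.1 (hlim.eventually (gt_mem_nhds (half_pos hA')))
  refine not_memLp_of_tendsto h (c := ‖A‖ / 2) (d := max d 0) (half_pos hA') ?_
  filter_upwards [hy] with s hs hds
  have h0 := (le_max_right _ _).trans hds
  rw [norm_mul, hw s h0, hs]
  have h1 : ‖A‖ * rexp (k * s) - ‖B‖ * rexp (-k * s) ≤ ‖A * cexpR k s + B * cexpR (-k) s‖ := by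
    have := norm_sub_le_norm_add (A * cexpR k s) (B * cexpR (-k) s)
    rwa [norm_mul, norm_mul, norm_cexpR, norm_cexpR] at this
  have h2 : rexp (-k * s) = rexp (-(2 * k) * s) * rexp (k * s) := by rw [← Real.exp_add]; ring_nf
  have h3 : 1 ≤ rexp (ν * s) * rexp (k * s) := by
    rw [← Real.exp_add]; exact Real.one_le_exp (by nlinarith)
  have h4 := hd s ((le_max_left _ _).trans hds)
  calc ‖A‖ / 2 ≤ (‖A‖ / 2) * (rexp (ν * s) * rexp (k * s)) := by nlinarith
    _ ≤ (‖A‖ - ‖B‖ * rexp (-(2 * k) * s)) * (rexp (ν * s) * rexp (k * s)) := by gcongr; linarith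
    _ = rexp (ν * s) * (‖A‖ * rexp (k * s) - ‖B‖ * rexp (-k * s)) := by rw [h2]; ring
    _ ≤ _ := by gcongr

lemma memLp_neg {f : ℝ → ℂ} (hf : MemLp f 2 volume) : MemLp (fun s => f (-s)) 2 volume :=
  hf.comp_measurePreserving (Measure.measurePreserving_neg volume)

end OrdinaryDifferentialEquation

section Modes

/-- The exponents `(m - 1/2) / 2`. -/
def kap (m : ℤ) : ℝ := ((m : ℝ) - 1 / 2) / 2

lemma kap_ne_zero (m : ℤ) : kap m ≠ 0 := by
  intro h
  have h1 : (m : ℝ) * 2 = 1 := by rw [kap] at h; linarith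
  have h2 : m * 2 = 1 := by exact_mod_cast h1
  omega

/-- The function `η(s) e^{iκφ}`, where `κ = (m - 1/2) / 2`. -/
def mode (η : ℝ → ℂ) (m : ℤ) (a : ℝ²) : ℂ := η a.1 * phase (kap m) a

lemma antiPer_phase (m : ℤ) : AntiPer (phase (kap m)) := fun s φ => by
  have h1 : phase (kap m) (s, φ + 4 * π) = exp ((kap m * φ : ℝ) * I + π * I
        + (m - 1 : ℤ) * (2 * π * I)) := by
    rw [phase, kap]; push_cast; ring
  rw [h1, exp_add, exp_int_mul_two_pi_mul_I, exp_add, exp_pi_mul_I, phase]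
  ring

lemma smooth_mode {η : ℝ → ℂ} (hη : Smooth1 η) (m : ℤ) : Smooth (mode η m) :=
  (smooth_fst hη).mul (smooth_phase _)

lemma antiPer_mode (η : ℝ → ℂ) (m : ℤ) : AntiPer (mode η m) := fun s φ => by
  rw [mode, antiPer_phase, mode]; ring

lemma lap_mode {η : ℝ → ℂ} (hη : Smooth1 η) (m : ℤ) : lap (mode η m) = mode (ode (kap m) η) m := by
  have hs : ∀ {θ : ℝ → ℂ}, Smooth1 θ → dS (mode θ m) = mode (deriv θ) m := fun {θ} hθ => by
    have h1 : dS (fun a : ℝ² => θ a.1) = fun a => deriv θ a.1 :=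
      funext fun a => (dS_fst (hθ.diff a.1).hasDerivAt).1
    unfold mode
    rw [dS_mul (smooth_fst hθ) (smooth_phase _), h1, (phase_derivs _).1]
    ring
  have hp : ∀ {θ : ℝ → ℂ}, Smooth1 θ → dP (mode θ m) = fun a => (kap m * I) * mode θ m a :=
    fun {θ} hθ => by
    have h1 : dP (fun a : ℝ² => θ a.1) = fun _ => 0 :=
      funext fun a => (dS_fst (hθ.diff a.1).hasDerivAt).2
    unfold mode
    rw [dP_mul (smooth_fst hθ) (smooth_phase _), h1, (phase_derivs _).2]
    funext a; ring
  funext a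
  rw [lap, hs hη, hs hη.deriv, hp hη, dP_const_mul (smooth_mode hη m), hp hη]
  simp [mode, ode]
  linear_combination (kap m : ℂ) ^ 2 * η a.1 * phase (kap m) a * I_sq

lemma cyl_mode {η : ℝ → ℂ} (hη : IsBump1 η) (m : ℤ) : Cyl (mode η m) := by
  refine ⟨smooth_mode hη.1 m, antiPer_mode η m, ?_⟩
  obtain ⟨-, c, d, h⟩ := hη
  refine ⟨max (-c) d, fun a ha => ?_⟩
  have : a.1 ≤ c ∨ d ≤ a.1 := by grind
  simp [mode, h _ this]

lemma norm_mode (η : ℝ → ℂ) (m : ℤ) (a : ℝ²) : ‖mode η m a‖ = ‖η a.1‖ := by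
  rw [mode, norm_mul, norm_phase, mul_one]

lemma ode_conj {η : ℝ → ℂ} (hη : Smooth1 η) (k : ℝ) :
  ode k (fun s => conj (η s)) = fun s => conj (ode k η s) := by
  have h : ∀ {θ : ℝ → ℂ}, Smooth1 θ → ∀ s, HasDerivAt (fun s => conj (θ s)) (conj (deriv θ s)) s :=
    fun hθ s => conjCLE.toContinuousLinearMap.hasFDerivAt.comp_hasDerivAt s (hθ.diff s).hasDerivAt
  rw [ode_eq (h hη) (h hη.deriv)]
  simp [ode]

lemma IsBump1.conj {η : ℝ → ℂ} (h : IsBump1 η) : IsBump1 fun s => conj (η s) :=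
  ⟨conjCLE.contDiff.comp h.1, by
    obtain ⟨-, c, d, h⟩ := h
    exact ⟨c, d, fun s hs => by simp [h s hs]⟩⟩

/-- Lebesgue measure on a period. -/
abbrev circleVol : Measure ℝ := volume.restrict (Set.Ioc (-(2 * π)) (2 * π))

/-- The Fourier coefficients of `z` in the angular variable. -/
def coeffFun (z : Fn) (m : ℤ) (s : ℝ) : ℂ := ∫ φ, z (s, φ) * conj (phase (kap m) (s, φ)) ∂circleVol

lemma sq_norm_integral_le {α : Type*} [MeasurableSpace α] {μ : Measure α} [IsFiniteMeasure μ]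
  {f : α → ℂ} (hf : MemLp f 2 μ) : ‖∫ x, f x ∂μ‖ ^ 2 ≤ μ.real Set.univ * ∫ x, ‖f x‖ ^ 2 ∂μ := by
  rcases eq_or_ne μ 0 with rfl | hμ
  · simp
  set A := ∫ x, ‖f x‖ ∂μ
  set L := μ.real Set.univ
  have : NeZero μ := ⟨hμ⟩
  have hL : 0 < L := measureReal_univ_pos
  have i1 : Integrable (fun x => ‖f x‖) μ := (hf.integrable (by norm_num)).norm
  have i2 := (memLp_two_iff_integrable_sq_norm hf.1).1 hf
  have h2 : 0 ≤ ∫ x, (‖f x‖ - A / L) ^ 2 ∂μ := integral_nonneg fun x => sq_nonneg _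
  have h3 : ∫ x, (‖f x‖ - A / L) ^ 2 ∂μ
      = (∫ x, ‖f x‖ ^ 2 ∂μ) - 2 * (A / L) * A + L * (A / L) ^ 2 := by
    have e : ∀ x, (‖f x‖ - A / L) ^ 2
        = ‖f x‖ ^ 2 - 2 * (A / L) * ‖f x‖ + (A / L) ^ 2 := fun x => by ring
    simp [e]
    rw [integral_add (f := fun x => ‖f x‖ ^ 2 - 2 * (A / L) * ‖f x‖)
      (i2.sub (i1.const_mul (2 * (A / L)))) (integrable_const _), integral_sub i2
      (i1.const_mul (2 * (A / L))), integral_const_mul, integral_const, smul_eq_mul]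
  have h4 : L * ((∫ x, ‖f x‖ ^ 2 ∂μ) - 2 * (A / L) * A + L * (A / L) ^ 2)
      = L * (∫ x, ‖f x‖ ^ 2 ∂μ) - A ^ 2 := by field_simp; ring
  rw [h3] at h2
  have h5 := mul_nonneg hL.le h2
  have h1 : ‖∫ x, f x ∂μ‖ ≤ A := norm_integral_le_integral_norm f
  have : ‖∫ x, f x ∂μ‖ ^ 2 ≤ A ^ 2 := by gcongr
  linarith

section

variable {W : ℝ → ℝ} (hW : Continuous W) (hW0 : ∀ s, 0 < W s) {z : Fn}
  (hz : MemLp (fun a => (W a.1 : ℂ) * z a) 2 svol)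
include hW hW0 hz

lemma aestronglyMeasurable_of_weight : AEStronglyMeasurable z svol := by
  have h1 : Continuous fun a : ℝ² => ((W a.1 : ℂ))⁻¹ :=
    Continuous.inv₀ (by fun_prop) fun a => by exact_mod_cast (hW0 a.1).ne'
  refine (h1.aestronglyMeasurable.mul hz.1).congr (.of_forall fun a => ?_)
  have : (W a.1 : ℂ) ≠ 0 := by exact_mod_cast (hW0 a.1).ne'
  simp_all

lemma ae_memLp_slice : ∀ᵐ s, MemLp (fun φ => z (s, φ)) 2 circleVol := by
  have h0 := aestronglyMeasurable_of_weight hW hW0 hz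
  have h1 := (memLp_two_iff_integrable_sq_norm hz.1).1 hz
  rw [stripVol_eq] at h0 h1
  filter_upwards [h1.prod_right_ae, h0.prodMk_left] with s hs hs0
  rw [memLp_two_iff_integrable_sq_norm hs0]
  refine (hs.const_mul ((W s ^ 2)⁻¹)).congr (.of_forall fun φ => ?_)
  have := (hW0 s).ne'
  simp [mul_pow]
  field_simp

lemma memLp_coeffFun (m : ℤ) : MemLp (fun s => (W s : ℂ) * coeffFun z m s) 2 volume := by
  have h0 := aestronglyMeasurable_of_weight hW hW0 hz
  have h1 := (memLp_two_iff_integrable_sq_norm hz.1).1 hz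
  have h2 := ae_memLp_slice hW hW0 hz
  have hm : AEStronglyMeasurable (fun s => (W s : ℂ) * coeffFun z m s) volume := by
    refine (continuous_ofReal.comp hW).aestronglyMeasurable.mul ?_
    have h3 : AEStronglyMeasurable (fun a => z a * conj (phase (kap m) a)) svol :=
      h0.mul (smooth_phase _).conj.continuous.aestronglyMeasurable
    rw [stripVol_eq] at h3
    exact h3.integral_prod_right'
  rw [memLp_two_iff_integrable_sq_norm hm]
  rw [stripVol_eq] at h1
  refine (h1.integral_prod_left.const_mul (circleVol.real Set.univ)).mono' (hm.norm.pow 2) ?_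
  filter_upwards [h2] with s hs
  have hs' : MemLp (fun φ => z (s, φ) * conj (phase (kap m) (s, φ))) 2 circleVol := by
    refine hs.of_le (hs.1.mul ((smooth_phase _).conj.continuous.comp
      (by fun_prop : Continuous fun φ : ℝ => (s, φ))).aestronglyMeasurable)
      (.of_forall fun φ => ?_)
    simp [norm_phase]
  have h4 := sq_norm_integral_le hs'
  simp only [norm_mul, RCLike.norm_conj, norm_phase, mul_one] at h4
  rw [Real.norm_of_nonneg (sq_nonneg _), norm_mul, mul_pow]
  simp only [norm_mul, mul_pow, integral_const_mul]
  calc _ ≤ ‖(W s : ℂ)‖ ^ 2 * (circleVol.real Set.univ * ∫ x, ‖z (s, x)‖ ^ 2 ∂circleVol) := by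
        gcongr; exact h4
    _ = _ := by ring

lemma locallyIntegrable_coeffFun (m : ℤ) : LocallyIntegrable (coeffFun z m) := by
  have h1 := (memLp_coeffFun hW hW0 hz m).locallyIntegrable (by norm_num)
  have h2 : Continuous fun s : ℝ => ((W s : ℂ))⁻¹ :=
    Continuous.inv₀ (by fun_prop) fun s => by exact_mod_cast (hW0 s).ne'
  have h3 := h1.continuous_smul h2
  refine h3.congr (.of_forall fun s => ?_)
  have : (W s : ℂ) ≠ 0 := by exact_mod_cast (hW0 s).ne'
  simp_all

lemma integral_mul_conj_mode (m : ℤ) {θ : ℝ → ℂ} (hθ : IsBump1 θ) :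
  Integrable (fun a => z a * conj (mode θ m a)) svol ∧
  ∫ a, z a * conj (mode θ m a) ∂svol = ∫ s, coeffFun z m s * conj (θ s) := by
  have hW' : Continuous fun a : ℝ² => ((W a.1 : ℂ))⁻¹ :=
    Continuous.inv₀ (by fun_prop) fun a => by exact_mod_cast (hW0 a.1).ne'
  have hc := cyl_mode hθ m
  have hl : MemLp (fun a => ((W a.1 : ℂ))⁻¹ * conj (mode θ m a)) 2 svol := by
    have hcont : Continuous fun a => ((W a.1 : ℂ))⁻¹ * conj (mode θ m a) :=
      hW'.mul hc.1.conj.continuous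
    rw [memLp_two_iff_integrable_sq_norm hcont.aestronglyMeasurable]
    have h1 := (integrable_strip (hcont.mul hcont) ((hc.2.2.conj.mul_left _).mul_left _)).norm
    refine h1.congr (.of_forall fun a => ?_)
    simp; ring
  have hi : Integrable (fun a => z a * conj (mode θ m a)) svol := by
    refine (hz.integrable_mul hl).congr (.of_forall fun a => ?_)
    have : (W a.1 : ℂ) ≠ 0 := by exact_mod_cast (hW0 a.1).ne'
    simp
    field_simp
  refine ⟨hi, ?_⟩
  rw [stripVol_eq] at hi ⊢
  rw [integral_prod _ hi]
  congr 1; funext s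
  rw [coeffFun, ← integral_mul_const]
  congr 1; funext φ
  simp [mode]; ring

lemma ae_eq_zero_of_coeffFun (h : ∀ m, ∀ᵐ s, coeffFun z m s = 0) : ∀ᵐ a ∂svol, z a = 0 := by
  have hpi := Real.pi_pos
  have h1 := (memLp_two_iff_integrable_sq_norm hz.1).1 hz
  have h2 := ae_memLp_slice hW hW0 hz
  have key : ∀ᵐ s, ∫ φ, ‖(W s : ℂ) * z (s, φ)‖ ^ 2 ∂circleVol = 0 := by
    filter_upwards [h2, ae_all_iff.2 h] with s hs hs0
    set f : ℝ → ℂ := fun φ => z (s, φ) * phase (1 / 4) (s, φ) with hf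
    have hf2 : MemLp f 2 circleVol := by
      refine hs.of_le (hs.1.mul ((smooth_phase _).continuous.comp
        (by fun_prop : Continuous fun φ : ℝ => (s, φ))).aestronglyMeasurable)
        (.of_forall fun φ => ?_)
      simp [hf, norm_phase]
    have hlt : -(2 * π) < 2 * π := by linarith
    have h3 := hasSum_sq_fourierCoeffOn hlt hf2
    have h4 : ∀ n, fourierCoeffOn hlt f n = 0 := fun n => by
      rw [fourierCoeffOn_eq_integral, intervalIntegral.integral_of_le hlt.le]
      convert smul_zero _
      rw [← hs0 n, coeffFun]
      congr 1; funext φ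
      rw [fourier_coe_apply, smul_eq_mul, hf]
      have e : exp (2 * π * I * ((-n : ℤ) : ℂ) * φ
          / ((2 * π - -(2 * π) : ℝ) : ℂ)) * phase (1 / 4) (s, φ)
          = conj (phase (kap n) (s, φ)) := by
        rw [phase, phase, ← exp_add, ← exp_conj]
        rw [map_mul, conj_ofReal, conj_I, kap]
        push_cast
        field_simp
        ring
      rw [← e]; ring
    simp only [h4, norm_zero, ne_eq, OfNat.ofNat_ne_zero, not_false_eq_true, zero_pow] at h3
    have h5 := h3.unique hasSum_zero
    rw [smul_eq_zero, or_iff_right (inv_ne_zero (sub_pos.2 hlt).ne'),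
      intervalIntegral.integral_of_le hlt.le] at h5
    simp [hf, norm_phase] at h5
    simp [mul_pow, integral_const_mul, h5]
  have h6 : ∫ a, ‖(W a.1 : ℂ) * z a‖ ^ 2 ∂svol = 0 := by
    rw [stripVol_eq] at h1 ⊢
    rw [integral_prod _ h1, integral_congr_ae key, integral_zero]
  rw [integral_eq_zero_iff_of_nonneg (fun a => sq_nonneg _) h1] at h6
  filter_upwards [h6] with a ha
  have := (hW0 a.1).ne'
  simpa [this] using ha

lemma weak_ode_coeffFun (h : ∀ (m : ℤ) (η : ℝ → ℂ), IsBump1 η →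
    ∫ a, z a * conj (lap (mode η m) a) ∂svol = 0) (m : ℤ) {η : ℝ → ℂ} (hη : IsBump1 η) :
  ∫ s, coeffFun z m s * ode (kap m) η s = 0 := by
  have h1 := h m _ hη.conj
  rw [lap_mode hη.conj.1] at h1
  rw [(integral_mul_conj_mode hW hW0 hz m (hη.conj.ode _)).2, ode_conj hη.1] at h1
  simpa using h1

end

lemma ode_cexpR (k l : ℝ) (hl : l ^ 2 = k ^ 2) : ode k (cexpR l) = fun _ => 0 := by
  have h := ode_cexpR_mul (χ := fun _ => 1) contDiff_const k l hl
  simpa using h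

lemma ode_compl_mul {χ : ℝ → ℂ} (hχ : Smooth1 χ) (k l : ℝ) (hl : l ^ 2 = k ^ 2) :
  ode k (fun s => (1 - χ s) * cexpR l s) = fun s => -ode k (fun s => χ s * cexpR l s) s := by
  have e : (fun s => (1 - χ s) * cexpR l s) = fun s => cexpR l s - χ s * cexpR l s := by
    funext s; ring
  rw [e, ode_sub (smooth1_cexpR l) (hχ.mul (smooth1_cexpR l)), ode_cexpR k l hl]
  ring

lemma one_lt_kap {m : ℤ} (hm : m ∉ Idx) : 1 < |kap m| := by
  rw [Finset.mem_Icc, not_and_or, not_le, not_le] at hm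
  rcases hm with hm | hm
  · have : (m : ℝ) ≤ -2 := by exact_mod_cast (by omega : m ≤ -2)
    rw [lt_abs]; right; rw [kap]; linarith
  · have : (3 : ℝ) ≤ m := by exact_mod_cast (by omega : 3 ≤ m)
    rw [lt_abs]; left; rw [kap]; linarith

lemma abs_kap_lt {m : ℤ} (hm : m ∈ Idx) : |kap m| < 1 := by
  rw [Finset.mem_Icc] at hm
  have h1 : (-1 : ℝ) ≤ m := by exact_mod_cast hm.1
  have h2 : (m : ℝ) ≤ 2 := by exact_mod_cast hm.2
  rw [abs_lt, kap]; constructor <;> linarith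

lemma ode_abs (k : ℝ) (η : ℝ → ℂ) : ode |k| η = ode k η := by
  funext s
  have : ((|k| : ℝ) : ℂ) ^ 2 = (k : ℂ) ^ 2 := by exact_mod_cast sq_abs k
  rw [ode, ode, this]

lemma reflect_coeffs {y : ℝ → ℂ} {A B : ℂ} {k : ℝ}
  (hy : ∀ᵐ s, y s = A * cexpR k s + B * cexpR (-k) s) :
  ∀ᵐ s, y (-s) = B * cexpR k s + A * cexpR (-k) s := by
  filter_upwards [(Measure.measurePreserving_neg
    (volume : Measure ℝ)).quasiMeasurePreserving.ae hy] with s hs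
  rw [hs]; simp only [cexpR]; ring_nf

lemma exists_coeffFun_eq {W : ℝ → ℝ} (hW : Continuous W) (hW0 : ∀ s, 0 < W s) {z : Fn}
  (hz : MemLp (fun a => (W a.1 : ℂ) * z a) 2 svol)
  (h : ∀ (m : ℤ) (η : ℝ → ℂ), IsBump1 η → ∫ a, z a * conj (lap (mode η m) a) ∂svol = 0)
  {χ : ℝ → ℂ} (hχ : IsStep χ) (m : ℤ) : ∃ A B : ℂ,
  (∀ᵐ s, coeffFun z m s = A * cexpR |kap m| s + B * cexpR (-|kap m|) s) ∧
  ((∀ l : ℝ, l ^ 2 = kap m ^ 2 →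
    ∫ t, coeffFun z m t * ode (kap m) (fun s => χ s * cexpR l s) t = 0) → A = 0 ∧ B = 0) := by
  have hsol := weak_ode (abs_pos.2 (kap_ne_zero m)).ne' (locallyIntegrable_coeffFun hW hW0 hz m)
    (fun η hη => by rw [ode_abs]; exact weak_ode_coeffFun hW hW0 hz h m hη) hχ
  simp only [ode_abs] at hsol
  refine ⟨-(1 / (2 * (|kap m| : ℝ) : ℂ) * ∫ t, coeffFun z m t *
      ode (kap m) (fun s => χ s * cexpR (-|kap m|) s) t), 1 / (2 * (|kap m| : ℝ) : ℂ) * ∫ t,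
      coeffFun z m t * ode (kap m) (fun s => χ s * cexpR |kap m| s) t, ?_, fun h0 => ⟨neg_eq_zero.2 ?_, ?_⟩⟩
  · filter_upwards [hsol] with s hs
    rw [hs, sub_eq_neg_add, neg_mul]
  · rw [h0 _ (by rw [neg_sq, sq_abs]), mul_zero]
  · rw [h0 _ (sq_abs _), mul_zero]

lemma ae_eq_zero_of_modes {z : Fn} (hz : MemLp (fun a => (rexp (-|a.1|) : ℂ) * z a) 2 svol)
  (h : ∀ (m : ℤ) (η : ℝ → ℂ), IsBump1 η → ∫ a, z a * conj (lap (mode η m) a) ∂svol = 0)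
  {χ : ℝ → ℂ} (hχ : IsStep χ) (hχr : ∀ s, conj (χ s) = χ s)
  (hb : ∀ m ∈ Idx, ∀ l : ℝ, l ^ 2 = kap m ^ 2 →
    ∫ a, z a * conj (lap (mode (fun s => (1 - χ s) * cexpR l s) m) a) ∂svol = 0) :
  ∀ᵐ a ∂svol, z a = 0 := by
  have hW : Continuous fun s : ℝ => rexp (-|s|) := by fun_prop
  have hW0 : ∀ s : ℝ, 0 < rexp (-|s|) := fun s => Real.exp_pos _
  refine ae_eq_zero_of_coeffFun hW hW0 hz fun m => ?_
  obtain ⟨A, B, hsol, hAB⟩ := exists_coeffFun_eq hW hW0 hz h hχ m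
  suffices h0 : A = 0 ∧ B = 0 by
    filter_upwards [hsol] with s hs
    rw [hs, h0.1, h0.2]; ring
  by_cases hm : m ∈ Idx
  · refine hAB fun l hl => ?_
    have h1 := hb m hm l hl
    rw [lap_mode ((contDiff_const.sub hχ.smooth).mul (smooth1_cexpR l)),
      ode_compl_mul hχ.smooth _ _ hl] at h1
    have hbump := hχ.isBump1_ode (kap m) l hl
    have hneg : IsBump1 fun s => -ode (kap m) (fun s => χ s * cexpR l s) s :=
      ⟨hbump.1.neg, by obtain ⟨-, c, d, h⟩ := hbump; exact ⟨c, d, fun s hs => by simp [h s hs]⟩⟩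
    rw [(integral_mul_conj_mode hW hW0 hz m hneg).2] at h1
    have e : ∀ s, conj (ode (kap m) (fun s => χ s * cexpR l s) s)
        = ode (kap m) (fun s => χ s * cexpR l s) s := fun s => by
      rw [← congrFun (ode_conj (hχ.smooth.mul (smooth1_cexpR l)) (kap m)) s]
      simp only [map_mul, hχr, cexpR, conj_ofReal]
    simpa only [map_neg, e, mul_neg, integral_neg, neg_eq_zero] using h1
  · have hL := memLp_coeffFun hW hW0 hz m
    have key : ∀ {y : ℝ → ℂ} {A B : ℂ}, (∀ᵐ s, y s = A * cexpR |kap m| s + B * cexpR (-|kap m|) s) →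
        MemLp (fun s => (rexp (-|s|) : ℂ) * y s) 2 volume → A = 0 := fun hy h =>
      coeff_eq_zero_of_memLp (abs_pos.2 (kap_ne_zero m)) (ν := -1) (by linarith [one_lt_kap hm]) hy
        (w := fun s => (rexp (-|s|) : ℂ)) (fun s hs => by
          rw [norm_rexp, abs_of_nonneg hs, neg_one_mul]) h
    exact ⟨key hsol hL, key (reflect_coeffs hsol) (by simpa only [abs_neg] using memLp_neg hL)⟩

lemma exp_coeffs_eq_zero {y : ℝ → ℂ} {A B : ℂ} {k : ℝ} (hk : 0 < k)
  (hy : ∀ᵐ s, y s = A * cexpR k s + B * cexpR (-k) s)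
  (hL : MemLp (fun s => (rexp s : ℂ) * y s) 2 volume) : A = 0 ∧ B = 0 := by
  have hw : ∀ s ≥ (0 : ℝ), ‖(rexp s : ℂ)‖ = rexp (1 * s) := fun s _ => by rw [norm_rexp, one_mul]
  have hA := coeff_eq_zero_of_memLp hk (ν := 1) (by linarith) hy hw hL
  refine ⟨hA, ?_⟩
  rcases le_total 1 k with hk1 | hk1
  · exact coeff_eq_zero_of_memLp hk (ν := -1) (by linarith) (reflect_coeffs hy)
      (w := fun s => (rexp (-s) : ℂ)) (fun s hs => by rw [norm_rexp, neg_one_mul])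
      (memLp_neg hL)
  · by_contra hB
    refine not_memLp_of_tendsto hL (c := ‖B‖) (d := 0) (norm_pos_iff.2 hB) ?_
    filter_upwards [hy] with s hs h0
    rw [hs, hA, zero_mul, zero_add, norm_mul, norm_mul, norm_cexpR, hw s h0, mul_left_comm,
      ← Real.exp_add]
    exact le_mul_of_one_le_right (norm_nonneg _) (Real.one_le_exp (by nlinarith))

lemma ae_eq_zero_of_modes_exp {ν : ℝ} (hν : ν = 1 ∨ ν = -1) {z : Fn}
  (hz : MemLp (fun a => (rexp (ν * a.1) : ℂ) * z a) 2 svol)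
  (h : ∀ (m : ℤ) (η : ℝ → ℂ), IsBump1 η → ∫ a, z a * conj (lap (mode η m) a) ∂svol = 0)
  {χ : ℝ → ℂ} (hχ : IsStep χ) :
  ∀ᵐ a ∂svol, z a = 0 := by
  have hW : Continuous fun s : ℝ => rexp (ν * s) := by fun_prop
  have hW0 : ∀ s : ℝ, 0 < rexp (ν * s) := fun s => Real.exp_pos _
  refine ae_eq_zero_of_coeffFun hW hW0 hz fun m => ?_
  have hk := abs_pos.2 (kap_ne_zero m)
  obtain ⟨A, B, hsol, -⟩ := exists_coeffFun_eq hW hW0 hz h hχ m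
  have hL := memLp_coeffFun hW hW0 hz m
  have hAB : A = 0 ∧ B = 0 := by
    rcases hν with rfl | rfl
    · exact exp_coeffs_eq_zero hk hsol (by simpa only [one_mul] using hL)
    · exact (exp_coeffs_eq_zero hk (reflect_coeffs hsol)
        (by simpa only [neg_mul, one_mul, neg_neg] using memLp_neg hL)).symm
  filter_upwards [hsol] with s hs
  rw [hs, hAB.1, hAB.2]; ring

end Modes

section ConeApproximation

open ENNReal

lemma enorm_integral_mul_le {α : Type*} [MeasurableSpace α] {μ : Measure α} {f g : α → ℂ}
  (hf : AEStronglyMeasurable f μ) (hg : AEStronglyMeasurable g μ) :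
  ‖∫ a, f a * g a ∂μ‖ₑ ≤ eLpNorm f 2 μ * eLpNorm g 2 μ := by
  refine (enorm_integral_le_lintegral_enorm _).trans ?_
  have h := eLpNorm_smul_le_mul_eLpNorm (p := 2) (q := 2) (r := 1) hg hf
  rw [eLpNorm_one_eq_lintegral_enorm] at h
  exact h

lemma tendsto_integral_mul_of_eLpNorm {α ι : Type*} [MeasurableSpace α] {μ : Measure α}
  {l : Filter ι} {f : ι → α → ℂ} {f₀ g : α → ℂ} (hf : ∀ n, MemLp (f n) 2 μ) (hf₀ : MemLp f₀ 2 μ)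
  (hg : MemLp g 2 μ) (h : Tendsto (fun n => eLpNorm (fun a => f n a - f₀ a) 2 μ) l (𝓝 0)) :
  Tendsto (fun n => ∫ a, f n a * g a ∂μ) l (𝓝 (∫ a, f₀ a * g a ∂μ)) := by
  rw [tendsto_iff_edist_tendsto_0]
  have h1 : Tendsto (fun n => eLpNorm g 2 μ * eLpNorm (fun a => f n a - f₀ a) 2 μ) l (𝓝 0) := by
    simpa using ENNReal.Tendsto.const_mul h (.inr hg.2.ne)
  refine tendsto_of_tendsto_of_tendsto_of_le_of_le tendsto_const_nhds h1 (fun _ => zero_le)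
    fun n => ?_
  have e : (∫ a, f n a * g a ∂μ) - ∫ a, f₀ a * g a ∂μ = ∫ a, (f n a - f₀ a) * g a ∂μ := by
    refine (integral_sub ((hf n).integrable_mul hg) (hf₀.integrable_mul hg)).symm.trans ?_
    congr 1; funext a; simp; ring
  simp [edist_eq_enorm_sub]
  rw [e, mul_comm]
  exact enorm_integral_mul_le ((hf n).1.sub hf₀.1) hg.1

/-- The span of the Fourier modes with compact support. -/
def modeSpan : Submodule ℂ Fn := Submodule.span ℂ {ψ | ∃ η m, IsBump1 η ∧ ψ = mode η m}

lemma cyl_zero : Cyl (0 : Fn) := ⟨contDiff_const, fun s φ => by simp, 0, fun a _ => rfl⟩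

lemma cyl_of_mem_modeSpan {ψ : Fn} (h : ψ ∈ modeSpan) : Cyl ψ := by
  refine Submodule.span_induction ?_ cyl_zero (fun f g _ _ hf hg => ibpClass_cyl.add hf hg)
    (fun c f _ hf => ibpClass_cyl.smul c hf) h
  rintro _ ⟨η, m, hη, rfl⟩
  exact cyl_mode hη m

lemma memLp_of_cyl (hf : Cyl f) : MemLp f 2 svol := ibpClass_cyl.memLp hf

lemma exists_lap_approximation {F : Fn} (hF : MemLp F 2 svol) {χ : ℝ → ℂ}
  (hχ : IsStep χ) : ∃ ψ : ℕ → Fn, (∀ n, ψ n ∈ modeSpan) ∧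
    Tendsto (fun n => eLpNorm (fun a => wt a * lap (ψ n) a - F a) 2 svol) atTop (𝓝 0) := by
  have hs : ∀ {ψ}, ψ ∈ modeSpan → Smooth ψ := fun h => (cyl_of_mem_modeSpan h).1
  let K : Submodule ℂ (Lp ℂ 2 svol) :=
    { carrier := {g | ∃ ψ ∈ modeSpan, g =ᵐ[svol] fun a => wt a * lap ψ a}
      zero_mem' := ⟨0, zero_mem _, by
        filter_upwards [Lp.coeFn_zero ℂ 2 svol] with a ha
        have : lap (0 : Fn) a = 0 := by
          have := congrFun (lap_const_mul (f := 0) contDiff_const 0) a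
          rw [show (0 : Fn) = fun _ => 0 from rfl]
          simpa using this
        rw [ha, this]; simp⟩
      add_mem' := by
        rintro f g ⟨ψ, hψ, hf⟩ ⟨θ, hθ, hg⟩
        refine ⟨ψ + θ, add_mem hψ hθ, ?_⟩
        filter_upwards [Lp.coeFn_add f g, hf, hg] with a h1 h2 h3
        have h4 := congrFun (lap_add (hs hψ) (hs hθ)) a
        rw [h1, Pi.add_apply, h2, h3, ← mul_add]
        exact congrArg _ h4.symm
      smul_mem' := by
        rintro c f ⟨ψ, hψ, hf⟩
        refine ⟨c • ψ, Submodule.smul_mem _ c hψ, ?_⟩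
        filter_upwards [Lp.coeFn_smul c f, hf] with a h1 h2
        have h4 := congrFun (lap_const_mul (hs hψ) c) a
        rw [h1, Pi.smul_apply, h2, smul_eq_mul, mul_left_comm]
        exact congrArg _ h4.symm }
  have hK : Kᗮ = ⊥ := by
    rw [Submodule.eq_bot_iff]
    intro g hg
    have hexp : ∀ a : ℝ², (rexp a.1 : ℂ) * (wt a * g a) = g a := fun a => by
      rw [← mul_assoc, wt, ← Complex.ofReal_mul, ← Real.exp_add]; simp
    have hz := ae_eq_zero_of_modes_exp (ν := 1) (.inl rfl) (z := fun a => wt a * g a)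
      (by simp only [one_mul, hexp]; exact Lp.memLp g) (fun m η hη => ?_) hχ
    · rw [Lp.eq_zero_iff_ae_eq_zero]
      filter_upwards [hz] with a ha
      rw [← hexp a, ha]; simp
    · have hc := (cyl_mode hη m)
      have hL := memLp_of_cyl hc.lap.wt_mul
      have h1 := hg (hL.toLp _) ⟨mode η m, Submodule.subset_span ⟨η, m, hη, rfl⟩, hL.coeFn_toLp⟩
      rw [← h1]
      refine integral_congr_ae ?_
      filter_upwards [hL.coeFn_toLp] with a ha
      rw [ha]
      simp only [RCLike.inner_apply, map_mul, wt, Complex.conj_ofReal]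
      ring
  have hd := Submodule.topologicalClosure_eq_top_iff.2 hK
  have hmem : hF.toLp F ∈ closure (K : Set (Lp ℂ 2 svol)) := by
    rw [← Submodule.topologicalClosure_coe, hd]; trivial
  obtain ⟨g, hgK, hg⟩ := mem_closure_iff_seq_limit.1 hmem
  choose ψ hψ hψg using hgK
  refine ⟨ψ, hψ, ?_⟩
  rw [Lp.tendsto_Lp_iff_tendsto_eLpNorm'] at hg
  refine hg.congr fun n => eLpNorm_congr_ae ?_
  filter_upwards [hψg n, hF.coeFn_toLp] with a h1 h2
  simp [h1, h2]

/-- The radial profiles that are admissible as test functions on the cone. -/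
structure Admissible (m : ℤ) (θ : ℝ → ℂ) : Prop where
  smooth : Smooth1 θ
  memLp : MemLp (fun s => (rexp s : ℂ) * θ s) 2 volume
  bump : IsBump1 (ode (kap m) θ)

lemma IsBump1.admissible {θ : ℝ → ℂ} (h : IsBump1 θ) (m : ℤ) : Admissible m θ where
  smooth := h.1
  memLp := by
    have hc : Continuous fun s => (rexp s : ℂ) * θ s := by have := h.1.continuous; fun_prop
    exact hc.memLp_of_hasCompactSupport h.hasCompactSupport.mul_left
  bump := h.ode _

lemma IsStep.admissible {χ : ℝ → ℂ} (hχ : IsStep χ) (m : ℤ) {l : ℝ} (hl : l ^ 2 = kap m ^ 2)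
  (hm : m ∈ Idx) : Admissible m fun s => (1 - χ s) * cexpR l s where
  smooth := (contDiff_const.sub hχ.smooth).mul (smooth1_cexpR l)
  memLp := by
    obtain ⟨c, hc⟩ := hχ.left
    obtain ⟨d, hd⟩ := hχ.right
    have hl2 : -1 < l := by
      have := abs_kap_lt hm
      rw [← sq_lt_one_iff_abs_lt_one, ← hl, sq_lt_one_iff_abs_lt_one] at this
      exact (abs_lt.1 this).1
    have hcont : Continuous fun s : ℝ => (rexp s : ℂ) * ((1 - χ s) * cexpR l s) := by
      have := hχ.smooth.continuous; have := (smooth1_cexpR l).continuous; fun_prop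
    obtain ⟨M, hM⟩ := (isCompact_Icc (a := c) (b := d)).exists_bound_of_continuousOn
      (f := fun s => 1 - χ s) (continuous_const.sub hχ.smooth.continuous).continuousOn
    rw [memLp_two_iff_integrable_sq_norm hcont.aestronglyMeasurable]
    refine (IntegrableOn.integrable_indicator ((integrableOn_exp_mul_Iic (a := 2 * (1 + l))
      (by linarith) d).const_mul (max M 1 ^ 2)) measurableSet_Iic).mono' (hcont.norm.pow 2).aestronglyMeasurable (.of_forall fun s => ?_)
    rw [Real.norm_of_nonneg (sq_nonneg _)]
    by_cases hs : s ≤ d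
    · rw [Set.indicator_of_mem (Set.mem_Iic.2 hs), norm_mul, norm_mul, norm_cexpR, norm_rexp,
        mul_left_comm, ← Real.exp_add, mul_pow, ← Real.exp_nat_mul,
        show ((2 : ℕ) : ℝ) * (s + l * s) = 2 * (1 + l) * s by push_cast; ring]
      gcongr
      by_cases h1 : s < c
      · simp [hc s h1.le]
      · exact (hM s ⟨not_lt.1 h1, hs⟩).trans (le_max_left _ _)
    · rw [Set.indicator_of_notMem (mt Set.mem_Iic.1 hs), hd s (not_le.1 hs).le]; simp
  bump := by
    rw [ode_compl_mul hχ.smooth _ _ hl]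
    obtain ⟨h1, c, d, h2⟩ := hχ.isBump1_ode (kap m) l hl
    exact ⟨h1.neg, c, d, fun s hs => by simp [h2 s hs]⟩

lemma Admissible.memLp_mode {m : ℤ} {θ : ℝ → ℂ} (h : Admissible m θ) :
  MemLp (fun a => (rexp a.1 : ℂ) * conj (mode θ m a)) 2 svol := by
  have hc : Continuous fun a : ℝ² => (rexp a.1 : ℂ) * conj (mode θ m a) := by
    have := (smooth_mode h.smooth m).conj.continuous; fun_prop
  rw [memLp_two_iff_integrable_sq_norm hc.aestronglyMeasurable]
  have h1 := (memLp_two_iff_integrable_sq_norm h.memLp.1).1 h.memLp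
  have h2 := h1.mul_prod (integrable_const (μ := circleVol) (1 : ℝ))
  rw [stripVol_eq]
  refine h2.congr (.of_forall fun a => ?_)
  simp [norm_mode]

lemma Admissible.memLp_lap {m : ℤ} {θ : ℝ → ℂ} (h : Admissible m θ) {W : ℝ → ℝ}
  (hW : Continuous W) : MemLp (fun a => (W a.1 : ℂ) * conj (lap (mode θ m) a)) 2 svol := by
  rw [lap_mode h.smooth]
  have hc := cyl_mode h.bump m
  have hcont : Continuous fun a : ℝ² => (W a.1 : ℂ) * conj (mode (ode (kap m) θ) m a) := by
    have := hc.1.conj.continuous; fun_prop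
  rw [memLp_two_iff_integrable_sq_norm hcont.aestronglyMeasurable]
  refine (integrable_strip (hcont.mul hcont)
    ((hc.2.2.conj.mul_left _).mul_left _)).norm.congr (.of_forall fun a => ?_)
  simp; ring

lemma nsq_le_of_wnsq (hf : Cyl f) (hg : Cyl g) {c : ℝ} (hc : 0 ≤ c)
  (h : wnsq f ≤ c * wnsq g) : eLpNorm (fun a => wt a * f a) 2 svol ^ 2
    ≤ ENNReal.ofReal c * eLpNorm (fun a => wt a * g a) 2 svol ^ 2 := by
  rw [eLpNorm_sq_eq_nsq (memLp_of_cyl hf.wt_mul), eLpNorm_sq_eq_nsq (memLp_of_cyl hg.wt_mul),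
    ← ENNReal.ofReal_mul hc]
  exact ENNReal.ofReal_le_ofReal h

lemma Cyl.sub (hf : Cyl f) (hg : Cyl g) : Cyl fun a => f a - g a := by
  simpa only [neg_one_mul, sub_eq_add_neg] using ibpClass_cyl.add hf (ibpClass_cyl.smul (-1) hg)

lemma Cyl.dSP (hf : Cyl f) (p q : ℕ) : Cyl (dSP p q f) :=
  iterate_mem (Q := Cyl) (fun _ => ibpClass_cyl.dP)
    (iterate_mem (Q := Cyl) (fun _ => ibpClass_cyl.dS) hf p) q

lemma tendsto_dSP_of_lap {ψ : ℕ → Fn} (hψ : ∀ n, Cyl (ψ n))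
  (h : Tendsto (fun k : ℕ × ℕ => eLpNorm (fun a => wt a * lap (ψ k.1) a - wt a * lap (ψ k.2) a) 2
    svol) atTop (𝓝 0)) {p q : ℕ} (hpq : p + q ≤ 2) :
  Tendsto (fun k : ℕ × ℕ => eLpNorm (fun a => wt a * dSP p q (ψ k.1) a
    - wt a * dSP p q (ψ k.2) a) 2 svol) atTop (𝓝 0) := by
  obtain ⟨C, hC, hest⟩ := exists_wnsq_dSP_le
  rw [← tendsto_sq_iff] at h ⊢
  refine tendsto_of_le_const_mul (c := ENNReal.ofReal C) ofReal_ne_top h fun k => ?_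
  have hd := (hψ k.1).sub (hψ k.2)
  have h1 := nsq_le_of_wnsq (hd.dSP p q) hd.lap hC (hest _ hd p q hpq)
  rw [dSP_sub (hψ _).1 (hψ _).1, lap_sub (hψ _).1 (hψ _).1] at h1
  simpa only [mul_sub] using h1

/-- Functions approximable by finite sums of modes in the graph norm of the cone Laplacian. -/
def ModeApprox (v : Fn) : Prop := ∃ ψ : ℕ → Fn, (∀ n, ψ n ∈ modeSpan) ∧
  Tendsto (fun n => eLpNorm (fun a => wt a * ψ n a - wt a * v a) 2 svol) atTop (𝓝 0) ∧
  Tendsto (fun k : ℕ × ℕ => eLpNorm (fun a => wt a * lap (ψ k.1) a - wt a * lap (ψ k.2) a) 2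
    svol) atTop (𝓝 0)

lemma exists_cone_approximation {v F : Fn} (hv : MemLp (fun a => (rexp (-|a.1|) : ℂ) * v a) 2 svol)
  (hF : MemLp (fun a => wt a * F a) 2 svol)
  {χ : ℝ → ℂ} (hχ : IsStep χ) (hχr : ∀ s, conj (χ s) = χ s)
  (h : ∀ (m : ℤ) (η : ℝ → ℂ), IsBump1 η →
    ∫ a, v a * conj (lap (mode η m) a) ∂svol = ∫ a, F a * conj (mode η m a) ∂svol)
  (hb : MemLp (fun a => wt a * v a) 2 svol ∨ ∀ m ∈ Idx, ∀ l : ℝ, l ^ 2 = kap m ^ 2 →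
    ∫ a, v a * conj (lap (mode (fun s => (1 - χ s) * cexpR l s) m) a) ∂svol
      = ∫ a, F a * conj (mode (fun s => (1 - χ s) * cexpR l s) m a) ∂svol) :
  ModeApprox v := by
  obtain ⟨ψ, hψ, hψF⟩ := exists_lap_approximation hF hχ
  have hc : ∀ n, Cyl (ψ n) := fun n => cyl_of_mem_modeSpan (hψ n)
  have hlL : ∀ n, MemLp (fun a => wt a * lap (ψ n) a) 2 svol := fun n =>
    memLp_of_cyl (hc n).lap.wt_mul
  have hL : ∀ n, MemLp (fun a => wt a * ψ n a) 2 svol := fun n => memLp_of_cyl (hc n).wt_mul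
  have h1 := tendsto_cauchy_of_tendsto (fun n => (hlL n).1) hF.1 hψF
  have hcau := tendsto_dSP_of_lap hc h1 (p := 0) (q := 0) (by norm_num)
  obtain ⟨w, hw, hwl⟩ := exists_eLpNorm_limit (f := fun n a => wt a * ψ n a) hL hcau
  refine ⟨ψ, hψ, ?_, h1⟩
  have cancel : ∀ (a : ℝ²) (x y : ℂ), wt a * x * ((rexp a.1 : ℂ) * y) = x * y := fun a x y => by
    linear_combination x * y * wt_mul_rexp a
  have hwE : MemLp (fun a => (rexp (-|a.1|) : ℂ) * ((rexp a.1 : ℂ) * w a)) 2 svol := by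
    have hcont : Continuous fun a : ℝ² => (rexp (-|a.1|) : ℂ) * (rexp a.1 : ℂ) := by fun_prop
    simp only [← mul_assoc]
    refine hw.of_le (hcont.aestronglyMeasurable.mul hw.1) (.of_forall fun a => ?_)
    rw [← Complex.ofReal_mul, ← Real.exp_add, norm_mul, norm_rexp]
    refine mul_le_of_le_one_left (norm_nonneg _) (Real.exp_le_one_iff.2 ?_)
    linarith [le_abs_self a.1]
  have key : ∀ (m : ℤ) (θ : ℝ → ℂ), Admissible m θ →
      ∫ a, v a * conj (lap (mode θ m) a) ∂svol = ∫ a, F a * conj (mode θ m a) ∂svol →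
      ∫ a, (v a - (rexp a.1 : ℂ) * w a) * conj (lap (mode θ m) a) ∂svol = 0 := by
    intro m θ hθ heq
    have t1 := tendsto_integral_mul_of_eLpNorm hL hw
      (hθ.memLp_lap (W := rexp) Real.continuous_exp) hwl
    have t2 := tendsto_integral_mul_of_eLpNorm hlL hF hθ.memLp_mode hψF
    simp only [cancel] at t1 t2
    have e0 : ∀ n, ∫ a, ψ n a * conj (lap (mode θ m) a) ∂svol
        = ∫ a, lap (ψ n) a * conj (mode θ m a) ∂svol := fun n => by
      have g := congrArg conj (integral_strip_lap (smooth_mode hθ.smooth m) (antiPer_mode θ m)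
        (hc n))
      rw [← integral_conj, ← integral_conj] at g
      simpa only [map_mul, conj_conj, mul_comm] using g
    simp only [e0] at t1
    have i1 : Integrable (fun a => v a * conj (lap (mode θ m) a)) svol := by
      refine (hv.integrable_mul (hθ.memLp_lap (W := fun s => rexp |s|) (by fun_prop))).congr
        (.of_forall fun a => ?_)
      have : (rexp (-|a.1|) : ℂ) * (rexp |a.1| : ℂ) = 1 := by
        rw [← Complex.ofReal_mul, ← Real.exp_add]; simp
      simp only [Pi.mul_apply]
      linear_combination v a * conj (lap (mode θ m) a) * this
    have i2 : Integrable (fun a => w a * ((rexp a.1 : ℂ) * conj (lap (mode θ m) a))) svol :=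
      hw.integrable_mul (hθ.memLp_lap (W := rexp) Real.continuous_exp)
    simp only [sub_mul, mul_comm (rexp _ : ℂ) (w _), mul_assoc]
    rw [integral_sub i1 i2, heq, tendsto_nhds_unique t1 t2, sub_self]
  have hz : ∀ᵐ a ∂svol, v a - (rexp a.1 : ℂ) * w a = 0 := by
    have h0 := fun m η hη => key m η (IsBump1.admissible hη m) (h m η hη)
    rcases hb with hb | hb
    · refine ae_eq_zero_of_modes_exp (ν := -1) (.inr rfl) ?_ h0 hχ
      have e : ∀ a : ℝ², (rexp (-1 * a.1) : ℂ) * (v a - (rexp a.1 : ℂ) * w a)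
          = wt a * v a - w a := fun a => by
        rw [neg_one_mul]; change wt a * _ = _
        linear_combination -(w a) * wt_mul_rexp a
      simp only [e]
      exact hb.sub hw
    · exact ae_eq_zero_of_modes (by simp only [mul_sub]; exact hv.sub hwE) h0
        hχ hχr fun m hm l hl => key m _ (hχ.admissible m hl hm) (hb m hm l hl)
  refine hwl.congr fun n => eLpNorm_congr_ae ?_
  filter_upwards [hz] with a ha
  simp only [show wt a * v a = w a by rw [sub_eq_zero.1 ha, ← mul_assoc, wt_mul_rexp, one_mul]]

end ConeApproximation

section ConeCoordinate

open ENNReal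

/-- Smooth functions of a complex variable, in the real sense. -/
abbrev SmoothC (f : ℂ → ℂ) : Prop := ContDiff ℝ ∞ f

lemma det_smul_one (c : ℂ) : ContinuousLinearMap.det (c • (1 : ℂ →L[ℝ] ℂ)) = ‖c‖ ^ 2 := by
  have h : ((c • (1 : ℂ →L[ℝ] ℂ) : ℂ →L[ℝ] ℂ) : ℂ →ₗ[ℝ] ℂ) = LinearMap.mulLeft ℝ c := by ext; simp
  rw [ContinuousLinearMap.det, h, ← normSq_eq_norm_sq]
  rw [← LinearMap.det_toMatrix basisOneI, Matrix.det_fin_two]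
  simp [LinearMap.toMatrix_apply, normSq_apply]

lemma map_holomorphic {τ τ' : ℂ → ℂ} {s : Set ℂ} (hs : MeasurableSet s)
  (h : ∀ z ∈ s, HasDerivAt τ (τ' z) z) (hi : Set.InjOn τ s) :
  Measure.map τ (((volume : Measure ℂ).restrict s).withDensity fun z => ‖τ' z‖ₑ ^ 2)
    = volume.restrict (τ '' s) := by
  have h1 := map_withDensity_abs_det_fderiv_eq_addHaar (μ := (volume : Measure ℂ))
    hs.nullMeasurableSet (fun z hz => (h z hz).complexToReal_fderiv.hasFDerivWithinAt) hi
  rw [← h1]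
  congr 2
  funext z
  rw [det_smul_one, abs_of_nonneg (sq_nonneg _), ENNReal.ofReal_pow (norm_nonneg _), ofReal_norm]

/-- The identification of the plane with the complex line. -/
def toC (a : ℝ²) : ℂ := a.1 + a.2 * Complex.I

lemma toC_eq (a : ℝ²) : toC a = measurableEquivRealProd.symm a := by
  rw [measurableEquivRealProd_symm_apply, toC, mk_eq_add_mul_I]

lemma measurePreserving_toC : MeasurePreserving toC volume volume := by
  rw [show toC = measurableEquivRealProd.symm from funext toC_eq]
  exact volume_preserving_equiv_real_prod.symm

lemma measurableEmbedding_toC : MeasurableEmbedding toC := by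
  rw [show toC = measurableEquivRealProd.symm from funext toC_eq]
  exact MeasurableEquiv.measurableEmbedding _

lemma toC_re_im (z : ℂ) : toC (z.re, z.im) = z := by simp [toC]

lemma toC_re (a : ℝ²) : (toC a).re = a.1 := by simp [toC]

lemma toC_im (a : ℝ²) : (toC a).im = a.2 := by simp [toC]

/-- The identification as a linear map. -/
def toCL : ℝ × ℝ →L[ℝ] ℂ := (ContinuousLinearMap.fst ℝ ℝ ℝ).smulRight (1 : ℂ) +
    (ContinuousLinearMap.snd ℝ ℝ ℝ).smulRight Complex.I

lemma toCL_apply (a : ℝ²) : toCL a = toC a := by simp [toCL, toC]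

lemma contDiff_toC : ContDiff ℝ ∞ toC := by
  rw [show toC = toCL from funext fun a => (toCL_apply a).symm]
  exact toCL.contDiff

lemma continuous_toC : Continuous toC := contDiff_toC.continuous

lemma hasFDerivAt_toC (a : ℝ²) : HasFDerivAt toC toCL a := by
  rw [show toC = toCL from funext fun a => (toCL_apply a).symm]
  exact toCL.hasFDerivAt

lemma smooth_comp_toC {f : ℂ → ℂ} (hf : SmoothC f) : Smooth fun a => f (toC a) :=
  hf.comp contDiff_toC

lemma fderiv_comp_toC {f : ℂ → ℂ} {a : ℝ²} (hf : DifferentiableAt ℝ f (toC a)) :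
  dS (fun a => f (toC a)) a = fderiv ℝ f (toC a) 1 ∧
  dP (fun a => f (toC a)) a = fderiv ℝ f (toC a) I := by
  have h := (hf.hasFDerivAt.comp a (hasFDerivAt_toC a)).fderiv
  have e : (fun a => f (toC a)) = f ∘ toC := rfl
  rw [dS, dP, e, h]
  simp [toCL]

/-- The coordinate `√2 e^{ζ/2}`, as a function of `ζ = s + iφ`. -/
def econe (a : ℝ²) : ℂ := ((√2 : ℝ) : ℂ) * Complex.exp (toC a / 2)

/-- The passage from the distinguished coordinate to the cone coordinates. -/
def coneMap (r : ℂ → ℂ) (a : ℝ²) : ℂ :=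
  ((2 : ℝ) ^ (-(1 / 4) : ℝ) : ℝ) * Complex.exp (-(toC a / 4)) * r (econe a)

lemma norm_exp_toC_mul (a : ℝ²) (c : ℝ) : ‖exp (c * toC a)‖ = rexp (c * a.1) := by
  rw [norm_exp]; simp [toC]

lemma norm_econe (a : ℝ²) : ‖econe a‖ = √2 * rexp (a.1 / 2) := by
  have h := norm_exp_toC_mul a (1 / 2)
  have e : ((1 / 2 : ℝ) : ℂ) * toC a = toC a / 2 := by push_cast; ring
  rw [e] at h
  rw [econe, norm_mul, h, norm_real, Real.norm_of_nonneg (Real.sqrt_nonneg 2)]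
  ring_nf

lemma econe_ne_zero (a : ℝ²) : econe a ≠ 0 := by
  rw [← norm_ne_zero_iff, norm_econe]
  positivity

lemma econe_add (s φ : ℝ) : econe (s, φ + 4 * π) = econe (s, φ) := by
  have h : toC (s, φ + 4 * π) / 2 = toC (s, φ) / 2 + 2 * π * I := by simp [toC]; push_cast; ring
  rw [econe, h, exp_add, exp_two_pi_mul_I, mul_one, econe]

lemma antiPer_coneMap (r : ℂ → ℂ) : AntiPer (coneMap r) := fun s φ => by
  have h : -(toC (s, φ + 4 * π) / 4) = -(toC (s, φ) / 4) - π * I := by simp [toC]; push_cast; ring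
  rw [coneMap, econe_add, h, exp_sub, exp_pi_mul_I, coneMap]
  ring

lemma smooth_econe : Smooth econe := contDiff_const.mul (contDiff_toC.div_const 2).cexp

lemma smooth_coneMap {r : ℂ → ℂ} (hr : ContDiffOn ℝ ∞ r {0}ᶜ) : Smooth (coneMap r) := by
  have h1 : Smooth fun a => r (econe a) := by
    refine contDiffOn_univ.1 ?_
    exact hr.comp smooth_econe.contDiffOn fun a _ => econe_ne_zero a
  exact (contDiff_const.mul (contDiff_toC.div_const 4).neg.cexp).mul h1

lemma sBounded_coneMap {r : ℂ → ℂ} {ε R : ℝ} (hε : 0 < ε)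
  (hr : ∀ x, ‖x‖ ≤ ε ∨ R ≤ ‖x‖ → r x = 0) : SBounded (coneMap r) := by
  have h2 : (0 : ℝ) < √2 := by positivity
  refine ⟨max (-(2 * Real.log (ε / √2))) (2 * Real.log (max R 1 / √2)), fun a ha => ?_⟩
  rw [coneMap, hr, mul_zero]
  rw [norm_econe]
  rcases le_abs.1 ha with h | h
  · right
    have h1 := (le_max_right _ _).trans h
    have h3 : max R 1 / √2 ≤ rexp (a.1 / 2) :=
      (Real.log_le_iff_le_exp (by positivity)).1 (by linarith)
    rw [div_le_iff₀ h2] at h3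
    linarith [le_max_left R 1]
  · left
    have h1 := (le_max_left _ _).trans h
    have h3 : rexp (a.1 / 2) ≤ ε / √2 := (Real.le_log_iff_exp_le (by positivity)).1 (by linarith)
    rw [le_div_iff₀ h2] at h3
    linarith

lemma econe_image_strip : econe '' strip = {0}ᶜ := by
  have h2 : ((√2 : ℝ) : ℂ) ≠ 0 := by rw [ofReal_ne_zero]; positivity
  ext x
  constructor
  · rintro ⟨a, -, rfl⟩; exact econe_ne_zero a
  · intro hx
    have hx' := div_ne_zero hx h2
    refine ⟨(2 * (log (x / ((√2 : ℝ) : ℂ))).re, 2 * (log (x / ((√2 : ℝ) : ℂ))).im),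
      ⟨trivial, ?_, ?_⟩, ?_⟩
    · have := neg_pi_lt_log_im (x / ((√2 : ℝ) : ℂ)); linarith
    · have := log_im_le_pi (x / ((√2 : ℝ) : ℂ)); linarith
    · have : toC (2 * (log (x / ((√2 : ℝ) : ℂ))).re,
          2 * (log (x / ((√2 : ℝ) : ℂ))).im) / 2 = log (x / ((√2 : ℝ) : ℂ)) := by
        apply ext <;> simp [toC]
      rw [econe, this, exp_log hx', mul_div_cancel₀ _ h2]

lemma econe_injOn_strip : Set.InjOn econe strip := by
  intro a ha b hb h
  have h2 : ((√2 : ℝ) : ℂ) ≠ 0 := by rw [ofReal_ne_zero]; positivity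
  have h1 := mul_left_cancel₀ h2 h
  have him : ∀ c : ℝ², (toC c / 2).im = c.2 / 2 := fun c => by simp [toC]
  have h3 := exp_inj_of_neg_pi_lt_of_le_pi (x := toC a / 2) (y := toC b / 2)
    (by rw [him]; linarith [ha.2.1]) (by rw [him]; linarith [ha.2.2])
    (by rw [him]; linarith [hb.2.1]) (by rw [him]; linarith [hb.2.2]) h1
  have h4 : toC a = toC b := by linear_combination 2 * h3
  have := congrArg re h4
  have := congrArg im h4
  simp [toC_re, toC_im] at *
  exact Prod.ext ‹_› ‹_›

lemma map_econe : Measure.map econe (svol.withDensity fun a => ENNReal.ofReal (rexp a.1 / 2))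
  = (volume : Measure ℂ) := by
  set τ : ℂ → ℂ := fun ζ => ((√2 : ℝ) : ℂ) * exp (ζ / 2) with hτ
  have h2 : √2 * √2 = (2 : ℝ) := Real.mul_self_sqrt (by norm_num)
  have hmp := measurePreserving_toC
  have hs := measurableEmbedding_toC.measurableSet_image.2 measurableSet_strip
  have hd : ∀ z ∈ toC '' strip, HasDerivAt τ (((√2 : ℝ) : ℂ) * (exp (z / 2) * (1 / 2))) z :=
    fun z _ => (((hasDerivAt_id z).div_const 2).cexp).const_mul _
  have hi : Set.InjOn τ (toC '' strip) := by
    rintro _ ⟨a, ha, rfl⟩ _ ⟨b, hb, rfl⟩ h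
    exact congrArg toC (econe_injOn_strip ha hb h)
  have h1 := map_holomorphic hs hd hi
  have him : τ '' (toC '' strip) = {0}ᶜ := by rw [← Set.image_comp]; exact econe_image_strip
  have h0 : (volume : Measure ℂ).restrict ({0}ᶜ) = volume :=
    Measure.restrict_eq_self_of_ae_mem (s := {0}ᶜ) (compl_mem_ae_iff.2 (measure_singleton 0))
  rw [him, h0] at h1
  rw [← h1]
  have hτm : Measurable τ := by fun_prop
  rw [show econe = τ ∘ toC from rfl, ← Measure.map_map hτm measurableEmbedding_toC.measurable]
  congr 1
  ext t ht
  rw [measurableEmbedding_toC.map_apply, withDensity_apply _ ht,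
    withDensity_apply _ (measurableEmbedding_toC.measurable ht), svol,
    Measure.restrict_restrict ht, Measure.restrict_restrict (measurableEmbedding_toC.measurable ht)]
  have hpre : toC ⁻¹' t ∩ strip = toC ⁻¹' (t ∩ toC '' strip) := by
    rw [Set.preimage_inter, Set.preimage_image_eq _ measurableEmbedding_toC.injective]
  rw [hpre, ← hmp.setLIntegral_comp_preimage_emb measurableEmbedding_toC]
  refine lintegral_congr fun a => ?_
  have e1 : ‖((√2 : ℝ) : ℂ) * (exp (toC a / 2) * (1 / 2))‖ = √2 * rexp (a.1 / 2) / 2 := by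
    rw [← mul_assoc, norm_mul]
    have := norm_econe a
    rw [econe] at this
    rw [this]; norm_num; ring
  rw [← ofReal_norm, e1, ← ENNReal.ofReal_pow (by positivity)]
  congr 1
  have e2 : rexp a.1 = rexp (a.1 / 2) * rexp (a.1 / 2) := by rw [← Real.exp_add]; ring_nf
  grind

lemma measurable_econe : Measurable econe := smooth_econe.continuous.measurable

lemma quasiMeasurePreserving_econe : Measure.QuasiMeasurePreserving econe svol volume := by
  refine ⟨measurable_econe, ?_⟩
  rw [← map_econe]
  refine Measure.AbsolutelyContinuous.map ?_ measurable_econe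
  refine withDensity_absolutelyContinuous' (by fun_prop) (.of_forall fun a => ?_)
  positivity

lemma lintegral_econe {f : ℂ → ℝ≥0∞} (hf : AEMeasurable f) :
  ∫⁻ x, f x = ∫⁻ a, f (econe a) * ENNReal.ofReal (rexp a.1 / 2) ∂svol := by
  have hf' : AEMeasurable f (Measure.map econe
    (svol.withDensity fun a => ENNReal.ofReal (rexp a.1 / 2))) := by rwa [map_econe]
  conv_lhs => rw [← map_econe]
  rw [lintegral_map' hf' measurable_econe.aemeasurable]
  refine (lintegral_withDensity_eq_lintegral_mul₀' (g := f ∘ econe) (by fun_prop)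
      (hf'.comp_measurable measurable_econe)).trans ?_
  simp [mul_comm]

lemma integral_econe {f : ℂ → ℂ} (hf : AEStronglyMeasurable f) :
  ∫ x, f x = ∫ a, ((rexp a.1 / 2 : ℝ) : ℂ) * f (econe a) ∂svol := by
  have hf' : AEStronglyMeasurable f (Measure.map econe
    (svol.withDensity fun a => ENNReal.ofReal (rexp a.1 / 2))) := by rwa [map_econe]
  conv_lhs => rw [← map_econe]
  rw [integral_map measurable_econe.aemeasurable hf',
    integral_withDensity_eq_integral_toReal_smul (by fun_prop)
      (.of_forall fun a => ENNReal.ofReal_lt_top)]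
  refine integral_congr_ae (.of_forall fun a => ?_)
  have : 0 ≤ rexp a.1 / 2 := by positivity
  simp_all

lemma aestronglyMeasurable_coneMap {r : ℂ → ℂ} (hr : AEStronglyMeasurable r) :
  AEStronglyMeasurable (coneMap r) svol := by
  have h1 := hr.comp_quasiMeasurePreserving quasiMeasurePreserving_econe
  have h2 : Continuous fun a => ((2 : ℝ) ^ (-(1 / 4) : ℝ) : ℝ) * exp (-(toC a / 4)) := by
    have := continuous_toC; fun_prop
  exact h2.aestronglyMeasurable.mul h1

lemma two_rpow_quarter_mul (a : ℝ²) :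
  (((2 : ℝ) ^ (-(1 / 4) : ℝ)) * rexp (-(1 / 4) * a.1)) ^ 2 * rexp a.1 ^ 2
    = rexp a.1 / 2 * (√2 * rexp (a.1 / 2)) := by
  have h1 : ((2 : ℝ) ^ (-(1 / 4) : ℝ)) ^ 2 = (√2)⁻¹ := by
    rw [← Real.rpow_natCast, ← Real.rpow_mul (by norm_num), Real.sqrt_eq_rpow,
      ← Real.rpow_neg (by norm_num)]
    norm_num
  have h2 : (√2)⁻¹ = √2 / 2 := by grind
  have h3 : rexp (-(1 / 4) * a.1) ^ 2 * rexp a.1 ^ 2 = rexp a.1 * rexp (a.1 / 2) := by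
    rw [← Real.exp_nat_mul, ← Real.exp_nat_mul, ← Real.exp_add, ← Real.exp_add]
    ring
  grind

lemma norm_coneMap (r : ℂ → ℂ) (a : ℝ²) :
  ‖coneMap r a‖ = (2 : ℝ) ^ (-(1 / 4) : ℝ) * rexp (-(1 / 4) * a.1) * ‖r (econe a)‖ := by
  have h := norm_exp_toC_mul a (-(1 / 4))
  have e : ((-(1 / 4) : ℝ) : ℂ) * toC a = -(toC a / 4) := by push_cast; ring
  rw [e] at h
  rw [coneMap, norm_mul, norm_mul, h, norm_real,
    Real.norm_of_nonneg (Real.rpow_nonneg (by norm_num) _)]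

lemma lintegral_coneMap {r : ℂ → ℂ} (hr : AEStronglyMeasurable r) :
  ∫⁻ x, ‖r x‖ₑ ^ 2 * ‖x‖ₑ = ∫⁻ a, ‖(rexp a.1 : ℂ) * coneMap r a‖ₑ ^ 2 ∂svol := by
  rw [lintegral_econe (by fun_prop)]
  refine lintegral_congr fun a => ?_
  have h := two_rpow_quarter_mul a
  rw [← ofReal_norm, ← ofReal_norm, ← ofReal_norm, norm_mul, norm_coneMap, norm_econe, norm_rexp,
    ← ENNReal.ofReal_pow (norm_nonneg _), ← ENNReal.ofReal_mul (by positivity),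
    ← ENNReal.ofReal_mul (by positivity), ← ENNReal.ofReal_pow (by positivity)]
  grind

lemma coneMap_mul_conj (r r' : ℂ → ℂ) (a : ℝ²) :
  (rexp a.1 : ℂ) ^ 2 * (coneMap r a * conj (coneMap r' a))
    = ((rexp a.1 / 2 : ℝ) : ℂ) * (r (econe a) * conj (r' (econe a)) * (‖econe a‖ : ℂ)) := by
  have h := two_rpow_quarter_mul a
  have h1 := norm_exp_toC_mul a (-(1 / 4))
  have e : ((-(1 / 4) : ℝ) : ℂ) * toC a = -(toC a / 4) := by push_cast; ring
  rw [e] at h1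
  have h2 : exp (-(toC a / 4)) * conj (exp (-(toC a / 4)))
      = ((rexp (-(1 / 4) * a.1) ^ 2 : ℝ) : ℂ) := by
    rw [mul_conj', h1]; push_cast; rfl
  have h3 : ((((2 : ℝ) ^ (-(1 / 4) : ℝ)) * rexp (-(1 / 4) * a.1)) ^ 2 * rexp a.1 ^ 2 : ℝ)
      = ((rexp a.1 / 2 * (√2 * rexp (a.1 / 2)) : ℝ) : ℂ) := by rw [h]
  rw [norm_econe]
  simp only [coneMap, map_mul, conj_ofReal]
  push_cast at h2 h3 ⊢
  grind

lemma integral_coneMap {r r' : ℂ → ℂ} (hr : AEStronglyMeasurable r)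
  (hr' : AEStronglyMeasurable r') :
  ∫ x, r x * conj (r' x) * (‖x‖ : ℂ) =
    ∫ a, (rexp a.1 : ℂ) ^ 2 * (coneMap r a * conj (coneMap r' a)) ∂svol := by
  have hm : AEStronglyMeasurable (fun x : ℂ => r x * conj (r' x) * (‖x‖ : ℂ)) := by fun_prop
  rw [integral_econe hm]
  exact integral_congr_ae (.of_forall fun a => (coneMap_mul_conj r r' a).symm)

end ConeCoordinate

/-! ### The local expression of the Laplacian -/

/-- The Dolbeault Laplacian `-|c|⁻² h⁻¹ ∂(h ∂̄ f)` in a local coordinate. -/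
def locLap (c h f : ℂ → ℂ) (z : ℂ) : ℂ :=
  -(((‖c z‖ ^ 2 : ℝ) : ℂ)⁻¹ * (h z)⁻¹ * wirtinger (fun w => h w * wirtingerBar f w) z)

lemma realLinear_apply (L : ℂ →L[ℝ] ℂ) (w : ℂ) : L w = (L 1 - I * L I) / 2 * w
    + (L 1 + I * L I) / 2 * conj w := by
  have h : L w = w.re * L 1 + w.im * L I := by
    have h0 : w = w.re • (1 : ℂ) + w.im • I := by simp
    conv_lhs => rw [h0]
    rw [map_add, map_smul, map_smul, real_smul, real_smul]
  have hI := I_mul_I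
  have hw := (re_add_im w).symm
  have hw' : conj w = w.re - w.im * I := by apply ext <;> simp
  grind

lemma fderiv_eq_wirtinger (f : ℂ → ℂ) (z w : ℂ) :
  fderiv ℝ f z w = wirtinger f z * w + wirtingerBar f z * conj w :=
  realLinear_apply _ _

lemma wirtinger_congr {f g : ℂ → ℂ} {z : ℂ} (h : f =ᶠ[𝓝 z] g) : wirtinger f z = wirtinger g z := by
  rw [wirtinger, wirtinger, h.fderiv_eq]

lemma wirtingerBar_congr {f g : ℂ → ℂ} {z : ℂ} (h : f =ᶠ[𝓝 z] g) :
  wirtingerBar f =ᶠ[𝓝 z] wirtingerBar g := by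
  filter_upwards [h.eventuallyEq_nhds] with w hw
  rw [wirtingerBar, wirtingerBar, hw.fderiv_eq]

lemma wirtingerBar_mul_comp {a τ g : ℂ → ℂ} {a' τ' z : ℂ} (ha : HasDerivAt a a' z)
  (hτ : HasDerivAt τ τ' z) (hg : DifferentiableAt ℝ g (τ z)) :
  wirtingerBar (fun w => a w * g (τ w)) z = a z * (conj τ' * wirtingerBar g (τ z)) := by
  have h := ha.complexToReal_fderiv.mul (hg.hasFDerivAt.comp z hτ.complexToReal_fderiv)
  rw [wirtingerBar, show (fun w => a w * g (τ w)) = a * (g ∘ τ) from rfl, h.fderiv]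
  simp [fderiv_eq_wirtinger g]
  have hI := I_mul_I
  linear_combination (1 / 2 * a z * wirtinger g (τ z) * τ'
    - 1 / 2 * a z * wirtingerBar g (τ z) * conj τ' + 1 / 2 * g (τ z) * a') * hI

lemma wirtinger_conj_mul_comp {a τ g : ℂ → ℂ} {a' τ' z : ℂ} (ha : HasDerivAt a a' z)
  (hτ : HasDerivAt τ τ' z) (hg : DifferentiableAt ℝ g (τ z)) :
  wirtinger (fun w => conj (a w) * g (τ w)) z = conj (a z) * (τ' * wirtinger g (τ z)) := by
  have h0 := (conjCLE.toContinuousLinearMap.hasFDerivAt).comp z ha.complexToReal_fderiv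
  have h := h0.mul (hg.hasFDerivAt.comp z hτ.complexToReal_fderiv)
  rw [wirtinger, show (fun w => conj (a w) * g (τ w)) =
    (conjCLE.toContinuousLinearMap ∘ a) * (g ∘ τ) from rfl, h.fderiv]
  simp only [add_apply, smul_apply,
    ContinuousLinearMap.comp_apply, one_apply_eq_self, smul_eq_mul, mul_one,
    Function.comp_apply, fderiv_eq_wirtinger g]
  simp
  have hI := I_mul_I
  linear_combination (- 1 / 2 * conj (a z) * wirtinger g (τ z) * τ'
    + 1 / 2 * conj (a z) * wirtingerBar g (τ z) * conj τ' + 1 / 2 * g (τ z) * conj a') * hI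

lemma differentiableAt_wirtingerBar {g : ℂ → ℂ} {z : ℂ} (hg : ContDiffAt ℝ 2 g z) :
  DifferentiableAt ℝ (wirtingerBar g) z := by
  have h := (hg.fderiv_right (m := 1) (by norm_num)).differentiableAt (by norm_num)
  have h1 : ∀ v, DifferentiableAt ℝ (fun w => fderiv ℝ g w v) z := fun v =>
    h.clm_apply (differentiableAt_const v)
  exact (((h1 1).add ((h1 I).const_mul I)).mul_const (2 : ℂ)⁻¹ :)

lemma locLap_comp {c h f C H r a τ : ℂ → ℂ} {τ' : ℂ → ℂ} {z : ℂ}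
  (ha : ∀ᶠ w in 𝓝 z, DifferentiableAt ℂ a w) (ha0 : a z ≠ 0)
  (hτ : ∀ᶠ w in 𝓝 z, HasDerivAt τ (τ' w) w) (hτ' : DifferentiableAt ℂ τ' z) (hτ0 : τ' z ≠ 0)
  (hc : c z = C (τ z) * τ' z) (hh : ∀ᶠ w in 𝓝 z, h w = ((‖a w‖ ^ 2 : ℝ) : ℂ)⁻¹ * H (τ w))
  (hf : ∀ᶠ w in 𝓝 z, f w = a w * r (τ w))
  (hr : ∀ᶠ x in 𝓝 (τ z), ContDiffAt ℝ 2 r x) (hH : DifferentiableAt ℝ H (τ z)) :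
  locLap c h f z = a z * locLap C H r (τ z) := by
  have hτc := hτ.self_of_nhds.continuousAt
  have hae := ha.self_of_nhds.continuousAt.eventually_ne ha0
  have h1 : (fun w => h w * wirtingerBar f w) =ᶠ[𝓝 z]
      fun w => conj (τ' w / a w) * (H (τ w) * wirtingerBar r (τ w)) := by
    filter_upwards [ha, hτ, hh, hf.eventually_nhds, hτc.eventually hr, hae] with w h1 h2 h3 h4 h5 h6
    have h7 := h4
    rw [(wirtingerBar_congr h7).self_of_nhds, wirtingerBar_mul_comp h1.hasDerivAt h2
      (h5.differentiableAt (by norm_num)), h3, map_div₀]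
    push_cast
    rw [← mul_conj']
    field_simp
  have hd : DifferentiableAt ℂ (fun w => τ' w / a w) z := hτ'.div ha.self_of_nhds ha0
  have hG : DifferentiableAt ℝ (fun x => H x * wirtingerBar r x) (τ z) :=
    hH.mul (differentiableAt_wirtingerBar hr.self_of_nhds)
  rw [locLap, wirtinger_congr h1, wirtinger_conj_mul_comp (g := fun x => H x * wirtingerBar r x)
    hd.hasDerivAt hτ.self_of_nhds hG, locLap, hh.self_of_nhds, hc, map_div₀]
  have h8 : conj (a z) ≠ 0 := by simpa using ha0
  have h9 : conj (τ' z) ≠ 0 := by simpa using hτ0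
  rw [norm_mul]
  push_cast
  rw [mul_pow, ← mul_conj' (τ' z), ← mul_conj' (a z)]
  grind

lemma locLap_congr {c h f g : ℂ → ℂ} {z : ℂ} (hfg : f =ᶠ[𝓝 z] g) :
  locLap c h f z = locLap c h g z := by
  have : (fun w => h w * wirtingerBar f w) =ᶠ[𝓝 z] fun w => h w * wirtingerBar g w :=
    (EventuallyEq.refl _ h).mul (wirtingerBar_congr hfg)
  rw [locLap, locLap, wirtinger_congr this]

lemma locLap_toC {c f : ℂ → ℂ} {a : ℝ²} (hf : ∀ᶠ z in 𝓝 (toC a), ContDiffAt ℝ ∞ f z) :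
  locLap c (fun _ => 1) f (toC a)
    = -(((‖c (toC a)‖ ^ 2 : ℝ) : ℂ)⁻¹ * (1 / 4 * lap (fun b => f (toC b)) a)) := by
  have hd := continuous_toC.continuousAt.eventually hf
  have h0 : ∞ ≠ 0 := by simp
  have e1 : dS (fun b => f (toC b)) =ᶠ[𝓝 a] fun b => fderiv ℝ f (toC b) 1 := by
    filter_upwards [hd] with b hb using (fderiv_comp_toC (hb.differentiableAt h0)).1
  have e2 : dP (fun b => f (toC b)) =ᶠ[𝓝 a] fun b => fderiv ℝ f (toC b) I := by
    filter_upwards [hd] with b hb using (fderiv_comp_toC (hb.differentiableAt h0)).2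
  have hfd : ContDiffAt ℝ ∞ (fderiv ℝ f) (toC a) := hf.self_of_nhds.fderiv_right le_rfl
  have hfv : ∀ v, DifferentiableAt ℝ (fun z => fderiv ℝ f z v) (toC a) := fun v =>
    ((hfd.clm_apply contDiffAt_const).differentiableAt h0)
  have e3 : dS (dS fun b => f (toC b)) a = fderiv ℝ (fun z => fderiv ℝ f z 1) (toC a) 1 := by
    rw [(Filter.EventuallyEq.dS e1).self_of_nhds, (fderiv_comp_toC (hfv 1)).1]
  have e4 : dP (dP fun b => f (toC b)) a = fderiv ℝ (fun z => fderiv ℝ f z I) (toC a) I := by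
    rw [(Filter.EventuallyEq.dP e2).self_of_nhds, (fderiv_comp_toC (hfv I)).2]
  have hsymm : fderiv ℝ (fun z => fderiv ℝ f z 1) (toC a) I
      = fderiv ℝ (fun z => fderiv ℝ f z I) (toC a) 1 := by
    have hs := hf.self_of_nhds.isSymmSndFDerivAt (by simp; norm_cast)
    have hfdd := hfd.differentiableAt h0
    rw [fderiv_clm_apply hfdd (differentiableAt_const _),
      fderiv_clm_apply hfdd (differentiableAt_const _)]
    simpa using hs.eq I 1
  have hb : HasFDerivAt (wirtingerBar f) ((2 : ℂ)⁻¹ • (fderiv ℝ (fun z => fderiv ℝ f z 1) (toC a)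
        + I • fderiv ℝ (fun z => fderiv ℝ f z I) (toC a))) (toC a) := by
    have := ((hfv 1).hasFDerivAt.add ((hfv I).hasFDerivAt.const_mul I)).mul_const (2 : ℂ)⁻¹
    exact this
  have hI := I_mul_I
  simp only [locLap, one_mul, inv_one, mul_one]
  rw [wirtinger, hb.fderiv, lap, e3, e4]
  simp only [add_apply, smul_apply]
  rw [hsymm]
  congr 2
  linear_combination (-(1 / 4) * fderiv ℝ (fun z => fderiv ℝ f z I) (toC a) I) * hI

/-- The Laplacian of the cone in the distinguished coordinate. -/
def coneLap (r : ℂ → ℂ) : ℂ → ℂ := locLap (fun z => z) (fun z => ((‖z‖ : ℂ))⁻¹) r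

lemma contDiffAt_inv_norm {z : ℂ} (hz : z ≠ 0) : ContDiffAt ℝ ∞ (fun z : ℂ => ((‖z‖ : ℂ))⁻¹) z := by
  have h1 : ContDiffAt ℝ ∞ (fun z : ℂ => ((‖z‖ : ℂ))) z :=
    ofRealCLM.contDiff.contDiffAt.comp z (contDiffAt_norm ℝ hz)
  exact h1.inv (by simpa using hz)

lemma coneMap_coneLap {r : ℂ → ℂ} {a : ℝ²} (hr : ∀ᶠ z in 𝓝 (econe a), ContDiffAt ℝ ∞ r z) :
  coneMap (coneLap r) a = -(1 / 4) * ((rexp (-2 * a.1) : ℂ) * lap (coneMap r) a) := by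
  set τ : ℂ → ℂ := fun ζ => ((√2 : ℝ) : ℂ) * exp (ζ / 2) with hτ
  set b : ℂ → ℂ := fun ζ => (((2 : ℝ) ^ (-(1 / 4) : ℝ) : ℝ) : ℂ) * exp (-(ζ / 4)) with hb
  have hτd : ∀ w, HasDerivAt τ (τ w / 2) w := fun w => by
    have := (((hasDerivAt_id w).div_const 2).cexp).const_mul ((√2 : ℝ) : ℂ)
    grind
  have hbd : Differentiable ℂ b := by fun_prop
  have h20 : ((2 : ℝ) ^ (-(1 / 4) : ℝ)) ≠ 0 := (Real.rpow_pos_of_pos (by norm_num) _).ne'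
  have hb0 : ∀ w, b w ≠ 0 := fun w => mul_ne_zero (by exact_mod_cast h20) (exp_ne_zero _)
  have hτ0 : ∀ w, τ w ≠ 0 := fun w => mul_ne_zero (by simp) (exp_ne_zero _)
  have hn : ∀ w, ‖b w‖ ^ 2 * ‖τ w‖ = 1 := fun w => by
    have e1 : ‖b w‖ = (2 : ℝ) ^ (-(1 / 4) : ℝ) * rexp (-(w.re / 4)) := by
      rw [hb, norm_mul, norm_real, Real.norm_of_nonneg (Real.rpow_nonneg (by norm_num) _), norm_exp]
      simp
    have e2 : ‖τ w‖ = √2 * rexp (w.re / 2) := by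
      rw [hτ, norm_mul, norm_real, Real.norm_of_nonneg (Real.sqrt_nonneg _), norm_exp]
      simp
    rw [e1, e2, mul_pow, ← Real.rpow_natCast, ← Real.rpow_mul (by norm_num), Real.sqrt_eq_rpow,
      ← Real.exp_nat_mul, mul_mul_mul_comm, ← Real.rpow_add (by norm_num), ← Real.exp_add]
    norm_num
    ring
  have key := locLap_comp (c := fun ζ => τ ζ * (τ ζ / 2)) (h := fun _ => 1)
    (f := fun ζ => b ζ * r (τ ζ)) (C := fun z => z) (H := fun z => ((‖z‖ : ℂ))⁻¹) (r := r) (a := b)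
    (τ := τ) (τ' := fun w => τ w / 2) (z := toC a)
    (.of_forall fun w => hbd w) (hb0 _) (.of_forall hτd)
    ((hτd _).differentiableAt.div_const 2) (div_ne_zero (hτ0 _) two_ne_zero) rfl
    (.of_forall fun w => by rw [← mul_inv, ← ofReal_mul, hn]; simp)
    (.of_forall fun w => rfl)
    (hr.mono fun x hx => hx.of_le (by norm_cast))
    ((contDiffAt_inv_norm (hτ0 _)).differentiableAt (by simp))
  have hsm : ∀ᶠ z in 𝓝 (toC a), ContDiffAt ℝ ∞ (fun ζ => b ζ * r (τ ζ)) z := by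
    have hτc : ContDiff ℝ ∞ τ := contDiff_const.mul (contDiff_id.div_const 2).cexp
    have hbc : ContDiff ℝ ∞ b := contDiff_const.mul (contDiff_id.div_const 4).neg.cexp
    filter_upwards [(hτc.continuous.continuousAt (x := toC a)).eventually hr] with z hz
    fun_prop
  rw [locLap_toC hsm] at key
  change b (toC a) * coneLap r (τ (toC a)) = _
  rw [coneLap, ← key]
  have hc : ‖τ (toC a) * (τ (toC a) / 2)‖ ^ 2 = rexp (2 * a.1) := by
    have : ‖τ (toC a)‖ = √2 * rexp (a.1 / 2) := norm_econe a
    rw [norm_mul, norm_div, this]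
    have h2 : √2 ^ 2 = (2 : ℝ) := Real.sq_sqrt (by norm_num)
    have h3 : (rexp (a.1 / 2)) ^ 4 = rexp (2 * a.1) := by rw [← Real.exp_nat_mul]; ring
    rw [← h3]
    simp
    grind
  rw [hc, show (-2 * a.1) = -(2 * a.1) by ring, Real.exp_neg (2 * a.1)]
  push_cast
  rw [show (fun b_1 => b (toC b_1) * r (τ (toC b_1))) = coneMap r from rfl]
  ring

/-! ### Holomorphic charts -/

section Charts

variable {X : Type*} [TopologicalSpace X] [ChartedSpace ℂ X]

lemma contDiffGroupoid_complex_le : contDiffGroupoid ⊤ω 𝓘(ℂ) ≤ contDiffGroupoid ∞ 𝓘(ℝ, ℂ) := by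
  refine groupoid_of_pregroupoid_le _ _ fun f s hfs => ?_
  exact (ContDiffOn.restrict_scalars ℝ hfs).of_le le_top

variable [IsManifold 𝓘(ℂ) ⊤ω X]

instance isManifold_real : IsManifold 𝓘(ℝ, ℂ) ∞ X :=
  { hasGroupoid_of_le (G₁ := contDiffGroupoid ⊤ω 𝓘(ℂ)) inferInstance
      contDiffGroupoid_complex_le with }

local notation "Chart" => OpenPartialHomeomorph X ℂ

variable (X) in
/-- The holomorphic charts. -/
abbrev HolAtlas : Set Chart := IsManifold.maximalAtlas 𝓘(ℂ) ⊤ω X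

lemma HolAtlas.real {x : Chart} (hx : x ∈ HolAtlas X) :
  x ∈ IsManifold.maximalAtlas 𝓘(ℝ, ℂ) ∞ X := fun e' he' =>
  ⟨contDiffGroupoid_complex_le (hx e' he').1, contDiffGroupoid_complex_le (hx e' he').2⟩

variable {x c : OpenPartialHomeomorph X ℂ}

/-- The overlap of two charts. -/
def overlap (x c : Chart) : Set ℂ := x.target ∩ x.symm ⁻¹' c.source

lemma isOpen_overlap (x c : Chart) : IsOpen (overlap x c) :=
  x.isOpen_inter_preimage_symm c.open_source

/-- The coordinate change. -/
def chg (x c : Chart) (z : ℂ) : ℂ := c (x.symm z)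

lemma differentiableOn_chg (hx : x ∈ HolAtlas X) (hc : c ∈ HolAtlas X) :
  DifferentiableOn ℂ (chg x c) (overlap x c) := by
  intro z hz
  have h := (contMDiffAt_of_mem_maximalAtlas hc hz.2).comp z
    (contMDiffAt_symm_of_mem_maximalAtlas hx hz.1)
  exact ((contMDiffAt_iff_contDiffAt.1 h).differentiableAt (by simp)).differentiableWithinAt

lemma hasDerivAt_chg (hx : x ∈ HolAtlas X) (hc : c ∈ HolAtlas X) {z : ℂ}
  (hz : z ∈ overlap x c) : HasDerivAt (chg x c) (deriv (chg x c) z) z :=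
  ((differentiableOn_chg hx hc).differentiableAt ((isOpen_overlap x c).mem_nhds hz)).hasDerivAt

lemma chg_mem {z : ℂ} (hz : z ∈ overlap x c) : chg x c z ∈ overlap c x := by
  refine ⟨c.map_source hz.2, ?_⟩
  rw [Set.mem_preimage, chg, c.left_inv hz.2]
  exact x.map_target hz.1

lemma chg_chg {z : ℂ} (hz : z ∈ overlap x c) : chg c x (chg x c z) = z := by
  rw [chg, chg, c.left_inv hz.2, x.right_inv hz.1]

lemma deriv_chg_ne_zero (hx : x ∈ HolAtlas X) (hc : c ∈ HolAtlas X) {z : ℂ}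
  (hz : z ∈ overlap x c) : deriv (chg x c) z ≠ 0 := by
  intro h
  have h1 := (hasDerivAt_chg hc hx (chg_mem hz)).comp z (hasDerivAt_chg hx hc hz)
  have h2 : chg c x ∘ chg x c =ᶠ[𝓝 z] id := by
    filter_upwards [(isOpen_overlap x c).mem_nhds hz] with w hw using chg_chg hw
  have h3 := (h1.congr_of_eventuallyEq h2.symm).unique (hasDerivAt_id z)
  grind

lemma coefficient_eq (η : ∀ y : X, Cotangent X y) (hx : x ∈ HolAtlas X) (hc : c ∈ HolAtlas X)
  {z : ℂ} (hz : z ∈ overlap x c) :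
  coefficient η x z = coefficient η c (chg x c z) * deriv (chg x c) z := by
  have h1 := (contMDiffAt_symm_of_mem_maximalAtlas hc (chg_mem hz).1).mdifferentiableAt (by simp)
  have hd := hasDerivAt_chg hx hc hz
  have h2 := hd.differentiableAt.mdifferentiableAt
  have h3 : x.symm =ᶠ[𝓝 z] c.symm ∘ chg x c := by
    filter_upwards [(isOpen_overlap x c).mem_nhds hz] with w hw
    exact (c.left_inv hw.2).symm
  have h4 : (mfderiv 𝓘(ℂ) 𝓘(ℂ) (c.symm ∘ chg x c) z (1 : ℂ) : ℂ)
      = deriv (chg x c) z * (show ℂ from mfderiv 𝓘(ℂ) 𝓘(ℂ) c.symm (chg x c z) (1 : ℂ)) := by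
    rw [mfderiv_comp z h1 h2]
    have e1 : (mfderiv 𝓘(ℂ) 𝓘(ℂ) (chg x c) z (1 : ℂ) : ℂ) = deriv (chg x c) z • (1 : ℂ) := by
      have e0 : fderiv ℂ (chg x c) z (1 : ℂ) = deriv (chg x c) z • (1 : ℂ) := by simp
      exact (congrArg (fun L : ℂ →L[ℂ] ℂ => L 1) mfderiv_eq_fderiv).trans e0
    have e2 : ∀ v : ℂ, (mfderiv 𝓘(ℂ) 𝓘(ℂ) c.symm (chg x c z) (v • (1 : ℂ)) : ℂ)
        = v • (show ℂ from mfderiv 𝓘(ℂ) 𝓘(ℂ) c.symm (chg x c z) (1 : ℂ)) := fun v =>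
      map_smul (mfderiv 𝓘(ℂ) 𝓘(ℂ) c.symm (chg x c z)) v (1 : ℂ)
    exact (congrArg (fun v : ℂ => (mfderiv 𝓘(ℂ) 𝓘(ℂ) c.symm (chg x c z) v : ℂ)) e1).trans (e2 _)
  have h5 : (mfderiv 𝓘(ℂ) 𝓘(ℂ) x.symm z (1 : ℂ) : ℂ)
      = mfderiv 𝓘(ℂ) 𝓘(ℂ) (c.symm ∘ chg x c) z (1 : ℂ) := by
    have := Filter.EventuallyEq.mfderiv_eq (I := 𝓘(ℂ)) (I' := 𝓘(ℂ)) h3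
    exact congrArg (fun L : ℂ →L[ℂ] ℂ => L 1) this
  have key : ∀ y : X, y = x.symm z → ∀ v w : ℂ, v = w → (η (x.symm z) v : ℂ) = η y w := by
    rintro _ rfl v _ rfl; rfl
  rw [coefficient, key (c.symm (chg x c z)) h3.self_of_nhds.symm _ _ (h5.trans h4), cotangent_apply,
    coefficient, cotangent_apply _ (mfderiv 𝓘(ℂ) 𝓘(ℂ) c.symm (chg x c z) (1 : ℂ) : ℂ)]
  grind

lemma chart_mem (y : X) : chartAt ℂ y ∈ HolAtlas X := IsManifold.chart_mem_maximalAtlas y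

lemma mem_overlap_chart {y : X} (hy : y ∈ x.source) (hc : y ∈ c.source) : x y ∈ overlap x c :=
  ⟨x.map_source hy, by simp_all⟩

lemma chg_apply {y : X} (hy : y ∈ x.source) : chg x c (x y) = c y := by rw [chg, x.left_inv hy]

lemma quot_eq_coefficient (η θ : ∀ y : X, Cotangent X y) (hx : x ∈ HolAtlas X) {y : X}
  (hy : y ∈ x.source) :
  quot (η y) (θ y) = coefficient η x (x y) / coefficient θ x (x y) := by
  have hz := mem_overlap_chart hy (mem_chart_source ℂ y)
  rw [quot_eq η θ y y (mem_chart_source ℂ y), coefficient_eq η hx (chart_mem y) hz,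
    coefficient_eq θ hx (chart_mem y) hz, chg_apply hy,
    mul_div_mul_right _ _ (deriv_chg_ne_zero hx (chart_mem y) hz)]

variable [MeasurableSpace X] [BorelSpace X] [CompactSpace X]

lemma form_eq_zero_iff (ω : HolomorphicForm X) (hx : x ∈ HolAtlas X) {y : X}
  (hy : y ∈ x.source) : ω.1 y = 0 ↔ coefficient ω.1 x (x y) = 0 := by
  have hz := mem_overlap_chart hy (mem_chart_source ℂ y)
  rw [eq_zero_iff ω y y (mem_chart_source ℂ y), coefficient_eq ω.1 hx (chart_mem y) hz,
    chg_apply hy, mul_eq_zero, or_iff_left (deriv_chg_ne_zero hx (chart_mem y) hz)]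

/-- The area measure in a chart. -/
def chartArea (ω : HolomorphicForm X) (x : Chart) : Measure X :=
  ((volume.withDensity fun z : ℂ => ‖coefficient ω.1 x z‖ₑ ^ 2).restrict x.target).map x.symm

lemma aemeasurable_symm (x : Chart) (μ : Measure ℂ) : AEMeasurable x.symm (μ.restrict x.target) :=
  x.continuousOn_symm.aemeasurable x.open_target.measurableSet

lemma measurableSet_inter_preimage_symm (x : Chart) {A : Set X}
  (hA : MeasurableSet A) : MeasurableSet (x.target ∩ x.symm ⁻¹' A) := by
  have : x.target ∩ x.symm ⁻¹' A = Subtype.val '' ((fun z : x.target => x.symm z) ⁻¹' A) := by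
    ext z
    simp [and_comm]
  rw [this]
  exact x.open_target.measurableSet.subtype_image
    ((continuousOn_iff_continuous_domRestrict.1 x.continuousOn_symm).measurable hA)

lemma chartArea_apply (ω : HolomorphicForm X) (x : Chart) {A : Set X} (hA : MeasurableSet A) :
  chartArea ω x A = ∫⁻ z in x.target ∩ x.symm ⁻¹' A, ‖coefficient ω.1 x z‖ₑ ^ 2 := by
  have hm := measurableSet_inter_preimage_symm x hA
  rw [chartArea, Measure.map_apply_of_aemeasurable (aemeasurable_symm x _) hA,
    Measure.restrict_apply' x.open_target.measurableSet, Set.inter_comm, withDensity_apply _ hm]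

lemma chartArea_overlap (ω : HolomorphicForm X) (hx : x ∈ HolAtlas X) (hc : c ∈ HolAtlas X) :
  (chartArea ω x).restrict c.source = (chartArea ω c).restrict x.source := by
  ext A hA
  rw [Measure.restrict_apply hA, Measure.restrict_apply hA,
    chartArea_apply ω x (hA.inter c.open_source.measurableSet),
    chartArea_apply ω c (hA.inter x.open_source.measurableSet)]
  set D := x.target ∩ x.symm ⁻¹' (A ∩ c.source) with hD
  have hsub : ∀ z ∈ D, z ∈ overlap x c := fun z hz => ⟨hz.1, hz.2.2⟩
  have him : c.target ∩ c.symm ⁻¹' (A ∩ x.source) = chg x c '' D := by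
    ext w
    constructor
    · rintro ⟨h1, h2, h3⟩
      have hw : w ∈ overlap c x := ⟨h1, h3⟩
      refine ⟨chg c x w, ⟨(chg_mem hw).1, ?_, (chg_mem hw).2⟩, chg_chg hw⟩
      change x.symm (x (c.symm w)) ∈ A
      rwa [x.left_inv h3]
    · rintro ⟨z, hz, rfl⟩
      refine ⟨(chg_mem (hsub z hz)).1, ?_, (chg_mem (hsub z hz)).2⟩
      change c.symm (c (x.symm z)) ∈ A
      simp_all
  have hDm := measurableSet_inter_preimage_symm x (hA.inter c.open_source.measurableSet)
  rw [him, lintegral_image_eq_lintegral_abs_det_fderiv_mul volume hDm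
    (fun z hz => (hasDerivAt_chg hx hc (hsub z hz)).complexToReal_fderiv.hasFDerivWithinAt)
    (fun z hz w hw h => by rw [← chg_chg (hsub z hz), h, chg_chg (hsub w hw)])]
  refine setLIntegral_congr_fun hDm fun z hz => ?_
  rw [coefficient_eq ω.1 hx hc (hsub z hz), det_smul_one, enorm_mul, mul_pow, mul_comm,
    abs_of_nonneg (by positivity), ENNReal.ofReal_pow (norm_nonneg _), ofReal_norm]

lemma chartArea_restrict_source (ω : HolomorphicForm X) (x : Chart) :
  (chartArea ω x).restrict x.source = chartArea ω x := by
  ext A hA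
  rw [Measure.restrict_apply hA, chartArea_apply ω x hA,
    chartArea_apply ω x (hA.inter x.open_source.measurableSet)]
  congr 2
  ext z
  simp_all

lemma area_eq_iSup (ω : HolomorphicForm X) : area ω = ⨆ y : X, chartArea ω (chartAt ℂ y) := rfl

lemma area_restrict_le (ω : HolomorphicForm X) (hx : x ∈ HolAtlas X) :
  (area ω).restrict x.source ≤ chartArea ω x := by
  have hm := x.open_source.measurableSet
  have h : area ω ≤ chartArea ω x + (area ω).restrict x.sourceᶜ := by
    conv_lhs => rw [area_eq_iSup]
    refine iSup_le fun y => ?_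
    rw [← Measure.restrict_add_restrict_compl (μ := chartArea ω (chartAt ℂ y)) hm]
    refine add_le_add ?_ (Measure.restrict_mono le_rfl (le_iSup (fun y : X =>
      chartArea ω (chartAt ℂ y)) y))
    rw [chartArea_overlap ω (chart_mem y) hx]
    exact Measure.restrict_le_self
  refine (Measure.restrict_mono (le_refl x.source) h).trans ?_
  rw [Measure.restrict_add, Measure.restrict_restrict hm, Set.inter_compl_self,
    Measure.restrict_empty, add_zero]
  exact Measure.restrict_le_self

lemma area_restrict_chart (ω : HolomorphicForm X) (y : X) :
  (area ω).restrict (chartAt ℂ y).source = chartArea ω (chartAt ℂ y) := by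
  refine le_antisymm (area_restrict_le ω (chart_mem y)) ?_
  rw [← chartArea_restrict_source ω (chartAt ℂ y)]
  exact Measure.restrict_mono le_rfl (le_iSup (fun y : X => chartArea ω (chartAt ℂ y)) y)

lemma area_restrict_source (ω : HolomorphicForm X) (hx : x ∈ HolAtlas X) :
  (area ω).restrict x.source = chartArea ω x := by
  obtain ⟨t, ht⟩ := isCompact_univ.elim_nhds_subcover (fun y : X => (chartAt ℂ y).source)
    (fun y _ => (chartAt ℂ y).open_source.mem_nhds (mem_chart_source ℂ y))
  have hU : ⋃ i : t, (chartAt ℂ i.1).source = Set.univ := by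
    refine Set.eq_univ_of_forall fun y => ?_
    simpa using ht.2 (Set.mem_univ y)
  refine Measure.ext_of_iUnion_eq_univ hU fun i => ?_
  rw [Measure.restrict_comm (chartAt ℂ i.1).open_source.measurableSet, area_restrict_chart,
    chartArea_overlap ω (chart_mem _) hx]

end Charts

/-! ### Sections of the spinor bundle in a chart -/

section SpinorCharts

variable {X : Type*} [TopologicalSpace X] [T2Space X] [CompactSpace X] [ChartedSpace ℂ X]
  [IsManifold 𝓘(ℂ) ⊤ω X] [MeasurableSpace X] [BorelSpace X]
  {C : X → Type*} [TopologicalSpace (TotalSpace ℂ C)] [∀ y, AddCommGroup (C y)]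
  [∀ y, Module ℂ (C y)] [∀ y, TopologicalSpace (C y)] [FiberBundle ℂ C] [VectorBundle ℂ ℂ C]
  {S : SpinStructure C} {ω : HolomorphicForm X}

local notation "Chart" => OpenPartialHomeomorph X ℂ

local notation "Msec" => MeasurableSection (area ω)

variable {x : OpenPartialHomeomorph X ℂ}
  {e u v w f g : ∀ y, C y} {k : ℂ → ℂ} {χ ζ θ : X → ℝ} {p : X} {m : ℤ} {d l : ℝ} {η : ℝ → ℂ}
  {ι : Type*} [Fintype ι] {P : ι → X}

local notation "L²" => squareIntegrable S ω

/-- The representative of a section in a chart, extended by zero. -/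
def rep (x : Chart) (e u : ∀ y, C y) : ℂ → ℂ := representative x e (fun _ => 1) u

open scoped Classical in
/-- The section with the representative `g`, extended by zero. -/
def lift (x : Chart) (e : ∀ y, C y) (g : ℂ → ℂ) : ∀ y, C y := fun y =>
  if y ∈ x.source then g (x y) • e y else 0

lemma lift_apply {g : ℂ → ℂ} {y : X} (hy : y ∈ x.source) : lift x e g y = g (x y) • e y := if_pos hy

lemma lift_of_notMem {g : ℂ → ℂ} {y : X} (hy : y ∉ x.source) : lift x e g y = 0 := if_neg hy

lemma lift_sub (g g' : ℂ → ℂ) :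
  lift x e (fun z => g z - g' z) = fun y => lift x e g y - lift x e g' y := by
  ext y
  by_cases hy : y ∈ x.source
  · simp [lift_apply hy, sub_smul]
  · simp [lift_of_notMem hy]

lemma rep_of_notMem {z : ℂ} (hz : z ∉ x.target) : rep x e u z = 0 := if_neg hz

lemma IsSpinorChart.ne_zero (hs : IsSpinorChart S x e) {y : X} (hy : y ∈ x.source) : e y ≠ 0 := by
  intro h
  have h1 := hs.square (x y) (x.map_source hy)
  have key : ∀ y' : X, y' = y → ∀ v : ℂ, (S.mul y' (e y') (e y') v : ℂ) = 0 := by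
    rintro _ rfl v
    rw [h, map_zero]; rfl
  exact zero_ne_one ((key _ (x.left_inv hy) _).symm.trans h1)

lemma component_ne_zero {x₀ y : X} (hy : y ∈ (trivializationAt ℂ C x₀).baseSet) {a : C y}
  (ha : a ≠ 0) : component C x₀ y a ≠ 0 := fun h => ha <| by
  rw [← component_smul_frame x₀ y hy a, h, zero_smul]

lemma component_div {x₀ y : X} (hy : y ∈ (trivializationAt ℂ C x₀).baseSet) {a b : C y}
  (hb : b ≠ 0) : (component C x₀ y a / component C x₀ y b) • b = a := by
  conv_lhs => rw [← component_smul_frame x₀ y hy b]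
  rw [map_smul, component_frame x₀ y hy, smul_eq_mul, mul_one, smul_smul,
    div_mul_cancel₀ _ (component_ne_zero hy hb), component_smul_frame x₀ y hy]

lemma smul_left_inj_of_ne {y : X} {b : C y} (hb : b ≠ 0) {s t : ℂ} (h : s • b = t • b) : s = t := by
  simp_all

lemma IsSpinorChart.eq_rep_smul (hs : IsSpinorChart S x e) (u : ∀ y, C y) {y : X}
  (hy : y ∈ x.source) : u y = rep x e u (x y) • e y := by
  rw [rep, representative, if_pos (x.map_source hy), ofReal_one, one_mul]
  have key : ∀ y' : X, y' = y →
      (component C y' y' (u y') / component C y' y' (e y')) • e y = u y := by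
    rintro _ rfl
    exact component_div (FiberBundle.mem_baseSet_trivializationAt' (F := ℂ) (E := C) _)
      (hs.ne_zero hy)
  exact (key _ (x.left_inv hy)).symm

lemma IsSpinorChart.rep_eq (hs : IsSpinorChart S x e) {y : X} (hy : y ∈ x.source) {a : ℂ}
  (h : u y = a • e y) : rep x e u (x y) = a :=
  smul_left_inj_of_ne (hs.ne_zero hy) ((hs.eq_rep_smul u hy).symm.trans h)

lemma IsSpinorChart.rep_lift (hs : IsSpinorChart S x e) (g : ℂ → ℂ) {z : ℂ}
  (hz : z ∈ x.target) : rep x e (lift x e g) z = g z := by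
  have h := hs.rep_eq (x.map_target hz) (lift_apply (e := e) (g := g) (x.map_target hz))
  rwa [x.right_inv hz] at h

lemma representative_eq (χ : X → ℝ) (u : ∀ y, C y) (z : ℂ) :
  representative x e χ u z = χ (x.symm z) * rep x e u z := by
  by_cases hz : z ∈ x.target
  · rw [rep, representative, representative, if_pos hz, if_pos hz, ofReal_one, one_mul]
  · rw [rep, representative, representative, if_neg hz, if_neg hz, mul_zero]

lemma rep_smul (χ : X → ℝ) (u : ∀ y, C y) :
  rep x e (fun y => (χ y : ℂ) • u y) = representative x e χ u := by
  ext z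
  by_cases hz : z ∈ x.target
  · rw [rep, representative, representative, if_pos hz, if_pos hz, map_smul, smul_eq_mul,
      ofReal_one, one_mul, mul_div_assoc]
  · rw [rep, representative, representative, if_neg hz, if_neg hz]

lemma rep_add (u v : ∀ y, C y) :
  rep x e (fun y => u y + v y) = fun z => rep x e u z + rep x e v z := by
  ext z
  by_cases hz : z ∈ x.target
  · simp [rep, representative, if_pos hz, add_div]
  · simp [rep_of_notMem hz]

lemma rep_sub (u v : ∀ y, C y) :
  rep x e (fun y => u y - v y) = fun z => rep x e u z - rep x e v z := by
  ext z
  by_cases hz : z ∈ x.target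
  · simp [rep, representative, if_pos hz, sub_div]
  · simp [rep_of_notMem hz]

lemma IsSpinorChart.lift_rep (hs : IsSpinorChart S x e) (hu : ∀ y, y ∉ x.source → u y = 0) :
  lift x e (rep x e u) = u := by
  ext y
  by_cases hy : y ∈ x.source
  · rw [lift_apply hy, ← hs.eq_rep_smul u hy]
  · rw [lift_of_notMem hy, hu y hy]

lemma IsSpinorChart.quot_self (hs : IsSpinorChart S x e) {y : X} (hy : y ∈ x.source) :
  quot (S.mul y (e y) (e y)) (ω.1 y) = (coefficient ω.1 x (x y))⁻¹ := by
  rw [quot_eq_coefficient (fun y => S.mul y (e y) (e y)) ω.1 hs.mem_maximalAtlas hy,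
    hs.square _ (x.map_source hy), one_div]

lemma IsSpinorChart.herm_eq_rep (hs : IsSpinorChart S x e) (u v : ∀ y, C y) {y : X}
  (hy : y ∈ x.source) : herm S ω y (u y) (v y)
    = rep x e u (x y) * conj (rep x e v (x y)) * (‖coefficient ω.1 x (x y)‖ : ℂ)⁻¹ := by
  conv_lhs => rw [hs.eq_rep_smul u hy, hs.eq_rep_smul v hy]
  rw [herm_smul_smul, hs.quot_self hy, norm_inv]
  push_cast
  ring

lemma herm_zero_left (y : X) (b : C y) : herm S ω y 0 b = 0 := by simp [herm]

lemma differentiableOn_coefficient (ω : HolomorphicForm X) (hx : x ∈ HolAtlas X) :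
  DifferentiableOn ℂ (coefficient ω.1 x) x.target := by
  intro z hz
  set c := chartAt ℂ (x.symm z) with hc
  have hzo : z ∈ overlap x c := ⟨hz, mem_chart_source ℂ _⟩
  have hd := (differentiableOn_chg hx (chart_mem (x.symm z)))
  have hd' := hd.deriv (isOpen_overlap x c)
  have h1 : DifferentiableAt ℂ (fun w => coefficient ω.1 c (chg x c w) * deriv (chg x c) w) z := by
    refine DifferentiableAt.mul ?_ (hd'.differentiableAt ((isOpen_overlap x c).mem_nhds hzo))
    exact (((ω.2 (x.symm z)).differentiableAt (c.open_target.mem_nhds (chg_mem hzo).1)).comp z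
      (hd.differentiableAt ((isOpen_overlap x c).mem_nhds hzo)) :)
  refine (h1.congr_of_eventuallyEq ?_).differentiableWithinAt
  filter_upwards [(isOpen_overlap x c).mem_nhds hzo] with w hw
  exact coefficient_eq ω.1 hx (chart_mem _) hw

/-- The area measure in the coordinate. -/
def coordArea (ω : HolomorphicForm X) (x : Chart) : Measure ℂ :=
  (volume.withDensity fun z : ℂ => ‖coefficient ω.1 x z‖ₑ ^ 2).restrict x.target

lemma aemeasurable_symm_coordArea (ω : HolomorphicForm X) (x : Chart) :
  AEMeasurable x.symm (coordArea ω x) := aemeasurable_symm x _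

lemma coordArea_eq (ω : HolomorphicForm X) (x : Chart) :
  coordArea ω x = (volume.restrict x.target).withDensity fun z => ‖coefficient ω.1 x z‖ₑ ^ 2 :=
  restrict_withDensity x.open_target.measurableSet _

lemma area_eq_map (hx : x ∈ HolAtlas X) : (area ω).restrict x.source = (coordArea ω x).map x.symm :=
  area_restrict_source ω hx

lemma aemeasurable_density (hx : x ∈ HolAtlas X) :
  AEMeasurable (fun z => ‖coefficient ω.1 x z‖ₑ ^ 2) (volume.restrict x.target) :=
  (((differentiableOn_coefficient ω hx).continuousOn.aemeasurable
    x.open_target.measurableSet).enorm).pow_const 2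

lemma IsSpinorChart.integral_herm (hs : IsSpinorChart S x e) (hu : Msec u) (hv : Msec v)
  (h0 : ∀ y, y ∉ x.source → herm S ω y (u y) (v y) = 0) :
  ∫ y, herm S ω y (u y) (v y) ∂(area ω) =
    ∫ z in x.target, rep x e u z * conj (rep x e v z) * (‖coefficient ω.1 x z‖ : ℂ) := by
  have hx := hs.mem_maximalAtlas
  have hm := (aemeasurable_herm S ω hu hv).aestronglyMeasurable
  rw [← setIntegral_eq_integral_of_forall_compl_eq_zero h0, area_eq_map hx,
    integral_map (aemeasurable_symm_coordArea ω x) (by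
      have := hm.restrict (s := x.source)
      rwa [area_eq_map hx] at this), coordArea_eq,
    integral_withDensity_eq_integral_toReal_smul₀ (aemeasurable_density hx)
      (.of_forall fun z => by simp)]
  refine setIntegral_congr_fun x.open_target.measurableSet fun z hz => ?_
  rw [hs.herm_eq_rep u v (x.map_target hz), x.right_inv hz, ENNReal.toReal_pow, toReal_enorm,
    real_smul]
  by_cases hC : (‖coefficient ω.1 x z‖ : ℂ) = 0
  · rw [hC]; simp
  · push_cast
    field_simp

lemma IsSpinorChart.lintegral_herm (hs : IsSpinorChart S x e)
  (hu : Msec u) (h0 : ∀ y, y ∉ x.source → u y = 0) :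
  ∫⁻ y, ‖herm S ω y (u y) (u y)‖ₑ ∂(area ω) =
    ∫⁻ z in x.target, ‖rep x e u z‖ₑ ^ 2 * ‖coefficient ω.1 x z‖ₑ := by
  have hx := hs.mem_maximalAtlas
  have hm := (aemeasurable_herm S ω hu hu).enorm
  have h1 : Function.support (fun y => ‖herm S ω y (u y) (u y)‖ₑ) ⊆ x.source := fun y hy => by
    by_contra h
    exact hy (by simp [h0 y h, herm_zero_left])
  rw [← setLIntegral_eq_of_support_subset h1, area_eq_map hx, lintegral_map' (by
      have := hm.restrict (s := x.source)
      rwa [area_eq_map hx] at this) (aemeasurable_symm_coordArea ω x), coordArea_eq,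
    lintegral_withDensity_eq_lintegral_mul₀' (aemeasurable_density hx) (by
      have := hm.restrict (s := x.source)
      rw [area_eq_map hx] at this
      have := this.comp_aemeasurable (aemeasurable_symm_coordArea ω x)
      rwa [coordArea_eq] at this)]
  refine setLIntegral_congr_fun x.open_target.measurableSet fun z hz => ?_
  simp
  rw [hs.herm_eq_rep u u (x.map_target hz), x.right_inv hz, enorm_mul, enorm_mul, RCLike.enorm_conj]
  by_cases hC : coefficient ω.1 x z = 0
  · rw [hC]; simp
  · have h2 : ‖coefficient ω.1 x z‖ₑ ^ 2 * ‖((‖coefficient ω.1 x z‖ : ℝ) : ℂ)⁻¹‖ₑ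
        = ‖coefficient ω.1 x z‖ₑ := by
      rw [enorm_inv (by simpa using hC), show ‖((‖coefficient ω.1 x z‖ : ℝ) : ℂ)‖ₑ
        = ‖coefficient ω.1 x z‖ₑ by
          rw [← ofReal_norm, norm_real, norm_norm, ofReal_norm], sq, mul_assoc,
        ENNReal.mul_inv_cancel (by simpa using hC) (by simp), mul_one]
    rw [← mul_assoc, mul_comm _ (_ * _), mul_assoc, h2, sq]

lemma component_apply {x₀ y : X} (hy : y ∈ (trivializationAt ℂ C x₀).baseSet) (a : C y) :
  component C x₀ y a = (trivializationAt ℂ C x₀ ⟨y, a⟩).2 := by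
  rw [component, Trivialization.linearMapAt_apply, if_pos hy]

lemma baseSet_mem_nhds (y : X) : (trivializationAt ℂ C y).baseSet ∈ 𝓝 y :=
  (trivializationAt ℂ C y).open_baseSet.mem_nhds (FiberBundle.mem_baseSet_trivializationAt' y)

lemma IsSpinorChart.continuousOn_component (hs : IsSpinorChart S x e) (x₀ : X) :
  ContinuousOn (fun y => component C x₀ y (e y))
    (x.source ∩ (trivializationAt ℂ C x₀).baseSet) := by
  have h1 : ContinuousOn (fun y => TotalSpace.mk' ℂ y (e y))
      (x.source ∩ (trivializationAt ℂ C x₀).baseSet) :=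
    hs.holomorphic.continuousOn.mono Set.inter_subset_left
  have h2 := ((trivializationAt ℂ C x₀).continuousOn_toFun.comp h1 fun y hy => by
    rw [Trivialization.mem_source]; exact hy.2)
  refine (continuous_snd.comp_continuousOn h2).congr fun y hy => ?_
  exact component_apply hy.2 _

lemma contMDiffAt_real {f : X → ℂ} {y : X} (h : ContMDiffAt 𝓘(ℂ) 𝓘(ℂ) ⊤ω f y) :
  ContMDiffAt 𝓘(ℝ, ℂ) 𝓘(ℝ, ℂ) ∞ f y := by
  refine ⟨h.1, ?_⟩
  have := h.2
  exact (this.restrict_scalars ℝ).of_le le_top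

lemma IsSpinorChart.contMDiffAt_component (hs : IsSpinorChart S x e) {y : X} (hy : y ∈ x.source) :
  ContMDiffAt 𝓘(ℂ) 𝓘(ℂ) ⊤ω (fun y' => component C y y' (e y')) y := by
  have h := (contMDiffAt_section y).1 (hs.holomorphic.contMDiffAt (x.open_source.mem_nhds hy))
  refine h.congr_of_eventuallyEq ?_
  filter_upwards [baseSet_mem_nhds (C := C) y] with y' hy'
  exact component_apply hy' _

lemma contMDiffAt_section_iff {u : ∀ y, C y} (y : X) : ContMDiffAt 𝓘(ℝ, ℂ) (𝓘(ℝ, ℂ).prod 𝓘(ℝ, ℂ)) ∞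
    (fun y => TotalSpace.mk' ℂ y (u y)) y ↔
  ContMDiffAt 𝓘(ℝ, ℂ) 𝓘(ℝ, ℂ) ∞ (fun y' => component C y y' (u y')) y := by
  rw [contMDiffAt_section]
  refine Filter.EventuallyEq.contMDiffAt_iff ?_
  filter_upwards [baseSet_mem_nhds (C := C) y] with y' hy'
  exact (component_apply hy' _).symm

lemma contMDiffAt_mul {f g : X → ℂ} {y : X} (hf : ContMDiffAt 𝓘(ℝ, ℂ) 𝓘(ℝ, ℂ) ∞ f y)
  (hg : ContMDiffAt 𝓘(ℝ, ℂ) 𝓘(ℝ, ℂ) ∞ g y) :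
  ContMDiffAt 𝓘(ℝ, ℂ) 𝓘(ℝ, ℂ) ∞ (fun y => f y * g y) y :=
  ContMDiffAt.comp (I' := 𝓘(ℝ, ℂ × ℂ)) (g := fun p : ℂ × ℂ => p.1 * p.2) y
    (contDiff_mul (𝕜 := ℝ) (𝔸 := ℂ)).contMDiff.contMDiffAt (hf.prodMk_space hg)

lemma IsSpinorChart.contMDiffAt_iff_rep (hs : IsSpinorChart S x e) {y : X} (hy : y ∈ x.source) :
  ContMDiffAt 𝓘(ℝ, ℂ) (𝓘(ℝ, ℂ).prod 𝓘(ℝ, ℂ)) ∞ (fun y => TotalSpace.mk' ℂ y (u y)) y ↔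
  ContDiffAt ℝ ∞ (rep x e u) (x y) := by
  have hx := hs.mem_maximalAtlas
  have hcx := contMDiffAt_of_mem_maximalAtlas (HolAtlas.real hx) hy
  have hcs := contMDiffAt_symm_of_mem_maximalAtlas (HolAtlas.real hx) (x.map_source hy)
  have hce := contMDiffAt_real (hs.contMDiffAt_component hy)
  rw [contMDiffAt_section_iff, ← contMDiffAt_iff_contDiffAt]
  have hby := FiberBundle.mem_baseSet_trivializationAt' (F := ℂ) (E := C) y
  constructor
  · intro h
    have h1 : ContMDiffAt 𝓘(ℝ, ℂ) 𝓘(ℝ, ℂ) ∞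
        (fun y' => component C y y' (u y') * (component C y y' (e y'))⁻¹) y := by
      refine contMDiffAt_mul h ?_
      exact (contDiffAt_inv ℝ (component_ne_zero hby (hs.ne_zero hy))).contMDiffAt.comp y hce
    have h2 := ContMDiffAt.comp (x y) (g := fun y' => component C y y' (u y')
      * (component C y y' (e y'))⁻¹) (by rwa [x.left_inv hy]) hcs
    refine h2.congr_of_eventuallyEq ?_
    filter_upwards [x.open_target.mem_nhds (x.map_source hy),
      (x.continuousAt_symm (x.map_source hy)).preimage_mem_nhds (by
        rw [x.left_inv hy]; exact baseSet_mem_nhds (C := C) y)] with z hz hz'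
    have h3 := hs.eq_rep_smul u (x.map_target hz)
    rw [x.right_inv hz] at h3
    simp
    rw [h3, map_smul, smul_eq_mul, mul_assoc, mul_inv_cancel₀
      (component_ne_zero hz' (hs.ne_zero (x.map_target hz))), mul_one]
  · intro h
    have h1 := contMDiffAt_mul (h.comp y hcx) hce
    refine h1.congr_of_eventuallyEq ?_
    filter_upwards [x.open_source.mem_nhds hy] with y' hy'
    simp
    conv_lhs => rw [hs.eq_rep_smul u hy', map_smul, smul_eq_mul]

lemma isClosed_image_symm {K : Set ℂ} (hK : IsCompact K) (h : K ⊆ x.target) :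
  IsClosed (x.symm '' K) :=
  (hK.image_of_continuousOn (x.continuousOn_symm.mono h)).isClosed

lemma lift_eq_zero {g : ℂ → ℂ} {y : X} (hy : y ∉ x.symm '' tsupport g) : lift x e g y = 0 := by
  by_cases h : y ∈ x.source
  · rw [lift_apply h, zero_off_tsupport fun h' => hy ⟨x y, h', x.left_inv h⟩, zero_smul]
  · exact lift_of_notMem h

lemma IsSpinorChart.isTestSection_lift (hs : IsSpinorChart S x e) {g : ℂ → ℂ}
  (hg : ContDiff ℝ ∞ g) (hc : HasCompactSupport g)
  (ht : tsupport g ⊆ x.target) (h0 : ∀ z ∈ tsupport g, coefficient ω.1 x z ≠ 0) :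
  IsTestSection ω (lift x e g) := by
  have hcl := isClosed_image_symm hc ht
  constructor
  · intro y
    by_cases hy : y ∈ x.source
    · rw [hs.contMDiffAt_iff_rep hy]
      refine hg.contDiffAt.congr_of_eventuallyEq ?_
      filter_upwards [x.open_target.mem_nhds (x.map_source hy)] with z hz using hs.rep_lift g hz
    · rw [contMDiffAt_section_iff]
      have hy' : y ∉ x.symm '' tsupport g := by
        rintro ⟨z, hz, rfl⟩
        exact hy (x.map_target (ht hz))
      refine (contMDiffAt_const (c := (0 : ℂ))).congr_of_eventuallyEq ?_
      filter_upwards [hcl.isOpen_compl.mem_nhds hy'] with y' h'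
      rw [lift_eq_zero h', map_zero]
  · refine (closure_minimal ?_ hcl).trans ?_
    · intro y hy
      by_contra h
      exact hy (lift_eq_zero h)
    · rintro _ ⟨z, hz, rfl⟩
      intro h
      have := (form_eq_zero_iff ω hs.mem_maximalAtlas (x.map_target (ht hz))).1 h
      rw [x.right_inv (ht hz)] at this
      exact h0 z hz this

lemma IsSpinorChart.laplacian_eq (hs : IsSpinorChart S x e) (u : ∀ y, C y) {y : X}
  (hy : y ∈ x.source) (hu : ∀ᶠ z in 𝓝 (x y), ContDiffAt ℝ 2 (rep x e u) z)
  (h0 : coefficient ω.1 x (x y) ≠ 0) :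
  laplacian S ω u y = locLap (coefficient ω.1 x) (fun z => (‖coefficient ω.1 x z‖ : ℂ)⁻¹)
    (rep x e u) (x y) • e y := by
  have hx := hs.mem_maximalAtlas
  set c := chartAt ℂ y with hc
  have hyc : y ∈ c.source := mem_chart_source ℂ y
  have hz := mem_overlap_chart hyc hy
  have hτ := differentiableOn_chg (chart_mem y) hx
  have hby := FiberBundle.mem_baseSet_trivializationAt' (F := ℂ) (E := C) y
  set a : ℂ → ℂ := fun w => component C y (c.symm w) (e (c.symm w)) with ha
  have hov := (isOpen_overlap c x).mem_nhds hz
  have hb := (c.continuousAt_symm (c.map_source hyc)).preimage_mem_nhds (by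
      rw [c.left_inv hyc]; exact baseSet_mem_nhds (C := C) y)
  have had : ∀ᶠ w in 𝓝 (c y), DifferentiableAt ℂ a w := by
    have h1 : ContMDiffAt 𝓘(ℂ) 𝓘(ℂ) ⊤ω a (c y) := by
      refine ContMDiffAt.comp (c y) (g := fun y' => component C y y' (e y')) ?_
        (contMDiffAt_symm_of_mem_maximalAtlas (chart_mem y) (c.map_source hyc))
      rw [c.left_inv hyc]
      exact hs.contMDiffAt_component hy
    have h2 := (contMDiffAt_iff_contDiffAt.1 h1).of_le (m := 1) (by simp)
    exact (h2.eventually (by simp)).mono fun w hw => hw.differentiableAt (by simp)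
  have hane : ∀ᶠ w in 𝓝 (c y), a w ≠ 0 := by
    filter_upwards [hb, hov] with w h1 h2
    exact component_ne_zero h1 (hs.ne_zero h2.2)
  have hτy : chg c x (c y) = x y := chg_apply hyc
  have hC := coefficient_eq ω.1 (chart_mem y) hx hz
  have key := locLap_comp (c := coefficient ω.1 c) (h := fun z => (metric S ω y (c.symm z) : ℂ))
    (f := fun z => component C y (c.symm z) (u (c.symm z))) (C := coefficient ω.1 x)
    (H := fun z => (‖coefficient ω.1 x z‖ : ℂ)⁻¹) (r := rep x e u) (a := a) (τ := chg c x)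
    (τ' := deriv (chg c x)) (z := c y) had hane.self_of_nhds
    (by filter_upwards [hov] with w hw using hasDerivAt_chg (chart_mem y) hx hw)
    ((hτ.deriv (isOpen_overlap c x)).differentiableAt hov)
    (deriv_chg_ne_zero (chart_mem y) hx hz) hC
    (by
      filter_upwards [hb, hov, hane] with w h1 h2 h3
      have e1 : frame C y (c.symm w) = (a w)⁻¹ • e (c.symm w) := by
        rw [eq_inv_smul_iff₀ h3]
        exact component_smul_frame y _ h1 _
      rw [metric, e1, map_smul, map_smul, LinearMap.smul_apply, quot_smul, quot_smul,
        hs.quot_self h2.2, norm_mul, norm_mul, norm_inv, norm_inv]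
      push_cast
      rw [chg]
      ring)
    (by
      filter_upwards [hov] with w hw
      rw [hs.eq_rep_smul u hw.2, map_smul, smul_eq_mul, mul_comm]
      rfl)
    (by rwa [hτy])
    (by
      rw [hτy]
      have h1 := ((differentiableOn_coefficient ω hx).differentiableAt
          (x.open_target.mem_nhds (x.map_source hy))).restrictScalars ℝ
      have h2 := ofRealCLM.differentiableAt.comp (x y) (h1.norm ℝ h0)
      exact h2.inv (by simpa using h0))
  rw [hτy] at key
  change locLap (coefficient ω.1 c) (fun z => (metric S ω y (c.symm z) : ℂ))
    (fun z => component C y (c.symm z) (u (c.symm z))) (c y) • frame C y y = _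
  rw [key, mul_comm, mul_smul]
  congr 1
  have : ∀ y', y' = y → component C y y' (e y') • frame C y y = e y := by
    rintro _ rfl
    exact component_smul_frame _ _ hby _
  exact this _ (c.left_inv hyc)

lemma laplacian_congr {y : X} (h : ∀ᶠ y' in 𝓝 y, u y' = v y') :
  laplacian S ω u y = laplacian S ω v y := by
  set c := chartAt ℂ y with hc
  have hyc := mem_chart_source ℂ y
  have h1 := (c.continuousAt_symm (c.map_source hyc)).eventually (by rwa [c.left_inv hyc])
  have h2 : (fun z => component C y (c.symm z) (u (c.symm z))) =ᶠ[𝓝 (c y)]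
      fun z => component C y (c.symm z) (v (c.symm z)) := by
    filter_upwards [h1] with w hw
    rw [hw]
  change locLap (coefficient ω.1 c) (fun z => (metric S ω y (c.symm z) : ℂ))
    (fun z => component C y (c.symm z) (u (c.symm z))) (c y) • frame C y y
    = locLap (coefficient ω.1 c) (fun z => (metric S ω y (c.symm z) : ℂ))
    (fun z => component C y (c.symm z) (v (c.symm z))) (c y) • frame C y y
  rw [locLap_congr h2]

lemma laplacian_eq_zero {y : X} (h : ∀ᶠ y' in 𝓝 y, u y' = 0) : laplacian S ω u y = 0 := by
  rw [laplacian_congr (v := fun _ => 0) h]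
  simp [laplacian]
  have : wirtingerBar (fun _ => (0 : ℂ)) = fun _ => 0 := by ext z; simp [wirtingerBar]
  rw [this]
  simp [wirtinger]

/-! ### Existence of flat and distinguished charts -/

lemma exists_analytic_sqrt {h : ℂ → ℂ} {z₀ : ℂ} (hh : AnalyticAt ℂ h z₀) (h0 : h z₀ ≠ 0) :
  ∃ s : ℂ → ℂ, AnalyticAt ℂ s z₀ ∧ ∀ᶠ z in 𝓝 z₀, s z ^ 2 = h z := by
  refine ⟨fun z => exp (log (h z₀) / 2) * exp (log (h z / h z₀) / 2), ?_, ?_⟩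
  · have h1 := (hh.div analyticAt_const h0).clog (by simp_all)
    fun_prop
  · filter_upwards [hh.continuousAt.eventually_ne h0] with z hz
    rw [mul_pow, ← exp_nat_mul, ← exp_nat_mul]
    push_cast
    rw [mul_div_cancel₀ _ two_ne_zero, mul_div_cancel₀ _ two_ne_zero, exp_log h0,
      exp_log (div_ne_zero hz h0), mul_div_cancel₀ _ h0]

lemma exists_local_homeomorph {G : ℂ → ℂ} {z₀ : ℂ} {V : Set ℂ} (hV : V ∈ 𝓝 z₀)
  (hG : AnalyticAt ℂ G z₀) (hd : deriv G z₀ ≠ 0) :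
  ∃ φ : OpenPartialHomeomorph ℂ ℂ, z₀ ∈ φ.source ∧ φ.source ⊆ V ∧ (∀ z, φ z = G z) ∧
    (∀ z ∈ φ.source, AnalyticAt ℂ G z ∧ deriv G z ≠ 0) ∧
    ContDiffOn ℂ ⊤ω φ φ.source ∧
    ContDiffOn ℂ ⊤ω φ.symm φ.target := by
  have hev := (show ∀ᶠ z in 𝓝 z₀, z ∈ V from hV).and (hG.eventually_analyticAt.and
      (hG.deriv.continuousAt.eventually_ne hd))
  obtain ⟨W, hW, hWo, hzW⟩ := eventually_nhds_iff.1 hev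
  have hs := hG.hasStrictDerivAt
  set φ₀ := (hs.hasStrictFDerivAt_equiv hd).toOpenPartialHomeomorph G with hφ₀
  have hsrc : (φ₀.restr W).source = φ₀.source ∩ W := by grind
  have hco : ∀ z, φ₀.restr W z = G z := fun z => rfl
  refine ⟨φ₀.restr W, ?_, ?_, hco, ?_, ?_, ?_⟩
  · rw [hsrc]
    exact ⟨(hs.hasStrictFDerivAt_equiv hd).mem_toOpenPartialHomeomorph_source, hzW⟩
  · grind
  · grind
  · rw [hsrc]
    intro z hz
    exact (hW z hz.2).2.1.contDiffAt.contDiffWithinAt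
  · intro w hw
    have h1 := (φ₀.restr W).map_target hw
    rw [hsrc] at h1
    have h2 := (hW _ h1.2).2
    exact ((φ₀.restr W).contDiffAt_symm_deriv h2.2 hw h2.1.differentiableAt.hasDerivAt
      h2.1.contDiffAt).contDiffWithinAt

lemma coefficient_ne_zero (η : ∀ y : X, Cotangent X y) {x₀ y : X}
  (hy : y ∈ (chartAt ℂ x₀).source) (h : η y ≠ 0) :
  coefficient η (chartAt ℂ x₀) (chartAt ℂ x₀ y) ≠ 0 := by
  have hv := mfderiv_symm_ne_zero x₀ y hy
  have key : ∀ y' : X, y' = y → ∀ v : ℂ, v ≠ 0 → (η y' v : ℂ) ≠ 0 := by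
    rintro _ rfl v hv
    rw [cotangent_apply (η _)]
    exact mul_ne_zero hv fun h' => h (ContinuousLinearMap.ext_ring h')
  exact key _ ((chartAt ℂ x₀).left_inv hy) _ hv

variable [ContMDiffVectorBundle ⊤ω ℂ C 𝓘(ℂ)]

lemma exists_spinorChart (S : SpinStructure C) (ω : HolomorphicForm X) {y₀ : X} {U : Set X}
  (hU : U ∈ 𝓝 y₀) {G : ℂ → ℂ} (hG : AnalyticAt ℂ G (chartAt ℂ y₀ y₀))
  (hd : deriv G (chartAt ℂ y₀ y₀) ≠ 0) {V : Set ℂ} (hV : V ∈ 𝓝 (chartAt ℂ y₀ y₀)) :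
  ∃ (x : Chart) (e : ∀ y, C y), IsSpinorChart S x e ∧ y₀ ∈ x.source ∧
    x.source ⊆ U ∧ ∀ y ∈ x.source, y ∈ (chartAt ℂ y₀).source ∧ chartAt ℂ y₀ y ∈ V ∧
      x y = G (chartAt ℂ y₀ y) ∧ deriv G (chartAt ℂ y₀ y) ≠ 0 ∧
      coefficient ω.1 (chartAt ℂ y₀) (chartAt ℂ y₀ y)
        = coefficient ω.1 x (x y) * deriv G (chartAt ℂ y₀ y) := by
  set c := chartAt ℂ y₀ with hc
  set η : ∀ y : X, Cotangent X y := fun y => S.mul y (frame C y₀ y) (frame C y₀ y) with hη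
  set D := c.target ∩ c.symm ⁻¹' (trivializationAt ℂ C y₀).baseSet with hD
  have hyc := mem_chart_source ℂ y₀
  have hDo := c.isOpen_inter_preimage_symm (trivializationAt ℂ C y₀).open_baseSet
  have hzD : c y₀ ∈ D := ⟨c.map_source hyc, by
    rw [Set.mem_preimage, c.left_inv hyc]
    exact FiberBundle.mem_baseSet_trivializationAt' y₀⟩
  have hm := (S.holomorphic y₀).analyticAt (hDo.mem_nhds hzD)
  have hη0 : ∀ y ∈ (trivializationAt ℂ C y₀).baseSet, η y ≠ 0 := fun y hy =>
    S.mul_ne_zero y _ _ (frame_ne_zero y₀ y hy) (frame_ne_zero y₀ y hy)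
  have hm0 := coefficient_ne_zero η hyc (hη0 _ (FiberBundle.mem_baseSet_trivializationAt' y₀))
  obtain ⟨s, hs, hs2⟩ := exists_analytic_sqrt (hG.deriv.div hm hm0) (div_ne_zero hd hm0)
  have hU' := (c.continuousAt_symm (c.map_source hyc)).preimage_mem_nhds (by rwa [c.left_inv hyc])
  have hVW := inter_mem (inter_mem (inter_mem hV hU') (hDo.mem_nhds hzD))
      (hs2.and hs.eventually_analyticAt)
  obtain ⟨φ, h1, h2, h3, h4, h5, h6⟩ := exists_local_homeomorph hVW hG hd
  set x := c.trans φ with hx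
  have hsrc : ∀ y, y ∈ x.source ↔ y ∈ c.source ∧ c y ∈ φ.source := fun y => by simp_all
  have hxA : x ∈ HolAtlas X := by
    refine OpenPartialHomeomorph.mem_maximalAtlas_of_contMDiffOn x ?_ ?_
    · refine (contMDiffOn_iff_contDiffOn.2 h5).comp ((contMDiffOn_of_mem_maximalAtlas
        (chart_mem y₀)).mono fun y hy => ((hsrc y).1 hy).1) fun y hy => ((hsrc y).1 hy).2
    · have ht : ∀ z ∈ x.target, z ∈ φ.target ∧ φ.symm z ∈ c.target := fun z hz => by simp_all
      refine (contMDiffOn_symm_of_mem_maximalAtlas (chart_mem y₀)).comp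
        ((contMDiffOn_iff_contDiffOn.2 h6).mono fun z hz => (ht z hz).1) fun z hz => (ht z hz).2
  have hxy : ∀ y, x y = G (c y) := fun y => h3 _
  have hcoef : ∀ θ : ∀ y : X, Cotangent X y, ∀ y ∈ x.source,
      coefficient θ c (c y) = coefficient θ x (x y) * deriv G (c y) := fun θ y hy => by
    have hy' := (hsrc y).1 hy
    have ho := mem_overlap_chart hy'.1 hy
    rw [coefficient_eq θ (chart_mem y₀) hxA ho, chg_apply hy'.1]
    congr 1
    refine Filter.EventuallyEq.deriv_eq ?_
    filter_upwards [c.open_target.mem_nhds (c.map_source hy'.1)] with z hz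
    rw [chg, hxy, c.right_inv hz]
  have hbase : ∀ y ∈ x.source, y ∈ (trivializationAt ℂ C y₀).baseSet := fun y hy => by
    have hy' := (hsrc y).1 hy
    have := (h2 hy'.2).1.2.2
    rwa [Set.mem_preimage, c.left_inv hy'.1] at this
  refine ⟨x, fun y => s (c y) • frame C y₀ y, ⟨hxA, ?_, ?_⟩, (hsrc _).2 ⟨hyc, h1⟩, ?_, ?_⟩
  · rw [(trivializationAt ℂ C y₀).contMDiffOn_section_iff x.open_source hbase]
    have : ContMDiffOn 𝓘(ℂ) 𝓘(ℂ) ⊤ω (fun y => s (c y)) x.source := by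
      intro y hy
      have hy' := (hsrc y).1 hy
      have h7 := (h2 hy'.2).2.2
      exact (h7.contDiffAt.contMDiffAt.comp y
        (contMDiffAt_of_mem_maximalAtlas (chart_mem y₀) hy'.1)).contMDiffWithinAt
    refine this.congr fun y hy => ?_
    rw [← component_apply (hbase y hy), map_smul, component_frame y₀ y (hbase y hy), smul_eq_mul,
      mul_one]
  · intro z hz
    set y := x.symm z with hy
    have hys := x.map_target hz
    have hy' := (hsrc y).1 hys
    have hxz := x.right_inv hz
    have e1 : coefficient (fun y => S.mul y (s (c y) • frame C y₀ y) (s (c y) • frame C y₀ y)) x z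
        = s (c y) ^ 2 * coefficient η x z := by
      simp
      change s (c y) * (s (c y) * _) = _
      rw [← mul_assoc, ← sq]
      rfl
    have e2 := hcoef η y hys
    rw [hxz] at e2
    have e3 := (h2 hy'.2).2.1
    have e4 := coefficient_ne_zero η hy'.1 (hη0 y (hbase y hys))
    rw [e1, e3, Pi.div_apply, e2]
    grind
  · intro y hy
    have hy' := (hsrc y).1 hy
    have := (h2 hy'.2).1.1.2
    rwa [Set.mem_preimage, c.left_inv hy'.1] at this
  · intro y hy
    have hy' := (hsrc y).1 hy
    exact ⟨hy'.1, (h2 hy'.2).1.1.1, hxy y, (h4 _ hy'.2).2, hcoef ω.1 y hy⟩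

lemma exists_flatChart (S : SpinStructure C) (ω : HolomorphicForm X) {y₀ : X}
  (h0 : ω.1 y₀ ≠ 0) {U : Set X} (hU : U ∈ 𝓝 y₀) :
  ∃ (x : Chart) (e : ∀ y, C y), IsFlatChart S ω x e ∧ y₀ ∈ x.source ∧ x.source ⊆ U := by
  set c := chartAt ℂ y₀ with hc
  have hyc := mem_chart_source ℂ y₀
  obtain ⟨r, hr, hball⟩ := Metric.isOpen_iff.1 c.open_target _ (c.map_source hyc)
  obtain ⟨G, hG⟩ := ((ω.2 y₀).mono hball).isExactOn_ball
  have hball' : Metric.ball (c y₀) r ∈ 𝓝 (c y₀) := Metric.ball_mem_nhds _ hr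
  have hGa := DifferentiableOn.analyticAt
    (fun z hz => (hG z hz).differentiableAt.differentiableWithinAt) hball'
  have hd : deriv G (c y₀) ≠ 0 := by
    rw [(hG _ (Metric.mem_ball_self hr)).deriv]
    exact coefficient_ne_zero ω.1 hyc h0
  obtain ⟨x, e, hs, h1, h2, h3⟩ := exists_spinorChart S ω hU hGa hd hball'
  refine ⟨x, e, ⟨hs, fun z hz => ?_⟩, h1, h2⟩
  obtain ⟨-, h5, -, h7, h8⟩ := h3 _ (x.map_target hz)
  rw [x.right_inv hz, (hG _ h5).deriv] at h8
  rw [(hG _ h5).deriv] at h7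
  exact (mul_eq_right₀ h7).1 h8.symm

lemma exists_distinguishedChart (S : SpinStructure C) (ω : HolomorphicForm X) {p : X}
  (h0 : IsSimpleZero ω p) {U : Set X} (hU : U ∈ 𝓝 p) :
  ∃ (x : Chart) (e : ∀ y, C y), IsDistinguishedChart S ω p x e ∧ x.source ⊆ U := by
  set c := chartAt ℂ p with hc
  set f := coefficient ω.1 c with hf
  set z₀ := c p with hz₀
  have hpc : p ∈ c.source := mem_chart_source ℂ p
  obtain ⟨r, hr, hball⟩ := Metric.isOpen_iff.1 c.open_target _ (c.map_source hpc)
  have hfb : DifferentiableOn ℂ f (Metric.ball z₀ r) := (ω.2 p).mono hball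
  obtain ⟨F, hF0, hF⟩ := hfb.isExactOn_ball.with_val_at z₀ 0
  have hball' : Metric.ball z₀ r ∈ 𝓝 z₀ := Metric.ball_mem_nhds _ hr
  have hFd : DifferentiableOn ℂ F (Metric.ball z₀ r) :=
    fun z hz => (hF z hz).differentiableAt.differentiableWithinAt
  have hfz : f z₀ = 0 := (eq_zero_iff ω p p hpc).1 h0.1
  set q₁ := dslope F z₀ with hq₁
  set q := dslope q₁ z₀ with hq
  have hq₁d : DifferentiableOn ℂ q₁ (Metric.ball z₀ r) := (differentiableOn_dslope hball').2 hFd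
  have hqd : DifferentiableOn ℂ q (Metric.ball z₀ r) := (differentiableOn_dslope hball').2 hq₁d
  have hq₁0 : q₁ z₀ = 0 := by rw [hq₁, dslope_same, (hF _ (Metric.mem_ball_self hr)).deriv, hfz]
  have hFq : ∀ z, F z = (z - z₀) ^ 2 * q z := fun z => by
    have e1 : (z - z₀) • q₁ z = F z - F z₀ := sub_smul_dslope F z₀ z
    have e2 : (z - z₀) • q z = q₁ z - q₁ z₀ := sub_smul_dslope q₁ z₀ z
    rw [hF0, sub_zero, smul_eq_mul] at e1
    rw [hq₁0, sub_zero, smul_eq_mul] at e2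
    rw [← e1, ← e2]; ring
  have hqa : AnalyticAt ℂ q z₀ := hqd.analyticAt hball'
  have hq0 : q z₀ ≠ 0 := by
    have hfa : HasDerivAt f (deriv f z₀) z₀ := (hfb.differentiableAt hball').hasDerivAt
    have hfe : f =ᶠ[𝓝 z₀] fun z => 2 * (z - z₀) * q z + (z - z₀) ^ 2 * deriv q z := by
      filter_upwards [Metric.isOpen_ball.mem_nhds (Metric.mem_ball_self hr)] with z hz
      have h1 : HasDerivAt F (f z) z := hF z hz
      have h2 : HasDerivAt q (deriv q z) z :=
        (hqd.differentiableAt (Metric.isOpen_ball.mem_nhds hz)).hasDerivAt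
      have h3 := ((((hasDerivAt_id z).sub_const z₀).pow 2).mul h2)
      have h4 : F = (fun z => z - z₀) ^ 2 * q := by ext w; simp [hFq w]
      rw [h4] at h1
      have := h1.unique h3
      simpa using this
    have h5 : HasDerivAt (fun z => 2 * (z - z₀) * q z + (z - z₀) ^ 2 * deriv q z)
        (2 * q z₀) z₀ := by
      have h6 := ((((hasDerivAt_id z₀).sub_const z₀).const_mul 2).mul
        hqa.differentiableAt.hasDerivAt).add
        ((((hasDerivAt_id z₀).sub_const z₀).pow 2).mul hqa.deriv.differentiableAt.hasDerivAt)
      refine h6.congr_deriv ?_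
      simp
    have h7 := (h5.congr_of_eventuallyEq hfe).unique hfa
    intro h8
    rw [h8, mul_zero] at h7
    exact h0.2 h7.symm
  obtain ⟨s, hsa, hs2⟩ := exists_analytic_sqrt (h := fun z => 2 * q z) (z₀ := z₀)
    (analyticAt_const.mul hqa) (mul_ne_zero two_ne_zero hq0)
  set G : ℂ → ℂ := fun z => (z - z₀) * s z with hG
  have hGa : AnalyticAt ℂ G z₀ := (analyticAt_id.sub analyticAt_const).mul hsa
  have hGd : deriv G z₀ ≠ 0 := by
    have h1 := (((hasDerivAt_id z₀).sub_const z₀).mul hsa.differentiableAt.hasDerivAt).deriv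
    have h2 : deriv G z₀ = s z₀ := by
      refine Eq.trans h1 ?_
      simp
    rw [h2]
    intro h3
    have := hs2.self_of_nhds
    grind
  have hGf : ∀ᶠ z in 𝓝 z₀, f z = G z * deriv G z := by
    filter_upwards [hball', Metric.isOpen_ball.mem_nhds (Metric.mem_ball_self hr),
      hs2.eventually_nhds, hGa.eventually_analyticAt] with z hz _ h1 h2
    have h3 : F =ᶠ[𝓝 z] fun z => G z ^ 2 / 2 := by
      filter_upwards [h1] with w hw
      grind
    have h4 := (h2.differentiableAt.hasDerivAt.pow 2).div_const 2
    have h5 := ((hF z hz).congr_of_eventuallyEq h3.symm).unique h4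
    rw [h5]
    ring
  obtain ⟨x, e, hs, h1, h2, h3⟩ := exists_spinorChart S ω hU hGa hGd hGf
  refine ⟨x, e, ⟨hs, h1, ?_, fun z hz => ?_⟩, h2⟩
  · grind
  · obtain ⟨-, h5, h6, h7, h8⟩ := h3 _ (x.map_target hz)
    rw [x.right_inv hz] at h6 h8
    grind

/-! ### Square integrable sections -/

/-- A chart with a frame in which `ω = k(z) dz`, where `k` vanishes at most at the origin. -/
structure IsGoodChart (S : SpinStructure C) (ω : HolomorphicForm X)
    (x : Chart) (e : ∀ y, C y) (k : ℂ → ℂ) : Prop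
    extends IsSpinorChart S x e where
  form : ∀ z ∈ x.target, coefficient ω.1 x z = k z
  zero : ∀ z, k z = 0 → z = 0

lemma IsFlatChart.good (h : IsFlatChart S ω x e) : IsGoodChart S ω x e fun _ => 1 :=
  ⟨h.toIsSpinorChart, h.flat, fun _ h => absurd h one_ne_zero⟩

lemma IsDistinguishedChart.good {p : X} (h : IsDistinguishedChart S ω p x e) :
  IsGoodChart S ω x e fun z => z :=
  ⟨h.toIsSpinorChart, h.distinguished, fun _ h => h⟩

lemma coordArea_absolutelyContinuous (x : Chart) : coordArea ω x ≪ volume := by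
  rw [coordArea_eq]
  exact (withDensity_absolutelyContinuous _ _).trans
    (Measure.absolutelyContinuous_of_le Measure.restrict_le_self)

lemma area_preimage_null (hx : x ∈ HolAtlas X) {N : Set ℂ} (hN : volume N = 0) :
  area ω (x.source ∩ x ⁻¹' N) = 0 := by
  obtain ⟨N', hNN', hm, h0⟩ := exists_measurable_superset_of_null hN
  refine measure_mono_null (Set.inter_subset_inter_right _ (Set.preimage_mono hNN')) ?_
  have hms : MeasurableSet (x.source ∩ x ⁻¹' N') := by
    have h := (continuousOn_iff_continuous_domRestrict.1 x.continuousOn).measurable hm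
    convert MeasurableSet.subtype_image x.open_source.measurableSet h using 1
    ext y
    simp [and_comm]
  have h1 : area ω (x.source ∩ x ⁻¹' N') = (area ω).restrict x.source (x.source ∩ x ⁻¹' N') := by
    rw [Measure.restrict_apply hms]
    congr 1
    simp
  rw [h1, area_eq_map hx, Measure.map_apply_of_aemeasurable (aemeasurable_symm_coordArea ω x) hms]
  have h2 : x.symm ⁻¹' (x.source ∩ x ⁻¹' N') ⊆ N' ∪ x.targetᶜ := by
    intro z hz
    by_cases hzt : z ∈ x.target
    · simp_all
    · exact .inr hzt
  refine measure_mono_null h2 (measure_union_null (coordArea_absolutelyContinuous x h0) ?_)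
  rw [coordArea, Measure.restrict_apply x.open_target.measurableSet.compl, Set.compl_inter_self,
    measure_empty]

lemma IsGoodChart.volume_preimage_null (hs : IsGoodChart S ω x e k) {A : Set X}
  (hA : area ω A = 0) : volume (x.target ∩ x.symm ⁻¹' A) = 0 := by
  have hx := hs.mem_maximalAtlas
  obtain ⟨A', hAA', hm, h0⟩ := exists_measurable_superset_of_null hA
  refine measure_mono_null (Set.inter_subset_inter_right _ (Set.preimage_mono hAA')) ?_
  have h1 : (area ω).restrict x.source A' = 0 :=
    Measure.absolutelyContinuous_of_le Measure.restrict_le_self h0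
  rw [area_eq_map hx, Measure.map_apply_of_aemeasurable (aemeasurable_symm_coordArea ω x) hm,
    coordArea, Measure.restrict_apply' x.open_target.measurableSet, Set.inter_comm,
    withDensity_apply _ (measurableSet_inter_preimage_symm x hm)] at h1
  have hm' := measurableSet_inter_preimage_symm x hm
  have hd : AEMeasurable (fun z => ‖coefficient ω.1 x z‖ₑ ^ 2)
      (volume.restrict (x.target ∩ x.symm ⁻¹' A')) :=
    (aemeasurable_density hx).mono_measure (Measure.restrict_mono Set.inter_subset_left le_rfl)
  rw [lintegral_eq_zero_iff' hd] at h1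
  have h2 := (ae_restrict_iff' hm').1 h1
  refine measure_mono_null (t := {a | ¬(a ∈ x.target ∩ x.symm ⁻¹' A' →
    ‖coefficient ω.1 x a‖ₑ ^ 2 = (0 : ℂ → ENNReal) a)} ∪ {0}) (fun z hz => ?_)
    (measure_union_null h2 (measure_singleton 0))
  by_cases h : k z = 0
  · exact .inr (hs.zero z h)
  · left
    intro h3
    have := h3 hz
    rw [hs.form z hz.1] at this
    simp at this
    exact h this

lemma aemeasurable_comp_chart (hx : x ∈ HolAtlas X) {g : ℂ → ℂ} (hg : AEMeasurable g volume) :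
  AEMeasurable (fun y => g (x y)) ((area ω).restrict x.source) := by
  have h1 : AEMeasurable (fun y => hg.mk g (x y)) ((area ω).restrict x.source) :=
    hg.measurable_mk.comp_aemeasurable (x.continuousOn.aemeasurable x.open_source.measurableSet)
  refine h1.congr ?_
  rw [Filter.EventuallyEq, ae_restrict_iff' x.open_source.measurableSet, ae_iff]
  refine measure_mono_null ?_ (area_preimage_null (ω := ω) hx (ae_iff.1 hg.ae_eq_mk))
  grind

lemma IsSpinorChart.measurableSection_lift (hs : IsSpinorChart S x e) {g : ℂ → ℂ}
  (hg : AEMeasurable g volume) : Msec (lift x e g) := fun x₀ => by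
  set B := x.source ∩ (trivializationAt ℂ C x₀).baseSet with hB
  have hm : MeasurableSet B :=
    (x.open_source.inter (trivializationAt ℂ C x₀).open_baseSet).measurableSet
  have h1 : AEMeasurable (fun y => g (x y) * component C x₀ y (e y)) ((area ω).restrict B) :=
    ((aemeasurable_comp_chart hs.mem_maximalAtlas hg).mono_measure
      (Measure.restrict_mono Set.inter_subset_left le_rfl)).mul
      ((hs.continuousOn_component x₀).aemeasurable hm)
  refine ((aemeasurable_indicator_iff hm).2 h1).congr (.of_forall fun y => ?_)
  change _ = component C x₀ y (lift x e g y)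
  by_cases hy : y ∈ x.source
  · by_cases hy' : y ∈ (trivializationAt ℂ C x₀).baseSet
    · rw [Set.indicator_of_mem (show y ∈ B from ⟨hy, hy'⟩), lift_apply hy, map_smul, smul_eq_mul]
    · rw [Set.indicator_of_notMem fun h : y ∈ B => hy' h.2, component,
        Trivialization.linearMapAt_apply, if_neg hy']
  · rw [Set.indicator_of_notMem fun h : y ∈ B => hy h.1, lift_of_notMem hy, map_zero]

lemma IsGoodChart.aestronglyMeasurable_rep (hs : IsGoodChart S ω x e k)
  (hu : Msec u) : AEStronglyMeasurable (rep x e u) volume := by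
  obtain ⟨t, ht⟩ := exists_finset_nbhd C
  have hT : MeasurableSet x.target := x.open_target.measurableSet
  have hcomp : ∀ j, AEMeasurable (fun z => component C j (x.symm z) (u (x.symm z)))
      (volume.restrict x.target) := fun j => by
    have h1 : AEMeasurable (fun z => (hu j).mk _ (x.symm z)) (volume.restrict x.target) :=
      (hu j).measurable_mk.comp_aemeasurable (aemeasurable_symm x _)
    refine h1.congr ?_
    rw [Filter.EventuallyEq, ae_restrict_iff' hT, ae_iff]
    refine measure_mono_null ?_ (hs.volume_preimage_null (ae_iff.1 (hu j).ae_eq_mk))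
    grind
  set B : X → Set ℂ := fun j => x.target ∩ x.symm ⁻¹' (trivializationAt ℂ C j).baseSet with hB
  have hBm : ∀ j, MeasurableSet (B j) := fun j =>
    (x.isOpen_inter_preimage_symm (trivializationAt ℂ C j).open_baseSet).measurableSet
  have h2 : ∀ j, AEMeasurable (rep x e u) (volume.restrict (B j)) := fun j => by
    have he : AEMeasurable (fun z => component C j (x.symm z) (e (x.symm z)))
        (volume.restrict (B j)) := by
      refine ContinuousOn.aemeasurable ?_ (hBm j)
      exact (hs.continuousOn_component j).comp (x.continuousOn_symm.mono Set.inter_subset_left)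
        fun z hz => ⟨x.map_target hz.1, hz.2⟩
    refine (((hcomp j).mono_measure (Measure.restrict_mono Set.inter_subset_left le_rfl)).div
      he).congr ?_
    filter_upwards [ae_restrict_mem (hBm j)] with z hz
    have h3 := hs.eq_rep_smul u (x.map_target hz.1)
    rw [x.right_inv hz.1] at h3
    simp
    rw [h3, map_smul, smul_eq_mul,
      mul_div_cancel_right₀ _ (component_ne_zero hz.2 (hs.ne_zero (x.map_target hz.1)))]
  have hU : (⋃ j : t, B j.1) = x.target := by
    ext z
    simp only [Set.mem_iUnion]
    constructor
    · rintro ⟨j, hj⟩; exact hj.1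
    · intro hz
      obtain ⟨j, hj, hj'⟩ := ht (x.symm z)
      exact ⟨⟨j, hj⟩, hz, hj'.2⟩
  have h3 : AEMeasurable (rep x e u) (volume.restrict x.target) := by
    rw [← hU]
    exact aemeasurable_iUnion_iff.2 fun j => h2 j.1
  refine AEMeasurable.aestronglyMeasurable (((aemeasurable_indicator_iff hT).2 h3).congr
    (.of_forall fun z => ?_))
  by_cases hz : z ∈ x.target
  · rw [Set.indicator_of_mem hz]
  · rw [Set.indicator_of_notMem hz, rep_of_notMem hz]

/-- The Hermitian product of two sections. -/
def ip (S : SpinStructure C) (ω : HolomorphicForm X) (u v : ∀ y, C y) : ℂ :=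
  ∫ y, herm S ω y (u y) (v y) ∂(area ω)

/-- The squared norm of a section, as an extended number. -/
def sqNorm (S : SpinStructure C) (ω : HolomorphicForm X) (u : ∀ y, C y) : ENNReal :=
  ∫⁻ y, ‖herm S ω y (u y) (u y)‖ₑ ∂(area ω)

lemma herm_zero_right (y : X) (b : C y) : herm S ω y b 0 = 0 := by simp [herm]

lemma IsGoodChart.ip_eq (hs : IsGoodChart S ω x e k) (hu : Msec u)
  (hv : Msec v) (h0 : ∀ y, y ∉ x.source → v y = 0) :
  ip S ω u v = ∫ z, rep x e u z * conj (rep x e v z) * (‖k z‖ : ℂ) := by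
  have h1 : ∫ z in x.target, rep x e u z * conj (rep x e v z) * (‖k z‖ : ℂ)
      = ∫ z, rep x e u z * conj (rep x e v z) * (‖k z‖ : ℂ) :=
    setIntegral_eq_integral_of_forall_compl_eq_zero fun z hz => by
      rw [rep_of_notMem hz, zero_mul, zero_mul]
  rw [← h1, ip, hs.integral_herm hu hv (fun y hy => by rw [h0 y hy, herm_zero_right])]
  exact setIntegral_congr_fun x.open_target.measurableSet fun z hz => by simp [hs.form z hz]

lemma IsGoodChart.sqNorm_eq (hs : IsGoodChart S ω x e k) (hu : Msec u)
  (h0 : ∀ y, y ∉ x.source → u y = 0) :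
  sqNorm S ω u = ∫⁻ z, ‖rep x e u z‖ₑ ^ 2 * ‖k z‖ₑ := by
  have h1 : ∫⁻ z in x.target, ‖rep x e u z‖ₑ ^ 2 * ‖k z‖ₑ
      = ∫⁻ z, ‖rep x e u z‖ₑ ^ 2 * ‖k z‖ₑ := setLIntegral_eq_of_support_subset fun z hz => by
    by_contra h
    exact hz (by simp only [rep_of_notMem h]; simp)
  rw [← h1, sqNorm, hs.lintegral_herm hu h0]
  exact setLIntegral_congr_fun x.open_target.measurableSet fun z hz => by simp [hs.form z hz]

lemma mem_squareIntegrable_iff (hu : Msec u) : u ∈ L² ↔ sqNorm S ω u < ⊤ :=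
  ⟨fun h => h.2.2, fun h => ⟨hu, (aemeasurable_herm S ω hu hu).aestronglyMeasurable, h⟩⟩

/-- The class of a square integrable section. -/
def cls {u : ∀ y, C y} (hu : u ∈ squareIntegrable S ω) : L2 S ω :=
  SeparationQuotient.mk (X := SquareIntegrable S ω) ⟨u, hu⟩

lemma represents_cls (hu : u ∈ L²) : Represents S ω u (cls hu) := ⟨hu, rfl⟩

lemma exists_cls_eq (a : L2 S ω) : ∃ (u : ∀ y, C y) (hu : u ∈ L²), cls hu = a := by
  obtain ⟨⟨u, hu⟩, rfl⟩ := SeparationQuotient.surjective_mk a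
  exact ⟨u, hu, rfl⟩

lemma inner_cls (hu : u ∈ L²) (hv : v ∈ L²) : inner ℂ (cls hv) (cls hu) = ip S ω u v := by
  exact SeparationQuotient.inner_mk_mk (E := SquareIntegrable S ω) _ _

lemma cls_sub (hu : u ∈ L²) (hv : v ∈ L²)
  (h : (fun y => u y - v y) ∈ L²) : cls h = cls hu - cls hv := rfl

lemma cls_add (hu : u ∈ L²) (hv : v ∈ L²)
  (h : (fun y => u y + v y) ∈ L²) : cls h = cls hu + cls hv := rfl

lemma cls_smul (hu : u ∈ L²) (c : ℂ) (h : (fun y => c • u y) ∈ L²) : cls h = c • cls hu := rfl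

lemma mem_sub (hu : u ∈ L²) (hv : v ∈ L²) : (fun y => u y - v y) ∈ L² := Submodule.sub_mem _ hu hv

lemma mem_add (hu : u ∈ L²) (hv : v ∈ L²) : (fun y => u y + v y) ∈ L² := Submodule.add_mem _ hu hv

lemma mem_smul (c : ℂ) (hu : u ∈ L²) : (fun y => c • u y) ∈ L² := Submodule.smul_mem _ c hu

lemma enorm_cls_sq (hu : u ∈ L²) : ‖cls hu‖ₑ ^ 2 = sqNorm S ω u := by
  have h1 : ‖cls hu‖ = ‖(show SquareIntegrable S ω from ⟨u, hu⟩)‖ := SeparationQuotient.norm_mk _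
  rw [← ofReal_norm, ← ENNReal.ofReal_pow (norm_nonneg _), h1, norm_sq_eq,
    ofReal_integral_norm_eq_lintegral_enorm hu.2]
  rfl

lemma cls_eq_zero_iff (hu : u ∈ L²) : cls hu = 0 ↔ ∀ᵐ y ∂(area ω), u y = 0 := by
  have h1 : cls hu = 0 ↔ sqNorm S ω u = 0 := by rw [← enorm_cls_sq hu]; simp
  rw [h1, sqNorm, lintegral_eq_zero_iff' (aemeasurable_herm S ω hu.1 hu.1).enorm]
  have h0 : ∀ᵐ y ∂(area ω), ω.1 y ≠ 0 := by rw [ae_iff]; simpa using area_zeros ω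
  constructor
  · intro h
    filter_upwards [h, h0] with y hy hy0
    by_contra hne
    have hb := FiberBundle.mem_baseSet_trivializationAt' (F := ℂ) (E := C) y
    have h2 : herm S ω y (u y) (u y) = 0 := by simpa using hy
    rw [herm_self, ofReal_eq_zero, mul_eq_zero] at h2
    rcases h2 with h2 | h2
    · exact metric_ne_zero S ω y y hb hy0 h2
    · exact component_ne_zero hb hne (by simpa using h2)
  · intro h
    filter_upwards [h] with y hy
    rw [hy, herm_zero_left]; simp

lemma cls_eq_iff (hu : u ∈ L²) (hv : v ∈ L²) : cls hu = cls hv ↔ ∀ᵐ y ∂(area ω), u y = v y := by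
  rw [← sub_eq_zero, ← cls_sub hu hv (mem_sub hu hv), cls_eq_zero_iff]
  simp [sub_eq_zero]

lemma IsGoodChart.lift_mem (hs : IsGoodChart S ω x e k) {g : ℂ → ℂ}
  (hg : AEStronglyMeasurable g volume) (hfin : ∫⁻ z, ‖g z‖ₑ ^ 2 * ‖k z‖ₑ < ⊤) :
  lift x e g ∈ L² := by
  have hm := hs.toIsSpinorChart.measurableSection_lift (ω := ω) hg.aemeasurable
  rw [mem_squareIntegrable_iff hm, hs.sqNorm_eq hm fun y hy => lift_of_notMem hy]
  refine lt_of_le_of_lt (lintegral_mono fun z => ?_) hfin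
  by_cases hz : z ∈ x.target
  · rw [hs.rep_lift g hz]
  · rw [rep_of_notMem hz]; simp

/-! ### Test sections -/

/-- The product of a section with a real function. -/
def cut (χ : X → ℝ) (u : ∀ y, C y) : ∀ y, C y := fun y => (χ y : ℂ) • u y

abbrev SmoothFun (χ : X → ℝ) : Prop := ContMDiff 𝓘(ℝ, ℂ) 𝓘(ℝ, ℝ) ∞ χ

/-- Smoothness of a section at a point, in the real sense. -/
abbrev SmoothSectionAt (u : ∀ y, C y) (y : X) : Prop := ContMDiffAt 𝓘(ℝ, ℂ) (𝓘(ℝ, ℂ).prod 𝓘(ℝ, ℂ)) ∞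
    (fun y => TotalSpace.mk' ℂ y (u y)) y

lemma SmoothSectionAt.cut (hχ : SmoothFun χ) {y : X} (hu : SmoothSectionAt u y) :
  SmoothSectionAt (cut χ u) y := by
  rw [SmoothSectionAt, contMDiffAt_section_iff] at *
  have h := contMDiffAt_mul (ContMDiffAt.comp (I' := 𝓘(ℝ, ℝ)) (g := fun t : ℝ => (t : ℂ)) y
    (ofRealCLM.contDiff.contMDiff.contMDiffAt) hχ.contMDiffAt) hu
  refine h.congr_of_eventuallyEq (.of_forall fun y' => ?_)
  simp [SpinorLaplacian.cut]

lemma SmoothSectionAt.add {y : X} (hu : SmoothSectionAt u y) (hv : SmoothSectionAt v y) :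
  SmoothSectionAt (fun y => u y + v y) y := by
  rw [SmoothSectionAt, contMDiffAt_section_iff] at *
  refine (ContMDiffAt.add hu hv).congr_of_eventuallyEq (.of_forall fun y' => ?_)
  simp

lemma IsTestSection.eventually_zero (hu : IsTestSection ω u) {y : X} (hy : ω.1 y = 0) :
  ∀ᶠ y' in 𝓝 y, u y' = 0 := by
  filter_upwards [isClosed_closure.isOpen_compl.mem_nhds fun h => hu.2 h hy] with y' h
  by_contra h'
  exact h (subset_closure h')

lemma isTestSection_of {u : ∀ y, C y} (hu : ∀ y, SmoothSectionAt u y)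
  (h : ∀ y, ω.1 y = 0 → ∀ᶠ y' in 𝓝 y, u y' = 0) : IsTestSection ω u :=
  ⟨hu, fun y hy h0 => mem_closure_iff_frequently.1 hy ((h y h0).mono fun _ h h' => h' h)⟩

lemma IsTestSection.cut (hχ : SmoothFun χ) (hu : IsTestSection ω u) : IsTestSection ω (cut χ u) :=
  isTestSection_of (fun y => SmoothSectionAt.cut hχ (hu.1 y)) fun y hy =>
    (hu.eventually_zero hy).mono fun y' h => by rw [SpinorLaplacian.cut, h, smul_zero]

lemma IsTestSection.add (hu : IsTestSection ω u) (hv : IsTestSection ω v) :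
  IsTestSection ω fun y => u y + v y :=
  isTestSection_of (fun y => SmoothSectionAt.add (hu.1 y) (hv.1 y)) fun y hy => by
    filter_upwards [hu.eventually_zero hy, hv.eventually_zero hy] with y' h h'
    rw [h, h', add_zero]

lemma isTestSection_zero : IsTestSection ω fun y => (0 : C y) :=
  isTestSection_of (fun y => (contMDiffAt_section_iff y).2 (by
    simp; exact contMDiffAt_const)) fun y _ => .of_forall fun _ => rfl

lemma IsCutoff.zero (hχ : IsCutoff x.source χ) {y : X} (hy : y ∉ x.source) : χ y = 0 :=
  zero_off_tsupport fun h => hy (hχ.2 h)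

lemma tsupport_representative (hχ : IsCutoff x.source χ) (u : ∀ y, C y) :
  IsCompact (x '' tsupport χ) ∧ tsupport (representative x e χ u) ⊆ x '' tsupport χ ∧
    x '' tsupport χ ⊆ x.target := by
  have hK := (isClosed_tsupport χ).isCompact.image_of_continuousOn (x.continuousOn.mono hχ.2)
  refine ⟨hK, closure_minimal (fun z hz => ?_) hK.isClosed, ?_⟩
  · by_cases hzt : z ∈ x.target
    · refine ⟨x.symm z, subset_tsupport _ fun h => hz ?_, x.right_inv hzt⟩
      rw [representative_eq, h, ofReal_zero, zero_mul]
    · exact absurd (if_neg hzt) hz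
  · rintro _ ⟨y, hy, rfl⟩
    exact x.map_source (hχ.2 hy)

lemma IsSpinorChart.smooth_representative (hs : IsSpinorChart S x e)
  (hχ : IsCutoff x.source χ) (hu : ∀ y ∈ tsupport χ, SmoothSectionAt u y) :
  SmoothC (representative x e χ u) ∧ HasCompactSupport (representative x e χ u) := by
  obtain ⟨hK, hKs, hKt⟩ := tsupport_representative (e := e) hχ u
  refine ⟨contDiff_iff_contDiffAt.2 fun z => ?_, HasCompactSupport.intro' hK hK.isClosed
    fun z hz => zero_off_tsupport fun h => hz (hKs h)⟩
  by_cases hz : z ∈ x '' tsupport χ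
  · obtain ⟨y, hy, rfl⟩ := hz
    have := (hs.contMDiffAt_iff_rep (hχ.2 hy)).1 (SmoothSectionAt.cut hχ.1 (hu y hy))
    rwa [show rep x e (cut χ u) = representative x e χ u from rep_smul χ u] at this
  · refine (contDiffAt_const (c := (0 : ℂ))).congr_of_eventuallyEq ?_
    filter_upwards [hK.isClosed.isOpen_compl.mem_nhds hz] with w hw
    exact zero_off_tsupport fun h => hw (hKs h)

lemma IsSpinorChart.lift_representative (hs : IsSpinorChart S x e) (hχ : IsCutoff x.source χ) :
  lift x e (representative x e χ u) = cut χ u := by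
  rw [← rep_smul]
  exact hs.lift_rep fun y hy => by rw [hχ.zero hy, ofReal_zero, zero_smul]

lemma IsSpinorChart.rep_lift_eq (hs : IsSpinorChart S x e) {g : ℂ → ℂ}
  (hg : ∀ z ∉ x.target, g z = 0) : rep x e (lift x e g) = g := by
  ext z
  by_cases hz : z ∈ x.target
  · exact hs.rep_lift g hz
  · rw [rep_of_notMem hz, hg z hz]

lemma locLap_congr_coeff {c c' h h' g : ℂ → ℂ} {z : ℂ} (hc : c z = c' z) (hh : h =ᶠ[𝓝 z] h') :
  locLap c h g z = locLap c' h' g z := by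
  have h1 : (fun w => h w * wirtingerBar g w) =ᶠ[𝓝 z] fun w => h' w * wirtingerBar g w :=
    hh.mono fun w hw => by simp [hw]
  rw [locLap, locLap, hc, hh.eq_of_nhds, wirtinger_congr h1]

lemma locLap_add {c h g g' : ℂ → ℂ} {z : ℂ} (hh : DifferentiableAt ℝ h z)
  (hg : ∀ᶠ w in 𝓝 z, ContDiffAt ℝ 2 g w) (hg' : ∀ᶠ w in 𝓝 z, ContDiffAt ℝ 2 g' w) :
  locLap c h (fun w => g w + g' w) z = locLap c h g z + locLap c h g' z := by
  have h1 : (fun w => h w * wirtingerBar (fun w => g w + g' w) w)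
      =ᶠ[𝓝 z] fun w => h w * wirtingerBar g w + h w * wirtingerBar g' w := by
    filter_upwards [hg, hg'] with w h1 h2
    simp [wirtingerBar, fderiv_fun_add (h1.differentiableAt two_ne_zero)
      (h2.differentiableAt two_ne_zero)]
    ring
  rw [locLap, wirtinger_congr h1]
  simp [locLap, wirtinger, fderiv_fun_add
    (hh.fun_mul (differentiableAt_wirtingerBar hg.self_of_nhds))
    (hh.fun_mul (differentiableAt_wirtingerBar hg'.self_of_nhds))]
  ring

lemma notMem_image_symm {g : ℂ → ℂ} (hc : HasCompactSupport g) (ht : tsupport g ⊆ x.target)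
  {y : X} (hy : y ∉ x.symm '' tsupport g) : ∀ᶠ y' in 𝓝 y, lift x e g y' = 0 := by
  filter_upwards [(isClosed_image_symm hc ht).isOpen_compl.mem_nhds hy] with y' h
  exact lift_eq_zero h

lemma locLap_eq_zero {c h g : ℂ → ℂ} {z : ℂ} (hz : z ∉ tsupport g) : locLap c h g z = 0 := by
  rw [locLap_congr (notMem_tsupport_iff_eventuallyEq.1 hz)]
  simp [locLap, wirtinger, wirtingerBar]

lemma IsGoodChart.laplacian_lift (hs : IsGoodChart S ω x e k) {g : ℂ → ℂ} (hg : SmoothC g)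
  (hc : HasCompactSupport g) (ht : tsupport g ⊆ x.target) (h0 : ∀ z ∈ tsupport g, k z ≠ 0) :
  laplacian S ω (lift x e g) = lift x e (locLap k (fun z => (‖k z‖ : ℂ)⁻¹) g) := by
  ext y
  by_cases hy : y ∈ x.symm '' tsupport g
  · obtain ⟨z, hz, rfl⟩ := hy
    have hzt := ht hz
    have hy := x.map_target hzt
    have h1 : rep x e (lift x e g) =ᶠ[𝓝 z] g := by
      filter_upwards [x.open_target.mem_nhds hzt] with w hw using hs.rep_lift g hw
    have h2 := x.right_inv hzt
    rw [hs.laplacian_eq _ hy, lift_apply hy, h2, locLap_congr h1, locLap_congr_coeff (hs.form z hzt)]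
    · filter_upwards [x.open_target.mem_nhds hzt] with w hw
      rw [hs.form w hw]
    · rw [h2]
      filter_upwards [h1.eventuallyEq_nhds] with w hw
      exact (hg.contDiffAt.congr_of_eventuallyEq hw).of_le (by norm_cast)
    · rw [h2, hs.form z hzt]
      exact h0 z hz
  · rw [laplacian_eq_zero (notMem_image_symm hc ht hy)]
    by_cases h : y ∈ x.source
    · rw [lift_apply h, locLap_eq_zero fun h' => hy ⟨x y, h', x.left_inv h⟩]; simp
    · rw [lift_of_notMem h]

lemma IsGoodChart.isTestSection_lift (hs : IsGoodChart S ω x e k) {g : ℂ → ℂ} (hg : SmoothC g)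
  (hc : HasCompactSupport g) (ht : tsupport g ⊆ x.target) (h0 : ∀ z ∈ tsupport g, k z ≠ 0) :
  IsTestSection ω (lift x e g) :=
  hs.toIsSpinorChart.isTestSection_lift hg hc ht fun z hz => by
    rw [hs.form z (ht hz)]; exact h0 z hz

lemma IsGoodChart.ip_lift (hs : IsGoodChart S ω x e k) (hu : Msec u)
  {g : ℂ → ℂ} (hg : AEStronglyMeasurable g) (h0 : ∀ z ∉ x.target, g z = 0) :
  ip S ω u (lift x e g) = ∫ z, rep x e u z * conj (g z) * (‖k z‖ : ℂ) := by
  rw [hs.ip_eq hu (hs.measurableSection_lift hg.aemeasurable) fun y hy => lift_of_notMem hy,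
    hs.rep_lift_eq h0]

lemma measurable_locLap {c h g : ℂ → ℂ} (hc : Measurable c) (hh : Measurable h) :
  Measurable (locLap c h g) := by
  have hw : ∀ f : ℂ → ℂ, Measurable (wirtinger f) ∧ Measurable (wirtingerBar f) := fun f =>
    ⟨((measurable_fderiv_apply_const ℝ f 1).sub
      ((measurable_fderiv_apply_const ℝ f I).const_mul _)).div_const 2,
    ((measurable_fderiv_apply_const ℝ f 1).add
      ((measurable_fderiv_apply_const ℝ f I).const_mul _)).div_const 2⟩
  exact (((measurable_ofReal.comp (hc.norm.pow_const 2)).inv.mul hh.inv).mul (hw _).1).neg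

lemma integral_toC (g : ℂ → ℂ) : ∫ z, g z = ∫ a, g (toC a) :=
  (measurePreserving_toC.integral_comp measurableEmbedding_toC g).symm

lemma IsFlatChart.ip_lift (hs : IsFlatChart S ω x e) (hu : Msec u)
  {g : ℂ → ℂ} (hg : SmoothC g) (ht : tsupport g ⊆ x.target) :
  ip S ω u (lift x e g) = ∫ a, rep x e u (toC a) * conj (g (toC a)) := by
  rw [hs.good.ip_lift hu hg.continuous.aestronglyMeasurable fun z hz =>
    zero_off_tsupport fun h => hz (ht h), integral_toC]
  simp

lemma IsFlatChart.ip_laplacian_lift (hs : IsFlatChart S ω x e)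
  (hu : Msec u) {g : ℂ → ℂ} (hg : SmoothC g) (hc : HasCompactSupport g)
  (ht : tsupport g ⊆ x.target) :
  ip S ω u (laplacian S ω (lift x e g))
    = -(1 / 4) * ∫ a, rep x e u (toC a) * conj (lap (fun a => g (toC a)) a) := by
  rw [hs.good.laplacian_lift hg hc ht fun _ _ => one_ne_zero, hs.good.ip_lift hu
    (measurable_locLap measurable_const measurable_const).aestronglyMeasurable fun z hz =>
      locLap_eq_zero fun h => hz (ht h), integral_toC, ← integral_const_mul]
  congr 1; funext a
  rw [locLap_congr_coeff rfl (h' := fun _ => 1) (.of_forall fun z => by simp),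
    locLap_toC (.of_forall fun z => hg.contDiffAt)]
  have h4 : conj (4 : ℂ) = 4 := map_ofNat _ 4
  simp [h4]
  ring

lemma laplacian_add (hu : IsTestSection ω u) (hv : IsTestSection ω v) :
  laplacian S ω (fun y => u y + v y) = fun y => laplacian S ω u y + laplacian S ω v y := by
  ext y
  by_cases hy : ω.1 y = 0
  · rw [laplacian_eq_zero ((hu.add hv).eventually_zero hy),
      laplacian_eq_zero (hu.eventually_zero hy), laplacian_eq_zero (hv.eventually_zero hy), add_zero]
  · obtain ⟨x, e, hs, hyx, -⟩ := exists_flatChart (C := C) S ω hy univ_mem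
    have hsm : ∀ {u : ∀ y, C y}, IsTestSection ω u →
        ∀ᶠ z in 𝓝 (x y), ContDiffAt ℝ 2 (rep x e u) z := fun hu => by
      filter_upwards [x.open_target.mem_nhds (x.map_source hyx)] with z hz
      have := (hs.contMDiffAt_iff_rep (x.map_target hz)).1 (hu.1 _)
      rw [x.right_inv hz] at this
      exact this.of_le (by norm_cast)
    have h1 : coefficient ω.1 x (x y) ≠ 0 := by rw [hs.flat _ (x.map_source hyx)]; exact one_ne_zero
    have h2 : (fun z => (‖coefficient ω.1 x z‖ : ℂ)⁻¹) =ᶠ[𝓝 (x y)] fun _ => 1 := by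
      filter_upwards [x.open_target.mem_nhds (x.map_source hyx)] with z hz
      rw [hs.flat z hz]; simp
    rw [hs.laplacian_eq _ hyx (hsm (hu.add hv)) h1, hs.laplacian_eq _ hyx (hsm hu) h1,
      hs.laplacian_eq _ hyx (hsm hv) h1, rep_add, locLap_add
      ((differentiableAt_const 1).congr_of_eventuallyEq h2) (hsm hu) (hsm hv), add_smul]

lemma finset_sum_test {ι : Type*} (t : Finset ι) {φ : ι → ∀ y, C y}
  (h : ∀ i ∈ t, IsTestSection ω (φ i)) : IsTestSection ω (fun y => ∑ i ∈ t, φ i y) ∧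
    laplacian S ω (fun y => ∑ i ∈ t, φ i y) = fun y => ∑ i ∈ t, laplacian S ω (φ i) y := by
  classical
  induction t using Finset.induction_on with
  | empty =>
    exact ⟨isTestSection_zero, funext fun y => laplacian_eq_zero (.of_forall fun _ => rfl)⟩
  | insert i t hi ih =>
    obtain ⟨h1, h2⟩ := ih fun j hj => h j (Finset.mem_insert_of_mem hj)
    have h3 := h i (Finset.mem_insert_self i t)
    simp [Finset.sum_insert hi]
    exact ⟨h3.add h1, by rw [laplacian_add h3 h1, h2]⟩

lemma exists_flat_partition (S : SpinStructure C) (ω : HolomorphicForm X) {K : Set X}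
  (hK : IsClosed K) (h0 : ∀ y ∈ K, ω.1 y ≠ 0) :
  ∃ (t : Finset K) (x : K → Chart) (e : K → ∀ y, C y) (θ : K → X → ℝ),
    (∀ i, IsFlatChart S ω (x i) (e i)) ∧ (∀ i, IsCutoff (x i).source (θ i)) ∧
      ∀ y ∈ K, ∑ i ∈ t, θ i y = 1 := by
  choose x e hs hx _ using fun i : K => exists_flatChart (C := C) S ω (h0 i i.2) univ_mem
  obtain ⟨ρ, hρ⟩ := SmoothPartitionOfUnity.exists_isSubordinate 𝓘(ℝ, ℂ) hK
    (fun i : K => (x i).source) (fun i => (x i).open_source)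
    fun y hy => Set.mem_iUnion.2 ⟨⟨y, hy⟩, hx _⟩
  have hfin : {i | (Function.support (ρ i)).Nonempty}.Finite := by
    simpa using ρ.locallyFinite.finite_nonempty_inter_compact isCompact_univ
  refine ⟨hfin.toFinset, x, e, fun i => ρ i, hs, fun i => ⟨(ρ i).contMDiff, hρ i⟩, fun y hy => ?_⟩
  rw [← ρ.sum_eq_one hy]
  refine (finsum_eq_sum_of_support_subset _ fun i hi => ?_).symm
  simpa using fun h => hi (congrFun h y)

lemma IsTestSection.exists_sum (hu : IsTestSection ω u) :
  ∃ (t : Finset (closure {y | u y ≠ 0})) (x : closure {y | u y ≠ 0} → Chart)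
    (e : closure {y | u y ≠ 0} → ∀ y, C y) (g : closure {y | u y ≠ 0} → ℂ → ℂ), (∀ i, IsFlatChart S ω (x i) (e i) ∧ SmoothC (g i) ∧ HasCompactSupport (g i) ∧
      tsupport (g i) ⊆ (x i).target ∧ ∀ y, y ∉ closure {y | u y ≠ 0} → lift (x i) (e i) (g i) y = 0)
      ∧ u = fun y => ∑ i ∈ t, lift (x i) (e i) (g i) y := by
  obtain ⟨t, x, e, θ, hs, hθ, h1⟩ := exists_flat_partition S ω isClosed_closure hu.2
  have hl := fun i => (hs i).lift_representative (u := u) (hθ i)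
  refine ⟨t, x, e, fun i => representative (x i) (e i) (θ i) u, fun i => ?_, ?_⟩
  · obtain ⟨h2, h3⟩ := (hs i).smooth_representative (hθ i) fun y _ => hu.1 y
    obtain ⟨-, h4, h5⟩ := tsupport_representative (e := e i) (hθ i) u
    refine ⟨hs i, h2, h3, h4.trans h5, fun y hy => ?_⟩
    rw [hl i, SpinorLaplacian.cut, not_not.1 fun h => hy (subset_closure h), smul_zero]
  · ext y
    simp only [hl, SpinorLaplacian.cut, ← Finset.sum_smul]
    by_cases hy : u y = 0
    · rw [hy, smul_zero]
    · rw [← ofReal_sum, h1 y (subset_closure hy), ofReal_one, one_smul]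

/-! ### The weak form of the Laplacian -/

lemma ip_conj (u v : ∀ y, C y) : conj (ip S ω u v) = ip S ω v u := by
  rw [ip, ip, ← integral_conj]
  simp [herm_conj]

lemma ip_add_right (hu : u ∈ L²) (hv : v ∈ L²) (hw : w ∈ L²) :
  ip S ω u (fun y => v y + w y) = ip S ω u v + ip S ω u w := by
  simp [ip, herm_add_right]
  exact integral_add (integrable_herm S ω hu.1 hv.1 hu.2 hv.2)
    (integrable_herm S ω hu.1 hw.1 hu.2 hw.2)

lemma ip_add_left (hu : u ∈ L²) (hv : v ∈ L²) (hw : w ∈ L²) :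
  ip S ω (fun y => u y + v y) w = ip S ω u w + ip S ω v w := by
  rw [← ip_conj, ip_add_right hw hu hv, map_add, ip_conj, ip_conj]

lemma ip_sub_left (hu : u ∈ L²) (hv : v ∈ L²) (hw : w ∈ L²) :
  ip S ω (fun y => u y - v y) w = ip S ω u w - ip S ω v w := by
  have h := ip_add_left (mem_sub hu hv) hv hw
  simp_all

lemma ip_sub_right (hu : u ∈ L²) (hv : v ∈ L²) (hw : w ∈ L²) :
  ip S ω u (fun y => v y - w y) = ip S ω u v - ip S ω u w := by
  rw [← ip_conj, ip_sub_left hv hw hu, map_sub, ip_conj, ip_conj]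

lemma mem_sum {ι : Type*} (t : Finset ι) {φ : ι → ∀ y, C y}
  (h : ∀ i ∈ t, φ i ∈ L²) : (fun y => ∑ i ∈ t, φ i y) ∈ L² := by
  convert Submodule.sum_mem _ h using 1
  ext y; simp

lemma ip_sum_right {ι : Type*} (t : Finset ι) {φ : ι → ∀ y, C y}
  (hu : u ∈ L²) (h : ∀ i ∈ t, φ i ∈ L²) :
  ip S ω u (fun y => ∑ i ∈ t, φ i y) = ∑ i ∈ t, ip S ω u (φ i) := by
  classical
  induction t using Finset.induction_on with
  | empty => simp [ip, herm]
  | insert i t hi ih =>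
    have h1 := fun j hj => h j (Finset.mem_insert_of_mem hj)
    simp [Finset.sum_insert hi]
    rw [ip_add_right hu (h i (Finset.mem_insert_self i t)) (mem_sum t h1), ih h1]

lemma mem_cut (hχ : SmoothFun χ) (hu : u ∈ L²) : cut χ u ∈ L² := by
  obtain ⟨M, hM⟩ := isCompact_univ.exists_bound_of_continuousOn hχ.continuous.continuousOn
  have hm : Msec (cut χ u) := fun x₀ => by
    simp [cut]
    exact (continuous_ofReal.comp hχ.continuous).measurable.aemeasurable.mul (hu.1 x₀)
  refine ⟨hm, (hu.2.norm.const_mul (M * M)).mono' (aemeasurable_herm S ω hm hm).aestronglyMeasurable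
    (.of_forall fun y => ?_)⟩
  rw [cut, herm_smul_left, herm_smul_right, norm_mul, norm_mul, RCLike.norm_conj,
    norm_real, ← mul_assoc]
  have h := hM y (Set.mem_univ y)
  gcongr
  exact (norm_nonneg _).trans h

lemma ip_cut (χ : X → ℝ) (u v : ∀ y, C y) : ip S ω (cut χ u) v = ip S ω u (cut χ v) := by
  simp only [ip, cut, herm_smul_left, herm_smul_right, conj_ofReal]

lemma ip_congr {u' v' : ∀ y, C y} (h : ∀ y, (u y = u' y ∨ v y = 0 ∧ v' y = 0) ∧
  (v y = v' y ∨ u y = 0 ∧ u' y = 0)) : ip S ω u v = ip S ω u' v' := by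
  refine integral_congr_ae (.of_forall fun y => ?_)
  simp only
  rcases h y with ⟨h1 | h1, h2 | h2⟩
  · rw [h1, h2]
  · rw [h2.1, h2.2, herm_zero_left, herm_zero_left]
  · rw [h1.1, h1.2, herm_zero_right, herm_zero_right]
  grind

lemma isBump_toC {g : ℂ → ℂ} (hg : SmoothC g) (hc : HasCompactSupport g) :
  IsBump fun a => g (toC a) :=
  ⟨smooth_comp_toC hg, by
    convert hc.comp_homeomorph equivRealProdCLM.symm.toHomeomorph using 1
    ext a; simp [toC, equivRealProdCLM_symm_apply]⟩

lemma IsFlatChart.lift_mem (hs : IsFlatChart S ω x e) {g : ℂ → ℂ} (hg : SmoothC g)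
  (hc : HasCompactSupport g) (ht : tsupport g ⊆ x.target) :
  lift x e g ∈ L² ∧ laplacian S ω (lift x e g) ∈ L² := by
  have hb := isBump_toC hg hc
  have key : ∀ {f : ℂ → ℂ} {F : Fn}, MemLp F 2 volume → (∀ a, ‖f (toC a)‖ₑ = ‖F a‖ₑ) →
      ∫⁻ z, ‖f z‖ₑ ^ 2 * ‖(1 : ℂ)‖ₑ < ⊤ := fun {f F} hF h => by
    rw [← measurePreserving_toC.lintegral_comp_emb measurableEmbedding_toC]
    simp [h]
    rw [← eLpNorm_two_sq]
    exact ENNReal.pow_lt_top hF.2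
  refine ⟨hs.good.lift_mem hg.continuous.aestronglyMeasurable (key hb.memLp fun _ => rfl), ?_⟩
  rw [hs.good.laplacian_lift hg hc ht fun _ _ => one_ne_zero]
  refine hs.good.lift_mem (measurable_locLap measurable_const measurable_const).aestronglyMeasurable
    (key (hb.lap.smul (-(1 / 4))).memLp fun a => ?_)
  rw [locLap_congr_coeff rfl (h' := fun _ => 1) (.of_forall fun z => by simp),
    locLap_toC (.of_forall fun z => hg.contDiffAt)]
  simp

lemma exists_cutoff {K U : Set X} (hK : IsClosed K) (hU : IsOpen U) (h : K ⊆ U) :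
  ∃ χ : X → ℝ, SmoothFun χ ∧ tsupport χ ⊆ U ∧ ∀ y ∈ K, ∀ᶠ y' in 𝓝 y, χ y' = 1 := by
  obtain ⟨L, hL, hKL, hLU⟩ := exists_compact_between hK.isCompact hU h
  obtain ⟨f, h1, h2, -⟩ := exists_contMDiffMap_one_nhds_of_subset_interior
    (n := (⊤ : ℕ∞)) 𝓘(ℝ, ℂ) hK hKL
  exact ⟨f, f.contMDiff, (closure_minimal (fun y hy => by by_contra h'; exact hy (h2 y h'))
    hL.isClosed).trans hLU, fun y hy => eventually_nhdsSet_iff_forall.1 h1 y hy⟩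

lemma IsTestSection.mem (hu : IsTestSection ω u) : u ∈ L² ∧ laplacian S ω u ∈ L² := by
  obtain ⟨t, x, e, g, h, he⟩ := hu.exists_sum (S := S)
  have h1 := fun i => (h i).1.lift_mem (h i).2.1 (h i).2.2.1 (h i).2.2.2.1
  have h2 := finset_sum_test (S := S) (ω := ω) t (φ := fun i => lift (x i) (e i) (g i)) fun i _ =>
    (h i).1.good.isTestSection_lift (h i).2.1 (h i).2.2.1 (h i).2.2.2.1 fun _ _ => one_ne_zero
  rw [he, h2.2]
  exact ⟨mem_sum t fun i _ => (h1 i).1, mem_sum t fun i _ => (h1 i).2⟩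

/-- `u` is in the domain of the adjoint of the Laplacian on test sections, with the value `f`. -/
def IsWeak (S : SpinStructure C) (ω : HolomorphicForm X) (u f : ∀ y, C y) : Prop :=
  u ∈ squareIntegrable S ω ∧ f ∈ squareIntegrable S ω ∧
    ∀ ψ, IsTestSection ω ψ → ip S ω u (laplacian S ω ψ) = ip S ω f ψ

lemma isWeak_of_lift (hu : u ∈ L²) (hf : f ∈ L²)
  (h : ∀ (x : Chart) (e : ∀ y, C y) (g : ℂ → ℂ), IsFlatChart S ω x e →
    SmoothC g → HasCompactSupport g → tsupport g ⊆ x.target →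
    ip S ω u (laplacian S ω (lift x e g)) = ip S ω f (lift x e g)) : IsWeak S ω u f := by
  refine ⟨hu, hf, fun ψ hψ => ?_⟩
  obtain ⟨t, x, e, g, hg, he⟩ := hψ.exists_sum (S := S)
  have h1 := fun i => (hg i).1.lift_mem (hg i).2.1 (hg i).2.2.1 (hg i).2.2.2.1
  have h2 := finset_sum_test (S := S) (ω := ω) t (φ := fun i => lift (x i) (e i) (g i)) fun i _ =>
    (hg i).1.good.isTestSection_lift (hg i).2.1 (hg i).2.2.1 (hg i).2.2.2.1 fun _ _ => one_ne_zero
  rw [he, h2.2, ip_sum_right t hu fun i _ => (h1 i).2, ip_sum_right t hf fun i _ => (h1 i).1]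
  grind

lemma IsTestSection.isWeak (hu : IsTestSection ω u) : IsWeak S ω u (laplacian S ω u) := by
  refine isWeak_of_lift hu.mem.1 hu.mem.2 fun x e g hs hg hc ht => ?_
  have hK := isClosed_image_symm hc ht
  obtain ⟨χ, hχ, hχs, hχ1⟩ := exists_cutoff hK x.open_source (by
    rintro _ ⟨z, hz, rfl⟩; exact x.map_target (ht hz))
  have hχc : IsCutoff x.source χ := ⟨hχ, hχs⟩
  obtain ⟨hG, hGc⟩ := hs.smooth_representative hχc fun y _ => hu.1 y
  obtain ⟨-, h4, h5⟩ := tsupport_representative (e := e) hχc u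
  have h6 := hs.lift_representative (u := u) hχc
  set G := representative x e χ u
  have hu' := hs.good.isTestSection_lift hG hGc (h4.trans h5) fun _ _ => one_ne_zero
  have hg' := hs.good.isTestSection_lift hg hc ht fun _ _ => one_ne_zero
  have e1 : ip S ω u (laplacian S ω (lift x e g))
      = ip S ω (lift x e G) (laplacian S ω (lift x e g)) := ip_congr fun y => ⟨by
    by_cases hy : y ∈ x.symm '' tsupport g
    · left; rw [h6, SpinorLaplacian.cut, (hχ1 y hy).self_of_nhds, ofReal_one, one_smul]
    · right; rw [laplacian_eq_zero (notMem_image_symm hc ht hy)]; exact ⟨rfl, rfl⟩, .inl rfl⟩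
  have e2 : ip S ω (laplacian S ω u) (lift x e g)
      = ip S ω (laplacian S ω (lift x e G)) (lift x e g) := ip_congr fun y => ⟨by
    by_cases hy : y ∈ x.symm '' tsupport g
    · left; exact laplacian_congr ((hχ1 y hy).mono fun y' h => by
        rw [h6, SpinorLaplacian.cut, h, ofReal_one, one_smul])
    · right; rw [lift_eq_zero hy]; exact ⟨rfl, rfl⟩, .inl rfl⟩
  rw [e1, e2, ← ip_conj (lift x e g), hs.ip_laplacian_lift (hu'.mem (S := S)).1.1 hg hc ht,
    hs.ip_laplacian_lift (hg'.mem (S := S)).1.1 hG hGc (h4.trans h5),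
    hs.rep_lift_eq fun z hz => zero_off_tsupport fun h => hz (h5 (h4 h)),
    hs.rep_lift_eq fun z hz => zero_off_tsupport fun h => hz (ht h)]
  have hb := isBump_toC hg hc
  have h7 := integral_mul_lap (isBump_toC hG hGc).1 hb.conj
  rw [lap_conj hb.1] at h7
  rw [h7, map_mul, ← integral_conj]
  have h8 : conj (4 : ℂ) = 4 := map_ofNat _ 4
  simp [h8, mul_comm]

lemma IsGoodChart.lintegral_rep_le (hs : IsGoodChart S ω x e k) (hu : Msec u) :
  ∫⁻ z, ‖rep x e u z‖ₑ ^ 2 * ‖k z‖ₑ ≤ sqNorm S ω u := by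
  have hl := hs.measurableSection_lift (ω := ω) (hs.aestronglyMeasurable_rep hu).aemeasurable
  rw [← hs.rep_lift_eq (g := rep x e u) fun z hz => rep_of_notMem hz,
    ← hs.sqNorm_eq hl fun y hy => lift_of_notMem hy]
  refine lintegral_mono fun y => ?_
  by_cases hy : y ∈ x.source
  · rw [lift_apply hy, ← hs.eq_rep_smul u hy]
  · rw [lift_of_notMem hy, herm_zero_left]; simp

lemma IsFlatChart.memLp_rep (hs : IsFlatChart S ω x e) (hu : u ∈ L²) :
  MemLp (rep x e u) 2 volume := by
  refine ⟨hs.good.aestronglyMeasurable_rep hu.1, ?_⟩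
  have h := (hs.good.lintegral_rep_le hu.1).trans_lt ((mem_squareIntegrable_iff hu.1).1 hu)
  simp at h
  rw [← eLpNorm_two_sq] at h
  simp_all

lemma ae_eq_zero_of_test {O : Set X} (hO : IsOpen O) (hf : f ∈ L²)
  (h : ∀ ψ, IsTestSection ω ψ → closure {y | ψ y ≠ 0} ⊆ O → ip S ω f ψ = 0) :
  ∀ᵐ y ∂(area ω), y ∈ O → f y = 0 := by
  have := ChartedSpace.secondCountable_of_sigmaCompact ℂ X
  have h0 : ∀ᵐ y ∂(area ω), ω.1 y ≠ 0 := by rw [ae_iff]; simpa using area_zeros ω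
  have h1 : area ω {y | y ∈ O ∧ ω.1 y ≠ 0 ∧ f y ≠ 0} = 0 := by
    refine measure_null_of_locally_null _ fun y hy => ?_
    obtain ⟨x, e, hs, hyx, hxO⟩ := exists_flatChart (C := C) S ω hy.2.1 (hO.mem_nhds hy.1)
    have hrep : ∀ᵐ z, z ∈ x.target → rep x e f z = 0 := by
      refine x.open_target.ae_eq_zero_of_integral_contDiff_smul_eq_zero
        (((hs.memLp_rep hf).locallyIntegrable (by norm_num)).locallyIntegrableOn _)
        fun g hg hc ht => ?_
      have hg' : SmoothC fun z => (g z : ℂ) := ofRealCLM.contDiff.comp hg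
      have hsup : tsupport (fun z => (g z : ℂ)) ⊆ tsupport g :=
        closure_mono fun z hz hz' => hz (by simp [hz'])
      have hc' := hc.of_isClosed_subset (isClosed_tsupport _) hsup
      have h2 := h _ (hs.good.isTestSection_lift hg' hc' (hsup.trans ht) fun _ _ => one_ne_zero)
        ((closure_minimal (fun y hy => by by_contra h; exact hy (lift_eq_zero h)) (isClosed_image_symm
          hc' (hsup.trans ht))).trans ((Set.image_mono (hsup.trans ht)).trans
            (x.symm_image_target_eq_source.subset.trans hxO)))
      rw [hs.ip_lift hf.1 hg' (hsup.trans ht)] at h2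
      rw [← h2, integral_toC]
      congr 1; funext a
      rw [conj_ofReal, real_smul, mul_comm]
    refine ⟨_, Filter.inter_mem (mem_nhdsWithin_of_mem_nhds (x.open_source.mem_nhds hyx))
      self_mem_nhdsWithin, measure_mono_null ?_
        (area_preimage_null (ω := ω) hs.mem_maximalAtlas (ae_iff.1 hrep))⟩
    rintro y' ⟨h2, -, -, h3⟩
    refine ⟨h2, fun h4 => h3 ?_⟩
    rw [hs.eq_rep_smul f h2, h4 (x.map_source h2), zero_smul]
  filter_upwards [h0, measure_eq_zero_iff_ae_notMem.1 h1] with y h2 h3 h4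
  grind

lemma IsWeak.ae_eq_zero {O : Set X} (hO : IsOpen O) (hu : IsWeak S ω u f)
  (h : ∀ y ∈ O, u y = 0) : ∀ᵐ y ∂(area ω), y ∈ O → f y = 0 := by
  refine ae_eq_zero_of_test hO hu.2.1 fun ψ hψ hψO => ?_
  rw [← hu.2.2 ψ hψ, ip]
  refine integral_eq_zero_of_ae (.of_forall fun y => ?_)
  by_cases hy : y ∈ O
  · simp [h y hy, herm_zero_left]
  · simp
    rw [laplacian_eq_zero, herm_zero_right]
    filter_upwards [isClosed_closure.isOpen_compl.mem_nhds fun h' => hy (hψO h')] with y' h'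
    exact not_not.1 fun h'' => h' (subset_closure h'')

/-! ### The minimal and the maximal operator -/

lemma core_mem (hu : IsTestSection ω u) : (cls (S := S) hu.mem.1, cls hu.mem.2) ∈ coreGraph S ω :=
  Submodule.subset_span ⟨u, hu, represents_cls _, represents_cls _⟩

lemma IsWeak.inner_core (hu : IsWeak S ω u f) {p : L2 S ω × L2 S ω}
  (hp : p ∈ (coreGraph S ω).topologicalClosure) :
  inner ℂ p.2 (cls hu.1) = inner ℂ p.1 (cls hu.2.1) := by
  have hc : IsClosed {p : L2 S ω × L2 S ω | inner ℂ p.2 (cls hu.1) = inner ℂ p.1 (cls hu.2.1)} :=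
    isClosed_eq (continuous_snd.inner continuous_const) (continuous_fst.inner continuous_const)
  refine closure_minimal (fun p hp => ?_) hc hp
  refine Submodule.span_induction (p := fun p _ => inner ℂ p.2 (cls hu.1)
    = inner ℂ p.1 (cls hu.2.1)) ?_ (by simp) (fun p q _ _ hp hq => ?_) (fun c p _ hp => ?_) hp
  · rintro ⟨a, b⟩ ⟨ψ, hψ, ⟨h1, rfl⟩, h2, rfl⟩
    exact (inner_cls hu.1 h2).trans ((hu.2.2 ψ hψ).trans (inner_cls hu.2.1 h1).symm)
  · simp [inner_add_left, hp, hq]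
  · simp [inner_smul_left, hp]

lemma eq_zero_of_inner_test {a : L2 S ω}
  (h : ∀ ψ (hψ : IsTestSection ω ψ), inner ℂ (cls hψ.mem.1) a = 0) : a = 0 := by
  obtain ⟨u, hu, rfl⟩ := exists_cls_eq a
  rw [cls_eq_zero_iff]
  have := ae_eq_zero_of_test isOpen_univ hu fun ψ hψ _ => by exact h ψ hψ
  simpa using this

lemma graph_minimal : (minimalLaplacian S ω).graph = (coreGraph S ω).topologicalClosure := by
  have h0 : ∀ p ∈ (coreGraph S ω).topologicalClosure, p.1 = 0 → p.2 = 0 := fun p hp h1 => by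
    refine eq_zero_of_inner_test fun ψ hψ => ?_
    rw [← inner_conj_symm, hψ.isWeak.inner_core hp, h1, inner_zero_left, map_zero]
  have h1 := Submodule.toLinearPMap_graph_eq _ fun p hp => h0 p (Submodule.le_topologicalClosure _ hp)
  have hc : (coreGraph S ω).toLinearPMap.IsClosable := by
    refine ⟨(coreGraph S ω).topologicalClosure.toLinearPMap, ?_⟩
    rw [h1, Submodule.toLinearPMap_graph_eq _ h0]
  rw [minimalLaplacian, ← hc.graph_closure_eq_closure_graph, h1]

lemma mem_minimal_iff {a : L2 S ω} : a ∈ (minimalLaplacian S ω).domain ↔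
  ∃ b, (a, b) ∈ (coreGraph S ω).topologicalClosure := by
  rw [LinearPMap.mem_domain_iff, graph_minimal]

lemma minimal_mem (a : (minimalLaplacian S ω).domain) :
  ((a : L2 S ω), minimalLaplacian S ω a) ∈ (coreGraph S ω).topologicalClosure := by
  rw [← graph_minimal]; exact LinearPMap.mem_graph _ a

lemma dense_minimal : Dense ((minimalLaplacian S ω).domain : Set (L2 S ω)) := by
  rw [Submodule.dense_iff_topologicalClosure_eq_top, Submodule.topologicalClosure_eq_top_iff,
    Submodule.eq_bot_iff]
  intro a ha
  refine eq_zero_of_inner_test fun ψ hψ => (Submodule.mem_orthogonal _ _).1 ha _ ?_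
  exact mem_minimal_iff.2 ⟨_, Submodule.le_topologicalClosure _ (core_mem hψ)⟩

lemma IsWeak.mem_maximal (hu : IsWeak S ω u f) :
  ∃ h : cls hu.1 ∈ (maximalLaplacian S ω).domain, maximalLaplacian S ω ⟨_, h⟩ = cls hu.2.1 := by
  have h1 : ∀ a : (minimalLaplacian S ω).domain,
      inner ℂ (cls hu.2.1) (a : L2 S ω) = inner ℂ (cls hu.1) (minimalLaplacian S ω a) := fun a => by
    rw [← inner_conj_symm, ← hu.inner_core (minimal_mem a), inner_conj_symm]
  exact ⟨LinearPMap.mem_adjoint_domain_of_exists _ ⟨_, h1⟩,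
    LinearPMap.adjoint_apply_eq dense_minimal _ h1⟩

lemma isWeak_of_closure {p : L2 S ω × L2 S ω} (hp : p ∈ (coreGraph S ω).topologicalClosure)
  {u f : ∀ y, C y} (hu : u ∈ L²) (hf : f ∈ L²)
  (h1 : cls hu = p.1) (h2 : cls hf = p.2) : IsWeak S ω u f :=
  ⟨hu, hf, fun ψ hψ => by
    rw [← inner_cls hu hψ.mem.2, ← inner_cls hf hψ.mem.1, h1, h2, ← inner_conj_symm,
      ← hψ.isWeak.inner_core hp, inner_conj_symm]⟩

lemma minimal_le_maximal : minimalLaplacian S ω ≤ maximalLaplacian S ω := by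
  refine LinearPMap.IsFormalAdjoint.le_adjoint dense_minimal fun a b => ?_
  obtain ⟨u, hu, h1⟩ := exists_cls_eq (b : L2 S ω)
  obtain ⟨f, hf, h2⟩ := exists_cls_eq (minimalLaplacian S ω b)
  rw [← h1, ← h2]
  exact (isWeak_of_closure (minimal_mem b) hu hf h1 h2).inner_core (minimal_mem a)

lemma exists_isWeak (a : (maximalLaplacian S ω).domain) (hu : u ∈ L²)
  (h : cls hu = a) : ∃ f, ∃ hf : IsWeak S ω u f, cls hf.2.1 = maximalLaplacian S ω a := by
  obtain ⟨f, hf, h2⟩ := exists_cls_eq (maximalLaplacian S ω a)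
  refine ⟨f, ⟨hu, hf, fun ψ hψ => ?_⟩, h2⟩
  have h3 := Submodule.le_topologicalClosure _ (core_mem (S := S) hψ)
  rw [← graph_minimal, LinearPMap.mem_graph_iff] at h3
  obtain ⟨b, hb1, hb2⟩ := h3
  dsimp only at hb1 hb2
  have h4 := LinearPMap.adjoint_isFormalAdjoint dense_minimal a b
  rw [← inner_cls hu hψ.mem.2, ← inner_cls hf hψ.mem.1, h2, h, ← hb1, ← hb2, ← inner_conj_symm,
    ← h4, inner_conj_symm]
  rfl

/-- The section `u` represents an element of the domain of the minimal operator. -/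
def DomMin (S : SpinStructure C) (ω : HolomorphicForm X) (u : ∀ y, C y) : Prop :=
  ∃ a ∈ (minimalLaplacian S ω).domain, Represents S ω u a

lemma domMin_iff (hu : u ∈ L²) : DomMin S ω u ↔ cls hu ∈ (minimalLaplacian S ω).domain :=
  ⟨fun ⟨_, ha, _, h⟩ => by rw [show cls hu = _ from h]; exact ha, fun h => ⟨_, h, represents_cls hu⟩⟩

lemma DomMin.mem (h : DomMin S ω u) : u ∈ L² := let ⟨_, _, hu, _⟩ := h; hu

lemma DomMin.add (hu : DomMin S ω u) (hv : DomMin S ω v) : DomMin S ω fun y => u y + v y :=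
  (domMin_iff (mem_add hu.mem hv.mem)).2 (by
    rw [cls_add hu.mem hv.mem]
    exact Submodule.add_mem _ ((domMin_iff _).1 hu) ((domMin_iff _).1 hv))

lemma DomMin.sum {ι : Type*} (t : Finset ι) {φ : ι → ∀ y, C y}
  (h : ∀ i ∈ t, DomMin S ω (φ i)) : DomMin S ω fun y => ∑ i ∈ t, φ i y := by
  classical
  induction t using Finset.induction_on with
  | empty =>
    exact ⟨0, Submodule.zero_mem _, Submodule.zero_mem _, rfl⟩
  | insert i t hi ih =>
    simp [Finset.sum_insert hi]
    exact (h i (Finset.mem_insert_self i t)).add (ih fun j hj => h j (Finset.mem_insert_of_mem hj))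

lemma DomMin.exists_isWeak (h : DomMin S ω u) : ∃ f, IsWeak S ω u f ∧
  ∀ w g, IsWeak S ω w g → ip S ω f w = ip S ω u g := by
  have h1 := (domMin_iff h.mem).1 h
  obtain ⟨f, hf, h2⟩ := exists_cls_eq (minimalLaplacian S ω ⟨_, h1⟩)
  refine ⟨f, isWeak_of_closure (minimal_mem ⟨_, h1⟩) h.mem hf rfl h2, fun w g hw => ?_⟩
  have h3 := hw.inner_core (minimal_mem ⟨_, h1⟩)
  rw [← inner_cls hf hw.1, ← inner_cls h.mem hw.2.1, h2, ← inner_conj_symm, h3, inner_conj_symm]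

lemma IsTestSection.domMin (hu : IsTestSection ω u) : DomMin S ω u :=
  (domMin_iff hu.mem.1).2 (mem_minimal_iff.2 ⟨_, Submodule.le_topologicalClosure _ (core_mem hu)⟩)

lemma domMin_of_tendsto {ψ : ℕ → ∀ y, C y} (hψ : ∀ n, IsTestSection ω (ψ n)) (hu : Msec u)
  (h : Tendsto (fun n => sqNorm S ω fun y => ψ n y - u y) atTop (𝓝 0))
  (hc : Tendsto (fun k : ℕ × ℕ => sqNorm S ω fun y =>
    laplacian S ω (ψ k.1) y - laplacian S ω (ψ k.2) y) atTop (𝓝 0)) : DomMin S ω u := by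
  have hψm := fun n => (hψ n).mem (S := S)
  have hum : u ∈ L² := by
    obtain ⟨n, hn⟩ := (h.eventually_lt_const ENNReal.zero_lt_top).exists
    have hm : Msec fun y => ψ n y - u y := fun x₀ => by simp; exact ((hψm n).1.1 x₀).sub (hu x₀)
    have h1 := mem_sub (hψm n).1 ((mem_squareIntegrable_iff hm).2 hn)
    simpa using h1
  have key : ∀ {a b : ∀ y, C y} (ha : a ∈ L²) (hb : b ∈ L²),
      edist (cls ha) (cls hb) ^ 2 = sqNorm S ω fun y => a y - b y := fun ha hb => by
    rw [edist_eq_enorm_sub, ← cls_sub ha hb (mem_sub ha hb), enorm_cls_sq]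
  have h1 : Tendsto (fun n => cls (hψm n).1) atTop (𝓝 (cls hum)) := by
    rw [tendsto_iff_edist_tendsto_0, ← tendsto_sq_iff]
    simpa only [key] using h
  have h2 : CauchySeq fun n => cls (hψm n).2 := by
    rw [cauchySeq_iff_tendsto_dist_atTop_0]
    have h3 : Tendsto (fun k : ℕ × ℕ => edist (cls (hψm k.1).2) (cls (hψm k.2).2)) atTop (𝓝 0) := by
      rw [← tendsto_sq_iff]; simpa only [key] using hc
    have h4 := (ENNReal.tendsto_toReal ENNReal.zero_ne_top).comp h3
    simpa only [Function.comp_def, edist_dist, ENNReal.toReal_ofReal dist_nonneg,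
      ENNReal.toReal_zero] using h4
  obtain ⟨b, hb⟩ := cauchySeq_tendsto_of_complete h2
  exact (domMin_iff hum).2 (mem_minimal_iff.2 ⟨b, mem_closure_of_tendsto (h1.prodMk_nhds hb)
    (.of_forall fun n => core_mem (hψ n))⟩)

/-! ### Regularity away from the zeros -/

/-- A function on `ℝ²` as a function on `ℂ`. -/
def ofP (g : Fn) (z : ℂ) : ℂ := g (z.re, z.im)

lemma ofP_toC (g : Fn) (a : ℝ²) : ofP g (toC a) = g a := by rw [ofP, toC_re, toC_im]

lemma ofP_props {g : Fn} (hg : IsBump g) {T : Set ℂ} (ht : tsupport g ⊆ toC ⁻¹' T) :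
  SmoothC (ofP g) ∧ HasCompactSupport (ofP g) ∧ tsupport (ofP g) ⊆ T := by
  refine ⟨hg.1.comp equivRealProdCLM.contDiff,
    hg.2.comp_homeomorph equivRealProdCLM.toHomeomorph, fun z hz => ?_⟩
  have := ht (tsupport_comp_subset_preimage g equivRealProdCLM.continuous hz)
  rwa [Set.mem_preimage, show equivRealProdCLM z = (z.re, z.im) from rfl, toC_re_im] at this

lemma HasWeakDeriv.ae_eq {v w : Fn} (hv : LocallyIntegrable v) (hw : LocallyIntegrable w)
  (h : HasWeakDeriv 0 0 v w) : v =ᵐ[volume] w := by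
  refine ae_eq_of_integral_contDiff_smul_eq hv hw fun g hg hc => ?_
  have := h (fun a => (g a : ℂ)) (ofRealCLM.contDiff.comp hg) (hc.comp_left ofReal_zero)
  simp at this
  simpa only [real_smul, mul_comm] using this

lemma integrable_mul_bump {v g : Fn} (hv : LocallyIntegrable v) (hg : IsBump g) :
  Integrable fun a => v a * g a := by
  simpa only [smul_eq_mul, mul_comm] using
    hv.integrable_smul_left_of_hasCompactSupport hg.1.continuous hg.2

lemma HasWeakDeriv.lap {v w₁ w₂ : Fn} (h₁ : HasWeakDeriv 2 0 v w₁)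
  (h₂ : HasWeakDeriv 0 2 v w₂) (hv : LocallyIntegrable v) (hw₁ : LocallyIntegrable w₁)
  (hw₂ : LocallyIntegrable w₂) (g : Fn) (hg : IsBump g) :
  ∫ a, v a * lap g a = ∫ a, (w₁ a + w₂ a) * g a := by
  have e1 := h₁ g hg.1 hg.2
  have e2 := h₂ g hg.1 hg.2
  norm_num at e1 e2
  simp [add_mul, SpinorLaplacian.lap, mul_add]
  rw [integral_add (integrable_mul_bump hw₁ hg) (integrable_mul_bump hw₂ hg), integral_add
    (integrable_mul_bump hv hg.dS.dS) (integrable_mul_bump hv hg.dP.dP), ← e1, ← e2]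
  rfl

lemma IsFlatChart.sqNorm_sub (hs : IsFlatChart S ω x e) (hu : Msec u)
  (hv : Msec v) (h : ∀ y ∉ x.source, u y = v y) :
  sqNorm S ω (fun y => u y - v y)
    = eLpNorm (fun a => rep x e u (toC a) - rep x e v (toC a)) 2 volume ^ 2 := by
  rw [hs.good.sqNorm_eq (fun x₀ => by simp; exact (hu x₀).sub (hv x₀))
    fun y hy => by rw [h y hy, sub_self], rep_sub, eLpNorm_two_sq,
    ← measurePreserving_toC.lintegral_comp_emb measurableEmbedding_toC]
  simp

lemma IsFlatChart.domMin_of_bumps (hs : IsFlatChart S ω x e) (hu : Msec u)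
  (h0 : ∀ y ∉ x.source, u y = 0) {g : ℕ → Fn}
  (hg : ∀ n, IsBump (g n) ∧ tsupport (g n) ⊆ toC ⁻¹' x.target)
  (h : Tendsto (fun n => eLpNorm (fun a => g n a - rep x e u (toC a)) 2 volume) atTop (𝓝 0))
  (hc : Tendsto (fun k : ℕ × ℕ => eLpNorm (fun a => lap (g k.1) a - lap (g k.2) a) 2 volume)
    atTop (𝓝 0)) : DomMin S ω u := by
  have hG := fun n => ofP_props (hg n).1 (hg n).2
  have hz : ∀ n, ∀ z ∉ x.target, ofP (g n) z = 0 := fun n z hz =>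
    zero_off_tsupport fun h => hz ((hG n).2.2 h)
  have ht := fun n => hs.good.isTestSection_lift (hG n).1 (hG n).2.1 (hG n).2.2
    fun _ _ => one_ne_zero
  refine domMin_of_tendsto ht hu ?_ ?_
  · have h1 := tendsto_sq_iff.2 h
    refine h1.congr fun n => ?_
    rw [hs.sqNorm_sub ((ht n).mem (S := S)).1.1 hu fun y hy => by rw [lift_of_notMem hy, h0 y hy],
      hs.rep_lift_eq (hz n)]
    simp [ofP_toC]
  · have h1 := tendsto_sq_iff.2 (tendsto_of_le_const_mul (c := ‖(-(1 / 4) : ℂ)‖ₑ) (by simp) hc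
      fun k => (eLpNorm_const_smul (-(1 / 4) : ℂ) _ 2 volume).le)
    refine h1.congr fun k => ?_
    have e1 : ∀ n a, rep x e (laplacian S ω (lift x e (ofP (g n)))) (toC a)
        = -(1 / 4) * lap (g n) a := fun n a => by
      rw [hs.good.laplacian_lift (hG n).1 (hG n).2.1 (hG n).2.2 fun _ _ => one_ne_zero,
        hs.rep_lift_eq fun z hz' => locLap_eq_zero fun h => hz' ((hG n).2.2 h)]
      change locLap _ _ _ (toC a) = _
      rw [locLap_congr_coeff rfl (h' := fun _ => 1) (.of_forall fun z => by simp),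
        locLap_toC (.of_forall fun z => (hG n).1.contDiffAt)]
      simp [ofP_toC]
    rw [hs.sqNorm_sub ((ht _).mem (S := S)).2.1 ((ht _).mem (S := S)).2.1 fun y hy => ?_]
    · simp only [e1, ← mul_sub]; rfl
    · rw [hs.good.laplacian_lift (hG _).1 (hG _).2.1 (hG _).2.2 fun _ _ => one_ne_zero,
        hs.good.laplacian_lift (hG _).1 (hG _).2.1 (hG _).2.2 fun _ _ => one_ne_zero,
        lift_of_notMem hy, lift_of_notMem hy]

lemma IsWeak.flat (hs : IsFlatChart S ω x e) (hw : IsWeak S ω u f) {g : Fn}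
  (hg : IsBump g) (ht : tsupport g ⊆ toC ⁻¹' x.target) :
  ∫ a, rep x e u (toC a) * lap g a = ∫ a, (-4 * rep x e f (toC a)) * g a := by
  have hsup : tsupport (fun a => conj (g a)) ⊆ tsupport g :=
    closure_mono fun a ha h => ha (by simp [h])
  obtain ⟨h1, h2, h3⟩ := ofP_props hg.conj (hsup.trans ht)
  have h4 := hw.2.2 _ (hs.good.isTestSection_lift h1 h2 h3 fun _ _ => one_ne_zero)
  rw [hs.ip_laplacian_lift hw.1.1 h1 h2 h3, hs.ip_lift hw.2.1.1 h1 h3] at h4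
  simp [ofP_toC, lap_conj hg.1] at h4
  simp only [mul_assoc]
  rw [integral_const_mul, ← h4]
  ring

lemma IsSpinorChart.smoothSectionAt (hs : IsSpinorChart S x e) {y : X} (hy : y ∈ x.source) :
  SmoothSectionAt e y := by
  refine (hs.contMDiffAt_iff_rep hy).2 ((contDiffAt_const (c := (1 : ℂ))).congr_of_eventuallyEq ?_)
  filter_upwards [x.open_target.mem_nhds (x.map_source hy)] with z hz
  have := hs.rep_eq (u := e) (a := 1) (x.map_target hz) (one_smul _ _).symm
  rwa [x.right_inv hz] at this

lemma IsSpinorChart.representative_self (hs : IsSpinorChart S x e) (χ : X → ℝ) (u : ∀ y, C y)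
  (z : ℂ) : representative x e χ e z * rep x e u z = representative x e χ u z := by
  by_cases hz : z ∈ x.target
  · have := hs.rep_eq (u := e) (a := 1) (x.map_target hz) (one_smul _ _).symm
    rw [x.right_inv hz] at this
    rw [representative_eq, representative_eq, this, mul_one]
  · rw [rep_of_notMem hz, mul_zero, representative_eq, rep_of_notMem hz, mul_zero]

lemma measurableSection_cut (hχ : SmoothFun χ) (hu : Msec u) : Msec (cut χ u) := fun x₀ => by
  simp [cut]
  exact (continuous_ofReal.comp hχ.continuous).measurable.aemeasurable.mul (hu x₀)

lemma cut_eq_zero (hθ : IsCutoff x.source θ) (u : ∀ y, C y) : ∀ y ∉ x.source, cut θ u y = 0 :=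
  fun y hy => by rw [cut, hθ.zero hy, ofReal_zero, zero_smul]

lemma IsWeak.interior (hs : IsFlatChart S ω x e) (hw : IsWeak S ω u f)
  (hθ : IsCutoff x.source θ) : DomMin S ω (cut θ u) ∧
    MemSobolevSpace 2 fun a => representative x e θ u (toC a) := by
  obtain ⟨h1, h2⟩ := hs.smooth_representative hθ fun y hy => hs.smoothSectionAt (hθ.2 hy)
  obtain ⟨-, h3, h4⟩ := tsupport_representative (e := e) hθ e
  have hL : ∀ {u : ∀ y, C y}, u ∈ L² → MemLp (fun a => rep x e u (toC a)) 2
    volume := fun hu => (hs.memLp_rep hu).comp_measurePreserving measurePreserving_toC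
  have hsub : tsupport (fun a => representative x e θ e (toC a)) ⊆ toC ⁻¹' x.target :=
    (tsupport_comp_subset_preimage _ continuous_toC).trans (Set.preimage_mono (h3.trans h4))
  obtain ⟨g, hg, hgt, hgc⟩ := exists_interior_approximation
    (x.open_target.preimage continuous_toC) (hL hw.1) ((hL hw.2.1).const_mul (-4))
    (fun g hg ht => hw.flat hs hg ht) (isBump_toC h1 h2) hsub
  simp [hs.representative_self] at hgt
  have hm := mem_cut hθ.1 hw.1
  have hr : rep x e (cut θ u) = representative x e θ u := rep_smul θ u
  have hLr := hL hm
  simp [hr] at hLr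
  refine ⟨hs.domMin_of_bumps hm.1 (cut_eq_zero hθ u)
    (fun n => ⟨(hg n).1, (hg n).2.trans hsub⟩) ?_ hgc,
    memSobolevSpace_of_tendsto (fun n => (hg n).1) hLr hgt hgc⟩
  rwa [hr]

lemma IsFlatChart.domMin_of_sobolev (hs : IsFlatChart S ω x e) (hθ : IsCutoff x.source θ)
  (hu : Msec u)
  (h : MemSobolevSpace 2 fun a => representative x e θ u (toC a)) : DomMin S ω (cut θ u) := by
  obtain ⟨hl, h⟩ := h
  obtain ⟨w, hw, hwd⟩ := h 0 0 (by norm_num)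
  obtain ⟨w₁, hw₁, hd₁⟩ := h 2 0 (by norm_num)
  obtain ⟨w₂, hw₂, hd₂⟩ := h 0 2 (by norm_num)
  have hv := hw.ae_eq (hwd.ae_eq hl (hw.locallyIntegrable (by norm_num))).symm
  obtain ⟨hK, h3, h4⟩ := tsupport_representative (e := e) hθ u
  have hK' : IsCompact (toC ⁻¹' (x '' tsupport θ)) := by
    have := hK.image equivRealProdCLM.continuous
    rwa [ContinuousLinearEquiv.image_eq_preimage_symm, show ⇑equivRealProdCLM.symm = toC from
      funext fun a => by simp [toC, equivRealProdCLM_symm_apply]] at this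
  obtain ⟨β, hβ, -, hβ1, hβt⟩ := exists_bump hK' (x.open_target.preimage continuous_toC)
    (Set.preimage_mono h4)
  obtain ⟨g, hg, hgt, hgc⟩ := exists_interior_approximation isOpen_univ hv (hw₁.add hw₂)
    (fun g hg _ => hd₁.lap hd₂ hl (hw₁.locallyIntegrable (by norm_num))
      (hw₂.locallyIntegrable (by norm_num)) g hg) hβ (Set.subset_univ _)
  refine hs.domMin_of_bumps (measurableSection_cut hθ.1 hu) (cut_eq_zero hθ u)
    (fun n => ⟨(hg n).1, (hg n).2.trans hβt⟩) ?_ hgc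
  refine hgt.congr fun n => ?_
  congr 1
  funext a
  rw [show rep x e (cut θ u) = representative x e θ u from rep_smul θ u]
  by_cases ha : toC a ∈ x '' tsupport θ
  · rw [hβ1.self_of_nhdsSet a ha, one_mul]
  · rw [zero_off_tsupport fun h => ha (h3 h), mul_zero]

lemma SmoothFun.mul (hθ : SmoothFun θ) (hζ : SmoothFun ζ) : SmoothFun fun y => θ y * ζ y :=
  ContMDiff.comp (I' := 𝓘(ℝ, ℝ²)) (g := fun p : ℝ² => p.1 * p.2)
    contDiff_mul.contMDiff (hθ.prodMk_space hζ)

lemma IsCutoff.mul (hθ : IsCutoff x.source θ) (hζ : SmoothFun ζ) :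
  IsCutoff x.source fun y => θ y * ζ y :=
  ⟨SmoothFun.mul hθ.1 hζ, tsupport_mul_subset_left.trans hθ.2⟩

lemma domMin_cut_of_local (hζ : SmoothFun ζ) (h0 : ∀ y, ω.1 y = 0 → ∀ᶠ y' in 𝓝 y, ζ y' = 0)
  (h : ∀ (x : Chart) (e : ∀ y, C y) (θ : X → ℝ), IsFlatChart S ω x e →
    IsCutoff x.source θ → DomMin S ω (cut θ u)) : DomMin S ω (cut ζ u) := by
  obtain ⟨t, x, e, θ, hs, hθ, h1⟩ := exists_flat_partition (C := C) S ω (isClosed_tsupport ζ)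
    fun y hy hy0 => notMem_tsupport_iff_eventuallyEq.2 (h0 y hy0) hy
  have h2 := DomMin.sum t (φ := fun i => cut (fun y => θ i y * ζ y) u)
    fun i _ => h _ _ _ (hs i) ((hθ i).mul hζ)
  have he : (fun y => ∑ i ∈ t, cut (fun y => θ i y * ζ y) u y) = cut ζ u := ?_
  · rwa [he] at h2
  funext y
  simp only [cut, ← Finset.sum_smul, ← ofReal_sum, ← Finset.sum_mul]
  by_cases hy : y ∈ tsupport ζ
  · rw [h1 y hy, one_mul]
  · rw [zero_off_tsupport hy, mul_zero]

lemma IsWeak.domMin_cut (hw : IsWeak S ω u f) (hζ : SmoothFun ζ)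
  (h0 : ∀ y, ω.1 y = 0 → ∀ᶠ y' in 𝓝 y, ζ y' = 0) : DomMin S ω (cut ζ u) :=
  domMin_cut_of_local hζ h0 fun _ _ _ hs hθ => (hw.interior hs hθ).1

lemma IsWeak.exists_cut (hw : IsWeak S ω u f) (hχ : SmoothFun χ)
  (h0 : ∀ y, ω.1 y = 0 → (∀ᶠ y' in 𝓝 y, χ y' = 0) ∨ ∀ᶠ y' in 𝓝 y, χ y' = 1) :
  ∃ f', IsWeak S ω (cut χ u) f' := by
  set D := {y | (∀ᶠ y' in 𝓝 y, χ y' = 0) ∨ ∀ᶠ y' in 𝓝 y, χ y' = 1}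
  have hD : IsOpen D := (isOpen_setOfPred_eventually_nhds).union isOpen_setOfPred_eventually_nhds
  obtain ⟨ζ, hζ, hζs, hζ1⟩ := exists_cutoff hD.isClosed_compl (isClosed_zeros ω).isOpen_compl
    (Set.compl_subset_compl.2 fun y hy => h0 y hy)
  have hζ0 : ∀ y, ω.1 y = 0 → ∀ᶠ y' in 𝓝 y, ζ y' = 0 := fun y hy =>
    notMem_tsupport_iff_eventuallyEq.1 fun h => hζs h hy
  obtain ⟨g, hg, -⟩ := (hw.domMin_cut hζ hζ0).exists_isWeak
  have hχζ := (hw.domMin_cut (ζ := fun y => χ y * ζ y) (hχ.mul hζ) fun y hy =>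
    (hζ0 y hy).mono fun y' h => by simp [h])
  rw [show cut (fun y => χ y * ζ y) u = cut χ (cut ζ u) from
    funext fun y => by simp only [cut, smul_smul, ofReal_mul]] at hχζ
  obtain ⟨g', hg', -⟩ := hχζ.exists_isWeak
  refine ⟨fun y => cut χ f y - (cut χ g y - g' y), mem_cut hχ hw.1, mem_sub (mem_cut hχ hw.2.1)
    (mem_sub (mem_cut hχ hg.2.1) hg'.2.1), fun ψ hψ => ?_⟩
  have hχψ := hψ.cut hχ
  have e1 := hw.2.2 _ hχψ
  have e2 := hg.2.2 _ hχψ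
  have e3 := hg'.2.2 _ hψ
  have e4 : ip S ω u (fun y => laplacian S ω (cut χ ψ) y - cut χ (laplacian S ω ψ) y)
      = ip S ω (cut ζ u) (fun y => laplacian S ω (cut χ ψ) y - cut χ (laplacian S ω ψ) y) := by
    refine ip_congr fun y => ⟨?_, .inl rfl⟩
    by_cases hy : y ∈ D
    · rcases hy with hy | hy
      · rw [laplacian_eq_zero (hy.mono fun y' h => by simp [cut, h])]
        simp [cut, hy.self_of_nhds]
      · rw [laplacian_congr (hy.mono fun y' h => by rw [cut, h, ofReal_one, one_smul])]
        simp [cut, hy.self_of_nhds]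
    · simp [cut, (hζ1 y hy).self_of_nhds]
  have hm := mem_cut hχ hψ.mem.2 (S := S)
  rw [ip_sub_right hw.1 hχψ.mem.2 hm, ip_sub_right hg.1 hχψ.mem.2 hm, e1, e2] at e4
  rw [ip_sub_left (mem_cut hχ hw.2.1) (mem_sub (mem_cut hχ hg.2.1) hg'.2.1) hψ.mem.1,
    ip_sub_left (mem_cut hχ hg.2.1) hg'.2.1 hψ.mem.1, ← e3, ip_cut, ip_cut, ip_cut, ip_cut χ (cut ζ u)]
  linear_combination -e4

/-! ### Approximable functions and the weighted space on the cone -/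

section ConeSpaces

open ENNReal

/-- A slowly decaying integrable weight on the line. -/
def decay (φ : ℝ) : ℝ≥0∞ := ENNReal.ofReal (1 + φ ^ 2)⁻¹

lemma decay_props (φ : ℝ) : decay φ ≠ 0 ∧ decay φ ≠ ⊤ :=
  ⟨by rw [decay, Ne, ENNReal.ofReal_eq_zero, not_le]; positivity, ofReal_ne_top⟩

lemma measurable_decay : Measurable decay := by unfold decay; fun_prop

lemma decay_le {x y : ℝ} (h : |x - y| ≤ 4 * π) :
  decay x ≤ ENNReal.ofReal (2 + 2 * (4 * π) ^ 2) * decay y := by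
  rw [decay, decay, ← ENNReal.ofReal_mul (by positivity)]
  refine ENNReal.ofReal_le_ofReal ?_
  rw [← div_eq_mul_inv, inv_eq_one_div, div_le_div_iff₀ (by positivity) (by positivity)]
  have h1 := sq_le_sq' (abs_le.1 h).1 (abs_le.1 h).2
  nlinarith [sq_nonneg (2 * x - y), sq_nonneg (x * (4 * π)), sq_nonneg x]

lemma four_pi_pos : 0 < 4 * π := by positivity

lemma lintegral_period {f : ℝ → ℝ≥0∞} (hf : ∀ φ, f (φ + 4 * π) = f φ) (a : ℝ) :
  ∫⁻ φ in Set.Icc a (a + 4 * π), f φ = ∫⁻ φ, f φ ∂circleVol := by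
  rw [setLIntegral_congr Ioc_ae_eq_Icc.symm, circleVol, show Set.Ioc (-(2 * π)) (2 * π)
    = Set.Ioc (-(2 * π)) (-(2 * π) + 4 * π) by ring_nf]
  refine (isAddFundamentalDomain_Ioc four_pi_pos a).setLIntegral_eq
    (isAddFundamentalDomain_Ioc four_pi_pos (-(2 * π))) _ fun g x => ?_
  obtain ⟨g, n, rfl⟩ := g
  simpa [AddSubgroup.vadd_def, add_comm] using (Function.Periodic.zsmul (f := f) hf n) x

lemma exists_lintegral_decay_le : ∃ K : ℝ≥0∞, K ≠ ⊤ ∧ ∀ f : ℝ → ℝ≥0∞, (∀ φ, f (φ + 4 * π) = f φ) →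
  ∫⁻ φ, f φ * decay φ ≤ K * ∫⁻ φ, f φ ∂circleVol := by
  set c := ENNReal.ofReal (2 + 2 * (4 * π) ^ 2)
  have hd := isAddFundamentalDomain_Ioc four_pi_pos (-(2 * π))
  have hs : -(2 * π) + 4 * π = 2 * π := by ring
  rw [hs] at hd
  have hx : ∀ (g : AddSubgroup.zmultiples (4 * π)), ∀ x ∈ Set.Ioc (-(2 * π)) (2 * π),
      decay (-g +ᵥ x) ≤ c * decay (-g : ℝ) ∧ decay (-g : ℝ) ≤ c * decay (-g +ᵥ x) := fun g x hx => by
    have hpi := Real.pi_pos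
    have : |x| ≤ 4 * π := abs_le.2 ⟨by linarith [hx.1], by linarith [hx.2]⟩
    refine ⟨decay_le ?_, decay_le ?_⟩ <;> simpa [AddSubgroup.vadd_def]
  have hfin : ∑' g : AddSubgroup.zmultiples (4 * π), decay (-g : ℝ) ≠ ⊤ := fun h => by
    have h1 : ∑' g : AddSubgroup.zmultiples (4 * π),
        decay (-g : ℝ) * ENNReal.ofReal (4 * π) ≤ c * ∫⁻ φ, decay φ := by
      rw [hd.lintegral_eq_tsum' decay, ← ENNReal.tsum_mul_left]
      refine ENNReal.tsum_le_tsum fun g => ?_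
      calc _ = ∫⁻ x in Set.Ioc (-(2 * π)) (2 * π), decay (-g : ℝ) := by
            rw [setLIntegral_const, Real.volume_Ioc]; ring
        _ ≤ ∫⁻ x in Set.Ioc (-(2 * π)) (2 * π), c * decay (-g +ᵥ x) :=
            setLIntegral_mono' measurableSet_Ioc fun x h => (hx g x h).2
        _ = _ := lintegral_const_mul' _ _ ofReal_ne_top
    rw [ENNReal.tsum_mul_right, h, top_mul (by simp [Real.pi_pos])] at h1
    exact (ENNReal.mul_lt_top ofReal_lt_top (integrable_inv_one_add_sq.lintegral_lt_top)).ne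
      (top_le_iff.1 h1)
  refine ⟨∑' g : AddSubgroup.zmultiples (4 * π), c * decay (-g : ℝ), by
    rw [ENNReal.tsum_mul_left]; exact mul_ne_top ofReal_ne_top hfin, fun f hf => ?_⟩
  rw [hd.lintegral_eq_tsum', ← ENNReal.tsum_mul_right]
  refine ENNReal.tsum_le_tsum fun g => ?_
  rw [← lintegral_const_mul' _ _ (mul_ne_top ofReal_ne_top (decay_props _).2)]
  refine setLIntegral_mono' measurableSet_Ioc fun x h => ?_
  have : f (-g +ᵥ x) = f x := by
    obtain ⟨g, n, rfl⟩ := g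
    simpa [AddSubgroup.vadd_def, add_comm] using (Function.Periodic.zsmul (f := f) hf (-n)) x
  rw [this, mul_comm]
  gcongr
  exact (hx g x h).1

lemma exists_lintegral_strip_le : ∃ K : ℝ≥0∞, K ≠ ⊤ ∧ ∀ F : ℝ × ℝ → ℝ≥0∞, AEMeasurable F →
  (∀ s φ, F (s, φ + 4 * π) = F (s, φ)) →
  ∫⁻ a, F a * decay a.2 ≤ K * ∫⁻ a, F a ∂svol := by
  obtain ⟨K, hK, h⟩ := exists_lintegral_decay_le
  refine ⟨K, hK, fun F hF hp => ?_⟩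
  have h1 : AEMeasurable F ((volume : Measure ℝ).prod circleVol) := by
    rw [← stripVol_eq]; exact hF.restrict
  rw [stripVol_eq, lintegral_prod _ h1, Measure.volume_eq_prod,
    lintegral_prod (fun a : ℝ² => F a * decay a.2)
      (hF.mul (measurable_decay.comp measurable_snd).aemeasurable), ← lintegral_const_mul' _ _ hK]
  exact lintegral_mono fun s => h _ (hp s)

lemma lintegral_strip_eq {F : ℝ × ℝ → ℝ≥0∞} (hF : Measurable F)
  (hp : ∀ s φ, F (s, φ + 4 * π) = F (s, φ)) (φ₀ : ℝ) :
  ∫⁻ a in Set.univ ×ˢ Set.Icc φ₀ (φ₀ + 4 * π), F a = ∫⁻ a, F a ∂svol := by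
  rw [stripVol_eq, lintegral_prod _ hF.aemeasurable, Measure.volume_eq_prod,
    ← Measure.prod_restrict, Measure.restrict_univ, lintegral_prod _ hF.aemeasurable]
  exact lintegral_congr fun s => lintegral_period (hp s) φ₀

lemma quasiMeasurePreserving_econe_volume : Measure.QuasiMeasurePreserving econe volume volume := by
  refine ⟨measurable_econe, Measure.AbsolutelyContinuous.mk fun N hN h0 => ?_⟩
  rw [Measure.map_apply measurable_econe hN]
  obtain ⟨K, -, h⟩ := exists_lintegral_strip_le
  set F : ℝ × ℝ → ℝ≥0∞ := (econe ⁻¹' N).indicator 1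
  have hm := measurable_econe hN
  have hF : Measurable F := measurable_one.indicator hm
  have h1 := h F hF.aemeasurable fun s φ => by
    change Set.indicator N 1 (econe _) = Set.indicator N 1 (econe _); rw [econe_add]
  rw [lintegral_indicator_one hm, ← Measure.map_apply measurable_econe hN,
    quasiMeasurePreserving_econe.absolutelyContinuous h0, mul_zero, nonpos_iff_eq_zero,
    lintegral_eq_zero_iff (f := fun a => F a * decay a.2)
      (hF.mul (measurable_decay.comp measurable_snd))] at h1
  refine measure_mono_null (fun a ha => ?_) (ae_iff.1 h1)
  simp [F, show econe a ∈ N from ha, (decay_props _).1]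

/-- A measure on the plane controlled by the weighted norm of antiperiodic functions. -/
def decayVol : Measure ℝ² := volume.withDensity fun a => ‖wt a‖ₑ ^ 2 * decay a.2

lemma measurable_wt : Measurable wt := smooth_wt.continuous.measurable

lemma wt_ne_zero (a : ℝ²) : wt a ≠ 0 := by rw [wt]; exact_mod_cast (Real.exp_pos _).ne'

lemma measurable_decayDensity : Measurable fun a : ℝ² => ‖wt a‖ₑ ^ 2 * decay a.2 :=
  (measurable_wt.enorm.pow_const _).mul (measurable_decay.comp measurable_snd)

lemma dominates_decayVol : Dominates decayVol := by
  have h0 : ∀ a : ℝ², ‖wt a‖ₑ ^ 2 * decay a.2 ≠ 0 := fun a =>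
    mul_ne_zero (pow_ne_zero _ (by simp [wt_ne_zero])) (decay_props _).1
  refine ⟨withDensity_absolutelyContinuous' measurable_decayDensity.aemeasurable
    (.of_forall h0), fun K hK => ?_⟩
  have hc : ContinuousOn (fun a : ℝ² => rexp (2 * a.1) * (1 + a.2 ^ 2)) K := by fun_prop
  obtain ⟨M, hM⟩ := hK.exists_bound_of_continuousOn hc
  refine ⟨ENNReal.ofReal M, ofReal_ne_top, ?_⟩
  have h2 : ∀ a ∈ K, 1 ≤ ENNReal.ofReal M * (‖wt a‖ₑ ^ 2 * decay a.2) := fun a ha => by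
    rw [← ofReal_norm, wt, norm_rexp, decay,
      ← ENNReal.ofReal_pow (Real.exp_pos _).le, ← ENNReal.ofReal_mul (by positivity),
      ← ENNReal.ofReal_mul ((norm_nonneg _).trans (hM a ha)), ← ENNReal.ofReal_one]
    refine ENNReal.ofReal_le_ofReal ?_
    have h3 := (le_abs_self _).trans (hM a ha)
    rw [← Real.exp_nat_mul, ← mul_assoc, ← div_eq_mul_inv, le_div_iff₀ (by positivity), one_mul]
    calc 1 + a.2 ^ 2 = (rexp (2 * a.1) * (1 + a.2 ^ 2)) * rexp (((2 : ℕ) : ℝ) * -a.1) := by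
          rw [mul_right_comm, ← Real.exp_add]; norm_num
      _ ≤ _ := by gcongr
  refine Measure.le_iff.2 fun A hA => ?_
  rw [Measure.smul_apply, decayVol, withDensity_apply _ hA, smul_eq_mul,
    ← lintegral_const_mul' _ _ ofReal_ne_top, Measure.restrict_apply hA]
  calc volume (A ∩ K) = ∫⁻ a in A ∩ K, 1 := by simp
    _ ≤ ∫⁻ a in A ∩ K, ENNReal.ofReal M * (‖wt a‖ₑ ^ 2 * decay a.2) :=
      setLIntegral_mono' (hA.inter hK.measurableSet) fun a ha => h2 a ha.2
    _ ≤ _ := lintegral_mono_set Set.inter_subset_left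

lemma eLpNorm_decayVol (f : Fn) :
  eLpNorm f 2 decayVol ^ 2 = ∫⁻ a, ‖wt a * f a‖ₑ ^ 2 * decay a.2 := by
  rw [eLpNorm_two_sq, decayVol, lintegral_withDensity_eq_lintegral_mul_non_measurable _
    measurable_decayDensity (.of_forall fun a =>
      ENNReal.mul_lt_top (by simp) (decay_props _).2.lt_top)]
  refine lintegral_congr fun a => ?_
  simp
  ring

lemma exists_eLpNorm_decayVol_le : ∃ K : ℝ≥0∞, K ≠ ⊤ ∧ ∀ f : Fn,
  AEStronglyMeasurable f → AntiPer f →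
  eLpNorm f 2 decayVol ≤ K * eLpNorm (fun a => wt a * f a) 2 svol := by
  obtain ⟨K, hK, h⟩ := exists_lintegral_strip_le
  refine ⟨K + 1, by simp [hK], fun f hf ha => ?_⟩
  rw [← sq_le_sq_ennreal, eLpNorm_decayVol, mul_pow, eLpNorm_two_sq]
  refine (h (fun a => ‖wt a * f a‖ₑ ^ 2)
    ((measurable_wt.aemeasurable.mul hf.aemeasurable).enorm.pow_const _) fun s φ => by
    simp [ha s φ, wt]).trans ?_
  gcongr
  calc K ≤ K + 1 := le_self_add
    _ = (K + 1) * 1 := (mul_one _).symm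
    _ ≤ (K + 1) ^ 2 := by rw [sq]; gcongr; exact le_add_self

/-- `v` is a limit of smooth antiperiodic functions in the graph norm of the cone Laplacian. -/
def ConeApprox (v : Fn) : Prop := ∃ ψ : ℕ → Fn, (∀ n, Cyl (ψ n)) ∧
  Tendsto (fun n => eLpNorm (fun a => wt a * ψ n a - wt a * v a) 2 svol) atTop (𝓝 0) ∧
  Tendsto (fun k : ℕ × ℕ => eLpNorm (fun a => wt a * lap (ψ k.1) a - wt a * lap (ψ k.2) a) 2
    svol) atTop (𝓝 0)

lemma lintegral_weight (ν : Measure ℝ²) (f : Fn) :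
  ∫⁻ a : ℝ², ‖f a‖ₑ ^ 2 * ENNReal.ofReal (rexp (2 * -1 * a.1)) ∂ν
    = eLpNorm (fun a => wt a * f a) 2 ν ^ 2 := by
  rw [eLpNorm_two_sq]
  refine lintegral_congr fun a => ?_
  rw [enorm_mul, mul_pow, mul_comm, ← ofReal_norm (wt a), wt, norm_rexp, ← ENNReal.ofReal_pow (Real.exp_pos _).le,
    ← Real.exp_nat_mul]
  ring

lemma ConeApprox.memConeSpace {v : Fn} (h : ConeApprox v) (hm : AEStronglyMeasurable v)
  (ha : AntiPer v) : MemConeSpace (4 * π) 2 (-1) v := by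
  obtain ⟨ψ, hψ, hv, hc⟩ := h
  obtain ⟨K, hK, hle⟩ := exists_eLpNorm_decayVol_le
  have hfin : ∀ {f : Fn}, AEStronglyMeasurable f volume → AntiPer f → eLpNorm (fun a => wt a * f a) 2 svol ≠ ⊤ →
      MemLp f 2 decayVol := fun hf hfa ht =>
    ⟨hf.mono_ac (withDensity_absolutelyContinuous _ _), (hle _ hf hfa).trans_lt
      (ENNReal.mul_lt_top hK.lt_top ht.lt_top)⟩
  have hcyl : ∀ {f}, Cyl f → MemLp f 2 decayVol := fun hf =>
    hfin hf.1.continuous.aestronglyMeasurable hf.2.1 (memLp_of_cyl hf.wt_mul).2.ne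
  have hd : ∀ {f g : Fn}, AntiPer f → AntiPer g → AntiPer fun a => f a - g a :=
    fun hf hg s φ => by simp [hf s φ, hg s φ]; ring
  have hvψ := tendsto_of_le_const_mul hK hv fun n => by
      simp [← mul_sub]
      exact hle _ ((hψ n).1.continuous.aestronglyMeasurable.sub hm) (hd (hψ n).2.1 ha)
  have hvm : MemLp v 2 decayVol := by
    obtain ⟨n, hn⟩ := (hvψ.eventually (gt_mem_nhds zero_lt_one)).exists
    have h1 : MemLp (fun a => ψ n a - v a) 2 decayVol :=
      ⟨((hψ n).1.continuous.aestronglyMeasurable.sub hm).mono_ac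
        (withDensity_absolutelyContinuous _ _), hn.trans one_lt_top⟩
    simpa [Pi.sub_def] using (hcyl (hψ n)).sub h1
  refine ⟨dominates_decayVol.locallyIntegrable hvm, ha, fun p q hpq => ?_⟩
  have hq := tendsto_dSP_of_lap hψ hc hpq
  have hD := fun n => (hψ n).dSP p q
  obtain ⟨w, hw, hwd, hwl⟩ := dominates_decayVol.exists_hasWeakDeriv (fun n => (hψ n).1)
    (fun n => hcyl (hψ n)) hvm hvψ (fun n => hcyl (hD n)) (tendsto_of_le_const_mul hK hq fun k => by
      simp [← mul_sub]
      exact hle _ ((hD _).sub (hD _)).1.continuous.aestronglyMeasurable ((hD _).sub (hD _)).2.1)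
  obtain ⟨W, hW, hWl⟩ := exists_eLpNorm_limit (fun n => memLp_of_cyl (hD n).wt_mul) hq
  have hwm := hw.1.mono_ac dominates_decayVol.absCont
  refine ⟨w, dominates_decayVol.locallyIntegrable hw, hwd, lt_of_le_of_lt (iSup_le fun φ₀ => ?_)
    (ENNReal.pow_lt_top hW.2 : eLpNorm W 2 svol ^ 2 < ⊤)⟩
  set ν := (volume : Measure ℝ²).restrict (Set.univ ×ˢ Set.Icc φ₀ (φ₀ + 4 * π))
  rw [lintegral_weight, sq_le_sq_ennreal]
  set c := ENNReal.ofReal (1 + (|φ₀| + 4 * π) ^ 2)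
  have hcν : ∀ f : Fn, eLpNorm (fun a => wt a * f a) 2 ν ≤ (c + 1) * eLpNorm f 2 decayVol :=
    fun f => by
    rw [← sq_le_sq_ennreal, mul_pow, eLpNorm_decayVol, eLpNorm_two_sq,
      ← lintegral_const_mul' _ _ (by simp [c])]
    refine (setLIntegral_mono' (MeasurableSet.univ.prod measurableSet_Icc) fun a ha => ?_).trans
      (lintegral_mono' Measure.restrict_le_self le_rfl)
    have h1 : 1 ≤ c * decay a.2 := by
      rw [decay, ← ENNReal.ofReal_mul (by positivity), ← ENNReal.ofReal_one]
      refine ENNReal.ofReal_le_ofReal ?_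
      rw [← div_eq_mul_inv, le_div_iff₀ (by positivity), one_mul]
      have h3 : |a.2| ≤ |φ₀| + 4 * π := abs_le.2
        ⟨by linarith [ha.2.1, neg_abs_le φ₀, four_pi_pos], by linarith [ha.2.2, le_abs_self φ₀]⟩
      linarith [(sq_abs a.2).symm.trans_le (pow_le_pow_left₀ (abs_nonneg _) h3 2)]
    calc ‖wt a * f a‖ₑ ^ 2 ≤ (c * decay a.2) * ‖wt a * f a‖ₑ ^ 2 := le_mul_of_one_le_left' h1
      _ ≤ ((c + 1) ^ 2 * decay a.2) * ‖wt a * f a‖ₑ ^ 2 := by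
        gcongr
        calc c ≤ c + 1 := le_self_add
          _ = (c + 1) * 1 := (mul_one _).symm
          _ ≤ (c + 1) ^ 2 := by rw [sq]; gcongr; exact le_add_self
      _ = _ := by ring
  have hlim : Tendsto (fun n => (c + 1) * eLpNorm (fun a => dSP p q (ψ n) a - w a) 2 decayVol
      + (eLpNorm (fun a => wt a * dSP p q (ψ n) a - W a) 2 svol + eLpNorm W 2 svol)) atTop
      (𝓝 (eLpNorm W 2 svol)) := by
    simpa using (ENNReal.Tendsto.const_mul hwl (.inr (by simp [c] : c + 1 ≠ ⊤))).add
      (hWl.add_const (eLpNorm W 2 svol))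
  refine ge_of_tendsto' hlim fun n => ?_
  have hmν : ∀ {f : Fn}, AEStronglyMeasurable f volume →
      AEStronglyMeasurable (fun a => wt a * f a) ν := fun hf =>
    (smooth_wt.continuous.aestronglyMeasurable.mul hf).restrict
  have hDm := (hD n).1.continuous.aestronglyMeasurable (μ := (volume : Measure ℝ²))
  have e2 : eLpNorm (fun a => wt a * dSP p q (ψ n) a) 2 ν
      = eLpNorm (fun a => wt a * dSP p q (ψ n) a) 2 svol := by
    suffices h : eLpNorm (fun a => wt a * dSP p q (ψ n) a) 2 ν ^ 2
        = eLpNorm (fun a => wt a * dSP p q (ψ n) a) 2 svol ^ 2 from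
      (sq_le_sq_ennreal.1 h.le).antisymm (sq_le_sq_ennreal.1 h.ge)
    rw [eLpNorm_two_sq, eLpNorm_two_sq]
    refine lintegral_strip_eq ((hD n).wt_mul.1.continuous.measurable.enorm.pow_const _)
      (fun s φ => ?_) φ₀
    simp [(hD n).2.1 s φ, wt]
  calc eLpNorm (fun a => wt a * w a) 2 ν
      = eLpNorm ((fun a => wt a * dSP p q (ψ n) a) - fun a => wt a * (dSP p q (ψ n) a - w a)) 2 ν := by
        congr 1; funext a; simp; ring
    _ ≤ eLpNorm (fun a => wt a * dSP p q (ψ n) a) 2 ν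
        + eLpNorm (fun a => wt a * (dSP p q (ψ n) a - w a)) 2 ν :=
      eLpNorm_sub_le (hmν hDm) (hmν (hDm.sub hwm)) (by norm_num)
    _ ≤ _ := by
      rw [e2, add_comm]
      refine add_le_add (hcν _) ?_
      calc _ = eLpNorm ((fun a => wt a * dSP p q (ψ n) a - W a) + W) 2 svol := by
            congr 1; funext a; simp
        _ ≤ _ := eLpNorm_add_le (((memLp_of_cyl (hD n).wt_mul).sub hW).1) hW.1 (by norm_num)

lemma graph_mul {v B : Fn} {ψ : ℕ → Fn} (hψ : ∀ n, Cyl (ψ n))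
  (hv : Tendsto (fun n => eLpNorm (fun a => wt a * ψ n a - wt a * v a) 2 svol) atTop (𝓝 0))
  (hc : Tendsto (fun k : ℕ × ℕ => eLpNorm (fun a => wt a * lap (ψ k.1) a - wt a * lap (ψ k.2) a)
    2 svol) atTop (𝓝 0)) (hB : Smooth B)
  (hp : ∀ s φ, B (s, φ + 4 * π) = B (s, φ)) {M : ℝ}
  (hM : ∀ a, ‖B a‖ ≤ M ∧ ‖dS B a‖ ≤ M ∧ ‖dP B a‖ ≤ M ∧ ‖lap B a‖ ≤ M) :
  (∀ n, Cyl fun a => B a * ψ n a) ∧ Tendsto (fun n => eLpNorm (fun a => wt a * (B a * ψ n a) -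
    wt a * (B a * v a)) 2 svol) atTop (𝓝 0) ∧ Tendsto (fun k : ℕ × ℕ => eLpNorm (fun a =>
    wt a * lap (fun a => B a * ψ k.1 a) a - wt a * lap (fun a => B a * ψ k.2 a) a) 2 svol)
    atTop (𝓝 0) := by
  have hmul : ∀ {ι : Type} {l : Filter ι} {f : ι → Fn} {g : Fn}, (∀ a, ‖g a‖ ≤ M) →
      Tendsto (fun i => eLpNorm (f i) 2 svol) l (𝓝 0) →
      Tendsto (fun i => eLpNorm (fun a => g a * f i a) 2 svol) l (𝓝 0) := fun hg hf =>
    tendsto_of_le_const_mul ofReal_ne_top hf fun i =>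
      eLpNorm_le_mul_eLpNorm_of_ae_le_mul (.of_forall fun a => by
        rw [norm_mul]; gcongr; exact hg a) 2
  have hC : ∀ {f}, Cyl f → Cyl fun a => B a * f a := fun hf =>
    ⟨hB.mul hf.1, fun s φ => by simp [hp s φ, hf.2.1 s φ], hf.2.2.mul_left _⟩
  refine ⟨fun n => hC (hψ n), ?_, ?_⟩
  · refine (hmul (fun a => (hM a).1) hv).congr fun n => ?_
    congr 1; funext a; ring
  · have t0 := hmul (fun a => (hM a).1) hc
    have t1 := hmul (fun a => (hM a).2.1) (tendsto_dSP_of_lap hψ hc (p := 1) (q := 0) (by norm_num))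
    have t2 := hmul (fun a => (hM a).2.2.1) (tendsto_dSP_of_lap hψ hc (p := 0) (q := 1) (by norm_num))
    have t3 := hmul (fun a => (hM a).2.2.2) (tendsto_dSP_of_lap hψ hc (p := 0) (q := 0) (by norm_num))
    have hlim := t0.add ((t1.add t1).add ((t2.add t2).add t3))
    simp at hlim
    refine tendsto_of_tendsto_of_tendsto_of_le_of_le tendsto_const_nhds hlim (fun _ => zero_le)
      fun k => ?_
    have hm : ∀ {f g b : Fn}, Smooth f → Smooth g → Smooth b → AEStronglyMeasurable
        (fun a => b a * (wt a * f a - wt a * g a)) svol := fun hf hg hb =>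
      (hb.mul ((smooth_wt.mul hf).sub (smooth_wt.mul hg))).continuous.aestronglyMeasurable
    have hs := fun n => (hψ n).1
    have m0 := hm (hs k.1).lap (hs k.2).lap hB
    have m1 := hm ((hs k.1).dSP 1 0) ((hs k.2).dSP 1 0) hB.dS
    have m2 := hm ((hs k.1).dSP 0 1) ((hs k.2).dSP 0 1) hB.dP
    have m3 := hm ((hs k.1).dSP 0 0) ((hs k.2).dSP 0 0) hB.lap
    refine (eLpNorm_congr_ae (.of_forall fun a => ?_)).trans_le
      ((eLpNorm_add_le m0 ((m1.add m1).add ((m2.add m2).add m3)) (by norm_num)).trans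
      (add_le_add le_rfl ((eLpNorm_add_le (m1.add m1) ((m2.add m2).add m3) (by norm_num)).trans
      (add_le_add (eLpNorm_add_le m1 m1 (by norm_num))
      ((eLpNorm_add_le (m2.add m2) m3 (by norm_num)).trans (add_le_add
        (eLpNorm_add_le m2 m2 (by norm_num)) le_rfl))))))
    simp [lap_mul hB (hs _), dSP]
    ring

end ConeSpaces

/-! ### Unfolding the cone -/

section Unfolding

open Real (smoothTransition)

lemma ModeApprox.coneApprox {v : Fn} (h : ModeApprox v) : ConeApprox v :=
  let ⟨ψ, h1, h2⟩ := h; ⟨ψ, fun n => cyl_of_mem_modeSpan (h1 n), h2⟩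

/-- A smooth step. -/
def step (s : ℝ) : ℂ := (smoothTransition s : ℂ)

lemma isStep_step : IsStep step where
  smooth := ofRealCLM.contDiff.comp Real.smoothTransition.contDiff
  left := ⟨0, fun s hs => by simp [step, Real.smoothTransition.zero_of_nonpos hs]⟩
  right := ⟨1, fun s hs => by simp [step, Real.smoothTransition.one_of_one_le hs]⟩

/-- The rotation by `4π`. -/
def rot (a : ℝ²) : ℝ² := a + (0, 4 * π)

lemma measurePreserving_rot : MeasurePreserving rot volume volume :=
  measurePreserving_add_right volume _

variable {P : Fn} (hp : (fun a => P (rot a)) =ᵐ[volume] P)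
  (hi : ∀ c, IntegrableOn P {a | |a.2| ≤ c})
include hp hi

/-- The difference of two shifts of a function by `2 * π`. -/
def shiftDiff (τ : ℝ → ℂ) (x : ℝ) : ℂ := τ (x + 2 * π) - τ (x - 2 * π)

lemma integral_fold_sub {τ : ℝ → ℂ} (hτ : Measurable τ) {M : ℝ} (hM : ∀ x, ‖τ x‖ ≤ M)
  (h0 : ∀ x, 1 < |x| → τ x = 0) :
  Integrable (fun a => P a * shiftDiff τ a.2) ∧ ∫ a, P a * shiftDiff τ a.2 = 0 := by
  have hI : ∀ c, Integrable fun a : ℝ² => P a * τ (a.2 + c) := fun c => by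
    refine (((hi (1 + |c|)).integrable_indicator (measurableSet_le (by fun_prop)
      (by fun_prop))).mul_bdd (g := fun a => τ (a.2 + c))
      (hτ.comp (by fun_prop)).aestronglyMeasurable (.of_forall fun a => hM _)).congr
      (.of_forall fun a => ?_)
    by_cases ha : |a.2| ≤ 1 + |c|
    · simp [ha]
    · have := abs_sub_abs_le_abs_sub a.2 (-c)
      rw [abs_neg, sub_neg_eq_add] at this
      simp [h0 (a.2 + c) (by linarith)]
  have h1 := hI (2 * π)
  have h2 := hI (-(2 * π))
  simp only [← sub_eq_add_neg] at h2
  simp only [shiftDiff, mul_sub]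
  refine ⟨h1.sub h2, ?_⟩
  rw [integral_sub h1 h2, sub_eq_zero,
    ← integral_add_right_eq_self (fun a : ℝ² => P a * τ (a.2 - 2 * π)) (0, 4 * π)]
  refine integral_congr_ae (hp.mono fun a ha => ?_)
  change P (rot a) = P a at ha
  change P a * _ = P (rot a) * τ (a.2 + 4 * π - 2 * π)
  rw [ha]
  ring_nf

lemma integral_fold : ∫ a, P a * shiftDiff step a.2 = ∫ a, P a ∂svol := by
  set τ : ℝ → ℂ := fun x => step x - (Set.Ioi 0).indicator 1 x
  have hb : ∀ x, ‖step x‖ ≤ 1 := fun x => by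
    rw [step, norm_real, Real.norm_of_nonneg (Real.smoothTransition.nonneg x)]
    exact Real.smoothTransition.le_one x
  obtain ⟨h1, h2⟩ := integral_fold_sub hp hi (τ := τ) (M := 2)
    (isStep_step.smooth.continuous.measurable.sub (measurable_one.indicator measurableSet_Ioi))
    (fun x => (norm_sub_le _ _).trans ((add_le_add (hb x) (norm_indicator_le_norm_self 1 x)).trans
      (by norm_num))) fun x hx => by
      rcases lt_abs.1 hx with h | h
      · simp [τ, step, Real.smoothTransition.one_of_one_le h.le, zero_lt_one.trans h]
      · simp [τ, step, Real.smoothTransition.zero_of_nonpos (by linarith : x ≤ 0), Set.indicator,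
          (by linarith : x ≤ 0)]
  have h3 := ((hi (2 * π)).mono_set fun a (ha : a ∈ strip) => abs_le.2
    ⟨ha.2.1.le, ha.2.2⟩ : IntegrableOn P strip).integrable_indicator measurableSet_strip
  rw [svol, ← integral_indicator measurableSet_strip, ← sub_eq_zero, ← h2, ← sub_eq_zero,
    sub_sub, ← integral_add h3 h1, sub_eq_zero]
  refine integral_congr_ae (.of_forall fun a => ?_)
  have hpi := Real.pi_pos
  simp only [shiftDiff, τ, strip, Set.indicator, Set.mem_prod, Set.mem_univ, true_and,
    Set.mem_Ioc, Set.mem_Ioi, Pi.one_apply]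
  split_ifs <;> first | (exfalso; grind) | ring

omit hp hi

lemma lap_translate (g : Fn) (c : ℝ²) : lap (fun a => g (a + c)) = fun a => lap g (a + c) := by
  have h1 : ∀ g : Fn, dS (fun a => g (a + c)) = fun a => dS g (a + c) := fun g =>
    funext fun a => by simp [dS, fderiv_comp_add_right]
  have h2 : ∀ g : Fn, dP (fun a => g (a + c)) = fun a => dP g (a + c) := fun g =>
    funext fun a => by simp [dP, fderiv_comp_add_right]
  funext a
  simp [lap, h1, h2]

lemma ae_antiperiodic {v F : Fn} (ha : AntiPer v) (hF : LocallyIntegrable F)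
  (h : ∀ g, IsBump g → ∫ a, v a * lap g a = ∫ a, F a * g a) :
  (fun a => F (rot a)) =ᵐ[volume] fun a => -F a := by
  have hF' := (locallyIntegrable_map_homeomorph (Homeomorph.addRight ((0 : ℝ), 4 * π)) (f := F)
      (μ := volume)).1 (by
        rwa [show Measure.map (Homeomorph.addRight ((0 : ℝ), 4 * π)) volume = volume from
          measurePreserving_rot.map_eq])
  refine ae_eq_of_integral_contDiff_smul_eq hF' hF.neg fun g hg hc => ?_
  set G : Fn := fun a => (g a : ℂ)
  have hG : IsBump G := ⟨ofRealCLM.contDiff.comp hg, hc.comp_left ofReal_zero⟩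
  have hG' : IsBump fun a => G (a + -(0, 4 * π)) :=
    ⟨hG.1.comp (contDiff_id.add contDiff_const), hG.2.comp_homeomorph (Homeomorph.addRight _)⟩
  have e1 := h _ hG'
  rw [← integral_add_right_eq_self _ ((0 : ℝ), 4 * π),
    ← integral_add_right_eq_self (fun a => F a * _) ((0 : ℝ), 4 * π)] at e1
  have e2 : ∀ a : ℝ², v (a + (0, 4 * π)) = -v a := fun a => by
    rw [Prod.add_def, add_zero]; exact ha _ _
  simp only [lap_translate, add_neg_cancel_right, e2, neg_mul, integral_neg, h _ hG] at e1
  simp [mul_comm (ofReal _), integral_neg]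
  exact e1.symm

lemma integrableOn_slab {v h : Fn} (hv : LocallyIntegrable v) (hh : Continuous h)
  (hb : SBounded h) (c : ℝ) : IntegrableOn (fun a => v a * h a) {a | |a.2| ≤ c} := by
  obtain ⟨R, hR⟩ := hb
  have hK : IsCompact (Set.Icc (-R) R ×ˢ Set.Icc (-c) c) := isCompact_Icc.prod isCompact_Icc
  refine ((hv.integrableOn_isCompact hK).mul_continuousOn hh.continuousOn hK).of_forall_sdiff_eq_zero
    (measurableSet_le (by fun_prop) (by fun_prop)) fun a ha => ?_
  grind

lemma MemConeSpace.modeApprox {v : Fn} (h : MemConeSpace (4 * π) 2 (-1) v) : ModeApprox v := by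
  obtain ⟨hl, ha, h⟩ := h
  obtain ⟨w, hw, hwd, hwf⟩ := h 0 0 (by norm_num)
  obtain ⟨w₁, hw₁, hd₁, hf₁⟩ := h 2 0 (by norm_num)
  obtain ⟨w₂, hw₂, hd₂, hf₂⟩ := h 0 2 (by norm_num)
  have hL : ∀ {w : Fn}, LocallyIntegrable w → (⨆ φ₀ : ℝ, ∫⁻ a in Set.univ ×ˢ
      Set.Icc φ₀ (φ₀ + 4 * π), ‖w a‖ₑ ^ 2 * ENNReal.ofReal (rexp (2 * -1 * a.1))) < ⊤ →
      MemLp (fun a => wt a * w a) 2 svol := fun {w} hw hf => by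
    refine ⟨(smooth_wt.continuous.aestronglyMeasurable.mul hw.aestronglyMeasurable).restrict, ?_⟩
    rw [← ENNReal.pow_lt_top_iff.trans (or_iff_left two_ne_zero), ← lintegral_weight]
    refine lt_of_le_of_lt ?_ (lt_of_le_of_lt (le_iSup _ (-(2 * π))) hf)
    refine lintegral_mono_set (Set.prod_mono le_rfl fun φ hφ => ⟨hφ.1.le, ?_⟩)
    linarith [hφ.2]
  have hv : MemLp (fun a => wt a * v a) 2 svol := (memLp_congr_ae
    ((ae_restrict_of_ae (hwd.ae_eq hl hw)).mono fun a h => by simp only [h])).1 (hL hw hwf)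
  set F : Fn := fun a => w₁ a + w₂ a
  have hF : MemLp (fun a => wt a * F a) 2 svol := by
    simp only [F, mul_add]
    exact (hL hw₁ hf₁).add (hL hw₂ hf₂)
  have hFl : LocallyIntegrable F := hw₁.add hw₂
  have hlap : ∀ g, IsBump g → ∫ a, v a * lap g a = ∫ a, F a * g a := hd₁.lap hd₂ hl hw₁ hw₂
  have hva : (fun a => v (rot a)) =ᵐ[volume] fun a => -v a := .of_forall fun a => by
    change v (a + (0, 4 * π)) = _
    rw [Prod.add_def, add_zero]; exact ha _ _
  refine exists_cone_approximation (χ := step) ?_ hF isStep_step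
    (fun s => conj_ofReal _) (fun m η hη => ?_) (.inl hv)
  · refine hv.mono ((continuous_ofReal.comp (by fun_prop :
      Continuous fun a : ℝ² => rexp (-|a.1|))).aestronglyMeasurable.mul
      hl.aestronglyMeasurable.restrict) (.of_forall fun a => ?_)
    simp only [wt, norm_mul, norm_rexp]
    gcongr
    exact le_abs_self _
  set k : Fn := fun a => conj (mode η m a)
  have hk : Cyl k := ⟨(cyl_mode hη m).1.conj, (cyl_mode hη m).2.1.conj, (cyl_mode hη m).2.2.conj⟩
  have hfold : ∀ {u k : Fn}, LocallyIntegrable u → (fun a => u (rot a)) =ᵐ[volume]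
      (fun a => -u a) → Cyl k → ((fun a => u (rot a) * k (rot a)) =ᵐ[volume] fun a => u a * k a) ∧
      ∀ c, IntegrableOn (fun a => u a * k a) {a | |a.2| ≤ c} := fun hu hua hk =>
    ⟨hua.mono fun a h => by
      have : rot a = (a.1, a.2 + 4 * π) := by rw [rot, Prod.add_def, add_zero]
      dsimp only at h ⊢
      rw [h, this, hk.2.1]; simp,
      integrableOn_slab hu hk.1.continuous hk.2.2⟩
  obtain ⟨p0, i0⟩ := hfold hl hva hk.lap
  obtain ⟨p1, i1⟩ := hfold hl hva (ibpClass_cyl.dP hk)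
  obtain ⟨p2, i2⟩ := hfold hl hva hk
  obtain ⟨p3, i3⟩ := hfold hFl (ae_antiperiodic ha hFl hlap) hk
  have h0 := isStep_step.smooth
  have h1 := h0.deriv
  have z : ∀ x, x < 0 ∨ 1 < x → deriv step x = 0 ∧ deriv (deriv step) x = 0 := fun x hx => by
    obtain ⟨c, h⟩ : ∃ c : ℂ, step =ᶠ[𝓝 x] fun _ => c := hx.elim
      (fun h => ⟨0, (eventually_lt_nhds h).mono fun y hy => by
        simp [step, Real.smoothTransition.zero_of_nonpos hy.le]⟩)
      fun h => ⟨1, (eventually_gt_nhds h).mono fun y hy => by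
        simp [step, Real.smoothTransition.one_of_one_le hy.le]⟩
    rw [h.deriv_eq, h.deriv.deriv_eq]; simp
  have hz : ∀ {τ : ℝ → ℂ}, Smooth1 τ → (∀ x, x < 0 ∨ 1 < x → τ x = 0) →
      ∀ {u k : Fn}, ((fun a => u (rot a) * k (rot a)) =ᵐ[volume] fun a => u a * k a) →
      (∀ c, IntegrableOn (fun a => u a * k a) {a | |a.2| ≤ c}) →
      Integrable (fun a => u a * k a * shiftDiff τ a.2) ∧
      ∫ a, u a * k a * shiftDiff τ a.2 = 0 := fun {τ} hτ h0 _ _ p i => by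
    obtain ⟨M, hM⟩ := (HasCompactSupport.intro (isCompact_Icc (a := 0) (b := 1)) fun x hx => h0 x (by
      by_contra! h'; exact hx h') : HasCompactSupport τ).exists_bound_of_continuous hτ.continuous
    exact integral_fold_sub p i hτ.continuous.measurable hM fun x hx => h0 x
      ((lt_abs.1 hx).symm.imp_left fun h => by linarith)
  obtain ⟨j1, f1⟩ := hz h1 (fun x hx => (z x hx).1) p1 i1
  obtain ⟨j2, f2⟩ := hz h1.deriv (fun x hx => (z x hx).2) p2 i2
  set β := shiftDiff step
  have hsh : ∀ (τ : ℝ → ℂ), Smooth1 τ → ∀ x, HasDerivAt (shiftDiff τ) (shiftDiff (deriv τ) x) x :=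
    fun τ hτ x => by
      have := fun c => (hτ.diff (x + c)).hasDerivAt.comp_add_const x c
      exact (this (2 * π)).sub (this (-(2 * π)))
  have hB : Smooth fun a : ℝ² => β a.2 := smooth_snd ((h0.comp (contDiff_id.add
    contDiff_const)).sub (h0.comp (contDiff_id.sub contDiff_const)))
  have hBS : dS (fun a : ℝ² => β a.2) = fun _ => 0 := funext fun a => (dP_snd (hsh _ h0 a.2)).1
  have hBP : dP (fun a : ℝ² => β a.2) = fun a => shiftDiff (deriv step) a.2 :=
    funext fun a => (dP_snd (hsh _ h0 a.2)).2
  have hBL : lap (fun a : ℝ² => β a.2) = fun a => shiftDiff (deriv (deriv step)) a.2 :=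
    funext fun a => by
      rw [lap, hBS, hBP, show dS (fun _ : ℝ² => (0 : ℂ)) a = 0 by simp [dS], zero_add]
      exact (dP_snd (hsh _ h1 a.2)).2
  have hgb : ∀ {k : Fn}, Cyl k → IsBump fun a => β a.2 * k a := fun hk => by
    obtain ⟨R, hR⟩ := hk.2.2
    refine ⟨hB.mul hk.1, HasCompactSupport.intro (isCompact_Icc.prod isCompact_Icc :
      IsCompact (Set.Icc (-R) R ×ˢ Set.Icc (-(2 * π)) (2 * π + 1))) fun a ha => ?_⟩
    have hpi := Real.pi_pos
    by_cases h' : R ≤ |a.1|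
    · rw [hR a h', mul_zero]
    · rcases not_and_or.1 (fun h => ha ⟨abs_le.1 (not_le.1 h').le, h⟩) with h' | h' <;>
        simp only [β, shiftDiff, step] <;> rw [not_le] at h'
      · rw [Real.smoothTransition.zero_of_nonpos (by linarith),
          Real.smoothTransition.zero_of_nonpos (by linarith), sub_self, zero_mul]
      · rw [Real.smoothTransition.one_of_one_le (by linarith),
          Real.smoothTransition.one_of_one_le (by linarith), sub_self, zero_mul]
  have key := hlap _ (hgb hk)
  have j0 : Integrable fun a => v a * lap k a * β a.2 :=
    (integrable_mul_bump hl (hgb hk.lap)).congr (.of_forall fun a => by ring)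
  have e1 : ∀ a, v a * lap (fun a => β a.2 * k a) a = v a * lap k a * β a.2
      + (2 * (v a * dP k a * shiftDiff (deriv step) a.2)
      + v a * k a * shiftDiff (deriv (deriv step)) a.2) := fun a => by
    rw [lap_mul hB hk.1, hBS, hBP, hBL]; ring
  simp only [e1] at key
  simp only [mul_comm (β _), ← mul_assoc (F _)] at key
  have j3 : Integrable fun a => 2 * (v a * dP k a * shiftDiff (deriv step) a.2)
      + v a * k a * shiftDiff (deriv (deriv step)) a.2 := (j1.const_mul 2).add j2
  rw [integral_add j0 j3, integral_add (j1.const_mul 2) j2,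
    integral_const_mul, f1, f2, integral_fold p0 i0, integral_fold p3 i3] at key
  simpa [k, lap_conj (cyl_mode hη m).1] using key

end Unfolding

/-! ### Sections near a conical point -/

/-- The coordinate `s` as a function of the distinguished coordinate. -/
def logT (z : ℂ) : ℝ := 2 * Real.log (‖z‖ / √2)

/-- The function of the distinguished coordinate that corresponds to a mode. -/
def conePre (η : ℝ → ℂ) (m : ℤ) (z : ℂ) : ℂ := η (logT z) * (√‖z‖ : ℝ) * (z / (‖z‖ : ℂ)) ^ m

/-- The radius of the disc `s ≤ d`. -/
def rad (d : ℝ) : ℝ := √2 * rexp (d / 2)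

lemma exists_econe {z : ℂ} (hz : z ≠ 0) : ∃ a, econe a = z := by
  obtain ⟨a, -, h⟩ : z ∈ econe '' strip := by rw [econe_image_strip]; exact hz
  exact ⟨a, h⟩

lemma logT_econe (a : ℝ²) : logT (econe a) = a.1 := by
  rw [logT, norm_econe, mul_div_cancel_left₀ _ (by positivity), Real.log_exp]; ring

lemma logT_lt_iff {z : ℂ} (hz : z ≠ 0) : logT z < d ↔ ‖z‖ < rad d := by
  obtain ⟨a, rfl⟩ := exists_econe hz
  rw [logT_econe, norm_econe, rad, mul_lt_mul_iff_right₀ (by positivity), Real.exp_lt_exp]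
  constructor <;> intro <;> linarith

lemma lt_logT_iff {z : ℂ} (hz : z ≠ 0) : d < logT z ↔ rad d < ‖z‖ := by
  obtain ⟨a, rfl⟩ := exists_econe hz
  rw [logT_econe, norm_econe, rad, mul_lt_mul_iff_right₀ (by positivity), Real.exp_lt_exp]
  constructor <;> intro <;> linarith

lemma rad_pos (d : ℝ) : 0 < rad d := by unfold rad; positivity

lemma coneMap_conePre (η : ℝ → ℂ) (m : ℤ) : coneMap (conePre η m) = mode η m := by
  funext a
  have h2 : ((√2 : ℝ) : ℂ) ≠ 0 := by simp
  have h1 : econe a / (‖econe a‖ : ℂ) = exp ((a.2 / 2 : ℝ) * I) := by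
    rw [norm_econe, econe, ofReal_mul, mul_div_mul_left _ _ h2, ofReal_exp, ← exp_sub]
    congr 1; simp only [toC]; push_cast; ring
  have h3 : (√(√2 * rexp (a.1 / 2)) : ℝ) = (2 : ℝ) ^ (1 / 4 : ℝ) * rexp (a.1 / 4) := by
    rw [Real.sqrt_mul (by positivity), Real.sqrt_eq_rpow, Real.sqrt_eq_rpow, ← Real.rpow_mul
      (by norm_num), ← Real.exp_half]
    norm_num; ring_nf
  have h4 : (((2 : ℝ) ^ (-(1 / 4) : ℝ) : ℝ) : ℂ) * (((2 : ℝ) ^ (1 / 4 : ℝ) : ℝ) : ℂ) = 1 := by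
    rw [← ofReal_mul, ← Real.rpow_add (by norm_num)]; norm_num
  rw [coneMap, conePre, logT_econe, h1, norm_econe, h3, ← exp_int_mul, mode, phase,
    ofReal_mul, ofReal_exp]
  calc _ = η a.1 * (((2 : ℝ) ^ (-(1 / 4) : ℝ) : ℝ) * ((2 : ℝ) ^ (1 / 4 : ℝ) : ℝ)) *
        (exp (-(toC a / 4)) * exp ((a.1 / 4 : ℝ) : ℂ) * exp (m * ((a.2 / 2 : ℝ) * I))) := by ring
    _ = _ := by
      rw [h4, mul_one, ← exp_add, ← exp_add]
      congr 2; simp only [toC, kap]; push_cast; ring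

lemma contDiffAt_conePre (hη : Smooth1 η) (m : ℤ) {z : ℂ} (hz : z ≠ 0) :
  ContDiffAt ℝ ∞ (conePre η m) z := by
  have h0 : ‖z‖ ≠ 0 := norm_ne_zero_iff.2 hz
  have hn : ContDiffAt ℝ ∞ (fun z : ℂ => ‖z‖) z := contDiffAt_norm ℝ hz
  have hl : ContDiffAt ℝ ∞ logT z := contDiffAt_const.mul ((hn.div_const _).log (by positivity))
  have hq := contDiffAt_id.mul (contDiffAt_inv_norm hz)
  have hzp : ContDiffAt ℝ ∞ (fun w : ℂ => w ^ m) (z / (‖z‖ : ℂ)) := by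
    have h1 : z / (‖z‖ : ℂ) ≠ 0 := div_ne_zero hz (by simpa using hz)
    rcases m with n | n
    · fun_prop
    · exact ((contDiffAt_id (𝕜 := ℝ) (E := ℂ)).pow (n + 1)).inv (pow_ne_zero _ h1)
  exact ((hη.contDiffAt.comp z hl).mul (ofRealCLM.contDiff.contDiffAt.comp z
    (hn.sqrt h0))).mul (hzp.comp (f := fun z : ℂ => z / (‖z‖ : ℂ)) z hq)

lemma measurable_conePre (hη : Smooth1 η) (m : ℤ) : Measurable (conePre η m) := by
  have := hη.continuous.measurable
  unfold conePre logT; fun_prop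

lemma conePre_eq_zero {z : ℂ} (h : z ≠ 0 → η (logT z) = 0) : conePre η m z = 0 := by
  by_cases hz : z = 0
  · simp [conePre, hz]
  · rw [conePre, h hz, zero_mul, zero_mul]

lemma conePre_bump (hη : IsBump1 η) (m : ℤ) : SmoothC (conePre η m) ∧
  HasCompactSupport (conePre η m) ∧ 0 ∉ tsupport (conePre η m) := by
  obtain ⟨hs, c, d, h⟩ := hη
  have h0 : conePre η m =ᶠ[𝓝 0] 0 := by
    filter_upwards [Metric.ball_mem_nhds (0 : ℂ) (rad_pos c)] with z hz
    exact conePre_eq_zero fun hz0 => h _ (.inl ((logT_lt_iff hz0).2 (by simpa using hz)).le)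
  refine ⟨contDiff_iff_contDiffAt.2 fun z => ?_, HasCompactSupport.intro
    (isCompact_closedBall 0 (rad d)) fun z hz => conePre_eq_zero fun hz0 =>
      h _ (.inr ((lt_logT_iff hz0).2 (by simpa using hz)).le),
    notMem_tsupport_iff_eventuallyEq.2 h0⟩
  by_cases hz : z = 0
  · subst hz; exact contDiffAt_const.congr_of_eventuallyEq h0
  · exact contDiffAt_conePre hs m hz

lemma exists_coneMap_eq {ψ : Fn} (h : ψ ∈ modeSpan) :
  ∃ r, SmoothC r ∧ HasCompactSupport r ∧ 0 ∉ tsupport r ∧ coneMap r = ψ := by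
  induction h using Submodule.span_induction with
  | mem ψ h =>
    obtain ⟨η, m, hη, rfl⟩ := h
    obtain ⟨h1, h2, h3⟩ := conePre_bump hη m
    exact ⟨_, h1, h2, h3, coneMap_conePre η m⟩
  | zero => exact ⟨0, contDiff_const, HasCompactSupport.zero, by simp,
      funext fun a => by simp [coneMap]⟩
  | add ψ φ _ _ h1 h2 =>
    obtain ⟨r, a1, a2, a3, rfl⟩ := h1
    obtain ⟨r', b1, b2, b3, rfl⟩ := h2
    refine ⟨r + r', a1.add b1, a2.add b2, fun h => ?_, funext fun a => by simp [coneMap, mul_add]⟩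
    exact (tsupport_add r r' h).elim a3 b3
  | smul c ψ _ h1 =>
    obtain ⟨r, a1, a2, a3, rfl⟩ := h1
    exact ⟨c • r, contDiff_const.smul a1, a2.smul_left (f := fun _ => c),
      fun h => a3 (tsupport_smul_subset_right (fun _ => c) r h),
      funext fun a => by simp [coneMap]; ring⟩

lemma cyl_coneMap {r : ℂ → ℂ} (hr : SmoothC r) (hc : HasCompactSupport r) (h0 : 0 ∉ tsupport r) :
  Cyl (coneMap r) := by
  obtain ⟨ε, hε, h1⟩ := Metric.eventually_nhds_iff.1 (notMem_tsupport_iff_eventuallyEq.1 h0)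
  obtain ⟨R, -, h2⟩ := hc.exists_pos_le_norm
  refine ⟨smooth_coneMap hr.contDiffOn, antiPer_coneMap r, sBounded_coneMap (half_pos hε)
    (R := R) fun z hz => ?_⟩
  rcases hz with hz | hz
  · exact h1 (by rw [dist_zero_right]; linarith)
  · exact h2 z hz

lemma IsDistinguishedChart.ip_lift (hd : IsDistinguishedChart S ω p x e)
  (hu : Msec u) {g : ℂ → ℂ} (hg : AEStronglyMeasurable g)
  (h0 : ∀ z ∉ x.target, g z = 0) : ip S ω u (lift x e g) =
    ∫ a, (rexp a.1 : ℂ) ^ 2 * (coneMap (rep x e u) a * conj (coneMap g a)) ∂svol := by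
  rw [hd.good.ip_lift hu hg h0, integral_coneMap (hd.good.aestronglyMeasurable_rep hu) hg]

lemma IsDistinguishedChart.laplacian_lift (hd : IsDistinguishedChart S ω p x e) {r : ℂ → ℂ}
  (hr : SmoothC r) (hc : HasCompactSupport r) (ht : tsupport r ⊆ x.target)
  (h0 : 0 ∉ tsupport r) : IsTestSection ω (lift x e r) ∧
    laplacian S ω (lift x e r) = lift x e (coneLap r) ∧ (∀ z ∉ x.target, coneLap r z = 0) ∧
    ∀ a, coneMap (coneLap r) a = -(1 / 4) * ((rexp (-2 * a.1) : ℂ) * lap (coneMap r) a) := by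
  have h1 : ∀ z ∈ tsupport r, z ≠ 0 := fun z hz h => h0 (h ▸ hz)
  exact ⟨hd.good.isTestSection_lift hr hc ht h1, hd.good.laplacian_lift hr hc ht h1,
    fun z hz => locLap_eq_zero fun h => hz (ht h),
    fun a => coneMap_coneLap (.of_forall fun z => hr.contDiffAt)⟩

lemma measurable_coneLap (r : ℂ → ℂ) : Measurable (coneLap r) :=
  measurable_locLap measurable_id (by fun_prop)

lemma exp_sq_mul (s : ℝ) : (rexp s : ℂ) ^ 2 * (rexp (-2 * s) : ℂ) = 1 := by
  rw [← ofReal_pow, ← ofReal_mul, ← Real.exp_nat_mul, ← Real.exp_add]; norm_num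

lemma IsDistinguishedChart.ip_laplacian (hd : IsDistinguishedChart S ω p x e)
  (hu : Msec u) {r : ℂ → ℂ} (hr : SmoothC r) (hc : HasCompactSupport r)
  (ht : tsupport r ⊆ x.target) (h0 : 0 ∉ tsupport r) :
  ip S ω u (laplacian S ω (lift x e r))
    = ∫ a, -(1 / 4) * (coneMap (rep x e u) a * conj (lap (coneMap r) a)) ∂svol := by
  obtain ⟨-, h1, h2, h3⟩ := hd.laplacian_lift hr hc ht h0
  rw [h1, hd.ip_lift hu (measurable_coneLap r).aestronglyMeasurable h2]
  refine integral_congr_ae (.of_forall fun a => ?_)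
  simp only [h3, map_mul, conj_ofReal, map_neg, map_div₀, map_one, map_ofNat _ 4]
  linear_combination (-(1 / 4) * (coneMap (rep x e u) a * conj (lap (coneMap r) a))) * exp_sq_mul a.1

lemma IsDistinguishedChart.memLp_rep (hd : IsDistinguishedChart S ω p x e) (hu : u ∈ L²) :
  MemLp (fun a => (rexp a.1 : ℂ) * coneMap (rep x e u) a) 2 svol := by
  have hm := hd.good.aestronglyMeasurable_rep hu.1
  refine ⟨(by fun_prop : Continuous fun a : ℝ² => (rexp a.1 : ℂ)).aestronglyMeasurable.mul
    (aestronglyMeasurable_coneMap hm), ?_⟩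
  rw [← ENNReal.pow_lt_top_iff.trans (or_iff_left two_ne_zero), eLpNorm_two_sq,
    ← lintegral_coneMap hm]
  exact (hd.good.lintegral_rep_le hu.1).trans_lt ((mem_squareIntegrable_iff hu.1).1 hu)

lemma IsDistinguishedChart.lift_mem (hd : IsDistinguishedChart S ω p x e) {g : ℂ → ℂ}
  (hg : AEStronglyMeasurable g)
  (h : MemLp (fun a => (rexp a.1 : ℂ) * coneMap g a) 2 svol) :
  lift x e g ∈ L² := by
  refine hd.good.lift_mem hg ?_
  rw [lintegral_coneMap hg, ← eLpNorm_two_sq]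
  exact ENNReal.pow_lt_top h.2

/-- The singular profile `e^{ls}`, cut off at `s = d`. -/
def sing (d l s : ℝ) : ℂ := (1 - step (s - d + 1)) * cexpR l s

/-- The radial part of the Laplacian of a mode. -/
def lapPro (m : ℤ) (η : ℝ → ℂ) (s : ℝ) : ℂ := -(1 / 4) * ((rexp (-2 * s) : ℂ) * ode (kap m) η s)

lemma isStep_shift (d : ℝ) : IsStep fun s => step (s - d + 1) where
  smooth := isStep_step.smooth.comp ((contDiff_id.sub contDiff_const).add contDiff_const)
  left := ⟨d - 1, fun s hs => by simp [step, Real.smoothTransition.zero_of_nonpos (by linarith : s - d + 1 ≤ 0)]⟩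
  right := ⟨d, fun s hs => by simp [step, Real.smoothTransition.one_of_one_le (by linarith : 1 ≤ s - d + 1)]⟩

lemma sing_admissible (hl : l ^ 2 = kap m ^ 2) (hm : m ∈ Idx) (d : ℝ) :
  Admissible m (sing d l) := (isStep_shift d).admissible m hl hm

lemma sing_zero {s : ℝ} (hs : d ≤ s) : sing d l s = 0 := by
  simp [sing, step, Real.smoothTransition.one_of_one_le (by linarith : 1 ≤ s - d + 1)]

lemma bump_lapPro (h : Admissible m η) : IsBump1 (lapPro m η) := by
  obtain ⟨h1, c, d, h2⟩ := h.bump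
  exact ⟨contDiff_const.mul ((ofRealCLM.contDiff.comp (Real.contDiff_exp.comp
    (contDiff_const.mul contDiff_id))).mul h1), c, d, fun s hs => by simp [lapPro, h2 s hs]⟩

lemma conePre_sing_zero (m : ℤ) {z : ℂ} (hz : rad d < ‖z‖) :
  conePre (sing d l) m z = 0 ∧ conePre (lapPro m (sing d l)) m z = 0 :=
  ⟨conePre_eq_zero fun h => sing_zero ((lt_logT_iff h).2 hz).le, conePre_eq_zero fun h => by
      rw [lapPro, ode_eqOn_zero isOpen_Ioi (fun s hs => sing_zero (le_of_lt hs)) _ _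
        ((lt_logT_iff h).2 hz), mul_zero, mul_zero]⟩

/-- The singular section near a conical point. -/
def singSec (x : Chart) (e : ∀ y, C y) (d l : ℝ) (m : ℤ) : ∀ y, C y :=
  lift x e (conePre (sing d l) m)

/-- The Laplacian of the singular section. -/
def singLap (x : Chart) (e : ∀ y, C y) (d l : ℝ) (m : ℤ) : ∀ y, C y :=
  lift x e (conePre (lapPro m (sing d l)) m)

lemma mode_lapPro (h : Admissible m η) (a : ℝ²) : mode (lapPro m η) m a
  = -(1 / 4) * ((rexp (-2 * a.1) : ℂ) * lap (mode η m) a) := by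
  rw [lap_mode h.smooth]; simp [mode, lapPro]; ring

lemma IsDistinguishedChart.isWeak_sing (hd : IsDistinguishedChart S ω p x e)
  (hR : Metric.closedBall 0 (rad d) ⊆ x.target) (hm : m ∈ Idx)
  (hl : l ^ 2 = kap m ^ 2) : IsWeak S ω (singSec x e d l m) (singLap x e d l m) := by
  have ha := sing_admissible hl hm d
  have hb := bump_lapPro ha
  have hz : ∀ z ∉ x.target, rad d < ‖z‖ := fun z hz => by
    by_contra! h; exact hz (hR (by simpa using h))
  have m1 := (measurable_conePre ha.smooth m).aestronglyMeasurable (μ := volume)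
  have m2 := (measurable_conePre hb.1 m).aestronglyMeasurable (μ := volume)
  have r1 := hd.rep_lift_eq fun z h => (conePre_sing_zero (l := l) m (hz z h)).1
  have r2 := hd.rep_lift_eq fun z h => (conePre_sing_zero (l := l) m (hz z h)).2
  have hmem : ∀ {η}, Admissible m η → AEStronglyMeasurable (conePre η m) volume →
      lift x e (conePre η m) ∈ L² := fun ha h => hd.lift_mem h (by
    rw [coneMap_conePre]
    refine ha.memLp_mode.congr_norm ?_ (.of_forall fun a => by simp)
    have := (smooth_mode ha.smooth m).continuous
    fun_prop)
  have M1 : singSec x e d l m ∈ L² := hmem ha m1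
  have M2 : singLap x e d l m ∈ L² := hmem (hb.admissible m) m2
  refine ⟨M1, M2, fun ψ hψ => ?_⟩
  set K := x.symm '' Metric.closedBall 0 (rad d)
  have hK : IsClosed K := isClosed_image_symm (isCompact_closedBall _ _) hR
  obtain ⟨χ, hχ, hχt, hχ1⟩ := exists_cutoff hK x.open_source (by
    rintro _ ⟨z, h, rfl⟩; exact x.map_target (hR h))
  have hK0 : ∀ y ∉ K, singSec x e d l m y = 0 ∧ singLap x e d l m y = 0 := fun y hy => by
    by_cases hs : y ∈ x.source
    · have := conePre_sing_zero (l := l) (d := d) m (z := x y) (by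
        by_contra! h; exact hy ⟨x y, by simpa using h, x.left_inv hs⟩)
      simp [singSec, singLap, lift_apply hs, this]
    · exact ⟨lift_of_notMem hs, lift_of_notMem hs⟩
  obtain ⟨s1, s2⟩ := hd.smooth_representative ⟨hχ, hχt⟩ fun y _ => hψ.1 y
  obtain ⟨-, s3, s4⟩ := tsupport_representative (e := e) ⟨hχ, hχt⟩ ψ
  have s5 : 0 ∉ tsupport (representative x e χ ψ) := by
    have hp : x.symm 0 = p := by rw [← hd.map_point, x.left_inv hd.mem_source]
    have h0 : (0 : ℂ) ∈ x.target := hd.map_point ▸ x.map_source hd.mem_source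
    rw [notMem_tsupport_iff_eventuallyEq]
    have h1 := hψ.eventually_zero ((form_eq_zero_iff ω hd.mem_maximalAtlas hd.mem_source).2 (by
      rw [hd.map_point, hd.distinguished 0 h0]))
    filter_upwards [(x.continuousAt_symm h0).eventually (hp.symm ▸ h1)] with z hz
    simp [representative, hz]
  have e1 : ip S ω (singSec x e d l m) (laplacian S ω ψ)
      = ip S ω (singSec x e d l m) (laplacian S ω (lift x e (representative x e χ ψ))) := by
    refine ip_congr fun y => ⟨.inl rfl, ?_⟩
    by_cases hy : y ∈ K
    · left
      rw [hd.lift_representative ⟨hχ, hχt⟩]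
      exact laplacian_congr ((hχ1 y hy).mono fun y' h => by simp [cut, h])
    grind
  have e2 : ip S ω (singLap x e d l m) ψ
      = ip S ω (singLap x e d l m) (lift x e (representative x e χ ψ)) := by
    refine ip_congr fun y => ⟨.inl rfl, ?_⟩
    by_cases hy : y ∈ K
    · rw [hd.lift_representative ⟨hχ, hχt⟩, cut, (hχ1 y hy).self_of_nhds]; simp
    grind
  have hc := cyl_coneMap s1 s2 s5
  rw [e1, e2, hd.ip_laplacian M1.1 s1 s2 (s3.trans s4) s5,
    hd.ip_lift M2.1 s1.continuous.aestronglyMeasurable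
      (fun z hz => zero_off_tsupport fun h => hz (s4 (s3 h))), singSec, r1, singLap, r2,
    coneMap_conePre, coneMap_conePre, integral_const_mul, ← integral_strip_lap
      (smooth_mode ha.smooth m) (antiPer_mode _ m) hc, ← integral_const_mul]
  refine integral_congr_ae (.of_forall fun a => ?_)
  simp only [mode_lapPro ha]
  linear_combination (1 / 4 * (lap (mode (sing d l) m) a * conj (coneMap (representative x e χ ψ) a))) * exp_sq_mul a.1

lemma IsDistinguishedChart.eq_point (hd : IsDistinguishedChart S ω p x e) {y : X}
  (hy : y ∈ x.source) (h0 : ω.1 y = 0) : y = p := by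
  have := (form_eq_zero_iff ω hd.mem_maximalAtlas hy).1 h0
  rw [hd.distinguished _ (x.map_source hy)] at this
  exact x.injOn hy hd.mem_source (this.trans hd.map_point.symm)

lemma IsWeak.sub {u' f' : ∀ y, C y} (h : IsWeak S ω u f) (h' : IsWeak S ω u' f') :
  IsWeak S ω (fun y => u y - u' y) fun y => f y - f' y :=
  ⟨mem_sub h.1 h'.1, mem_sub h.2.1 h'.2.1, fun ψ hψ => by
    rw [ip_sub_left h.1 h'.1 hψ.mem.2, ip_sub_left h.2.1 h'.2.1 hψ.mem.1, h.2.2 ψ hψ, h'.2.2 ψ hψ]⟩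

lemma ip_congr_ae {u' : ∀ y, C y} (h : ∀ᵐ y ∂area ω, u y = u' y ∨ v y = 0) :
  ip S ω u v = ip S ω u' v :=
  integral_congr_ae (h.mono fun y h => by
    rcases h with h | h
    · simp [h]
    · simp [h, herm_zero_right])

lemma IsDistinguishedChart.exists_plateau (hd : IsDistinguishedChart S ω p x e) {K : Set X}
  (hK : IsClosed K) (hKs : K ⊆ x.source) : ∃ b, SmoothC b ∧ HasCompactSupport b ∧
    tsupport b ⊆ x.target ∧ ∀ y ∈ K, ∀ᶠ z in 𝓝 (x y), b z = 1 := by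
  obtain ⟨χ, hχ, hχt, hχ1⟩ := exists_cutoff hK x.open_source hKs
  have hcut : IsCutoff x.source χ := ⟨hχ, hχt⟩
  obtain ⟨c1, c2⟩ := hd.smooth_representative hcut fun y hy => hd.smoothSectionAt (hχt hy)
  obtain ⟨-, c3, c4⟩ := tsupport_representative (e := e) hcut e
  refine ⟨_, c1, c2, c3.trans c4, fun y hy => ?_⟩
  have hs := hKs hy
  filter_upwards [x.open_target.mem_nhds (x.map_source hs), (x.continuousAt_symm
    (x.map_source hs)).eventually ((x.left_inv hs).symm ▸ hχ1 y hy)] with z hz hz1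
  have := hd.rep_eq (u := e) (a := 1) (x.map_target hz) (one_smul _ _).symm
  rw [x.right_inv hz] at this
  simp [representative_eq, hz1, this]

lemma IsDistinguishedChart.ae_rep_eq_zero (hd : IsDistinguishedChart S ω p x e) {A : Set X}
  (h : ∀ᵐ y ∂area ω, y ∈ A → u y = 0) :
  ∀ᵐ a ∂svol, x.symm (econe a) ∈ A → rep x e u (econe a) = 0 := by
  have h0 := hd.good.volume_preimage_null (ae_iff.1 h)
  filter_upwards [quasiMeasurePreserving_econe.ae (compl_mem_ae_iff.2 h0)] with a ha hA
  by_cases hz : econe a ∈ x.target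
  · have h1 : u (x.symm (econe a)) = 0 := by grind
    have := hd.rep_eq (u := u) (a := 0) (x.map_target hz) (by rw [h1, zero_smul])
    rwa [x.right_inv hz] at this
  · exact rep_of_notMem hz

lemma IsDistinguishedChart.exists_closedBall (hd : IsDistinguishedChart S ω p x e) {U : Set X}
  (hU : U ∈ 𝓝 p) : ∃ d, ∀ z ∈ Metric.closedBall 0 (rad d), z ∈ x.target ∧ x.symm z ∈ U := by
  have h0 := hd.map_point ▸ x.map_source hd.mem_source
  have hp : x.symm 0 = p := by rw [← hd.map_point, x.left_inv hd.mem_source]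
  obtain ⟨ε, hε, hball⟩ := Metric.eventually_nhds_iff_ball.1
    ((x.open_target.eventually_mem h0).and ((x.continuousAt_symm h0).eventually (hp.symm ▸ hU)))
  have : Tendsto rad atBot (𝓝 0) := mul_zero √2 ▸
    (Real.tendsto_exp_atBot.comp (tendsto_id.atBot_div_const two_pos)).const_mul _
  obtain ⟨d, hd⟩ := (this.eventually (gt_mem_nhds hε)).exists
  exact ⟨d, fun z hz => hball z (Metric.closedBall_subset_ball hd hz)⟩

lemma IsWeak.modeApprox (hw : IsWeak S ω u f) (hd : IsDistinguishedChart S ω p x e)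
  (hχ : IsCutoff x.source χ) (h1 : ∀ᶠ y in 𝓝 p, χ y = 1)
  (hpair : ∀ d l m, Metric.closedBall 0 (rad d) ⊆ x.target → m ∈ Idx →
    l ^ 2 = kap m ^ 2 → ip S ω f (singSec x e d l m) = ip S ω u (singLap x e d l m)) :
  ModeApprox (coneMap (representative x e χ u)) := by
  obtain ⟨f', hf'⟩ := hw.exists_cut hχ.1 fun y hy => by
    by_cases hs : y ∈ x.source
    · rw [hd.eq_point hs hy]; exact .inr h1
    · exact .inl (notMem_tsupport_iff_eventuallyEq.1 fun h => hs (hχ.2 h))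
  have hrep : rep x e (cut χ u) = representative x e χ u := rep_smul χ u
  have L1 := hd.memLp_rep hf'.1
  have L2 := hd.memLp_rep hf'.2.1
  rw [hrep] at L1
  set V := coneMap (representative x e χ u)
  set F : Fn := fun a => -4 * ((rexp a.1 : ℂ) ^ 2 * coneMap (rep x e f') a)
  have hwF : (fun a => wt a * F a) = fun a => -4 * ((rexp a.1 : ℂ) * coneMap (rep x e f') a) := by
    funext a
    linear_combination (-4 * (rexp a.1 : ℂ) * coneMap (rep x e f') a) * wt_mul_rexp a
  have hF := hwF ▸ L2.const_mul (-4)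
  have hVm := aestronglyMeasurable_coneMap (hrep ▸ hd.good.aestronglyMeasurable_rep hf'.1.1)
  obtain ⟨d, hball⟩ := hd.exists_closedBall h1.eventually_nhds
  refine exists_cone_approximation (χ := fun s => step (s - d + 1)) ?_ hF (isStep_shift d)
    (fun s => conj_ofReal _) (fun m η hη => ?_) (.inr fun m hm l hl => ?_)
  · refine L1.mono ((continuous_ofReal.comp (by fun_prop :
      Continuous fun a : ℝ² => rexp (-|a.1|))).aestronglyMeasurable.mul hVm)
      (.of_forall fun a => ?_)
    simp only [norm_mul, norm_rexp]
    gcongr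
    exact neg_le.1 (neg_le_abs _)
  · obtain ⟨b1, b2, b3⟩ := conePre_bump hη m
    obtain ⟨b, c1, c2, c3, hb⟩ := hd.exists_plateau (isClosed_tsupport χ) hχ.2
    set r : ℂ → ℂ := fun z => b z * conePre η m z
    have r1 : SmoothC r := c1.mul b1
    have r2 : HasCompactSupport r := c2.mul_right
    have r3 : tsupport r ⊆ x.target := tsupport_mul_subset_left.trans c3
    have r4 : 0 ∉ tsupport r := fun h => b3 (tsupport_mul_subset_right h)
    have e1 := hf'.2.2 _ (hd.laplacian_lift r1 r2 r3 r4).1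
    rw [hd.ip_laplacian hf'.1.1 r1 r2 r3 r4, hrep, integral_const_mul,
      hd.ip_lift hf'.2.1.1 r1.continuous.aestronglyMeasurable
        fun z hz => zero_off_tsupport fun h => hz (r3 h)] at e1
    have e2 : ∀ a, V a * conj (lap (mode η m) a) = V a * conj (lap (coneMap r) a) := fun a => by
      by_cases ha : econe a ∈ x '' tsupport χ
      · obtain ⟨y, hy, hya⟩ := ha
        have h3 : mode η m =ᶠ[𝓝 a] coneMap r := (smooth_econe.continuous.continuousAt.eventually
          (hya ▸ hb y hy)).mono fun a' h => by
            rw [← coneMap_conePre, coneMap, coneMap]; simp only [r, h, one_mul]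
        rw [(Filter.EventuallyEq.lap h3).eq_of_nhds]
      · simp only [V, coneMap]
        rw [zero_off_tsupport fun h => ha ((tsupport_representative hχ u).2.1 h)]
        ring
    have e3 : ∫ a, F a * conj (mode η m a) ∂svol = -4 * ∫ a, (rexp a.1 : ℂ) ^ 2 *
        (coneMap (rep x e f') a * conj (coneMap r a)) ∂svol := by
      rw [← integral_const_mul]
      refine integral_congr_ae ?_
      filter_upwards [hd.ae_rep_eq_zero (hf'.ae_eq_zero (isClosed_tsupport χ).isOpen_compl
        fun y hy => by rw [cut, zero_off_tsupport hy]; simp)] with a ha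
      rw [← coneMap_conePre]
      simp only [F, coneMap]
      by_cases hz : econe a ∈ x.target
      · by_cases hy : x.symm (econe a) ∈ tsupport χ
        · have := (hb _ hy).self_of_nhds
          rw [x.right_inv hz] at this
          simp only [r, this, one_mul]; ring
        · rw [ha hy]; ring
      · rw [rep_of_notMem hz]; ring
    rw [e3, integral_congr_ae (.of_forall e2)]
    linear_combination -4 * e1
  · have ha := sing_admissible hl hm d
    have hout : ∀ z ∉ x.target, rad d < ‖z‖ := fun z hz => by
      by_contra! h; exact hz (hball z (by simpa using h)).1
    have hz := hpair d l m (fun z h => (hball z h).1) hm hl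
    have hχz : ∀ {η}, (∀ z, rad d < ‖z‖ → conePre η m z = 0) → ∀ y, (∀ᶠ y' in 𝓝 y, χ y' = 1) ∨
        lift x e (conePre η m) y = 0 := fun {η} h y => by
      by_cases hy : y ∈ x.source
      · by_cases hr : ‖x y‖ ≤ rad d
        · exact .inl (x.left_inv hy ▸ (hball (x y) (by simpa using hr)).2)
        · rw [lift_apply hy, h _ (not_le.1 hr), zero_smul]; exact .inr rfl
      · exact .inr (lift_of_notMem hy)
    have h3 : ip S ω f (singSec x e d l m) = ip S ω f' (singSec x e d l m) := by
      refine ip_congr_ae ?_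
      filter_upwards [(hw.sub hf').ae_eq_zero (isOpen_setOfPred_eventually_nhds (p := fun y => χ y = 1))
        fun y hy => by simp [cut, hy.self_of_nhds]] with y hy
      exact (hχz (fun z hz => (conePre_sing_zero m hz).1) y).imp_left fun h => sub_eq_zero.1 (hy h)
    have h4 : ip S ω u (singLap x e d l m) = ip S ω (cut χ u) (singLap x e d l m) :=
      ip_congr_ae (.of_forall fun y =>
        (hχz (fun z hz => (conePre_sing_zero m hz).2) y).imp_left fun h => by
          simp [cut, h.self_of_nhds])
    rw [h3, h4, singSec, singLap, hd.ip_lift hf'.2.1.1 (measurable_conePre ha.smooth m).aestronglyMeasurable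
      fun z hz => (conePre_sing_zero m (hout z hz)).1, hd.ip_lift hf'.1.1
      (measurable_conePre (bump_lapPro ha).1 m).aestronglyMeasurable
      fun z hz => (conePre_sing_zero m (hout z hz)).2, coneMap_conePre, coneMap_conePre, hrep] at hz
    change ∫ a, V a * conj (lap (mode (sing d l) m) a) ∂svol
      = ∫ a, F a * conj (mode (sing d l) m a) ∂svol
    have e3 : ∫ a, F a * conj (mode (sing d l) m a) ∂svol = -4 * ∫ a, (rexp a.1 : ℂ) ^ 2 *
        (coneMap (rep x e f') a * conj (mode (sing d l) m a)) ∂svol := by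
      rw [← integral_const_mul]; congr 1; funext a; simp only [F]; ring
    rw [e3, hz, ← integral_const_mul]
    refine integral_congr_ae (.of_forall fun a => ?_)
    simp only [mode_lapPro ha, map_mul, conj_ofReal, map_neg, map_div₀, map_one, map_ofNat _ 4]
    linear_combination (-(V a * conj (lap (mode (sing d l) m) a))) * exp_sq_mul a.1

/-! ### Minimal domain near a conical point -/

lemma exists_bound_comp_econe {b : ℂ → ℂ} (hb : SmoothC b) (hc : HasCompactSupport b) :
  ∃ M, ∀ a, ‖b (econe a)‖ ≤ M ∧ ‖dS (fun a => b (econe a)) a‖ ≤ M ∧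
    ‖dP (fun a => b (econe a)) a‖ ≤ M ∧ ‖lap (fun a => b (econe a)) a‖ ≤ M := by
  have key : ∀ (v : ℝ²) {b : ℂ → ℂ}, SmoothC b → HasCompactSupport b → ∃ b', SmoothC b' ∧
      HasCompactSupport b' ∧ (fun a => fderiv ℝ (fun a => b (econe a)) a v) = fun a => b' (econe a) :=
    fun v b hb hc => by
    refine ⟨fun z => fderiv ℝ b z (z * (toC v / 2)), (hb.fderiv_right (m := ∞)
      (by simp)).clm_apply (contDiff_id.mul contDiff_const),
      hc.fderiv (𝕜 := ℝ) |>.mono fun z hz h => hz (by simp [h]), funext fun a => ?_⟩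
    have h1 := (((toCL.hasFDerivAt (x := a)).const_mul (2⁻¹ : ℂ)).cexp.const_mul
      ((√2 : ℝ) : ℂ)).congr_of_eventuallyEq (f₁ := econe)
      (.of_forall fun a => by simp [econe, toCL_apply, div_eq_inv_mul])
    have h2 := (hb.differentiable (by simp) (econe a)).hasFDerivAt.comp a h1
    rw [show (fun a => b (econe a)) = b ∘ econe from rfl, h2.fderiv]
    simp
    simp [toCL_apply, econe]; ring_nf
  have bd : ∀ {b : ℂ → ℂ}, SmoothC b → HasCompactSupport b → ∃ M, ∀ a, ‖b (econe a)‖ ≤ M :=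
    fun hb hc => (hc.exists_bound_of_continuous hb.continuous).imp fun _ h a => h _
  obtain ⟨b1, h1, c1, e1⟩ := key (1, 0) hb hc
  obtain ⟨b2, h2, c2, e2⟩ := key (0, 1) hb hc
  obtain ⟨b3, h3, c3, e3⟩ := key (1, 0) h1 c1
  obtain ⟨b4, h4, c4, e4⟩ := key (0, 1) h2 c2
  obtain ⟨M0, k0⟩ := bd hb hc
  obtain ⟨M1, k1⟩ := bd h1 c1
  obtain ⟨M2, k2⟩ := bd h2 c2
  obtain ⟨M3, k3⟩ := bd h3 c3
  obtain ⟨M4, k4⟩ := bd h4 c4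
  have n0 := (norm_nonneg _).trans (k0 0)
  have n1 := (norm_nonneg _).trans (k1 0)
  have n2 := (norm_nonneg _).trans (k2 0)
  have n3 := (norm_nonneg _).trans (k3 0)
  have n4 := (norm_nonneg _).trans (k4 0)
  change dS (fun a => b (econe a)) = _ at e1
  change dP (fun a => b (econe a)) = _ at e2
  change dS (fun a => b1 (econe a)) = _ at e3
  change dP (fun a => b2 (econe a)) = _ at e4
  refine ⟨M0 + M1 + M2 + M3 + M4, fun a => ⟨by linarith [k0 a], ?_, ?_, ?_⟩⟩
  · rw [e1]; linarith [k1 a]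
  · rw [e2]; linarith [k2 a]
  · rw [lap, e1, e2, e3, e4]
    exact (norm_add_le _ _).trans (by linarith [k3 a, k4 a])

lemma IsDistinguishedChart.sqNorm_lift (hd : IsDistinguishedChart S ω p x e) {g : ℂ → ℂ}
  (hg : AEStronglyMeasurable g) (h0 : ∀ z ∉ x.target, g z = 0) : sqNorm S ω (lift x e g)
    = eLpNorm (fun a => (rexp a.1 : ℂ) * coneMap g a) 2 svol ^ 2 := by
  rw [hd.good.sqNorm_eq (hd.measurableSection_lift hg.aemeasurable) fun y hy => lift_of_notMem hy,
    hd.rep_lift_eq h0, eLpNorm_two_sq, ← lintegral_coneMap hg]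

lemma IsDistinguishedChart.domMin_cut_of_modeApprox (hd : IsDistinguishedChart S ω p x e)
  (hχ : IsCutoff x.source χ) (hu : Msec u)
  (h : ModeApprox (coneMap (representative x e χ u))) : DomMin S ω (cut χ u) := by
  obtain ⟨ψ, hψ, hv, hc⟩ := h
  choose r r1 r2 r3 r4 using fun n => exists_coneMap_eq (hψ n)
  obtain ⟨b, b1, b2, b3, b4⟩ := hd.exists_plateau (isClosed_tsupport χ) hχ.2
  obtain ⟨M, hM⟩ := exists_bound_comp_econe b1 b2
  obtain ⟨-, t1, t2⟩ := graph_mul (B := fun a => b (econe a)) (fun n => cyl_of_mem_modeSpan (hψ n)) hv hc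
    (b1.comp smooth_econe) (fun s φ => by simp [econe_add]) hM
  have hBψ : ∀ n, (fun a => b (econe a) * ψ n a) = coneMap fun z => b z * r n z := fun n => by
    funext a; rw [← r4 n]; simp [coneMap]; ring
  set ρ := representative x e χ u
  have hρm : AEStronglyMeasurable ρ volume := by
    have := hd.good.aestronglyMeasurable_rep (measurableSection_cut hχ.1 hu)
    rwa [show rep x e (cut χ u) = ρ from rep_smul χ u] at this
  have hbρ : ∀ z, b z * ρ z = ρ z := fun z => by
    by_cases hz : z ∈ x '' tsupport χ
    · obtain ⟨y, hy, rfl⟩ := hz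
      rw [(b4 y hy).self_of_nhds, one_mul]
    · rw [show ρ z = 0 from zero_off_tsupport fun h =>
        hz ((tsupport_representative hχ u).2.1 h), mul_zero]
  have p1 : ∀ n, SmoothC fun z => b z * r n z := fun n => b1.mul (r1 n)
  have p2 : ∀ n, HasCompactSupport fun z => b z * r n z := fun n => b2.mul_right
  have p3 : ∀ n, tsupport (fun z => b z * r n z) ⊆ x.target := fun n =>
    tsupport_mul_subset_left.trans b3
  have hL := fun n => hd.laplacian_lift (p1 n) (p2 n) (p3 n) fun h => r3 n (tsupport_mul_subset_right h)
  have hb0 : ∀ z ∉ x.target, b z = 0 := fun z hz => zero_off_tsupport fun h => hz (b3 h)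
  have cs : ∀ (f g : ℂ → ℂ) a, coneMap (fun z => f z - g z) a = coneMap f a - coneMap g a :=
    fun f g a => by simp [coneMap, mul_sub]
  have sq0 : ∀ {ι : Type} {l : Filter ι} {f : ι → ENNReal}, Tendsto f l (𝓝 0) →
      Tendsto (fun i => f i ^ 2) l (𝓝 0) := fun h => by
    simpa [Function.comp_def] using ((ENNReal.continuous_pow 2).tendsto 0).comp h
  refine domMin_of_tendsto (fun n => (hL n).1) (measurableSection_cut hχ.1 hu) ?_ ?_
  · have : ∀ n, sqNorm S ω (fun y => lift x e (fun z => b z * r n z) y - cut χ u y)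
        = eLpNorm (fun a => (rexp a.1 : ℂ) * (b (econe a) * ψ n a - b (econe a) * coneMap ρ a)) 2
          svol ^ 2 := fun n => by
      rw [← hd.lift_representative hχ, ← lift_sub, hd.sqNorm_lift (g := fun z => b z * r n z - ρ z)
        ((p1 n).continuous.aestronglyMeasurable.sub hρm) fun z hz => by grind]
      congr 2; funext a
      rw [cs, ← hBψ]
      simp [coneMap]
      rw [mul_left_comm, hbρ]
    simp only [this]
    obtain ⟨R, -, hR⟩ := b2.exists_pos_le_norm
    refine sq0 (tendsto_of_le_const_mul (ENNReal.ofReal_ne_top (r := R ^ 4 / 4)) t1 fun n =>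
      eLpNorm_le_mul_eLpNorm_of_ae_le_mul (.of_forall fun a => ?_) 2)
    by_cases ha : R ≤ ‖econe a‖
    · simp [hR _ ha]
    · rw [not_le, norm_econe] at ha
      have h1 : rexp (2 * a.1) ≤ R ^ 4 / 4 := by
        have h2 := pow_le_pow_left₀ (by positivity) ha.le 4
        rw [mul_pow, ← Real.exp_nat_mul, show (√2 : ℝ) ^ 4 = 4 by grind] at h2
        grind
      have h3 : (rexp a.1 : ℂ) = (rexp (2 * a.1) : ℂ) * wt a := by
        rw [wt, ← ofReal_mul, ← Real.exp_add]; ring_nf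
      rw [← mul_sub (wt a), h3, mul_assoc, norm_mul, norm_rexp]
      gcongr
  · have : ∀ k : ℕ × ℕ, sqNorm S ω (fun y => laplacian S ω (lift x e fun z => b z * r k.1 z) y -
          laplacian S ω (lift x e fun z => b z * r k.2 z) y) = eLpNorm (fun a => (-(1 / 4) : ℂ) *
          (wt a * lap (fun a => b (econe a) * ψ k.1 a) a - wt a * lap (fun a => b (econe a) * ψ k.2 a) a)) 2
          svol ^ 2 := fun k => by
      rw [(hL k.1).2.1, (hL k.2).2.1, ← lift_sub, hd.sqNorm_lift
        (g := fun z => coneLap (fun z => b z * r k.1 z) z - coneLap (fun z => b z * r k.2 z) z)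
        ((measurable_coneLap _).sub (measurable_coneLap _)).aestronglyMeasurable fun z hz => by
          rw [(hL k.1).2.2.1 z hz, (hL k.2).2.2.1 z hz, sub_zero]]
      congr 2; funext a
      rw [cs, (hL k.1).2.2.2, (hL k.2).2.2.2, hBψ, hBψ]
      have : (rexp a.1 : ℂ) * (rexp (-2 * a.1) : ℂ) = wt a := by
        rw [wt, ← ofReal_mul, ← Real.exp_add]; ring_nf
      rw [← this]; ring
    simp only [this]
    exact sq0 (tendsto_of_le_const_mul (ENNReal.ofReal_ne_top (r := 1)) t2 fun k =>
      eLpNorm_le_mul_eLpNorm_of_ae_le_mul (.of_forall fun a => by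
        rw [norm_mul]; gcongr; norm_num) 2)

/-! ### The boundary form of the singular sections -/

lemma integral_phase (m n : ℤ) : ∫ φ, phase (kap m) (0, φ) * conj (phase (kap n) (0, φ)) ∂circleVol
  = if m = n then 4 * (π : ℂ) else 0 := by
  have h1 : ∀ φ : ℝ, phase (kap m) (0, φ) * conj (phase (kap n) (0, φ))
      = exp (((m - n : ℤ) / 2 * I) * φ) := fun φ => by
    rw [phase, phase, ← exp_conj, ← exp_add]
    congr 1
    simp only [kap, map_mul, conj_ofReal, conj_I]
    push_cast; ring
  simp only [h1]
  rw [← intervalIntegral.integral_of_le (by linarith [Real.pi_pos])]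
  split_ifs with h
  · simp [h]; ring
  · have h0 : ((m - n : ℤ) / 2 * I : ℂ) ≠ 0 := by simp [sub_eq_zero, h]
    rw [integral_exp_mul_complex h0, div_eq_zero_iff, sub_eq_zero]
    left
    rw [exp_eq_exp_iff_exists_int]
    exact ⟨m - n, by push_cast; ring⟩

lemma integral_mode_mul_conj (η θ : ℝ → ℂ) (m n : ℤ) : ∫ a, mode η m a * conj (mode θ n a) ∂svol
    = (∫ s, η s * conj (θ s)) * if m = n then 4 * (π : ℂ) else 0 := by
  rw [← integral_phase, stripVol_eq, ← integral_prod_mul]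
  congr 1; funext a
  simp only [mode, phase, map_mul]; ring

lemma conj_sing (d l s : ℝ) : conj (sing d l s) = sing d l s := by
  simp only [sing, step, cexpR, map_mul, map_sub, map_one, conj_ofReal]

lemma integral_ode_sing {k l' : ℝ} (hl : l ^ 2 = k ^ 2) (hl' : l' ^ 2 = k ^ 2) :
  (∫ s, ode k (sing d l) s * sing d l' s) - ∫ s, sing d l s * ode k (sing d l') s = l' - l := by
  have hs : ∀ l, Smooth1 (sing d l) := fun l =>
    (contDiff_const.sub (isStep_shift d).smooth).mul (smooth1_cexpR l)
  have hleft : ∀ l, ∀ s < d - 1, sing d l =ᶠ[𝓝 s] cexpR l := fun l s h => by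
    filter_upwards [gt_mem_nhds h] with t ht
    simp [sing, step, Real.smoothTransition.zero_of_nonpos (by linarith : t - d + 1 ≤ 0)]
  have hb : ∀ {l}, l ^ 2 = k ^ 2 → IsBump1 (ode k (sing d l)) := fun {l} h => by
    refine ⟨smooth1_ode k (hs l), d - 2, d + 1, fun s h' => ?_⟩
    rcases h' with h' | h'
    · have h1 := hleft l s (by linarith)
      rw [ode, h1.deriv.deriv_eq, h1.self_of_nhds]
      exact congrFun (ode_cexpR k l h) s
    · exact ode_eqOn_zero isOpen_Ioi (fun t ht => sing_zero (le_of_lt ht)) k s (show d < s by linarith)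
  have hi : ∀ {l l'}, l ^ 2 = k ^ 2 → Integrable fun s => ode k (sing d l) s * sing d l' s :=
    fun h => ((hb h).1.continuous.mul (hs _).continuous).integrable_of_hasCompactSupport
      (hb h).hasCompactSupport.mul_right
  have hi' : Integrable fun s => sing d l s * ode k (sing d l') s :=
    (hi hl').congr (.of_forall fun s => mul_comm _ _)
  rw [← integral_sub (hi hl) hi']
  have hd : ∀ l s, HasDerivAt (sing d l) (deriv (sing d l) s) s ∧
      HasDerivAt (deriv (sing d l)) (deriv (deriv (sing d l)) s) s := fun l s =>
    ⟨((hs l).diff s).hasDerivAt, ((hs l).deriv.diff s).hasDerivAt⟩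
  have hbot : Tendsto (fun s => deriv (sing d l) s * sing d l' s - sing d l s * deriv (sing d l') s)
      atBot (𝓝 (l - l')) := by
    refine tendsto_const_nhds.congr' ?_
    filter_upwards [eventually_lt_atBot (d - 1)] with s h
    rw [(hleft l s h).deriv_eq, (hleft l' s h).deriv_eq, (hleft l s h).self_of_nhds,
      (hleft l' s h).self_of_nhds, (hasDerivAt_cexpR l s).deriv, (hasDerivAt_cexpR l' s).deriv]
    rcases sq_eq_sq_iff_eq_or_eq_neg.1 (hl'.trans hl.symm) with rfl | rfl
    · ring
    · push_cast; linear_combination (-2 * l : ℂ) * cexpR_mul_neg l s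
  have htop : Tendsto (fun s => deriv (sing d l) s * sing d l' s - sing d l s * deriv (sing d l') s)
      atTop (𝓝 0) := by
    refine tendsto_const_nhds.congr' ?_
    filter_upwards [eventually_gt_atTop d] with s h
    rw [sing_zero h.le, sing_zero h.le]; ring
  refine (integral_of_hasDerivAt_of_tendsto (fun s => ?_) ((hi hl).sub hi') hbot htop).trans (by ring)
  refine (((hd l s).2.mul (hd l' s).1).sub ((hd l s).1.mul (hd l' s).2)).congr_deriv ?_
  change _ = ode k (sing d l) s * sing d l' s - sing d l s * ode k (sing d l') s
  simp only [ode]; ring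

lemma IsDistinguishedChart.wronskian (hd : IsDistinguishedChart S ω p x e)
  (hR : Metric.closedBall 0 (rad d) ⊆ x.target) {n : ℤ} {l' : ℝ} (hm : m ∈ Idx)
  (hn : n ∈ Idx) (hl : l ^ 2 = kap m ^ 2) (hl' : l' ^ 2 = kap n ^ 2) :
  ip S ω (singLap x e d l m) (singSec x e d l' n) - ip S ω (singSec x e d l m) (singLap x e d l' n)
    = if m = n then (π : ℂ) * (l - l') else 0 := by
  have ha := sing_admissible hl hm d
  have hb := sing_admissible hl' hn d
  have hw := hd.isWeak_sing hR hm hl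
  have hz : ∀ z ∉ x.target, rad d < ‖z‖ := fun z hz => by
    by_contra! h; exact hz (hR (by simpa using h))
  have r1 := hd.rep_lift_eq fun z h => (conePre_sing_zero (l := l) m (hz z h)).1
  have r2 := hd.rep_lift_eq fun z h => (conePre_sing_zero (l := l) m (hz z h)).2
  have e1 : ip S ω (singLap x e d l m) (singSec x e d l' n) = -(1 / 4) *
      ∫ a, mode (ode (kap m) (sing d l)) m a * conj (mode (sing d l') n a) ∂svol := by
    rw [singSec, hd.ip_lift hw.2.1.1 (measurable_conePre hb.smooth n).aestronglyMeasurable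
      fun z h => (conePre_sing_zero n (hz z h)).1, singLap, r2, coneMap_conePre, coneMap_conePre,
      ← integral_const_mul]
    refine integral_congr_ae (.of_forall fun a => ?_)
    simp only [mode_lapPro ha, lap_mode ha.smooth]
    linear_combination (-(1 / 4) * (mode (ode (kap m) (sing d l)) m a *
      conj (mode (sing d l') n a))) * exp_sq_mul a.1
  have e2 : ip S ω (singSec x e d l m) (singLap x e d l' n) = -(1 / 4) *
      ∫ a, mode (sing d l) m a * conj (mode (ode (kap n) (sing d l')) n a) ∂svol := by
    rw [singLap, hd.ip_lift hw.1.1 (measurable_conePre (bump_lapPro hb).1 n).aestronglyMeasurable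
      fun z h => (conePre_sing_zero n (hz z h)).2, singSec, r1, coneMap_conePre, coneMap_conePre,
      ← integral_const_mul]
    refine integral_congr_ae (.of_forall fun a => ?_)
    simp only [mode_lapPro hb, lap_mode hb.smooth, map_mul, conj_ofReal, map_neg, map_div₀,
      map_one, map_ofNat _ 4]
    linear_combination (-(1 / 4) * (mode (sing d l) m a *
      conj (mode (ode (kap n) (sing d l')) n a))) * exp_sq_mul a.1
  have hc : ∀ s, conj (ode (kap n) (sing d l') s) = ode (kap n) (sing d l') s := fun s => by
    rw [← congrFun (ode_conj hb.smooth (kap n)) s]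
    simp only [conj_sing]
  rw [e1, e2, integral_mode_mul_conj, integral_mode_mul_conj]
  simp only [conj_sing, hc]
  split_ifs with h
  · subst h
    linear_combination (-(π : ℂ)) * integral_ode_sing (d := d) hl hl'
  · ring

lemma DomMin.congr (h : DomMin S ω u) (hv : ∀ᵐ y ∂area ω, u y = v y) : DomMin S ω v := by
  have hm : v ∈ L² := ⟨fun x₀ => (h.mem.1 x₀).congr (hv.mono fun y h => by simp only [h]),
      h.mem.2.congr (hv.mono fun y h => by simp only [h])⟩
  rw [domMin_iff hm, ← (cls_eq_iff h.mem hm).2 hv]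
  exact (domMin_iff h.mem).1 h

lemma IsDistinguishedChart.domMin_sub_sing (hd : IsDistinguishedChart S ω p x e)
  (hχ : IsCutoff x.source χ) (h1 : ∀ᶠ y in 𝓝 p, χ y = 1)
  (hR : Metric.closedBall 0 (rad d) ⊆ x.target) (c : ℂ) {r : ℂ → ℂ}
  (hr : ∀ z ≠ 0, r z = c * conePre (cexpR l) m z) :
  DomMin S ω fun y => ((χ y : ℂ) * r (x y)) • e y - c • singSec x e d l m y := by
  obtain ⟨b1, b2⟩ := hd.smooth_representative hχ fun y hy => hd.smoothSectionAt (hχ.2 hy)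
  obtain ⟨-, b3, b4⟩ := tsupport_representative (e := e) hχ e
  set b := representative x e χ e
  have hb : ∀ z ∈ x.target, b z = χ (x.symm z) := fun z hz => by
    have := hd.rep_eq (u := e) (a := 1) (x.map_target hz) (one_smul _ _).symm
    rw [x.right_inv hz] at this
    simp only [b, representative_eq, this, mul_one]
  set k : ℂ → ℂ := fun z => c * (b z * conePre (cexpR l) m z - conePre (sing d l) m z)
  have hs : Smooth1 (sing d l) := (contDiff_const.sub (isStep_shift d).smooth).mul (smooth1_cexpR l)
  have h0 : (0 : ℂ) ∈ x.target := hd.map_point ▸ x.map_source hd.mem_source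
  have hp : x.symm 0 = p := by rw [← hd.map_point, x.left_inv hd.mem_source]
  have k0 : k =ᶠ[𝓝 0] 0 := by
    filter_upwards [Metric.ball_mem_nhds (0 : ℂ) (rad_pos (d - 1)), x.open_target.mem_nhds h0,
      (x.continuousAt_symm h0).eventually (hp.symm ▸ h1)] with z hz hzt hz1
    by_cases hz0 : z = 0
    · simp [k, conePre, hz0]
    · have := (logT_lt_iff hz0).2 (by simpa using hz)
      simp [k, hb z hzt, hz1, conePre, sing, step,
        Real.smoothTransition.zero_of_nonpos (by linarith : logT z - d + 1 ≤ 0)]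
  have k1 : SmoothC k := contDiff_iff_contDiffAt.2 fun z => by
    by_cases hz : z = 0
    · subst hz; exact contDiffAt_const.congr_of_eventuallyEq k0
    · exact contDiffAt_const.mul ((b1.contDiffAt.mul
        (contDiffAt_conePre (smooth1_cexpR l) m hz)).sub (contDiffAt_conePre hs m hz))
  have hK : IsCompact (tsupport b ∪ Metric.closedBall 0 (rad d)) :=
    b2.isCompact.union (isCompact_closedBall _ _)
  have k2 : tsupport k ⊆ tsupport b ∪ Metric.closedBall 0 (rad d) := closure_minimal (fun z hz => by
      by_contra h
      rw [Set.mem_union, not_or] at h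
      exact hz (by simp only [k, zero_off_tsupport h.1, (conePre_sing_zero m
        (by simpa using h.2 : rad d < ‖z‖)).1, zero_mul, sub_zero, mul_zero])) hK.isClosed
  have kt := (hd.laplacian_lift k1 (hK.of_isClosed_subset (isClosed_tsupport k) k2)
    (k2.trans (Set.union_subset (b3.trans b4) hR)) (notMem_tsupport_iff_eventuallyEq.2 k0)).1
  refine kt.domMin.congr ?_
  have hz : ∀ᵐ y ∂area ω, ω.1 y ≠ 0 := by rw [ae_iff]; simpa using area_zeros ω
  filter_upwards [hz] with y hy
  by_cases hys : y ∈ x.source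
  · have hxy : x y ≠ 0 := fun h => hy ((form_eq_zero_iff ω hd.mem_maximalAtlas hys).2 (by
      rw [hd.distinguished _ (x.map_source hys), h]))
    rw [singSec, lift_apply hys, lift_apply hys, hr _ hxy]
    simp only [k, hb _ (x.map_source hys), x.left_inv hys, smul_smul, ← sub_smul]
    congr 1; ring
  · rw [singSec, lift_of_notMem hys, lift_of_notMem hys, hχ.zero hys]; simp

lemma conePre_cexpR {z : ℂ} (hz : z ≠ 0) (l : ℝ) (m : ℤ) : conePre (cexpR l) m z =
  ((2 : ℝ) ^ (-l) * ‖z‖ ^ (2 * l + 1 / 2 - m) : ℝ) * z ^ m := by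
  have h0 := norm_pos_iff.2 hz
  have h1 : rexp (l * logT z) = (2 : ℝ) ^ (-l) * ‖z‖ ^ (2 * l) := by
    rw [logT, Real.log_div h0.ne' (by positivity), Real.log_sqrt (by norm_num),
      Real.rpow_def_of_pos two_pos, Real.rpow_def_of_pos h0, ← Real.exp_add]
    congr 1; ring
  rw [conePre, cexpR, h1, Real.rpow_sub h0, Real.rpow_add h0, ← Real.sqrt_eq_rpow, div_zpow,
    Real.rpow_intCast]
  push_cast; ring

lemma two_kap (m : ℤ) : 2 * kap m = m - 1 / 2 := by rw [kap]; ring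

lemma zpow_eq_conePre {z : ℂ} (hz : z ≠ 0) (m : ℤ) :
  z ^ m = ((2 : ℝ) ^ kap m : ℝ) * conePre (cexpR (kap m)) m z := by
  rw [conePre_cexpR hz, two_kap, ← mul_assoc, ← ofReal_mul, ← mul_assoc, ← Real.rpow_add two_pos]
  simp

lemma conj_zpow_eq_conePre {z : ℂ} (hz : z ≠ 0) (m : ℤ) :
  conj z ^ (-m) * (‖z‖ : ℂ) / ((π : ℂ) * ((m : ℂ) - 1 / 2))
    = ((2 : ℝ) ^ (-kap m) / (2 * π * kap m) : ℝ) * conePre (cexpR (-kap m)) m z := by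
  have h0 : (‖z‖ : ℂ) ≠ 0 := by simpa using hz
  have h1 : conj z = (‖z‖ : ℂ) ^ 2 / z := by rw [eq_div_iff hz, mul_comm, mul_conj']
  have h2 : (‖z‖ : ℝ) ^ (2 * -kap m + 1 / 2 - m) = ‖z‖ ^ (1 - 2 * m : ℤ) := by
    rw [← Real.rpow_intCast]; congr 1
    push_cast; linear_combination - two_kap m
  have h3 : (2 : ℝ) ^ (-kap m) * (2 : ℝ) ^ (- -kap m) = 1 := by rw [← Real.rpow_add two_pos]; simp
  have h4 : (π : ℂ) * ((m : ℂ) - 1 / 2) = (2 * π * kap m : ℝ) := by rw [kap]; push_cast; ring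
  rw [conePre_cexpR hz, h2, h4, ← mul_assoc, ← ofReal_mul, div_mul_eq_mul_div, ← mul_assoc, h3,
    one_mul, h1, div_zpow, ← zpow_natCast, ← zpow_mul, zpow_neg z, ofReal_div,
    ofReal_zpow, zpow_sub₀ h0, zpow_one]
  push_cast
  rw [show (2 : ℤ) * -m = -(2 * m) by ring, zpow_neg, div_inv_eq_mul]
  ring

/-! ### The minimal domain and the boundary form -/

lemma domMin_of_cuts (hP : Function.Injective P) (hzero : ∀ y, ω.1 y = 0 ↔ y ∈ Set.range P)
  {x : ι → Chart} {e : ι → ∀ y, C y} {χ : ι → X → ℝ}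
  (hd : ∀ k, IsDistinguishedChart S ω (P k) (x k) (e k))
  (hχ : ∀ k, IsCutoff (x k).source (χ k)) (h1 : ∀ k, ∀ᶠ y in 𝓝 (P k), χ k y = 1)
  (hc : ∀ k, DomMin S ω (cut (χ k) u))
  (hζ : ∀ ζ, SmoothFun ζ → (∀ y, ω.1 y = 0 → ∀ᶠ y' in 𝓝 y, ζ y' = 0) → DomMin S ω (cut ζ u)) :
  DomMin S ω u := by
  have h2 := (hζ (fun y => 1 - ∑ k, χ k y) (contMDiff_const.sub (contMDiff_finsetSum fun k _ => (hχ k).1))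
    fun y hy => ?_).add (DomMin.sum Finset.univ fun k _ => hc k)
  · convert h2 using 2 with y
    simp only [cut]
    rw [← Finset.sum_smul, ← add_smul]
    simp
  · obtain ⟨j, rfl⟩ := (hzero y).1 hy
    have h3 : ∀ k, ∀ᶠ y in 𝓝 (P j), k ≠ j → χ k y = 0 := fun k => by
      by_cases hk : P j ∈ tsupport (χ k)
      · exact .of_forall fun y h => absurd (hP ((hd k).eq_point ((hχ k).2 hk) hy)) h.symm
      · exact (notMem_tsupport_iff_eventuallyEq.1 hk).mono fun y h _ => h
    filter_upwards [eventually_all.2 h3, h1 j] with y h4 h5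
    rw [Finset.sum_eq_single j (fun k _ hk => h4 k hk) (by simp), h5, sub_self]

lemma memWeightedSpace_of_domMin (h : DomMin S ω u) : MemWeightedSpace S ω 2 (-1) u := by
  obtain ⟨f, hw, hpair⟩ := h.exists_isWeak
  refine ⟨h.mem.1, fun x e χ hs hχ => (hw.interior hs hχ).2, fun p x e χ hd hχ => ?_⟩
  obtain ⟨θ, hθ, hθt, hθ1⟩ := exists_cutoff ((isClosed_tsupport χ).union isClosed_singleton)
    x.open_source (Set.union_subset hχ.2 (Set.singleton_subset_iff.2 hd.mem_source))
  obtain ⟨ψ, hψ, hv, hc⟩ := (hw.modeApprox hd ⟨hθ, hθt⟩ (hθ1 p (.inr rfl)) fun d l m hR hm hl =>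
    hpair _ _ (hd.isWeak_sing hR hm hl)).coneApprox
  obtain ⟨b1, b2⟩ := hd.smooth_representative hχ fun y hy => hd.smoothSectionAt (hχ.2 hy)
  obtain ⟨M, hM⟩ := exists_bound_comp_econe b1 b2
  have h2 := graph_mul (B := fun a => representative x e χ e (econe a)) hψ hv hc
    (b1.comp smooth_econe) (fun s φ => by simp only [econe_add]) hM
  have h3 : (fun a => representative x e χ e (econe a) * coneMap (representative x e θ u) a)
      = coneMap (representative x e χ u) := funext fun a => by
    simp only [coneMap]
    rw [mul_left_comm]
    congr 1
    by_cases hz : econe a ∈ x.target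
    · have := hd.rep_eq (u := e) (a := 1) (x.map_target hz) (one_smul _ _).symm
      rw [x.right_inv hz] at this
      simp only [representative_eq, this]
      by_cases hy : x.symm (econe a) ∈ tsupport χ
      · rw [(hθ1 _ (.inl hy)).self_of_nhds]; simp
      · rw [zero_off_tsupport hy]; simp
    · simp [representative, hz]
  have hm : AEStronglyMeasurable (representative x e χ u) := by
    have := hd.good.aestronglyMeasurable_rep (measurableSection_cut hχ.1 h.mem.1)
    rwa [show rep x e (cut χ u) = _ from rep_smul χ u] at this
  refine ConeApprox.memConeSpace (v := coneMap (representative x e χ u)) (h3 ▸ ⟨_, h2⟩)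
    (AEStronglyMeasurable.mul ?_ (hm.comp_quasiMeasurePreserving quasiMeasurePreserving_econe_volume))
    (antiPer_coneMap _)
  exact (continuous_const.mul (continuous_toC.div_const 4).neg.cexp).aestronglyMeasurable

lemma memWeightedSpace_iff (hP : Function.Injective P) (hzero : ∀ y, ω.1 y = 0 ↔ y ∈ Set.range P)
  (hsimple : ∀ k, IsSimpleZero ω (P k)) : MemWeightedSpace S ω 2 (-1) u ↔ DomMin S ω u := by
  refine ⟨fun h => ?_, memWeightedSpace_of_domMin⟩
  choose x e hd _ using fun k => exists_distinguishedChart S ω (hsimple k) Filter.univ_mem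
  choose χ hχ hχt h1 using fun k => exists_cutoff (isClosed_singleton (x := P k)) (x k).open_source
    (Set.singleton_subset_iff.2 (hd k).mem_source)
  refine domMin_of_cuts hP hzero hd (fun k => ⟨hχ k, hχt k⟩) (fun k => h1 k _ rfl)
    (fun k => (hd k).domMin_cut_of_modeApprox ⟨hχ k, hχt k⟩ h.1
      (h.2.2 _ _ _ _ (hd k) ⟨hχ k, hχt k⟩).modeApprox)
    fun ζ hζ h0 => domMin_cut_of_local hζ h0 fun x e θ hs hθ =>
      hs.domMin_of_sobolev hθ h.1 (h.2.1 x e θ hs hθ)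

lemma boundaryForm_minimal {a : (maximalLaplacian S ω).domain}
  (h : (a : L2 S ω) ∈ (minimalLaplacian S ω).domain) (b : (maximalLaplacian S ω).domain) :
  boundaryForm S ω a b = 0 := by
  have h1 := LinearPMap.adjoint_isFormalAdjoint dense_minimal b ⟨a, h⟩
  have h2 : minimalLaplacian S ω ⟨a, h⟩ = maximalLaplacian S ω a := minimal_le_maximal.2 rfl
  rw [h2] at h1
  exact sub_eq_zero.2 h1.symm

lemma boundaryForm_conj (a b : (maximalLaplacian S ω).domain) :
  conj (boundaryForm S ω a b) = -boundaryForm S ω b a := by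
  simp only [boundaryForm, map_sub, inner_conj_symm]; ring

lemma boundaryForm_add (a a' b : (maximalLaplacian S ω).domain) :
  boundaryForm S ω (a + a') b = boundaryForm S ω a b + boundaryForm S ω a' b := by
  simp only [boundaryForm, LinearPMap.map_add, Submodule.coe_add, inner_add_right]; ring

lemma boundaryForm_smul (c : ℂ) (a b : (maximalLaplacian S ω).domain) :
  boundaryForm S ω (c • a) b = c * boundaryForm S ω a b := by
  simp only [boundaryForm, Submodule.coe_smul, inner_smul_right, LinearPMap.map_smul]; ring

lemma exists_boundaryPairing (S : SpinStructure C) (ω : HolomorphicForm X) :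
  ∃ G : BoundarySpace S ω →ₗ[ℂ] BoundarySpace S ω →ₛₗ[starRingEnd ℂ] ℂ,
    ∀ u v, G (boundaryProj S ω u) (boundaryProj S ω v) = boundaryForm S ω u v := by
  have h0 : ∀ {a a'} b, boundaryProj S ω a = boundaryProj S ω a' →
      boundaryForm S ω a b = boundaryForm S ω a' b := fun {a a'} b h => by
    have h3 := (Submodule.Quotient.eq _).1 h
    have h1 := boundaryForm_minimal (S := S) (a := a - a') h3 b
    have h2 := boundaryForm_add (S := S) (a - a') a' b
    rwa [sub_add_cancel, h1, zero_add] at h2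
  have h0' : ∀ {a b b'}, boundaryProj S ω b = boundaryProj S ω b' →
      boundaryForm S ω a b = boundaryForm S ω a b' := fun {a b b'} h => by
    rw [← neg_inj, ← boundaryForm_conj, ← boundaryForm_conj, h0 a h]
  obtain ⟨σ, hσ⟩ := (Submodule.mkQ_surjective ((minimalLaplacian S ω).domain.submoduleOf
    (maximalLaplacian S ω).domain)).hasRightInverse
  have hadd : ∀ a b, boundaryProj S ω (σ (a + b)) = boundaryProj S ω (σ a + σ b) := fun a b => by
    rw [map_add, hσ, hσ, hσ]
  have hsmul : ∀ (c : ℂ) a, boundaryProj S ω (σ (c • a)) = boundaryProj S ω (c • σ a) := fun c a => by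
    rw [map_smul, hσ, hσ]
  refine ⟨LinearMap.mk₂'ₛₗ _ _ (fun a b => boundaryForm S ω (σ a) (σ b)) (fun a a' b => ?_)
    (fun c a b => ?_) (fun a b b' => ?_) (fun c a b => ?_), fun u v => ?_⟩
  · rw [h0 _ (hadd a a'), boundaryForm_add]
  · rw [h0 _ (hsmul c a), boundaryForm_smul]; rfl
  · rw [h0' (hadd b b'), ← neg_inj, ← boundaryForm_conj, boundaryForm_add, map_add, boundaryForm_conj,
      boundaryForm_conj, neg_add]
  · rw [h0' (hsmul c b), ← neg_inj, ← boundaryForm_conj, boundaryForm_smul, map_mul, boundaryForm_conj,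
      smul_eq_mul, mul_neg]
  · rw [LinearMap.mk₂'ₛₗ_apply, h0 _ (hσ _), h0' (hσ _)]

/-- The element of the maximal domain represented by a section with a weak Laplacian. -/
def weakClass (h : IsWeak S ω u f) : (maximalLaplacian S ω).domain := ⟨cls h.1, h.mem_maximal.fst⟩

lemma boundaryForm_weakClass (hu : IsWeak S ω u f) (hw : IsWeak S ω w g) :
  boundaryForm S ω (weakClass hu) (weakClass hw) = ip S ω f w - ip S ω u g := by
  rw [boundaryForm, weakClass, weakClass, hu.mem_maximal.snd, hw.mem_maximal.snd, inner_cls, inner_cls]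

lemma exists_boundaryProj_eq (hw : IsWeak S ω w g) {c : ℂ} (h : DomMin S ω fun y => u y - c • w y) :
  ∃ a : (maximalLaplacian S ω).domain, Represents S ω u a := by
  have hu : u ∈ L² := by simpa using mem_add h.mem (mem_smul c hw.1)
  refine ⟨⟨cls hu, ?_⟩, represents_cls hu⟩
  have h1 := Submodule.add_mem _ (minimal_le_maximal.1 ((domMin_iff h.mem).1 h))
    (Submodule.smul_mem _ c (weakClass hw).2)
  rwa [show cls hu = cls h.mem + c • cls hw.1 from by rw [cls_sub hu (mem_smul c hw.1), cls_smul hw.1, sub_add_cancel]]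

lemma boundaryProj_eq (hw : IsWeak S ω w g) {c : ℂ} (h : DomMin S ω fun y => u y - c • w y)
  {a : (maximalLaplacian S ω).domain} (ha : Represents S ω u a) :
  boundaryProj S ω a = c • boundaryProj S ω (weakClass hw) := by
  obtain ⟨hu, ha⟩ := ha
  rw [← map_smul]
  refine (Submodule.Quotient.eq _).2 ?_
  change (a : L2 S ω) - c • cls hw.1 ∈ (minimalLaplacian S ω).domain
  rw [← ha]
  exact (domMin_iff h.mem).1 h

lemma exists_basis_of_dual {V κ : Type*} [AddCommGroup V] [Module ℂ V] [Fintype κ] [DecidableEq κ]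
  (w : κ → V) (l : κ → V →ₗ[ℂ] ℂ) (hδ : ∀ a b, l a (w b) = if a = b then 1 else 0)
  (h0 : ∀ v, (∀ a, l a v = 0) → v = 0) : ∃ b : Module.Basis κ ℂ V, ⇑b = w := by
  have h1 : Function.Bijective (LinearMap.pi l) := by
    refine ⟨(injective_iff_map_eq_zero _).2 fun v hv => h0 v fun a => congrFun hv a,
      fun c => ⟨∑ b, c b • w b, funext fun a => ?_⟩⟩
    simp [hδ]
  refine ⟨Module.Basis.ofEquivFun (LinearEquiv.ofBijective _ h1), funext fun i => ?_⟩
  rw [Module.Basis.coe_ofEquivFun, LinearEquiv.symm_apply_eq]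
  funext a
  simp [hδ, Pi.single_apply]

lemma singSec_eq_zero {x : Chart} {e : ∀ y, C y} {d l : ℝ} {m : ℤ} {U : Set X}
  (hU : ∀ z ∈ Metric.closedBall 0 (rad d), z ∈ x.target ∧ x.symm z ∈ U) {y : X} (hy : y ∉ U) :
  singSec x e d l m y = 0 ∧ singLap x e d l m y = 0 := by
  by_cases hs : y ∈ x.source
  · have h := conePre_sing_zero (l := l) (d := d) m (z := x y) (by
      by_contra! h
      exact hy (x.left_inv hs ▸ (hU (x y) (by simpa using h)).2))
    rw [singSec, singLap, lift_apply hs, lift_apply hs, h.1, h.2, zero_smul]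
    exact ⟨rfl, rfl⟩
  · exact ⟨lift_of_notMem hs, lift_of_notMem hs⟩

lemma boundaryPairing_model [DecidableEq ι] {κ : Type*} (hP : Function.Injective P)
  {x : ι → Chart} {e : ι → ∀ y, C y}
  (hd : ∀ k, IsDistinguishedChart S ω (P k) (x k) (e k))
  {G : BoundarySpace S ω →ₗ[ℂ] BoundarySpace S ω →ₛₗ[starRingEnd ℂ] ℂ}
  (hG : ∀ u v, G (boundaryProj S ω u) (boundaryProj S ω v) = boundaryForm S ω u v)
  {k : κ → ι} {m : κ → ℤ} {l : κ → ℝ} {c : κ → ℂ} {M : κ → ∀ y, C y}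
  (hm : ∀ i, m i ∈ Idx) (hl : ∀ i, l i ^ 2 = kap (m i) ^ 2)
  (hM : ∀ i d, Metric.closedBall 0 (rad d) ⊆ (x (k i)).target → DomMin S ω fun y =>
    M i y - c i • singSec (x (k i)) (e (k i)) d (l i) (m i) y)
  {a : κ → (maximalLaplacian S ω).domain} (ha : ∀ i, Represents S ω (M i) (a i)) (i j : κ) :
  G (boundaryProj S ω (a i)) (boundaryProj S ω (a j))
    = c i * conj (c j) * if k i = k j ∧ m i = m j then (π : ℂ) * (l i - l j) else 0 := by
  obtain ⟨U, hU, hdis⟩ := (Set.finite_range P).t2_separation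
  choose d hB using fun k => (hd k).exists_closedBall ((hU (P k)).2.mem_nhds (hU (P k)).1)
  have hR := fun k => show Metric.closedBall 0 (rad (d k)) ⊆ (x k).target from fun z hz => (hB k z hz).1
  have hw := fun i => (hd (k i)).isWeak_sing (hR _) (hm i) (hl i)
  rw [boundaryProj_eq (hw i) (hM i _ (hR _)) (ha i), boundaryProj_eq (hw j) (hM j _ (hR _)) (ha j),
    LinearMap.map_smulₛₗ, LinearMap.map_smul, LinearMap.smul_apply, hG, boundaryForm_weakClass,
    smul_eq_mul, smul_eq_mul, ← mul_assoc, mul_comm (conj _)]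
  congr 2
  by_cases hk : k i = k j
  · have h := (hd (k j)).wronskian (hR _) (hm i) (hm j) (hl i) (hl j)
    rw [hk, h]; simp
  · rw [if_neg fun h => hk h.1]
    have h0 : ∀ y, y ∉ U (P (k i)) ∨ y ∉ U (P (k j)) := fun y => by
      by_contra! h
      exact Set.disjoint_left.1 (hdis ⟨_, rfl⟩ ⟨_, rfl⟩ fun h => hk (hP h)) h.1 h.2
    have h1 : ∀ {u v : ∀ y, C y}, (∀ y, y ∉ U (P (k i)) → u y = 0) → (∀ y, y ∉ U (P (k j)) → v y = 0) →
        ip S ω u v = 0 := fun hu hv => integral_eq_zero_of_ae (.of_forall fun y => by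
      rcases h0 y with h | h
      · simp only [hu y h, herm_zero_left, Pi.zero_apply]
      · simp only [hv y h, herm_zero_right, Pi.zero_apply])
    have h2 := fun i y (h : y ∉ U (P (k i))) => singSec_eq_zero (e := e (k i)) (l := l i) (m := m i) (hB _) h
    rw [h1 (fun y h => (h2 i y h).2) fun y h => (h2 j y h).1,
      h1 (fun y h => (h2 i y h).1) fun y h => (h2 j y h).2, sub_zero]

lemma eq_zero_of_pairing {κ : Type*} (hP : Function.Injective P)
  (hzero : ∀ y, ω.1 y = 0 ↔ y ∈ Set.range P)
  {x : ι → Chart} {e : ι → ∀ y, C y} {χ : ι → X → ℝ}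
  (hd : ∀ k, IsDistinguishedChart S ω (P k) (x k) (e k))
  (hχ : ∀ k, IsCutoff (x k).source (χ k) ∧ ∀ᶠ y in 𝓝 (P k), χ k y = 1)
  {G : BoundarySpace S ω →ₗ[ℂ] BoundarySpace S ω →ₛₗ[starRingEnd ℂ] ℂ}
  (hG : ∀ u v, G (boundaryProj S ω u) (boundaryProj S ω v) = boundaryForm S ω u v)
  {k : κ → ι} {m : κ → ℤ} {l : κ → ℝ} {c : κ → ℂ} {M : κ → ∀ y, C y} (hc : ∀ i, c i ≠ 0)
  (hall : ∀ n, ∀ n' ∈ Idx, ∀ l' : ℝ, l' ^ 2 = kap n' ^ 2 → ∃ i, k i = n ∧ m i = n' ∧ l i = l')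
  (hM : ∀ i d, Metric.closedBall 0 (rad d) ⊆ (x (k i)).target → DomMin S ω fun y =>
    M i y - c i • singSec (x (k i)) (e (k i)) d (l i) (m i) y)
  {a : κ → (maximalLaplacian S ω).domain} (ha : ∀ i, Represents S ω (M i) (a i))
  {v : BoundarySpace S ω} (hv : ∀ i, G v (boundaryProj S ω (a i)) = 0) : v = 0 := by
  obtain ⟨b, rfl⟩ := Submodule.mkQ_surjective _ v
  obtain ⟨u, hu, hub⟩ := exists_cls_eq (b : L2 S ω)
  obtain ⟨f, hf, -⟩ := exists_isWeak b hu hub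
  have hbf : b = weakClass hf := Subtype.ext hub.symm
  have hpair : ∀ n d l' n', Metric.closedBall 0 (rad d) ⊆ (x n).target → n' ∈ Idx →
      l' ^ 2 = kap n' ^ 2 →
      ip S ω f (singSec (x n) (e n) d l' n') = ip S ω u (singLap (x n) (e n) d l' n') :=
    fun n d l' n' hR hn hl => by
    obtain ⟨i, rfl, rfl, rfl⟩ := hall n n' hn l' hl
    have hw := (hd (k i)).isWeak_sing hR hn hl
    have h := hv i
    rw [boundaryProj_eq hw (hM i d hR) (ha i), LinearMap.map_smulₛₗ, hbf] at h
    erw [hG] at h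
    rw [boundaryForm_weakClass, smul_eq_mul, mul_eq_zero, or_iff_right (by simpa using hc i)] at h
    exact sub_eq_zero.1 h
  refine (Submodule.Quotient.mk_eq_zero _).2 ?_
  change (b : L2 S ω) ∈ (minimalLaplacian S ω).domain
  rw [← hub, ← domMin_iff]
  exact domMin_of_cuts hP hzero hd (fun k => (hχ k).1) (fun k => (hχ k).2)
    (fun n => (hd n).domMin_cut_of_modeApprox (hχ n).1 hu.1
      (hf.modeApprox (hd n) (hχ n).1 (hχ n).2 (hpair n)))
    fun ζ hζ h0 => hf.domMin_cut hζ h0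

lemma exists_basis_of_darboux {V J : Type*} [AddCommGroup V] [Module ℂ V] [Fintype J] [DecidableEq J]
  (G : V →ₗ[ℂ] V →ₛₗ[starRingEnd ℂ] ℂ) (w : J ⊕ J → V)
  (h1 : ∀ i j, G (w (Sum.inl i)) (w (Sum.inr j)) = if i = j then 1 else 0)
  (h2 : ∀ i j, G (w (Sum.inr i)) (w (Sum.inl j)) = if i = j then -1 else 0)
  (h3 : ∀ i j, G (w (Sum.inl i)) (w (Sum.inl j)) = 0)
  (h4 : ∀ i j, G (w (Sum.inr i)) (w (Sum.inr j)) = 0) (h0 : ∀ v, (∀ i, G v (w i) = 0) → v = 0) :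
  ∃ b : Module.Basis (J ⊕ J) ℂ V, ⇑b = w := by
  refine exists_basis_of_dual w (Sum.elim (fun i => G.flip (w (Sum.inr i)))
    fun i => -G.flip (w (Sum.inl i))) ?_ fun v hv => h0 v ?_
  · rintro (i | i) (j | j) <;> simp [h1, h2, h3, h4, eq_comm]
    split_ifs <;> simp
  · rintro (i | i)
    · simpa using hv (Sum.inr i)
    · simpa using hv (Sum.inl i)

lemma darboux_coeff [DecidableEq ι] (i j : ι × Idx) :
  (((2 : ℝ) ^ kap i.2 : ℝ) : ℂ) * conj (((2 : ℝ) ^ (-kap j.2) / (2 * π * kap j.2) : ℝ) : ℂ) *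
    (if i.1 = j.1 ∧ (i.2 : ℤ) = j.2 then (π : ℂ) * ((kap i.2 : ℝ) - (-kap j.2 : ℝ)) else 0)
    = (if i = j then 1 else 0) ∧
  (((2 : ℝ) ^ (-kap i.2) / (2 * π * kap i.2) : ℝ) : ℂ) * conj (((2 : ℝ) ^ kap j.2 : ℝ) : ℂ) *
    (if i.1 = j.1 ∧ (i.2 : ℤ) = j.2 then (π : ℂ) * ((-kap i.2 : ℝ) - (kap j.2 : ℝ)) else 0)
    = if i = j then -1 else 0 := by
  have hij : (i.1 = j.1 ∧ (i.2 : ℤ) = j.2) ↔ i = j := by rw [Prod.ext_iff, Subtype.ext_iff]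
  simp only [hij]
  split_ifs with h
  · subst h
    have h0 : ((kap i.2 : ℝ) : ℂ) ≠ 0 := by exact_mod_cast kap_ne_zero _
    have hpi : (π : ℂ) ≠ 0 := by exact_mod_cast Real.pi_ne_zero
    have h2 : (((2 : ℝ) ^ kap i.2 : ℝ) : ℂ) * (((2 : ℝ) ^ (-kap i.2) : ℝ) : ℂ) = 1 := by
      rw [← ofReal_mul, ← Real.rpow_add two_pos, add_neg_cancel, Real.rpow_zero, ofReal_one]
    rw [conj_ofReal, conj_ofReal]
    simp only [ofReal_div, ofReal_neg, ofReal_mul, ofReal_ofNat]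
    constructor <;> field_simp
    · linear_combination 2 * h2
    · linear_combination -2 * h2
  · simp

lemma exists_darboux_basis [DecidableEq ι] (hP : Function.Injective P) (hzero : ∀ y, ω.1 y = 0 ↔ y ∈ Set.range P)
  {x : ι → Chart} {e : ι → ∀ y, C y} {χ : ι → X → ℝ}
  (hd : ∀ k, IsDistinguishedChart S ω (P k) (x k) (e k))
  (hχ : ∀ k, IsCutoff (x k).source (χ k) ∧ ∀ᶠ y in 𝓝 (P k), χ k y = 1)
  {G : BoundarySpace S ω →ₗ[ℂ] BoundarySpace S ω →ₛₗ[starRingEnd ℂ] ℂ}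
  (hG : ∀ u v, G (boundaryProj S ω u) (boundaryProj S ω v) = boundaryForm S ω u v) :
  ∃ b : Module.Basis ((ι × Idx) ⊕ (ι × Idx)) ℂ (BoundarySpace S ω),
    (∀ i, ∃ a : (maximalLaplacian S ω).domain,
      Represents S ω (modelPlus (x i.1) (e i.1) (χ i.1) i.2) a ∧
      b (Sum.inl i) = boundaryProj S ω a) ∧
    (∀ i, ∃ a : (maximalLaplacian S ω).domain,
      Represents S ω (modelMinus (x i.1) (e i.1) (χ i.1) i.2) a ∧
      b (Sum.inr i) = boundaryProj S ω a) ∧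
    (∀ i j, G (b (Sum.inl i)) (b (Sum.inr j)) = if i = j then 1 else 0) ∧
    (∀ i j, G (b (Sum.inr i)) (b (Sum.inl j)) = if i = j then -1 else 0) ∧
    (∀ i j, G (b (Sum.inl i)) (b (Sum.inl j)) = 0) ∧
    (∀ i j, G (b (Sum.inr i)) (b (Sum.inr j)) = 0) := by
  let J := ι × Idx
  let k : J ⊕ J → ι := Sum.elim Prod.fst Prod.fst
  let m : J ⊕ J → ℤ := Sum.elim (fun i => i.2) fun i => i.2
  let l : J ⊕ J → ℝ := Sum.elim (fun i => kap i.2) fun i => -kap i.2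
  let c : J ⊕ J → ℂ := Sum.elim (fun i => ((2 : ℝ) ^ kap i.2 : ℝ)) fun i =>
    ((2 : ℝ) ^ (-kap i.2) / (2 * π * kap i.2) : ℝ)
  let M : J ⊕ J → ∀ y, C y := Sum.elim (fun i => modelPlus (x i.1) (e i.1) (χ i.1) i.2) fun i =>
    modelMinus (x i.1) (e i.1) (χ i.1) i.2
  have hm : ∀ i, m i ∈ Idx := by rintro (i | i) <;> exact i.2.2
  have hl : ∀ i, l i ^ 2 = kap (m i) ^ 2 := by rintro (i | i) <;> simp [l, m]
  have hM : ∀ i d, Metric.closedBall 0 (rad d) ⊆ (x (k i)).target → DomMin S ω fun y =>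
      M i y - c i • singSec (x (k i)) (e (k i)) d (l i) (m i) y := by
    rintro (i | i) d hR
    · exact (hd i.1).domMin_sub_sing (r := fun z => z ^ (i.2 : ℤ)) (l := kap i.2) (m := i.2) (hχ i.1).1
        (hχ i.1).2 hR _ fun z hz => zpow_eq_conePre hz _
    · exact (hd i.1).domMin_sub_sing (r := fun z => conj z ^ (-(i.2 : ℤ)) * (‖z‖ : ℂ) /
        ((π : ℂ) * (((i.2 : ℤ) : ℂ) - 1 / 2))) (l := -kap i.2) (m := i.2) (hχ i.1).1 (hχ i.1).2 hR _
        fun z hz => conj_zpow_eq_conePre hz _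
  have hex : ∀ i, ∃ a : (maximalLaplacian S ω).domain, Represents S ω (M i) a := fun i => by
    obtain ⟨d, hB⟩ := (hd (k i)).exists_closedBall Filter.univ_mem
    have hR := fun z hz => (hB z hz).1
    exact exists_boundaryProj_eq ((hd (k i)).isWeak_sing hR (hm i) (hl i)) (hM i d hR)
  choose a ha using hex
  have hpair := boundaryPairing_model hP hd hG hm hl hM ha
  have h1 : ∀ i j : J, G (boundaryProj S ω (a (Sum.inl i))) (boundaryProj S ω (a (Sum.inr j)))
      = if i = j then 1 else 0 := fun i j =>
    (hpair _ _).trans (by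
      simp only [k, m, l, c, Sum.elim_inl, Sum.elim_inr]
      exact (congrArg _ (if_congr Iff.rfl rfl rfl)).trans (darboux_coeff i j).1)
  have h2 : ∀ i j : J, G (boundaryProj S ω (a (Sum.inr i))) (boundaryProj S ω (a (Sum.inl j)))
      = if i = j then -1 else 0 := fun i j =>
    (hpair _ _).trans (by
      simp only [k, m, l, c, Sum.elim_inl, Sum.elim_inr]
      exact (congrArg _ (if_congr Iff.rfl rfl rfl)).trans (darboux_coeff i j).2)
  have h3 : ∀ (σ : J → J ⊕ J), (∀ i j, k (σ i) = k (σ j) ∧ m (σ i) = m (σ j) → l (σ i) = l (σ j)) →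
      ∀ i j, G (boundaryProj S ω (a (σ i))) (boundaryProj S ω (a (σ j))) = 0 := fun σ h i j => by
    rw [hpair]
    split_ifs with h'
    · rw [h i j h', sub_self, mul_zero, mul_zero]
    · rw [mul_zero]
  have h4 := h3 Sum.inl fun i j h => congrArg kap h.2
  have h5 := h3 Sum.inr fun i j h => congrArg (fun n => -kap n) h.2
  have hc : ∀ i, c i ≠ 0 := by
    rintro (i | i)
    · exact ofReal_ne_zero.2 (Real.rpow_pos_of_pos two_pos _).ne'
    · exact ofReal_ne_zero.2 (div_ne_zero (Real.rpow_pos_of_pos two_pos _).ne'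
        (mul_ne_zero (mul_ne_zero two_ne_zero Real.pi_ne_zero) (kap_ne_zero _)))
  have hall : ∀ n, ∀ n' ∈ Idx, ∀ l' : ℝ, l' ^ 2 = kap n' ^ 2 →
      ∃ i, k i = n ∧ m i = n' ∧ l i = l' := fun n n' hn l' hl' => by
    rcases sq_eq_sq_iff_eq_or_eq_neg.1 hl' with rfl | rfl
    · exact ⟨Sum.inl (n, ⟨n', hn⟩), rfl, rfl, rfl⟩
    · exact ⟨Sum.inr (n, ⟨n', hn⟩), rfl, rfl, rfl⟩
  obtain ⟨b, hb⟩ := exists_basis_of_darboux G (fun i => boundaryProj S ω (a i)) h1 h2 h4 h5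
    fun v hv => eq_zero_of_pairing hP hzero hd hχ hG hc hall hM ha hv
  have hb' := congrFun hb
  refine ⟨b, fun i => ⟨_, ha (Sum.inl i), hb' _⟩, fun i => ⟨_, ha (Sum.inr i), hb' _⟩, fun i j => ?_,
    fun i j => ?_, fun i j => ?_, fun i j => ?_⟩ <;> rw [hb', hb']
  exacts [h1 i j, h2 i j, h4 i j, h5 i j]

end SpinorCharts

end

end SpinorLaplacian

theorem mainTheorem8 {X : Type*} [TopologicalSpace X] [T2Space X] [CompactSpace X]
    [ConnectedSpace X] [ChartedSpace ℂ X] [IsManifold 𝓘(ℂ) (⊤ : WithTop ℕ∞) X]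
    [MeasurableSpace X] [BorelSpace X]
    {C : X → Type*} [TopologicalSpace (TotalSpace ℂ C)] [∀ y, AddCommGroup (C y)]
    [∀ y, Module ℂ (C y)] [∀ y, TopologicalSpace (C y)] [FiberBundle ℂ C] [VectorBundle ℂ ℂ C]
    [ContMDiffVectorBundle (⊤ : WithTop ℕ∞) ℂ C 𝓘(ℂ)]
    (S : SpinorLaplacian.SpinStructure C) (ω : SpinorLaplacian.HolomorphicForm X)
    (hg : 1 < SpinorLaplacian.genus X)
    (P : Fin (2 * SpinorLaplacian.genus X - 2) → X) (hP : Function.Injective P)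
    (hzero : ∀ y, ω.1 y = 0 ↔ y ∈ Set.range P)
    (hsimple : ∀ k, SpinorLaplacian.IsSimpleZero ω (P k)) :
    -- `Δ_min ⊆ Δ_min^*`, and `Dom Δ_min` is the weighted space
    SpinorLaplacian.minimalLaplacian S ω ≤ SpinorLaplacian.maximalLaplacian S ω ∧
    (∀ u : ∀ y, C y, SpinorLaplacian.MemWeightedSpace S ω 2 (-1) u ↔
      ∃ a ∈ (SpinorLaplacian.minimalLaplacian S ω).domain, SpinorLaplacian.Represents S ω u a) ∧
    -- the dimension of the quotient
    Module.finrank ℂ (SpinorLaplacian.BoundarySpace S ω)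
      = 8 * (2 * SpinorLaplacian.genus X - 2) ∧
    -- arbitrarily small distinguished coordinates and cut-off functions exist
    (∀ k, ∀ U ∈ 𝓝 (P k), ∃ (x : OpenPartialHomeomorph X ℂ) (e : ∀ y, C y) (χ : X → ℝ),
      x.source ⊆ U ∧ SpinorLaplacian.IsDistinguishedChart S ω (P k) x e ∧
      SpinorLaplacian.IsCutoff x.source χ ∧ ∀ᶠ y in 𝓝 (P k), χ y = 1) ∧
    -- the boundary form is a well defined sesquilinear form on the quotient
    ∃ G : SpinorLaplacian.BoundarySpace S ω →ₗ[ℂ]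
        SpinorLaplacian.BoundarySpace S ω →ₛₗ[starRingEnd ℂ] ℂ,
      (∀ u v, G (SpinorLaplacian.boundaryProj S ω u) (SpinorLaplacian.boundaryProj S ω v)
        = SpinorLaplacian.boundaryForm S ω u v) ∧
      -- all distinguished coordinates and cut-off functions give rise to a Darboux basis
      ∀ (x : Fin (2 * SpinorLaplacian.genus X - 2) → OpenPartialHomeomorph X ℂ)
        (e : Fin (2 * SpinorLaplacian.genus X - 2) → ∀ y, C y)
        (χ : Fin (2 * SpinorLaplacian.genus X - 2) → X → ℝ),
        (∀ k, SpinorLaplacian.IsDistinguishedChart S ω (P k) (x k) (e k)) →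
        (∀ k, SpinorLaplacian.IsCutoff (x k).source (χ k) ∧ ∀ᶠ y in 𝓝 (P k), χ k y = 1) →
        ∃ b : Module.Basis
            ((Fin (2 * SpinorLaplacian.genus X - 2) × Finset.Icc (-1 : ℤ) 2) ⊕
              (Fin (2 * SpinorLaplacian.genus X - 2) × Finset.Icc (-1 : ℤ) 2))
            ℂ (SpinorLaplacian.BoundarySpace S ω),
          (∀ i, ∃ a : (SpinorLaplacian.maximalLaplacian S ω).domain,
            SpinorLaplacian.Represents S ω
              (SpinorLaplacian.modelPlus (x i.1) (e i.1) (χ i.1) i.2) a ∧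
            b (Sum.inl i) = SpinorLaplacian.boundaryProj S ω a) ∧
          (∀ i, ∃ a : (SpinorLaplacian.maximalLaplacian S ω).domain,
            SpinorLaplacian.Represents S ω
              (SpinorLaplacian.modelMinus (x i.1) (e i.1) (χ i.1) i.2) a ∧
            b (Sum.inr i) = SpinorLaplacian.boundaryProj S ω a) ∧
          (∀ i j, G (b (Sum.inl i)) (b (Sum.inr j)) = if i = j then 1 else 0) ∧
          (∀ i j, G (b (Sum.inr i)) (b (Sum.inl j)) = if i = j then -1 else 0) ∧
          (∀ i j, G (b (Sum.inl i)) (b (Sum.inl j)) = 0) ∧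
          (∀ i j, G (b (Sum.inr i)) (b (Sum.inr j)) = 0) := by
  classical
  open SpinorLaplacian in
  have hex : ∀ k, ∀ U ∈ 𝓝 (P k), ∃ (x : OpenPartialHomeomorph X ℂ) (e : ∀ y, C y) (χ : X → ℝ),
      x.source ⊆ U ∧ IsDistinguishedChart S ω (P k) x e ∧ IsCutoff x.source χ ∧
      ∀ᶠ y in 𝓝 (P k), χ y = 1 := fun k U hU => by
    obtain ⟨x, e, hd, hxU⟩ := exists_distinguishedChart S ω (hsimple k) hU
    obtain ⟨χ, h1, h2, h3⟩ := exists_cutoff (isClosed_singleton (x := P k)) x.open_source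
      (Set.singleton_subset_iff.2 hd.mem_source)
    exact ⟨x, e, χ, hxU, hd, ⟨h1, h2⟩, h3 _ rfl⟩
  obtain ⟨G, hG⟩ := SpinorLaplacian.exists_boundaryPairing S ω
  refine ⟨SpinorLaplacian.minimal_le_maximal,
    fun u => SpinorLaplacian.memWeightedSpace_iff hP hzero hsimple, ?_, hex, G, hG,
    fun x e χ hd hχ => SpinorLaplacian.exists_darboux_basis hP hzero hd hχ hG⟩
  choose x e χ _ hd hχ using fun k => hex k _ Filter.univ_mem
  obtain ⟨b, -⟩ := SpinorLaplacian.exists_darboux_basis hP hzero hd hχ hG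
  rw [Module.finrank_eq_card_basis b]
  simp only [Fintype.card_sum, Fintype.card_prod, Fintype.card_fin, Fintype.card_coe, Int.card_Icc]
  rw [show (2 + 1 - -1 : ℤ).toNat = 4 from rfl]
  ring
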